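/- **Part 1.** Let $k$ be a field (for instance $\mathbb C$) and $q\in k^\times$ with $q^2\neq 1$. Let $U_q(b_-)$ be the Hopf algebra over $k$ generated by $X,g,g^{-1}$ with $gX=q^2Xg$, $\Delta X=X\otimes 1+g\otimes X$, $\Delta g=g\otimes g$, $\epsilon X=0$, $\epsilon g=1$, $SX=-g^{-1}X$, $Sg=g^{-1}$. It has exactly one Hopf algebra self-pairing with $\langle g,g\rangle=q^2$, $\langle g,X\rangle=\langle X,g\rangle=0$, $\langle X,X\rangle=(1-q^{-2})^{-1}$. The quantum double $D(U_q(b_-))$ for this pairing is the vector space $U_q(b_-)\otimes U_q(b_-)$ with tensor product unit, counit and coproduct and with the product $$(a\otimes x)(b\otimes y)=b_{(2)}a\otimes x_{(2)}y\,\langle Sx_{(1)},b_{(1)}\rangle\langle x_{(3)},b_{(3)}\rangle .$$ It is the Hopf algebra generated by $X=1\otimes X$, $g^{\pm1}=1\otimes g^{\pm1}$, $\bar X=X\otimes 1$, $\bar g^{\pm1}=g^{\pm1}\otimes 1$ with defining relations ($g,\bar g$ invertible) $$g\bar g=\bar g g,\quad gX=q^2Xg,\quad \bar gX=q^2X\bar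 g,\quad g\bar X=q^{-2}\bar Xg,\quad \bar g\bar X=q^{-2}\bar X\bar g,\quad X\bar X-q^{-2}\bar XX=\frac{\bar gg-1}{q^2-1},$$ with $g,\bar g$ group-like, $\Delta X=X\otimes1+g\otimes X$, $\Delta\bar X=\bar X\otimes1+\bar g\otimes\bar X$, $\epsilon X=\epsilon\bar X=0$, $SX=-g^{-1}X$, $S\bar X=-\bar g^{-1}\bar X$. **Part 2.** Let $c\in\mathbb C^\times$ and $q=e^{ct}\in\mathbb C[[t]]$. All algebras below are $t$-adically complete $\mathbb C[[t]]$-algebras, tensor products are $t$-adically completed, and $q^{a}=\exp(cta)$. Let * $U_q(sl_2)$ be topologically generated by $H,X_\pm$ with $[H,X_\pm]=\pm2X_\pm$, $[X_+,X_-]=\frac{q^H-q^{-H}}{q-q^{-1}}$, with $H$ primitive, $\Delta X_\pm=X_\pm\otimes q^{H/2}+q^{-H/2}\otimes X_\pm$, $\epsilon(H)=\epsilon(X_\pm)=0$, $SH=-H$, $SX_\pm=-q^{\pm1}X_\pm$ and $$\mathcal R=\sum_{m\ge0}\frac{(1-q^{-2})^m q^{m(m-1)/2}}{[m]!}\,q^{\frac12H\otimes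 H}\bigl(q^{H/2}X_+\otimes q^{-H/2}X_-\bigr)^m,\qquad [m]=\frac{q^m-q^{-m}}{q-q^{-1}};$$ * $U_{q^{-1}}(\mathbb C)$ be $\mathbb C[C][[t]]$ with $C$ primitive, $\epsilon(C)=0$, $SC=-C$ and $\mathcal R=q^{-\frac12C\otimes C}$; * $\hat D$ be the quantum double of $U_q(b_-)$ over $\mathbb C[[t]]$: the $t$-adic completion of the $\mathbb C[[t]]$-subalgebra of $D(U_q(b_-))$ over $\mathbb C((t))$ generated by $X,\bar X,g^{\pm1},\bar g^{\pm1},\frac{g-1}{q-1},\frac{\bar g-1}{q-1}$ (so that $g,\bar g$ have logarithms to the base $q$), with the coproduct, counit and antipode extended from $D(U_q(b_-))$ and with $\mathcal R=\sum_a(f^a\otimes1)\otimes(1\otimes e_a)$, the canonical element of the pairing, i.e. $\sum_a f^a\langle e_a,b\rangle=b$ for all $b$ in the corresponding subalgebra of $U_q(b_-)$ generated by $X,g^{\pm1},\frac{g-1}{q-1}$. These are quasitriangular Hopf algebras ($t$-adically completed), and so is the tensor product $W=U_q(sl_2)\otimes U_{q^{-1}}(\mathbb C)$. The element $\chi=q^{-\frac12C\otimes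 H}\in W\otimes W$ is a 2-cocycle for $W$: it is invertible, $\chi_{23}(\mathrm{id}\otimes\Delta)\chi=\chi_{12}(\Delta\otimes\mathrm{id})\chi$ and $(\epsilon\otimes\mathrm{id})\chi=1$. Let $\widetilde W$ be the twist of $W$ by $\chi$: the same algebra and counit, $\widetilde\Delta=\chi\,\Delta(\cdot)\,\chi^{-1}$, $\widetilde{\mathcal R}=\chi_{21}\mathcal R\chi^{-1}$, $\widetilde S=U\,S(\cdot)\,U^{-1}$ with $U=\chi^{(1)}S(\chi^{(2)})$. It is a quasitriangular Hopf algebra in which $C$ is central and primitive, $H$ is primitive and $$\widetilde\Delta X_\pm=X_\pm\otimes q^{H/2}+q^{-H/2}q^{\mp C}\otimes X_\pm .$$ There is an isomorphism of quasitriangular Hopf algebras $\widetilde W\cong\hat D$ that is given by the change of variables $$X=q^{-H/2}X_-,\quad \bar X=q^{-H/2}X_+,\quad g=q^{-H}q^{C},\quad \bar g=q^{-H}q^{-C}.$$ -/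

import Mathlib

open scoped TensorProduct

namespace QDbl

/-- The ground ring `ℂ[[t]]`. -/
abbrev Rt : Type := PowerSeries ℂ

/-- The deformation parameter `t`. -/
noncomputable abbrev tt : Rt := PowerSeries.X

section Completion

/-- The two-sided ideal `tⁿ A`. -/
noncomputable def tIdeal (A : Type*) [Ring A] [Algebra Rt A] (n : ℕ) : Ideal A :=
  Ideal.span {algebraMap Rt A (tt ^ n)}

theorem mem_tIdeal {A : Type*} [Ring A] [Algebra Rt A] {n : ℕ} {x : A} :
    x ∈ tIdeal A n ↔ ∃ y : A, x = tt ^ n • y := by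
  unfold tIdeal
  rw [Ideal.mem_span_singleton']
  constructor
  · rintro ⟨y, rfl⟩
    exact ⟨y, by rw [Algebra.smul_def, Algebra.commutes]⟩
  · rintro ⟨y, rfl⟩
    exact ⟨y, by rw [Algebra.smul_def, Algebra.commutes]⟩

instance tIdeal_isTwoSided (A : Type*) [Ring A] [Algebra Rt A] (n : ℕ) :
    (tIdeal A n).IsTwoSided := by
  refine ⟨fun {a} b ha => ?_⟩
  obtain ⟨y, rfl⟩ := mem_tIdeal.1 ha
  exact mem_tIdeal.2 ⟨y * b, by rw [smul_mul_assoc]⟩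

theorem tIdeal_le (A : Type*) [Ring A] [Algebra Rt A] {m n : ℕ} (h : m ≤ n) :
    tIdeal A n ≤ tIdeal A m := by
  intro x hx
  obtain ⟨y, rfl⟩ := mem_tIdeal.1 hx
  refine mem_tIdeal.2 ⟨tt ^ (n - m) • y, ?_⟩
  rw [smul_smul, ← pow_add, Nat.add_sub_cancel' h]

/-- The `t`-adic completion `lim A / tⁿ A` of a (not necessarily commutative) `ℂ[[t]]`-algebra,
as the algebra of compatible sequences. -/
noncomputable def compSub (A : Type*) [Ring A] [Algebra Rt A] :
    Subalgebra Rt (∀ n : ℕ, A ⧸ tIdeal A n) where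
  carrier := {x | ∀ (m n : ℕ) (h : m ≤ n),
    Ideal.Quotient.factorₐ Rt (tIdeal_le A h) (x n) = x m}
  mul_mem' := by
    intro x y hx hy m n h
    rw [Pi.mul_apply, Pi.mul_apply, map_mul, hx m n h, hy m n h]
  add_mem' := by
    intro x y hx hy m n h
    rw [Pi.add_apply, Pi.add_apply, map_add, hx m n h, hy m n h]
  algebraMap_mem' := by
    intro r m n h
    simp

/-- The `t`-adic completion of `A`. -/
def Comp (A : Type*) [Ring A] [Algebra Rt A] : Type _ := compSub A

variable {A B : Type*} [Ring A] [Algebra Rt A] [Ring B] [Algebra Rt B]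

noncomputable instance : Ring (Comp A) := inferInstanceAs (Ring (compSub A))
noncomputable instance : Algebra Rt (Comp A) := inferInstanceAs (Algebra Rt (compSub A))

/-- The component of `x` in `A / tⁿ A`. -/
noncomputable def Comp.proj (n : ℕ) : Comp A →ₐ[Rt] A ⧸ tIdeal A n :=
  (Pi.evalAlgHom Rt (fun n : ℕ => A ⧸ tIdeal A n) n).comp (compSub A).val

theorem Comp.factor_proj {m n : ℕ} (h : m ≤ n) (x : Comp A) :
    Ideal.Quotient.factorₐ Rt (tIdeal_le A h) (Comp.proj n x) = Comp.proj m x :=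
  x.2 m n h

/-- The canonical map of an algebra to its completion. -/
noncomputable def Comp.of : A →ₐ[Rt] Comp A :=
  AlgHom.codRestrict (AlgHom.pi fun n => Ideal.Quotient.mkₐ Rt (tIdeal A n)) (compSub A)
    (fun _ _ _ _ => rfl)

/-- The component modulo `tⁿ` of the extension of a linear map to the completion. -/
noncomputable def Comp.extendAux (f : A →ₗ[Rt] Comp B) (n : ℕ) :
    (A ⧸ tIdeal A n) →ₗ[Rt] (B ⧸ tIdeal B n) where
  toFun := QuotientAddGroup.lift (tIdeal A n).toAddSubgroup
    ((Comp.proj n).toLinearMap ∘ₗ f).toAddMonoidHom (by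
      intro x hx
      obtain ⟨y, rfl⟩ := mem_tIdeal.1 hx
      obtain ⟨z, hz⟩ := Ideal.Quotient.mk_surjective (Comp.proj n (f y))
      have : (Comp.proj n) (f (tt ^ n • y)) = 0 := by
        rw [map_smul, map_smul, ← hz]
        exact Ideal.Quotient.eq_zero_iff_mem.2 (mem_tIdeal.2 ⟨z, rfl⟩)
      exact this)
  map_add' := fun x y => map_add _ x y
  map_smul' := by
    intro r x
    obtain ⟨y, rfl⟩ := Ideal.Quotient.mk_surjective x
    change (Comp.proj n) (f (r • y)) = r • (Comp.proj n) (f y)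
    rw [map_smul, map_smul]

theorem Comp.extendAux_mk (f : A →ₗ[Rt] Comp B) (n : ℕ) (a : A) :
    Comp.extendAux f n (Ideal.Quotient.mk _ a) = Comp.proj n (f a) := rfl

/-- The unique extension to the completion of a linear map with complete target
(linear maps are automatically `t`-adically continuous). -/
noncomputable def Comp.extend (f : A →ₗ[Rt] Comp B) : Comp A →ₗ[Rt] Comp B :=
  LinearMap.codRestrict (Subalgebra.toSubmodule (compSub B))
    (LinearMap.pi fun n => Comp.extendAux f n ∘ₗ (Comp.proj n).toLinearMap)
    (by
      intro x m n h
      obtain ⟨a, ha⟩ := Ideal.Quotient.mk_surjective (Comp.proj n x)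
      have hm : Comp.proj m x = Ideal.Quotient.mk _ a := by
        rw [← Comp.factor_proj h x, ← ha]; rfl
      change Ideal.Quotient.factorₐ Rt (tIdeal_le B h) (Comp.extendAux f n (Comp.proj n x))
        = Comp.extendAux f m (Comp.proj m x)
      rw [← ha, hm, Comp.extendAux_mk, Comp.extendAux_mk, Comp.factor_proj h])

/-- Functoriality of the completion. -/
noncomputable def Comp.map (f : A →ₗ[Rt] B) : Comp A →ₗ[Rt] Comp B :=
  Comp.extend (Comp.of.toLinearMap ∘ₗ f)

theorem Comp.extend_of (f : A →ₗ[Rt] Comp B) (a : A) : Comp.extend f (Comp.of a) = f a := by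
  apply Subtype.ext
  funext n
  rfl

/-- `q ^ (s x) = ∑ₙ (s c t x)ⁿ / n!`, where `q = exp (c t)`, for an element `x` of a completed
algebra. -/
noncomputable def qpow (c s : ℂ) (x : Comp A) : Comp A :=
  ⟨fun n => ∑ k ∈ Finset.range n,
      (PowerSeries.C ((s * c) ^ k / (k.factorial : ℂ)) * tt ^ k) • (Comp.proj n x) ^ k, by
    intro m n h
    change Ideal.Quotient.factorₐ Rt (tIdeal_le A h) (∑ k ∈ Finset.range n,
      (PowerSeries.C ((s * c) ^ k / (k.factorial : ℂ)) * tt ^ k) • (Comp.proj n x) ^ k) =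
      ∑ k ∈ Finset.range m,
      (PowerSeries.C ((s * c) ^ k / (k.factorial : ℂ)) * tt ^ k) • (Comp.proj m x) ^ k
    simp only [map_sum, map_smul, map_pow, Comp.factor_proj h]
    symm
    apply Finset.sum_subset (Finset.range_mono h)
    intro k _ hk
    obtain ⟨z, hz⟩ := Ideal.Quotient.mk_surjective (Comp.proj m x ^ k)
    have hmk : m ≤ k := by simpa using hk
    rw [mul_smul, ← hz]
    have : (tt ^ k • (Ideal.Quotient.mk (tIdeal A m) z)) = 0 :=
      Ideal.Quotient.eq_zero_iff_mem.2 (tIdeal_le A hmk (mem_tIdeal.2 ⟨z, rfl⟩))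
    rw [this, smul_zero]⟩

/-- `s` is the `t`-adic sum of the series `∑ₙ a n`. -/
def HasTSum (a : ℕ → A) (s : A) : Prop :=
  ∀ N : ℕ, ∃ M : ℕ, ∀ n : ℕ, M ≤ n → ∃ y : A, s - ∑ k ∈ Finset.range n, a k = tt ^ N • y

end Completion


section HopfOfGenerators

variable {k A : Type*} [CommRing k] [Ring A] [Bialgebra k A]

theorem antipode_left_mul (S : A →ₐ[k] Aᵐᵒᵖ) (z w : A ⊗[k] A) (r : k)
    (hz : LinearMap.mul' k A
      (((MulOpposite.opLinearEquiv k).symm.toLinearMap ∘ₗ S.toLinearMap).rTensor A z)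
      = algebraMap k A r) :
    LinearMap.mul' k A
      (((MulOpposite.opLinearEquiv k).symm.toLinearMap ∘ₗ S.toLinearMap).rTensor A (z * w))
      = r • LinearMap.mul' k A
      (((MulOpposite.opLinearEquiv k).symm.toLinearMap ∘ₗ S.toLinearMap).rTensor A w) := by
  induction w with
  | zero => simp
  | add w₁ w₂ h₁ h₂ => rw [mul_add, map_add, map_add, h₁, h₂, map_add, map_add, smul_add]
  | tmul b₁ b₂ =>
    have key : ∀ z : A ⊗[k] A, LinearMap.mul' k A
        (((MulOpposite.opLinearEquiv k).symm.toLinearMap ∘ₗ S.toLinearMap).rTensor A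
          (z * b₁ ⊗ₜ b₂)) = (S b₁).unop * LinearMap.mul' k A
        (((MulOpposite.opLinearEquiv k).symm.toLinearMap ∘ₗ S.toLinearMap).rTensor A z) * b₂ := by
      intro z
      induction z with
      | zero => simp
      | add z₁ z₂ h₁ h₂ => rw [add_mul, map_add, map_add, h₁, h₂, map_add, map_add, mul_add, add_mul]
      | tmul a₁ a₂ => simp [mul_assoc]
    rw [key, hz, ← Algebra.commutes, mul_assoc, Algebra.smul_def]
    simp

theorem antipode_right_mul (S : A →ₐ[k] Aᵐᵒᵖ) (z w : A ⊗[k] A) (r : k)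
    (hw : LinearMap.mul' k A
      (((MulOpposite.opLinearEquiv k).symm.toLinearMap ∘ₗ S.toLinearMap).lTensor A w)
      = algebraMap k A r) :
    LinearMap.mul' k A
      (((MulOpposite.opLinearEquiv k).symm.toLinearMap ∘ₗ S.toLinearMap).lTensor A (z * w))
      = r • LinearMap.mul' k A
      (((MulOpposite.opLinearEquiv k).symm.toLinearMap ∘ₗ S.toLinearMap).lTensor A z) := by
  induction z with
  | zero => simp
  | add w₁ w₂ h₁ h₂ => rw [add_mul, map_add, map_add, h₁, h₂, map_add, map_add, smul_add]
  | tmul b₁ b₂ =>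
    have key : ∀ w : A ⊗[k] A, LinearMap.mul' k A
        (((MulOpposite.opLinearEquiv k).symm.toLinearMap ∘ₗ S.toLinearMap).lTensor A
          (b₁ ⊗ₜ b₂ * w)) = b₁ * LinearMap.mul' k A
        (((MulOpposite.opLinearEquiv k).symm.toLinearMap ∘ₗ S.toLinearMap).lTensor A w)
          * (S b₂).unop := by
      intro w
      induction w with
      | zero => simp
      | add z₁ z₂ h₁ h₂ => rw [mul_add, map_add, map_add, h₁, h₂, map_add, map_add, mul_add, add_mul]
      | tmul a₁ a₂ => simp [mul_assoc]
    rw [key, hw, ← Algebra.commutes, mul_assoc, Algebra.smul_def]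
    simp

/-- A bialgebra with an anti-homomorphism that satisfies the antipode axioms on a set of
algebra generators is a Hopf algebra. -/
@[reducible] noncomputable def hopfOfGenerators (S : A →ₐ[k] Aᵐᵒᵖ) (s : Set A)
    (hs : Algebra.adjoin k s = ⊤)
    (hl : ∀ x ∈ s, LinearMap.mul' k A
      (((MulOpposite.opLinearEquiv k).symm.toLinearMap ∘ₗ S.toLinearMap).rTensor A
        (Coalgebra.comul (R := k) x)) = algebraMap k A (Coalgebra.counit x))
    (hr : ∀ x ∈ s, LinearMap.mul' k A
      (((MulOpposite.opLinearEquiv k).symm.toLinearMap ∘ₗ S.toLinearMap).lTensor A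
        (Coalgebra.comul (R := k) x)) = algebraMap k A (Coalgebra.counit x)) :
    HopfAlgebra k A where
  antipode := (MulOpposite.opLinearEquiv k).symm.toLinearMap ∘ₗ S.toLinearMap
  mul_antipode_rTensor_comul := by
    ext a
    have ha : a ∈ Algebra.adjoin k s := hs ▸ Algebra.mem_top
    change LinearMap.mul' k A
      (((MulOpposite.opLinearEquiv k).symm.toLinearMap ∘ₗ S.toLinearMap).rTensor A
        (Coalgebra.comul (R := k) a)) = algebraMap k A (Coalgebra.counit a)
    induction ha using Algebra.adjoin_induction with
    | mem x hx => exact hl x hx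
    | algebraMap r =>
      rw [Bialgebra.comul_algebraMap, Algebra.TensorProduct.algebraMap_apply]
      simp
    | add x y _ _ hx hy => rw [map_add, map_add, map_add, hx, hy, map_add, map_add]
    | mul x y _ _ hx hy =>
      rw [Bialgebra.comul_mul, antipode_left_mul S _ _ _ hx, hy, Bialgebra.counit_mul, map_mul,
        Algebra.smul_def]
  mul_antipode_lTensor_comul := by
    ext a
    have ha : a ∈ Algebra.adjoin k s := hs ▸ Algebra.mem_top
    change LinearMap.mul' k A
      (((MulOpposite.opLinearEquiv k).symm.toLinearMap ∘ₗ S.toLinearMap).lTensor A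
        (Coalgebra.comul (R := k) a)) = algebraMap k A (Coalgebra.counit a)
    induction ha using Algebra.adjoin_induction with
    | mem x hx => exact hr x hx
    | algebraMap r =>
      rw [Bialgebra.comul_algebraMap, Algebra.TensorProduct.algebraMap_apply]
      simp
    | add x y _ _ hx hy => rw [map_add, map_add, map_add, hx, hy, map_add, map_add]
    | mul x y _ _ hx hy =>
      rw [Bialgebra.comul_mul, antipode_right_mul S _ _ _ hy, hx, Bialgebra.counit_mul, map_mul,
        Algebra.smul_def]
      exact Algebra.commutes _ _

end HopfOfGenerators

section Presentations

/-- The generators of a presented algebra generate it. -/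
theorem adjoin_ringQuot {k G : Type*} [CommRing k]
    (r : FreeAlgebra k G → FreeAlgebra k G → Prop) :
    Algebra.adjoin k (Set.range fun g : G => RingQuot.mkAlgHom k r (FreeAlgebra.ι k g)) = ⊤ := by
  have h := FreeAlgebra.adjoin_range_ι k G
  have h2 := congrArg (Subalgebra.map (RingQuot.mkAlgHom k r)) h
  rw [AlgHom.map_adjoin, ← Set.range_comp, Algebra.map_top,
    (AlgHom.range_eq_top _).2 (RingQuot.mkAlgHom_surjective k r)] at h2
  exact h2

/-- Generators `X, g, g⁻¹` of `U_q(b₋)`. -/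
inductive BGen : Type
  | X | g | gi

variable {k : Type*} [Field k] (q : kˣ)

/-- Relations of `U_q(b₋)`: `g` is invertible and `g X = q² X g`. -/
inductive BRel : FreeAlgebra k BGen → FreeAlgebra k BGen → Prop
  | g_gi : BRel (FreeAlgebra.ι k BGen.g * FreeAlgebra.ι k BGen.gi) 1
  | gi_g : BRel (FreeAlgebra.ι k BGen.gi * FreeAlgebra.ι k BGen.g) 1
  | gX : BRel (FreeAlgebra.ι k BGen.g * FreeAlgebra.ι k BGen.X)
      ((q : k) ^ 2 • (FreeAlgebra.ι k BGen.X * FreeAlgebra.ι k BGen.g))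

/-- The algebra `U_q(b₋)`. -/
def Ub : Type _ := RingQuot (BRel q)

noncomputable instance : Ring (Ub q) := inferInstanceAs (Ring (RingQuot (BRel q)))
noncomputable instance {S : Type*} [CommSemiring S] [Algebra S k] : Algebra S (Ub q) :=
  inferInstanceAs (Algebra S (RingQuot (BRel q)))

namespace Ub

/-- The generators of `U_q(b₋)`. -/
noncomputable def gen (x : BGen) : Ub q := RingQuot.mkAlgHom k (BRel q) (FreeAlgebra.ι k x)
noncomputable abbrev X : Ub q := gen q BGen.X
noncomputable abbrev g : Ub q := gen q BGen.g
noncomputable abbrev gi : Ub q := gen q BGen.gi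

theorem g_gi : g q * gi q = 1 := by
  have := RingQuot.mkAlgHom_rel k (BRel.g_gi (q := q))
  simpa using! this
theorem gi_g : gi q * g q = 1 := by
  have := RingQuot.mkAlgHom_rel k (BRel.gi_g (q := q))
  simpa using! this
theorem gX : g q * X q = (q : k) ^ 2 • (X q * g q) := by
  have := RingQuot.mkAlgHom_rel k (BRel.gX (q := q))
  simpa using! this

variable {A : Type*} [Ring A] [Algebra k A]

/-- The algebra map given by images of the generators that satisfy the relations. -/
noncomputable def lift (x g gi : A) (h₁ : g * gi = 1) (h₂ : gi * g = 1)
    (h₃ : g * x = (q : k) ^ 2 • (x * g)) : Ub q →ₐ[k] A :=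
  RingQuot.liftAlgHom k ⟨FreeAlgebra.lift k fun y => match y with
    | BGen.X => x
    | BGen.g => g
    | BGen.gi => gi, by
      intro a b hab
      cases hab <;> simp [h₁, h₂, h₃]⟩

@[simp] theorem lift_X (x g gi : A) (h₁ h₂ h₃) : lift q x g gi h₁ h₂ h₃ (X q) = x := by
  unfold lift X gen
  erw [RingQuot.liftAlgHom_mkAlgHom_apply]
  simp
@[simp] theorem lift_g (x g gi : A) (h₁ h₂ h₃) : lift q x g gi h₁ h₂ h₃ (Ub.g q) = g := by
  unfold lift Ub.g gen
  erw [RingQuot.liftAlgHom_mkAlgHom_apply]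
  simp
@[simp] theorem lift_gi (x g gi : A) (h₁ h₂ h₃) : lift q x g gi h₁ h₂ h₃ (Ub.gi q) = gi := by
  unfold lift Ub.gi gen
  erw [RingQuot.liftAlgHom_mkAlgHom_apply]
  simp

theorem adjoin_gen : Algebra.adjoin k (Set.range (gen q)) = ⊤ := adjoin_ringQuot (BRel q)

variable {q} in
theorem hom_ext {f h : Ub q →ₐ[k] A} (hX : f (X q) = h (X q)) (hg : f (g q) = h (g q))
    (hgi : f (gi q) = h (gi q)) : f = h := by
  refine AlgHom.ext_of_adjoin_eq_top (adjoin_gen q) ?_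
  rintro _ ⟨y, rfl⟩
  cases y <;> assumption

/-- The coproduct of `U_q(b₋)`: `Δ X = X ⊗ 1 + g ⊗ X`, `Δ g = g ⊗ g`. -/
noncomputable def comulHom : Ub q →ₐ[k] Ub q ⊗[k] Ub q :=
  lift q (X q ⊗ₜ 1 + g q ⊗ₜ X q) (g q ⊗ₜ g q) (gi q ⊗ₜ gi q)
    (by simp [g_gi, Algebra.TensorProduct.one_def]) (by simp [gi_g, Algebra.TensorProduct.one_def])
    (by simp [mul_add, add_mul, gX, TensorProduct.smul_tmul'])

/-- The counit of `U_q(b₋)`: `ε X = 0`, `ε g = 1`. -/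
noncomputable def counitHom : Ub q →ₐ[k] k := lift q 0 1 1 (by simp) (by simp) (by simp)

noncomputable instance : Bialgebra k (Ub q) :=
  Bialgebra.ofAlgHom (comulHom q) (counitHom q)
    (by apply hom_ext <;> simp [comulHom, TensorProduct.add_tmul, TensorProduct.tmul_add,
          Algebra.TensorProduct.one_def, add_assoc])
    (by apply hom_ext <;> simp [comulHom, counitHom])
    (by apply hom_ext <;> simp [comulHom, counitHom])

theorem comul_X : Coalgebra.comul (R := k) (X q) = X q ⊗ₜ 1 + g q ⊗ₜ X q := lift_X ..
theorem comul_g : Coalgebra.comul (R := k) (g q) = g q ⊗ₜ g q := lift_g ..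
theorem comul_gi : Coalgebra.comul (R := k) (gi q) = gi q ⊗ₜ gi q := lift_gi ..
theorem counit_X : Coalgebra.counit (R := k) (X q) = 0 := lift_X ..
theorem counit_g : Coalgebra.counit (R := k) (g q) = 1 := lift_g ..
theorem counit_gi : Coalgebra.counit (R := k) (gi q) = 1 := lift_gi ..

theorem X_gi : X q * gi q = (q : k) ^ 2 • (gi q * X q) := by
  calc X q * gi q = gi q * (g q * X q) * gi q := by rw [← mul_assoc, gi_g, one_mul]
    _ = (q : k) ^ 2 • (gi q * X q) := by
      rw [gX, mul_smul_comm, smul_mul_assoc, mul_assoc, mul_assoc, g_gi, mul_one]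

/-- The antipode of `U_q(b₋)` as an anti-homomorphism: `S X = -g⁻¹ X`, `S g = g⁻¹`. -/
noncomputable def antipodeHom : Ub q →ₐ[k] (Ub q)ᵐᵒᵖ :=
  lift q (MulOpposite.op (-(gi q * X q))) (MulOpposite.op (gi q)) (MulOpposite.op (g q))
    (by rw [← MulOpposite.op_mul, g_gi, MulOpposite.op_one])
    (by rw [← MulOpposite.op_mul, gi_g, MulOpposite.op_one])
    (by
      rw [← MulOpposite.op_mul, ← MulOpposite.op_mul, ← MulOpposite.op_smul]
      congr 1
      rw [neg_mul, mul_assoc, X_gi, mul_smul_comm, mul_neg, smul_neg])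

noncomputable instance : HopfAlgebra k (Ub q) :=
  hopfOfGenerators (antipodeHom q) (Set.range (gen q)) (adjoin_gen q)
    (by
      rintro _ ⟨y, rfl⟩
      cases y
      · simp [comul_X, counit_X, antipodeHom]
      · simp [comul_g, counit_g, antipodeHom, gi_g]
      · simp [comul_gi, counit_gi, antipodeHom, g_gi])
    (by
      rintro _ ⟨y, rfl⟩
      cases y
      · simp [comul_X, counit_X, antipodeHom, ← mul_assoc, g_gi]
      · simp [comul_g, counit_g, antipodeHom, g_gi]
      · simp [comul_gi, counit_gi, antipodeHom, gi_g])

end Ub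

/-- Generators `X, g, g⁻¹, X̄, ḡ, ḡ⁻¹` of `D(U_q(b₋))`. -/
inductive DGen : Type
  | X | g | gi | Y | h | hi

/-- Relations of `D(U_q(b₋))`; here `Y = X̄` and `h = ḡ`. -/
inductive DRel : FreeAlgebra k DGen → FreeAlgebra k DGen → Prop
  | g_gi : DRel (FreeAlgebra.ι k DGen.g * FreeAlgebra.ι k DGen.gi) 1
  | gi_g : DRel (FreeAlgebra.ι k DGen.gi * FreeAlgebra.ι k DGen.g) 1
  | h_hi : DRel (FreeAlgebra.ι k DGen.h * FreeAlgebra.ι k DGen.hi) 1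
  | hi_h : DRel (FreeAlgebra.ι k DGen.hi * FreeAlgebra.ι k DGen.h) 1
  | gh : DRel (FreeAlgebra.ι k DGen.g * FreeAlgebra.ι k DGen.h)
      (FreeAlgebra.ι k DGen.h * FreeAlgebra.ι k DGen.g)
  | gX : DRel (FreeAlgebra.ι k DGen.g * FreeAlgebra.ι k DGen.X)
      ((q : k) ^ 2 • (FreeAlgebra.ι k DGen.X * FreeAlgebra.ι k DGen.g))
  | hX : DRel (FreeAlgebra.ι k DGen.h * FreeAlgebra.ι k DGen.X)
      ((q : k) ^ 2 • (FreeAlgebra.ι k DGen.X * FreeAlgebra.ι k DGen.h))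
  | gY : DRel (FreeAlgebra.ι k DGen.g * FreeAlgebra.ι k DGen.Y)
      (((q : k) ^ 2)⁻¹ • (FreeAlgebra.ι k DGen.Y * FreeAlgebra.ι k DGen.g))
  | hY : DRel (FreeAlgebra.ι k DGen.h * FreeAlgebra.ι k DGen.Y)
      (((q : k) ^ 2)⁻¹ • (FreeAlgebra.ι k DGen.Y * FreeAlgebra.ι k DGen.h))
  | XY : DRel (FreeAlgebra.ι k DGen.X * FreeAlgebra.ι k DGen.Y
        - ((q : k) ^ 2)⁻¹ • (FreeAlgebra.ι k DGen.Y * FreeAlgebra.ι k DGen.X))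
      (((q : k) ^ 2 - 1)⁻¹ • (FreeAlgebra.ι k DGen.h * FreeAlgebra.ι k DGen.g - 1))

/-- The algebra with generators `X, g^{±1}, X̄, ḡ^{±1}` and the relations of `D(U_q(b₋))`. -/
def Dq : Type _ := RingQuot (DRel q)

noncomputable instance : Ring (Dq q) := inferInstanceAs (Ring (RingQuot (DRel q)))
noncomputable instance {S : Type*} [CommSemiring S] [Algebra S k] : Algebra S (Dq q) :=
  inferInstanceAs (Algebra S (RingQuot (DRel q)))

namespace Dq

/-- The generators. -/
noncomputable def gen (x : DGen) : Dq q := RingQuot.mkAlgHom k (DRel q) (FreeAlgebra.ι k x)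
noncomputable abbrev X : Dq q := gen q DGen.X
noncomputable abbrev g : Dq q := gen q DGen.g
noncomputable abbrev gi : Dq q := gen q DGen.gi
/-- The generator `X̄`. -/
noncomputable abbrev Y : Dq q := gen q DGen.Y
/-- The generator `ḡ`. -/
noncomputable abbrev h : Dq q := gen q DGen.h
/-- The generator `ḡ⁻¹`. -/
noncomputable abbrev hi : Dq q := gen q DGen.hi

theorem g_gi : g q * gi q = 1 := by
  have := RingQuot.mkAlgHom_rel k (DRel.g_gi (q := q))
  simpa using! this
theorem gi_g : gi q * g q = 1 := by
  have := RingQuot.mkAlgHom_rel k (DRel.gi_g (q := q))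
  simpa using! this
theorem h_hi : h q * hi q = 1 := by
  have := RingQuot.mkAlgHom_rel k (DRel.h_hi (q := q))
  simpa using! this
theorem hi_h : hi q * h q = 1 := by
  have := RingQuot.mkAlgHom_rel k (DRel.hi_h (q := q))
  simpa using! this
theorem gh : g q * h q = h q * g q := by
  have := RingQuot.mkAlgHom_rel k (DRel.gh (q := q))
  simpa using! this
theorem gX : g q * X q = (q : k) ^ 2 • (X q * g q) := by
  have := RingQuot.mkAlgHom_rel k (DRel.gX (q := q))
  simpa using! this
theorem hX : h q * X q = (q : k) ^ 2 • (X q * h q) := by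
  have := RingQuot.mkAlgHom_rel k (DRel.hX (q := q))
  simpa using! this
theorem gY : g q * Y q = ((q : k) ^ 2)⁻¹ • (Y q * g q) := by
  have := RingQuot.mkAlgHom_rel k (DRel.gY (q := q))
  rw [map_mul, map_smul, map_mul] at this
  exact this
theorem hY : h q * Y q = ((q : k) ^ 2)⁻¹ • (Y q * h q) := by
  have := RingQuot.mkAlgHom_rel k (DRel.hY (q := q))
  rw [map_mul, map_smul, map_mul] at this
  exact this
theorem XY : X q * Y q - ((q : k) ^ 2)⁻¹ • (Y q * X q)
    = ((q : k) ^ 2 - 1)⁻¹ • (h q * g q - 1) := by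
  have := RingQuot.mkAlgHom_rel k (DRel.XY (q := q))
  rw [map_sub, map_mul, map_smul, map_mul, map_smul, map_sub, map_mul, map_one] at this
  exact this

variable {A : Type*} [Ring A] [Algebra k A]

/-- The elements `x, g, g⁻¹, y, h, h⁻¹` of `A` satisfy the relations of `D(U_q(b₋))`. -/
structure Rels (x g gi y h hi : A) : Prop where
  g_gi : g * gi = 1
  gi_g : gi * g = 1
  h_hi : h * hi = 1
  hi_h : hi * h = 1
  gh : g * h = h * g
  gX : g * x = (q : k) ^ 2 • (x * g)
  hX : h * x = (q : k) ^ 2 • (x * h)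
  gY : g * y = ((q : k) ^ 2)⁻¹ • (y * g)
  hY : h * y = ((q : k) ^ 2)⁻¹ • (y * h)
  XY : x * y - ((q : k) ^ 2)⁻¹ • (y * x) = ((q : k) ^ 2 - 1)⁻¹ • (h * g - 1)

/-- The algebra map given by images of the generators that satisfy the relations. -/
noncomputable def lift (x g gi y h hi : A) (H : Rels q x g gi y h hi) : Dq q →ₐ[k] A :=
  RingQuot.liftAlgHom k ⟨FreeAlgebra.lift k fun z => match z with
    | DGen.X => x
    | DGen.g => g
    | DGen.gi => gi
    | DGen.Y => y
    | DGen.h => h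
    | DGen.hi => hi, by
      intro a b hab
      cases hab <;>
      simp only [map_mul, map_sub, map_smul, map_one, FreeAlgebra.lift_ι_apply]
      exacts [H.g_gi, H.gi_g, H.h_hi, H.hi_h, H.gh, H.gX, H.hX, H.gY, H.hY, H.XY]⟩

theorem lift_gen (x g gi y h hi : A) (H : Rels q x g gi y h hi) (z : DGen) :
    lift q x g gi y h hi H (gen q z) = match z with
    | DGen.X => x
    | DGen.g => g
    | DGen.gi => gi
    | DGen.Y => y
    | DGen.h => h
    | DGen.hi => hi := by
  unfold lift gen
  erw [RingQuot.liftAlgHom_mkAlgHom_apply]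
  simp

theorem adjoin_gen : Algebra.adjoin k (Set.range (gen q)) = ⊤ := adjoin_ringQuot (DRel q)

variable {q} in
theorem hom_ext {f h : Dq q →ₐ[k] A} (H : ∀ z, f (gen q z) = h (gen q z)) : f = h := by
  refine AlgHom.ext_of_adjoin_eq_top (adjoin_gen q) ?_
  rintro _ ⟨y, rfl⟩
  exact H y

theorem q_ne : ((q : k) ^ 2) ≠ 0 := pow_ne_zero _ q.ne_zero

/-- The coproduct of `D(U_q(b₋))`: `Δ X = X ⊗ 1 + g ⊗ X`, `Δ X̄ = X̄ ⊗ 1 + ḡ ⊗ X̄`, with `g` and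
`ḡ` group-like. -/
noncomputable def comulHom : Dq q →ₐ[k] Dq q ⊗[k] Dq q :=
  lift q (X q ⊗ₜ 1 + g q ⊗ₜ X q) (g q ⊗ₜ g q) (gi q ⊗ₜ gi q)
    (Y q ⊗ₜ 1 + h q ⊗ₜ Y q) (h q ⊗ₜ h q) (hi q ⊗ₜ hi q) (by
    have hXh : (q : k) ^ 2 • (X q * h q) = h q * X q := (hX q).symm
    constructor
    · simp [g_gi, Algebra.TensorProduct.one_def]
    · simp [gi_g, Algebra.TensorProduct.one_def]
    · simp [h_hi, Algebra.TensorProduct.one_def]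
    · simp [hi_h, Algebra.TensorProduct.one_def]
    · simp [gh]
    · simp [mul_add, add_mul, gX, TensorProduct.smul_tmul']
    · simp [mul_add, add_mul, hX, gh, TensorProduct.smul_tmul']
    · simp [mul_add, add_mul, gY, gh, TensorProduct.smul_tmul', -inv_pow]
    · simp [mul_add, add_mul, hY, TensorProduct.smul_tmul', -inv_pow]
    · have e1 := XY q
      rw [sub_eq_iff_eq_add] at e1
      simp only [mul_add, add_mul, Algebra.TensorProduct.tmul_mul_tmul, one_mul, mul_one,
        gY, hX, gh, e1, smul_add, TensorProduct.add_tmul, TensorProduct.tmul_add,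
        ← TensorProduct.smul_tmul', TensorProduct.tmul_smul, smul_smul,
        inv_mul_cancel₀ (q_ne q), one_smul, TensorProduct.sub_tmul, TensorProduct.tmul_sub,
        smul_sub, Algebra.TensorProduct.one_def]
      abel)

/-- The counit of `D(U_q(b₋))`: `ε X = ε X̄ = 0`, `ε g = ε ḡ = 1`. -/
noncomputable def counitHom : Dq q →ₐ[k] k :=
  lift q 0 1 1 0 1 1 (by constructor <;> simp)

noncomputable instance : Bialgebra k (Dq q) :=
  Bialgebra.ofAlgHom (comulHom q) (counitHom q)
    (by
      apply hom_ext
      rintro (_ | _) <;> simp [comulHom, lift_gen, TensorProduct.add_tmul, TensorProduct.tmul_add,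
          Algebra.TensorProduct.one_def, add_assoc])
    (by
      apply hom_ext
      rintro (_ | _) <;> simp [comulHom, counitHom, lift_gen])
    (by
      apply hom_ext
      rintro (_ | _) <;> simp [comulHom, counitHom, lift_gen])

theorem comul_gen (z : DGen) : Coalgebra.comul (R := k) (gen q z) = match z with
    | DGen.X => X q ⊗ₜ 1 + g q ⊗ₜ X q
    | DGen.g => g q ⊗ₜ g q
    | DGen.gi => gi q ⊗ₜ gi q
    | DGen.Y => Y q ⊗ₜ 1 + h q ⊗ₜ Y q
    | DGen.h => h q ⊗ₜ h q
    | DGen.hi => hi q ⊗ₜ hi q := lift_gen ..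

theorem counit_gen (z : DGen) : Coalgebra.counit (R := k) (gen q z) = match z with
    | DGen.X => 0
    | DGen.g => 1
    | DGen.gi => 1
    | DGen.Y => 0
    | DGen.h => 1
    | DGen.hi => 1 := lift_gen ..

variable {q} in
/-- Commutation with the inverse of an element. -/
theorem comm_inv {x u v : Dq q} {r : k} (huv : u * v = 1) (hvu : v * u = 1)
    (hx : u * x = r • (x * u)) : x * v = r • (v * x) := by
  calc x * v = v * (u * x) * v := by rw [← mul_assoc, hvu, one_mul]
    _ = r • (v * x) := by
      rw [hx, mul_smul_comm, smul_mul_assoc, mul_assoc, mul_assoc, huv, mul_one]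

/-- The antipode of `D(U_q(b₋))` as an anti-homomorphism: `S X = -g⁻¹ X`, `S X̄ = -ḡ⁻¹ X̄`,
`S g = g⁻¹`, `S ḡ = ḡ⁻¹`. -/
noncomputable def antipodeHom : Dq q →ₐ[k] (Dq q)ᵐᵒᵖ :=
  lift q (MulOpposite.op (-(gi q * X q))) (MulOpposite.op (gi q)) (MulOpposite.op (g q))
    (MulOpposite.op (-(hi q * Y q))) (MulOpposite.op (hi q)) (MulOpposite.op (h q)) (by
    have e1 : hi q * gi q = gi q * hi q := by
      have := comm_inv (q := q) (x := gi q) (u := h q) (v := hi q) (r := 1) (h_hi q) (hi_h q)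
        (by
          have := comm_inv (q := q) (x := h q) (u := g q) (v := gi q) (r := 1) (g_gi q) (gi_g q)
            (by rw [one_smul, gh])
          rw [one_smul] at this ⊢
          exact this)
      rw [one_smul] at this
      exact this.symm
    have eXg := comm_inv (g_gi q) (gi_g q) (gX q)
    have eXh := comm_inv (h_hi q) (hi_h q) (hX q)
    have eYg := comm_inv (g_gi q) (gi_g q) (gY q)
    have eYh := comm_inv (h_hi q) (hi_h q) (hY q)
    constructor <;>
    simp only [← MulOpposite.op_mul, ← MulOpposite.op_smul, ← MulOpposite.op_sub,
      ← MulOpposite.op_one] <;> congr 1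
    · exact g_gi q
    · exact gi_g q
    · exact h_hi q
    · exact hi_h q
    · rw [neg_mul, mul_assoc, eXg, mul_smul_comm, mul_neg, smul_neg]
    · rw [neg_mul, mul_assoc, eXh, mul_smul_comm, mul_neg, smul_neg, ← mul_assoc, ← mul_assoc, e1]
    · rw [neg_mul, mul_assoc, eYg, mul_smul_comm, mul_neg, smul_neg, ← mul_assoc, ← mul_assoc, e1]
    · rw [neg_mul, mul_assoc, eYh, mul_smul_comm, mul_neg, smul_neg]
    · have t1 : hi q * Y q * (gi q * X q) = ((q : k) ^ 2)⁻¹ • (gi q * hi q * (Y q * X q)) := by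
        rw [mul_assoc, ← mul_assoc (Y q), eYg, smul_mul_assoc, mul_smul_comm, ← e1]
        simp only [mul_assoc]
      have t2 : gi q * X q * (hi q * Y q) = (q : k) ^ 2 • (gi q * hi q * (X q * Y q)) := by
        rw [mul_assoc, ← mul_assoc (X q), eXh, smul_mul_assoc, mul_smul_comm]
        simp only [mul_assoc]
      have t3 : gi q * hi q * (h q * g q) = 1 := by
        rw [mul_assoc, ← mul_assoc (hi q), hi_h, one_mul, gi_g]
      rw [neg_mul_neg, neg_mul_neg, t1, t2, smul_smul, inv_mul_cancel₀ (q_ne q), one_smul,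
        ← mul_smul_comm, ← mul_sub, ← neg_sub, XY, mul_neg, mul_smul_comm, mul_sub, t3, mul_one,
        ← smul_neg, neg_sub])

noncomputable instance : HopfAlgebra k (Dq q) :=
  hopfOfGenerators (antipodeHom q) (Set.range (gen q)) (adjoin_gen q)
    (by
      rintro _ ⟨y, rfl⟩
      rw [comul_gen, counit_gen]
      cases y <;> simp [antipodeHom, lift_gen, g_gi, gi_g, h_hi, hi_h])
    (by
      rintro _ ⟨y, rfl⟩
      rw [comul_gen, counit_gen]
      cases y <;> simp [antipodeHom, lift_gen, g_gi, gi_g, h_hi, hi_h, ← mul_assoc])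

end Dq

end Presentations

section Double

variable {k : Type*} [Field k]

/-- A Hopf algebra pairing `⟨ , ⟩ : H ⊗ A → k`. -/
structure IsHopfPairing {H A : Type*} [Ring H] [HopfAlgebra k H] [Ring A] [HopfAlgebra k A]
    (σ : H →ₗ[k] A →ₗ[k] k) : Prop where
  mul_left : ∀ (x y : H) (a : A), σ (x * y) a =
    LinearMap.mul' k k (TensorProduct.map (σ x) (σ y) (Coalgebra.comul a))
  mul_right : ∀ (x : H) (a b : A), σ x (a * b) =
    LinearMap.mul' k k (TensorProduct.map (σ.flip a) (σ.flip b) (Coalgebra.comul x))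
  one_left : ∀ a : A, σ 1 a = Coalgebra.counit (R := k) a
  one_right : ∀ x : H, σ x 1 = Coalgebra.counit (R := k) x
  antipode : ∀ (x : H) (a : A),
    σ (HopfAlgebra.antipode k x) a = σ x (HopfAlgebra.antipode k a)

/-- The Hopf algebra `D` is, via `ψ`, the quantum double of the dually paired Hopf algebras
`A` and `H`: it is the vector space `A ⊗ H` with the tensor product unit, counit and coproduct,
and with the product
`(a ⊗ x)(b ⊗ y) = ∑ b₍₂₎ a ⊗ x₍₂₎ y ⟨S x₍₁₎, b₍₁₎⟩ ⟨x₍₃₎, b₍₃₎⟩`. -/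
structure IsQuantumDouble {H A D : Type*} [Ring H] [HopfAlgebra k H] [Ring A] [HopfAlgebra k A]
    [Ring D] [HopfAlgebra k D] (σ : H →ₗ[k] A →ₗ[k] k) (ψ : A ⊗[k] H ≃ₗ[k] D) : Prop where
  one : ψ (1 ⊗ₜ 1) = 1
  counit : ∀ z : A ⊗[k] H, Coalgebra.counit (R := k) (ψ z) = Coalgebra.counit (R := k) z
  comul : ∀ z : A ⊗[k] H, Coalgebra.comul (R := k) (ψ z) =
    TensorProduct.map ψ.toLinearMap ψ.toLinearMap (Coalgebra.comul (R := k) z)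
  mul : ∀ (a b : A) (x y : H) (m n : ℕ) (x₁ x₂ x₃ : Fin m → H) (b₁ b₂ b₃ : Fin n → A),
    LinearMap.lTensor H (Coalgebra.comul (R := k)) (Coalgebra.comul (R := k) x)
      = ∑ i, x₁ i ⊗ₜ[k] (x₂ i ⊗ₜ[k] x₃ i) →
    LinearMap.lTensor A (Coalgebra.comul (R := k)) (Coalgebra.comul (R := k) b)
      = ∑ j, b₁ j ⊗ₜ[k] (b₂ j ⊗ₜ[k] b₃ j) →
    ψ (a ⊗ₜ x) * ψ (b ⊗ₜ y) = ∑ i, ∑ j,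
      (σ (HopfAlgebra.antipode k (x₁ i)) (b₁ j) * σ (x₃ i) (b₃ j)) •
        ψ ((b₂ j * a) ⊗ₜ (x₂ i * y))

variable (q : kˣ)

/-- The Hopf algebra self-pairing of `U_q(b₋)` with
`⟨g,g⟩ = q²`, `⟨g,X⟩ = ⟨X,g⟩ = 0`, `⟨X,X⟩ = 1/(1 - q⁻²)`. -/
structure IsBorelPairing (σ : Ub q →ₗ[k] Ub q →ₗ[k] k) : Prop where
  pairing : IsHopfPairing σ
  gg : σ (Ub.g q) (Ub.g q) = (q : k) ^ 2
  gX : σ (Ub.g q) (Ub.X q) = 0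
  Xg : σ (Ub.X q) (Ub.g q) = 0
  XX : σ (Ub.X q) (Ub.X q) = (1 - ((q : k) ^ 2)⁻¹)⁻¹

/-- The presented Hopf algebra `Dq q` is the quantum double of `U_q(b₋)` for the pairing `σ`, with
`X, g` the generators of the factor `H = U_q(b₋)` and `X̄, ḡ` those of the factor `Hᵒᵖ`. -/
structure IsBorelDouble (σ : Ub q →ₗ[k] Ub q →ₗ[k] k) (ψ : Ub q ⊗[k] Ub q ≃ₗ[k] Dq q) : Prop where
  double : IsQuantumDouble σ ψ
  X : ψ (1 ⊗ₜ Ub.X q) = Dq.X q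
  g : ψ (1 ⊗ₜ Ub.g q) = Dq.g q
  Y : ψ (Ub.X q ⊗ₜ 1) = Dq.Y q
  h : ψ (Ub.g q ⊗ₜ 1) = Dq.h q

end Double

section TopologicalHopf

/-- The structure maps of a `t`-adic quasitriangular Hopf algebra. The coproduct takes values in
the completed tensor square. -/
structure QTData (A : Type*) [Ring A] [Algebra Rt A] where
  comul : A →ₐ[Rt] Comp (A ⊗[Rt] A)
  counit : A →ₐ[Rt] Rt
  antipode : A →ₗ[Rt] A
  R : Comp (A ⊗[Rt] A)

variable {A : Type*} [Ring A] [Algebra Rt A]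

/-- `x ↦ x₁₂` -/
noncomputable def leg12 : Comp (A ⊗[Rt] A) →ₗ[Rt] Comp ((A ⊗[Rt] A) ⊗[Rt] A) :=
  Comp.map (Algebra.TensorProduct.includeLeft :
    (A ⊗[Rt] A) →ₐ[Rt] ((A ⊗[Rt] A) ⊗[Rt] A)).toLinearMap

/-- `x ↦ x₁₃` -/
noncomputable def leg13 : Comp (A ⊗[Rt] A) →ₗ[Rt] Comp ((A ⊗[Rt] A) ⊗[Rt] A) :=
  Comp.map (TensorProduct.map (Algebra.TensorProduct.includeLeft :
    A →ₐ[Rt] (A ⊗[Rt] A)).toLinearMap LinearMap.id)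

/-- `x ↦ x₂₃` -/
noncomputable def leg23 : Comp (A ⊗[Rt] A) →ₗ[Rt] Comp ((A ⊗[Rt] A) ⊗[Rt] A) :=
  Comp.map (TensorProduct.map (Algebra.TensorProduct.includeRight :
    A →ₐ[Rt] (A ⊗[Rt] A)).toLinearMap LinearMap.id)

/-- `x ↦ x₂₁` -/
noncomputable def leg21 : Comp (A ⊗[Rt] A) →ₗ[Rt] Comp (A ⊗[Rt] A) :=
  Comp.map (TensorProduct.comm Rt A A).toLinearMap

namespace QTData

variable (d : QTData A)

/-- `Δ ⊗ id` on the completed tensor square: the extension of `a ⊗ b ↦ Δ(a)₁₂ b₃`. -/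
noncomputable def comulId : Comp (A ⊗[Rt] A) →ₗ[Rt] Comp ((A ⊗[Rt] A) ⊗[Rt] A) :=
  Comp.extend (LinearMap.mul' Rt (Comp ((A ⊗[Rt] A) ⊗[Rt] A)) ∘ₗ
    TensorProduct.map (leg12 ∘ₗ d.comul.toLinearMap)
      (Comp.of.toLinearMap ∘ₗ (Algebra.TensorProduct.includeRight :
        A →ₐ[Rt] ((A ⊗[Rt] A) ⊗[Rt] A)).toLinearMap))

/-- `id ⊗ Δ` on the completed tensor square: the extension of `a ⊗ b ↦ a₁ Δ(b)₂₃`. -/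
noncomputable def idComul : Comp (A ⊗[Rt] A) →ₗ[Rt] Comp ((A ⊗[Rt] A) ⊗[Rt] A) :=
  Comp.extend (LinearMap.mul' Rt (Comp ((A ⊗[Rt] A) ⊗[Rt] A)) ∘ₗ
    TensorProduct.map
      (Comp.of.toLinearMap ∘ₗ (Algebra.TensorProduct.includeLeft :
        (A ⊗[Rt] A) →ₐ[Rt] ((A ⊗[Rt] A) ⊗[Rt] A)).toLinearMap ∘ₗ
        (Algebra.TensorProduct.includeLeft : A →ₐ[Rt] (A ⊗[Rt] A)).toLinearMap)
      (leg23 ∘ₗ d.comul.toLinearMap))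

/-- `ε ⊗ id` on the completed tensor square. -/
noncomputable def counitId : Comp (A ⊗[Rt] A) →ₗ[Rt] Comp A :=
  Comp.map ((TensorProduct.lid Rt A).toLinearMap ∘ₗ d.counit.toLinearMap.rTensor A)

/-- `id ⊗ ε` on the completed tensor square. -/
noncomputable def idCounit : Comp (A ⊗[Rt] A) →ₗ[Rt] Comp A :=
  Comp.map ((TensorProduct.rid Rt A).toLinearMap ∘ₗ d.counit.toLinearMap.lTensor A)

/-- `a ⊗ b ↦ S(a) b` on the completed tensor square. -/
noncomputable def antipodeMul : Comp (A ⊗[Rt] A) →ₗ[Rt] Comp A :=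
  Comp.map (LinearMap.mul' Rt A ∘ₗ d.antipode.rTensor A)

/-- `a ⊗ b ↦ a S(b)` on the completed tensor square. -/
noncomputable def mulAntipode : Comp (A ⊗[Rt] A) →ₗ[Rt] Comp A :=
  Comp.map (LinearMap.mul' Rt A ∘ₗ d.antipode.lTensor A)

/-- The axioms of a `t`-adically complete quasitriangular Hopf algebra. -/
structure IsQTHopf : Prop where
  complete : IsAdicComplete (Ideal.span {tt}) A
  coassoc : ∀ a, d.comulId (d.comul a) = d.idComul (d.comul a)
  counit_left : ∀ a, d.counitId (d.comul a) = Comp.of a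
  counit_right : ∀ a, d.idCounit (d.comul a) = Comp.of a
  antipode_left : ∀ a, d.antipodeMul (d.comul a) = algebraMap Rt (Comp A) (d.counit a)
  antipode_right : ∀ a, d.mulAntipode (d.comul a) = algebraMap Rt (Comp A) (d.counit a)
  R_unit : IsUnit d.R
  R_comul : ∀ a, d.R * d.comul a = leg21 (d.comul a) * d.R
  comul_R_left : d.comulId d.R = leg13 d.R * leg23 d.R
  comul_R_right : d.idComul d.R = leg13 d.R * leg12 d.R

/-- `χ` is an (invertible, counital) 2-cocycle for the Hopf algebra:
`χ₂₃ (id ⊗ Δ)χ = χ₁₂ (Δ ⊗ id)χ` and `(ε ⊗ id)χ = 1`. -/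
structure IsCocycle (χ : Comp (A ⊗[Rt] A)) : Prop where
  unit : IsUnit χ
  cocycle : leg23 χ * d.idComul χ = leg12 χ * d.comulId χ
  counit : d.counitId χ = 1

/-- `d'` is the twist of `d` by `χ`: same algebra and counit, `Δ' = χ Δ(·) χ⁻¹`,
`R' = χ₂₁ R χ⁻¹` and `S' = U S(·) U⁻¹`, where `U = χ⁽¹⁾ S(χ⁽²⁾)`. -/
structure IsTwist (χ : Comp (A ⊗[Rt] A)) (d' : QTData A) : Prop where
  comul : ∀ a, d'.comul a * χ = χ * d.comul a
  counit : ∀ a, d'.counit a = d.counit a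
  antipode_unit : IsUnit (d.mulAntipode χ)
  antipode : ∀ a, Comp.of (d'.antipode a) * d.mulAntipode χ =
    d.mulAntipode χ * Comp.of (d.antipode a)
  R : d'.R * χ = leg21 χ * d.R

/-- `θ` is an isomorphism of quasitriangular Hopf algebras. -/
structure IsIso {B : Type*} [Ring B] [Algebra Rt B] (e : QTData B) (θ : A ≃ₐ[Rt] B) : Prop where
  comul : ∀ a, e.comul (θ a) =
    Comp.map (TensorProduct.map θ.toLinearMap θ.toLinearMap) (d.comul a)
  counit : ∀ a, e.counit (θ a) = d.counit a
  antipode : ∀ a, e.antipode (θ a) = θ (d.antipode a)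
  R : e.R = Comp.map (TensorProduct.map θ.toLinearMap θ.toLinearMap) d.R

/-- The inclusion of the left factor in the completed tensor product. -/
noncomputable def inl (A B : Type*) [Ring A] [Algebra Rt A] [Ring B] [Algebra Rt B] :
    A →ₐ[Rt] Comp (A ⊗[Rt] B) :=
  Comp.of.comp Algebra.TensorProduct.includeLeft

/-- The inclusion of the right factor in the completed tensor product. -/
noncomputable def inr (A B : Type*) [Ring A] [Algebra Rt A] [Ring B] [Algebra Rt B] :
    B →ₐ[Rt] Comp (A ⊗[Rt] B) :=
  Comp.of.comp Algebra.TensorProduct.includeRight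

/-- `w` is the tensor product quasitriangular Hopf algebra structure on `A ⊗̂ B`: both factors are
included as Hopf algebras, and `R_w = (R_A)₁₃ (R_B)₂₄`. -/
structure IsTensor {B : Type*} [Ring B] [Algebra Rt B] (e : QTData B)
    (w : QTData (Comp (A ⊗[Rt] B))) : Prop where
  comul_inl : ∀ a, w.comul (inl A B a) =
    Comp.map (TensorProduct.map (inl A B).toLinearMap (inl A B).toLinearMap) (d.comul a)
  comul_inr : ∀ b, w.comul (inr A B b) =
    Comp.map (TensorProduct.map (inr A B).toLinearMap (inr A B).toLinearMap) (e.comul b)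
  counit_inl : ∀ a, w.counit (inl A B a) = d.counit a
  counit_inr : ∀ b, w.counit (inr A B b) = e.counit b
  antipode_inl : ∀ a, w.antipode (inl A B a) = inl A B (d.antipode a)
  antipode_inr : ∀ b, w.antipode (inr A B b) = inr A B (e.antipode b)
  R : w.R =
    Comp.map (TensorProduct.map (inl A B).toLinearMap (inl A B).toLinearMap) d.R *
    Comp.map (TensorProduct.map (inr A B).toLinearMap (inr A B).toLinearMap) e.R

end QTData

end TopologicalHopf

section FormalAlgebras

/-- `q ^ s = exp (s c t)` in `ℂ[[t]]`. -/
noncomputable def qs (c s : ℂ) : Rt := PowerSeries.rescale (s * c) (PowerSeries.exp ℂ)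

/-- The `q`-integer `[n] = q^(n-1) + q^(n-3) + ⋯ + q^(1-n)`. -/
noncomputable def qint (c : ℂ) (n : ℕ) : Rt :=
  ∑ j ∈ Finset.range n, qs c ((n : ℂ) - 1 - 2 * (j : ℂ))

/-- The `q`-factorial `[m]! = [1] [2] ⋯ [m]`. -/
noncomputable def qfact (c : ℂ) (m : ℕ) : Rt := ∏ i ∈ Finset.range m, qint c (i + 1)

/-- Generators of `U_q(sl₂)`; `E = X₊` and `F = X₋`. -/
inductive SGen : Type
  | H | E | F

/-- The completed free algebra on `H, X₊, X₋`. -/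
abbrev SFree : Type := Comp (FreeAlgebra Rt SGen)

/-- A free generator. -/
noncomputable def SFree.gen (x : SGen) : SFree := Comp.of (FreeAlgebra.ι Rt x)

/-- Relations of `U_q(sl₂)`: `[H, X±] = ± 2 X±` and
`[X₊, X₋] = (q^H - q^(-H)) / (q - q⁻¹)`, the latter being the element `y` with
`(q - q⁻¹) y = q^H - q^(-H)`. -/
inductive SRel (c : ℂ) : SFree → SFree → Prop
  | HE : SRel c (SFree.gen SGen.H * SFree.gen SGen.E - SFree.gen SGen.E * SFree.gen SGen.H)
      (2 * SFree.gen SGen.E)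
  | HF : SRel c (SFree.gen SGen.H * SFree.gen SGen.F - SFree.gen SGen.F * SFree.gen SGen.H)
      (-(2 * SFree.gen SGen.F))
  | EF (y : SFree)
      (hy : (qs c 1 - qs c (-1)) • y =
        qpow c 1 (SFree.gen SGen.H) - qpow c (-1) (SFree.gen SGen.H)) :
      SRel c (SFree.gen SGen.E * SFree.gen SGen.F - SFree.gen SGen.F * SFree.gen SGen.E) y

/-- `U_q(sl₂)` over `ℂ[[t]]`, where `q = exp (c t)`: the `t`-adically complete algebra topologically
presented by `H, X₊, X₋` and the relations above. -/
abbrev Usl (c : ℂ) : Type := Comp (RingQuot (SRel c))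

namespace Usl
variable (c : ℂ)
/-- The generators. -/
noncomputable def gen (x : SGen) : Usl c := Comp.of (RingQuot.mkAlgHom Rt (SRel c) (SFree.gen x))
noncomputable abbrev H : Usl c := gen c SGen.H
/-- `X₊` -/
noncomputable abbrev E : Usl c := gen c SGen.E
/-- `X₋` -/
noncomputable abbrev F : Usl c := gen c SGen.F

/-- The coefficient of the `m`-th term of the universal R-matrix of `U_q(sl₂)`. -/
noncomputable def coef (m : ℕ) : Rt :=
  (1 - qs c (-2)) ^ m * qs c ((m : ℂ) * ((m : ℂ) - 1) / 2) * (qfact c m)⁻¹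

/-- The usual quasitriangular Hopf algebra structure of `U_q(sl₂)`. -/
structure IsStandard (d : QTData (Usl c)) : Prop where
  comul_H : d.comul (H c) = Comp.of (H c ⊗ₜ 1) + Comp.of (1 ⊗ₜ H c)
  comul_E : d.comul (E c) = Comp.of (E c ⊗ₜ qpow c (1 / 2) (H c)) +
    Comp.of (qpow c (-1 / 2) (H c) ⊗ₜ E c)
  comul_F : d.comul (F c) = Comp.of (F c ⊗ₜ qpow c (1 / 2) (H c)) +
    Comp.of (qpow c (-1 / 2) (H c) ⊗ₜ F c)
  counit_gen : ∀ x, d.counit (gen c x) = 0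
  antipode_H : d.antipode (H c) = -H c
  antipode_E : d.antipode (E c) = -(qs c 1 • E c)
  antipode_F : d.antipode (F c) = -(qs c (-1) • F c)
  R : HasTSum (fun m : ℕ => coef c m • (qpow c (1 / 2) (Comp.of (H c ⊗ₜ[Rt] H c)) *
    (Comp.of ((qpow c (1 / 2) (H c) * E c) ⊗ₜ[Rt] (qpow c (-1 / 2) (H c) * F c))) ^ m)) d.R

end Usl

/-- The algebra `ℂ[C][[t]]` of the quantum line. -/
abbrev Line : Type := Comp (Polynomial Rt)

namespace Line
/-- The generator `C`. -/
noncomputable def C : Line := Comp.of Polynomial.X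

/-- The quantum line `U_{q⁻¹}(ℂ)`: `C` is primitive and `R = q^(-½ C ⊗ C)`. -/
structure IsStandard (c : ℂ) (d : QTData Line) : Prop where
  comul_C : d.comul C = Comp.of (C ⊗ₜ 1) + Comp.of (1 ⊗ₜ C)
  counit_C : d.counit C = 0
  antipode_C : d.antipode C = -C
  R : d.R = qpow c (-1 / 2) (Comp.of (C ⊗ₜ[Rt] C))
end Line

/-- The algebra `U_q(sl₂) ⊗̂ U_{q⁻¹}(ℂ)`. -/
abbrev UL (c : ℂ) : Type := Comp (Usl c ⊗[Rt] Line)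

namespace UL
variable (c : ℂ)
noncomputable def H : UL c := QTData.inl (Usl c) Line (Usl.H c)
/-- `X₊` -/
noncomputable def E : UL c := QTData.inl (Usl c) Line (Usl.E c)
/-- `X₋` -/
noncomputable def F : UL c := QTData.inl (Usl c) Line (Usl.F c)
noncomputable def C : UL c := QTData.inr (Usl c) Line Line.C

/-- `χ = q^(-½ C ⊗ H)`. -/
noncomputable def chi : Comp (UL c ⊗[Rt] UL c) :=
  qpow c (-1 / 2) (Comp.of (C c ⊗ₜ[Rt] H c))

end UL

/-- The field `ℂ((t))`. -/
abbrev Kt : Type := LaurentSeries ℂ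

/-- `q = exp (c t)` as a unit of `ℂ((t))`. -/
noncomputable def qK (c : ℂ) : Ktˣ where
  val := algebraMap Rt Kt (qs c 1)
  inv := algebraMap Rt Kt (qs c (-1))
  val_inv := by
    have h : qs c 1 * qs c (-1) = 1 := by
      have := PowerSeries.exp_mul_exp_eq_exp_add (A := ℂ) (1 * c) (-1 * c)
      unfold qs
      rw [this]
      have h0 : (1 * c + -1 * c) = 0 := by ring
      rw [h0, PowerSeries.rescale_zero]
      simp
    rw [← map_mul, h, map_one]
  inv_val := by
    have h : qs c (-1) * qs c 1 = 1 := by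
      have := PowerSeries.exp_mul_exp_eq_exp_add (A := ℂ) (-1 * c) (1 * c)
      unfold qs
      rw [this]
      have h0 : (-1 * c + 1 * c) = 0 := by ring
      rw [h0, PowerSeries.rescale_zero]
      simp
    rw [← map_mul, h, map_one]

variable (c : ℂ)

/-- The `ℂ[[t]]`-subalgebra of `U_q(b₋)` over `ℂ((t))` generated by `X, g^{±1}` and
`(g - 1)/(q - 1)`. -/
noncomputable def HR : Subalgebra Rt (Ub (qK c)) :=
  Algebra.adjoin Rt (Set.range (Ub.gen (qK c)) ∪
    {(((qK c : Kt) - 1)⁻¹ • (Ub.g (qK c) - 1))})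

/-- The `ℂ[[t]]`-subalgebra of `D(U_q(b₋))` over `ℂ((t))` generated by `X, X̄, g^{±1}, ḡ^{±1}` and
`(g - 1)/(q - 1)`, `(ḡ - 1)/(q - 1)`. -/
noncomputable def DR : Subalgebra Rt (Dq (qK c)) :=
  Algebra.adjoin Rt (Set.range (Dq.gen (qK c)) ∪
    {(((qK c : Kt) - 1)⁻¹ • (Dq.g (qK c) - 1)), (((qK c : Kt) - 1)⁻¹ • (Dq.h (qK c) - 1))})

/-- The quantum double of `U_q(b₋)` over `ℂ[[t]]`: the completion of `DR`. In it `g` and `ḡ` are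
`1` modulo `q - 1`, so that they have logarithms to the base `q`. -/
abbrev Dhat : Type := Comp (DR c)

namespace Dhat

/-- The generators `X, X̄, g^{±1}, ḡ^{±1}` in `Dhat`. -/
noncomputable def gen (z : DGen) : Dhat c :=
  Comp.of ⟨Dq.gen (qK c) z, Algebra.subset_adjoin (Or.inl ⟨z, rfl⟩)⟩

/-- The coproduct, counit and antipode of `Dhat` are the continuous extensions of those of
the quantum double over `ℂ((t))`. -/
structure ExtendsDouble (d : QTData (Dhat c)) : Prop where
  comul : ∀ x : DR c, ∃ (n : ℕ) (a b : Fin n → DR c),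
    Coalgebra.comul (R := Kt) (x : Dq (qK c)) =
      ∑ i, (a i : Dq (qK c)) ⊗ₜ[Kt] (b i : Dq (qK c)) ∧
    d.comul (Comp.of x) = ∑ i, Comp.of (Comp.of (a i) ⊗ₜ[Rt] Comp.of (b i))
  counit : ∀ x : DR c, algebraMap Rt Kt (d.counit (Comp.of x)) =
    Coalgebra.counit (R := Kt) (x : Dq (qK c))
  antipode : ∀ x : DR c, ∃ s : DR c, (s : Dq (qK c)) = HopfAlgebra.antipode Kt (x : Dq (qK c)) ∧
    d.antipode (Comp.of x) = Comp.of s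

/-- `r` is the canonical element `∑ (fᵃ ⊗ 1) ⊗ (1 ⊗ eₐ)` of the quantum double, with `eₐ` a basis of
`H = U_q(b₋)` and `fᵃ` the dual basis for the pairing `σ`: it is the image of an element
`ρ = ∑ fᵃ ⊗ eₐ` such that `∑ fᵃ ⟨eₐ, b⟩ = b` for all `b`. As `⟨ , b⟩` takes values in
`t⁻ᴺ ℂ[[t]]`, the contraction is written with `f = tᴺ ⟨ , b⟩`. -/
def IsCanonical (σ : Ub (qK c) →ₗ[Kt] Ub (qK c) →ₗ[Kt] Kt)
    (ψ : Ub (qK c) ⊗[Kt] Ub (qK c) ≃ₗ[Kt] Dq (qK c)) (r : Comp (Dhat c ⊗[Rt] Dhat c)) : Prop :=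
  ∃ i j : HR c →ₗ[Rt] DR c,
    (∀ x : HR c, (i x : Dq (qK c)) = ψ ((x : Ub (qK c)) ⊗ₜ 1)) ∧
    (∀ x : HR c, (j x : Dq (qK c)) = ψ (1 ⊗ₜ (x : Ub (qK c)))) ∧
    ∃ ρ : Comp (HR c ⊗[Rt] HR c),
      r = Comp.map (TensorProduct.map (Comp.of.toLinearMap ∘ₗ i) (Comp.of.toLinearMap ∘ₗ j)) ρ ∧
      ∀ b : HR c, ∃ (N : ℕ) (f : HR c →ₗ[Rt] Rt),
        (∀ x : HR c, algebraMap Rt Kt (f x) =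
          algebraMap Rt Kt (tt ^ N) * σ (x : Ub (qK c)) (b : Ub (qK c))) ∧
        Comp.map ((TensorProduct.rid Rt (HR c)).toLinearMap ∘ₗ f.lTensor (HR c)) ρ =
          tt ^ N • Comp.of b

end Dhat

end FormalAlgebras

end QDbl

open QDbl

open scoped TensorProduct
open QDbl

namespace QDbl

open PowerSeries renaming C → cst
open _root_.QDbl.Comp (of)
open MulOpposite
open QDbl.QTData (inl inr)

section TAdic

theorem tt_ne_zero : tt ≠ 0 := PowerSeries.X_ne_zero

/-- `M` is `t`-adically separated. -/
def TSep (M : Type*) [AddCommGroup M] [Module Rt M] : Prop :=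
  ∀ x : M, (∀ n : ℕ, ∃ y : M, x = tt ^ n • y) → x = 0

/-- `s = ∑ₖ tᵏ aₖ`. -/
def IsSum {M : Type*} [AddCommGroup M] [Module Rt M] (a : ℕ → M) (s : M) : Prop :=
  ∀ n : ℕ, ∃ y : M, s - ∑ k ∈ Finset.range n, tt ^ k • a k = tt ^ n • y

/-- `M` is `t`-adically complete and separated. -/
structure TComplete (M : Type*) [AddCommGroup M] [Module Rt M] : Prop where
  sep : TSep M
  sum : ∀ a : ℕ → M, ∃ s, IsSum a s

variable {M N : Type*} [AddCommGroup M] [Module Rt M] [AddCommGroup N] [Module Rt N]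

theorem TSep.eq_of (h : TSep M) {x y : M} (H : ∀ n : ℕ, ∃ z : M, x - y = tt ^ n • z) : x = y :=
  sub_eq_zero.1 (h _ H)

theorem IsSum.unique (h : TSep M) {a : ℕ → M} {s s' : M} (hs : IsSum a s) (hs' : IsSum a s') :
    s = s' := by
  refine h.eq_of fun n => ?_
  obtain ⟨y, hy⟩ := hs n
  obtain ⟨y', hy'⟩ := hs' n
  exact ⟨y - y', by rw [smul_sub, ← hy, ← hy']; abel⟩

theorem IsSum.map {a : ℕ → M} {s : M} (hs : IsSum a s) (f : M →ₗ[Rt] N) :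
    IsSum (fun k => f (a k)) (f s) := by
  intro n
  obtain ⟨y, hy⟩ := hs n
  refine ⟨f y, ?_⟩
  rw [← map_smul, ← hy, map_sub, map_sum]
  simp only [map_smul]

theorem IsSum.sub {a b : ℕ → M} {s s' : M} (hs : IsSum a s) (hs' : IsSum b s') :
    IsSum (fun k => a k - b k) (s - s') := by
  intro n
  obtain ⟨y, hy⟩ := hs n
  obtain ⟨y', hy'⟩ := hs' n
  refine ⟨y - y', ?_⟩
  rw [smul_sub, ← hy, ← hy']
  simp only [smul_sub, Finset.sum_sub_distrib]
  abel

theorem IsSum.of_single (a : M) : IsSum (fun k => if k = 0 then a else 0) a := by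
  intro n
  cases n with
  | zero => exact ⟨a, by simp⟩
  | succ n => exact ⟨0, by rw [Finset.sum_range_succ']; simp⟩

/-- A shifted sum. -/
theorem IsSum.tail {a : ℕ → M} {s : M} (hs : IsSum a s) (n : ℕ) :
    ∃ y, s = ∑ k ∈ Finset.range n, tt ^ k • a k + tt ^ n • y := by
  obtain ⟨y, hy⟩ := hs n
  exact ⟨y, by rw [← hy]; abel⟩

theorem IsSum.cons {a : ℕ → M} {s : M} (x : M) (hs : IsSum a s) :
    IsSum (fun k => Nat.casesOn k x a) (x + tt • s) := by
  intro n
  cases n with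
  | zero => exact ⟨x + tt • s, by simp⟩
  | succ n =>
    obtain ⟨y, hy⟩ := hs n
    refine ⟨y, ?_⟩
    rw [Finset.sum_range_succ', pow_succ', mul_smul, ← hy, smul_sub, Finset.smul_sum]
    simp only [pow_zero, one_smul, pow_succ', mul_smul]
    rw [add_comm x]
    exact add_sub_add_right_eq_sub _ _ _

theorem smul_tt_cancel [Module.IsTorsionFree Rt M] {n : ℕ} {x y : M}
    (h : tt ^ n • x = tt ^ n • y) : x = y :=
  smul_right_injective M (pow_ne_zero n tt_ne_zero) h

theorem isTorsionFree_of_tt (h : ∀ x : M, tt • x = 0 → x = 0) : Module.IsTorsionFree Rt M := by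
  have hn : ∀ (n : ℕ) (x : M), tt ^ n • x = 0 → x = 0 := by
    intro n
    induction n with
    | zero => intro x hx; simpa using hx
    | succ n ih => intro x hx; rw [pow_succ, mul_smul] at hx; exact h _ (ih _ hx)
  refine ⟨fun r hr x y hxy => ?_⟩
  have hr0 : r ≠ 0 := hr.ne_zero
  obtain ⟨n, u, hu⟩ : ∃ (n : ℕ) (u : Rtˣ), r = tt ^ n * u := by
    obtain ⟨n, u, hu⟩ := IsDiscreteValuationRing.eq_unit_mul_pow_irreducible hr0
      PowerSeries.X_prime.irreducible
    exact ⟨n, u, by rw [hu, mul_comm]⟩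
  have hxy' : r • (x - y) = 0 := by
    rw [smul_sub]; exact sub_eq_zero.2 hxy
  have : (tt ^ n * (u : Rt)) • (x - y) = 0 := hu ▸ hxy'
  rw [mul_smul] at this
  have h2 := hn n _ this
  have h3 : x - y = (((u⁻¹ : Rtˣ) : Rt) * (u : Rt)) • (x - y) := by simp
  rw [mul_smul, h2, smul_zero] at h3
  exact sub_eq_zero.1 h3

/-- A submodule that is dense modulo `t` is dense modulo every power of `t`. -/
theorem dense_pow {P : Submodule Rt M} (hP : ∀ x : M, ∃ p ∈ P, ∃ y, x = p + tt • y) (n : ℕ)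
    (x : M) : ∃ p ∈ P, ∃ y, x = p + tt ^ n • y := by
  induction n with
  | zero => exact ⟨0, P.zero_mem, x, by simp⟩
  | succ n ih =>
    obtain ⟨p, hp, y, rfl⟩ := ih
    obtain ⟨p', hp', y', rfl⟩ := hP y
    exact ⟨p + tt ^ n • p', P.add_mem hp (P.smul_mem _ hp'), y', by
      rw [smul_add, pow_succ, mul_smul]; abel⟩

theorem linear_ext_of_dense (hN : TSep N) {P : Submodule Rt M}
    (hP : ∀ x : M, ∃ p ∈ P, ∃ y, x = p + tt • y) {f g : M →ₗ[Rt] N} (h : ∀ p ∈ P, f p = g p) :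
    f = g := by
  ext x
  refine hN.eq_of fun n => ?_
  obtain ⟨p, hp, y, rfl⟩ := dense_pow hP n x
  exact ⟨f y - g y, by rw [map_add, map_add, h p hp, map_smul, map_smul, smul_sub]; abel⟩

/-- A map between complete modules that is onto modulo `t` is onto. -/
theorem surjective_of_mod_tt (hM : TComplete M) (hN : TSep N) (f : M →ₗ[Rt] N)
    (hf : ∀ y : N, ∃ x z, y = f x + tt • z) : Function.Surjective f := by
  intro y
  choose g r hg using hf
  let z : ℕ → N := fun n => Nat.rec y (fun _ w => r w) n
  have hz : ∀ n, y = ∑ k ∈ Finset.range n, tt ^ k • f (g (z k)) + tt ^ n • z n := by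
    intro n
    induction n with
    | zero => simp [z]
    | succ n ih =>
      have e : z n = f (g (z n)) + tt • z (n + 1) := hg (z n)
      rw [Finset.sum_range_succ, pow_succ, mul_smul, add_assoc, ← smul_add, ← e, ← ih]
  obtain ⟨s, hs⟩ := hM.sum fun k => g (z k)
  refine ⟨s, (hs.map f).unique hN fun n => ⟨z n, ?_⟩⟩
  nth_rewrite 1 [hz n]
  abel

/-- A map of a separated module to a torsion-free one that is injective modulo `t` is injective. -/
theorem injective_of_mod_tt (hM : TSep M) [Module.IsTorsionFree Rt N] (f : M →ₗ[Rt] N)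
    (hf : ∀ x z, f x = tt • z → ∃ x', x = tt • x') : Function.Injective f := by
  rw [← LinearMap.ker_eq_bot, LinearMap.ker_eq_bot']
  intro x hx
  refine hM x fun n => ?_
  suffices h : ∃ y, x = tt ^ n • y ∧ f y = 0 from ⟨h.choose, h.choose_spec.1⟩
  induction n with
  | zero => exact ⟨x, by simp, hx⟩
  | succ n ih =>
    obtain ⟨y, rfl, hy⟩ := ih
    obtain ⟨y', rfl⟩ := hf y 0 (by rw [hy, smul_zero])
    refine ⟨y', by rw [pow_succ, mul_smul], ?_⟩
    rw [map_smul] at hy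
    exact smul_tt_cancel (n := 1) (by rw [pow_one, hy, smul_zero])

theorem TComplete.isAdicComplete (h : TComplete M) : IsAdicComplete (Ideal.span {tt}) M := by
  have key : ∀ (n : ℕ) (x : M),
      x ∈ ((Ideal.span {tt} ^ n • ⊤ : Submodule Rt M)) ↔ ∃ y, x = tt ^ n • y := by
    intro n x
    rw [Ideal.span_singleton_pow, Submodule.ideal_span_singleton_smul,
      Submodule.mem_smul_pointwise_iff_exists]
    exact ⟨fun ⟨y, _, h⟩ => ⟨y, h.symm⟩, fun ⟨y, h⟩ => ⟨y, trivial, h.symm⟩⟩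
  refine { haus' := ?_, prec' := ?_ }
  · intro x hx
    refine h.sep x fun n => ?_
    have := hx n
    rw [SModEq.zero] at this
    exact (key n x).1 this
  · intro f hf
    have hd : ∀ n, ∃ y, f (n + 1) - f n = tt ^ n • y := by
      intro n
      have := (hf (Nat.le_succ n)).symm
      rw [SModEq.sub_mem] at this
      exact (key n _).1 this
    choose d hd using hd
    obtain ⟨s, hs⟩ := h.sum d
    refine ⟨f 0 + s, fun n => ?_⟩
    rw [SModEq.comm, SModEq.sub_mem, key]
    obtain ⟨y, hy⟩ := hs n
    refine ⟨y, ?_⟩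
    rw [← hy]
    have : f n = f 0 + ∑ k ∈ Finset.range n, tt ^ k • d k := by
      simp only [← hd]
      rw [Finset.sum_range_sub]
      abel
    rw [this]
    abel

theorem TComplete.of_equiv (h : TComplete M) (e : M ≃ₗ[Rt] N) : TComplete N where
  sep := by
    intro x hx
    rw [← e.symm.map_eq_zero_iff]
    refine h.sep _ fun n => ?_
    obtain ⟨y, rfl⟩ := hx n
    exact ⟨e.symm y, by rw [map_smul]⟩
  sum := by
    intro a
    obtain ⟨s, hs⟩ := h.sum fun k => e.symm (a k)
    refine ⟨e s, ?_⟩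
    simpa using hs.map e.toLinearMap

end TAdic

theorem antidiagonal_sum_range {M : Type*} [AddCommMonoid M] (n : ℕ) (f : ℕ → ℕ → M) :
    ∑ m ∈ Finset.range n, ∑ p ∈ Finset.HasAntidiagonal.antidiagonal m, f p.1 p.2 =
      ∑ p ∈ (Finset.range n ×ˢ Finset.range n) with p.1 + p.2 < n, f p.1 p.2 := by
  rw [← Finset.sum_fiberwise_of_maps_to (t := Finset.range n) (g := fun p : ℕ × ℕ => p.1 + p.2)]
  · refine Finset.sum_congr rfl fun m hm => Finset.sum_congr ?_ fun _ _ => rfl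
    ext ⟨i, j⟩
    simp only [Finset.mem_range] at hm
    simp only [Finset.HasAntidiagonal.mem_antidiagonal, Finset.mem_filter, Finset.mem_product, Finset.mem_range]
    omega
  · rintro ⟨i, j⟩ h
    simp only [Finset.mem_filter] at h
    simpa using h.2

section SumAlg

variable {A : Type*} [Ring A] [Algebra Rt A]

theorem IsSum.mul_left {a : ℕ → A} {s : A} (hs : IsSum a s) (x : A) :
    IsSum (fun k => x * a k) (x * s) := hs.map (LinearMap.mulLeft Rt x)

theorem IsSum.mul_right {a : ℕ → A} {s : A} (hs : IsSum a s) (x : A) :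
    IsSum (fun k => a k * x) (s * x) := hs.map (LinearMap.mulRight Rt x)

theorem IsSum.hasTSum {a : ℕ → A} {s : A} (hs : IsSum a s) :
    HasTSum (fun k => tt ^ k • a k) s := by
  intro N
  refine ⟨N, fun n hn => ?_⟩
  obtain ⟨y, hy⟩ := hs n
  exact ⟨tt ^ (n - N) • y, by rw [hy, smul_smul, ← pow_add, Nat.add_sub_cancel' hn]⟩

/-- The Cauchy product. -/
theorem IsSum.mul {a b : ℕ → A} {s s' : A} (hs : IsSum a s) (hs' : IsSum b s') :
    IsSum (fun n => ∑ p ∈ Finset.HasAntidiagonal.antidiagonal n, a p.1 * b p.2) (s * s') := by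
  intro n
  obtain ⟨y, hy⟩ := hs.tail n
  obtain ⟨y', hy'⟩ := hs'.tail n
  have e1 : ∑ m ∈ Finset.range n, tt ^ m • ∑ p ∈ Finset.HasAntidiagonal.antidiagonal m, a p.1 * b p.2 =
      ∑ p ∈ (Finset.range n ×ˢ Finset.range n) with p.1 + p.2 < n,
        (tt ^ p.1 • a p.1) * (tt ^ p.2 • b p.2) := by
    rw [← antidiagonal_sum_range n (fun i j => (tt ^ i • a i) * (tt ^ j • b j))]
    refine Finset.sum_congr rfl fun m _ => ?_
    rw [Finset.smul_sum]
    refine Finset.sum_congr rfl fun p hp => ?_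
    rw [Finset.HasAntidiagonal.mem_antidiagonal] at hp
    rw [smul_mul_smul_comm, ← pow_add, hp]
  have e2 : (∑ k ∈ Finset.range n, tt ^ k • a k) * (∑ k ∈ Finset.range n, tt ^ k • b k) =
      ∑ p ∈ Finset.range n ×ˢ Finset.range n, (tt ^ p.1 • a p.1) * (tt ^ p.2 • b p.2) := by
    rw [Finset.sum_mul_sum, Finset.sum_product]
  have e3 := Finset.sum_filter_add_sum_filter_not (Finset.range n ×ˢ Finset.range n)
    (fun p : ℕ × ℕ => p.1 + p.2 < n) (fun p => (tt ^ p.1 • a p.1) * (tt ^ p.2 • b p.2))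
  have e4 : ∃ z, ∑ p ∈ (Finset.range n ×ˢ Finset.range n) with ¬ p.1 + p.2 < n,
        (tt ^ p.1 • a p.1) * (tt ^ p.2 • b p.2) = tt ^ n • z := by
    refine ⟨∑ p ∈ (Finset.range n ×ˢ Finset.range n) with ¬ p.1 + p.2 < n,
        tt ^ (p.1 + p.2 - n) • (a p.1 * b p.2), ?_⟩
    rw [Finset.smul_sum]
    refine Finset.sum_congr rfl fun p hp => ?_
    rw [Finset.mem_filter, not_lt] at hp
    rw [smul_mul_smul_comm, smul_smul, ← pow_add, ← pow_add, Nat.add_sub_cancel' hp.2]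
  obtain ⟨z, hz⟩ := e4
  refine ⟨z + (∑ k ∈ Finset.range n, tt ^ k • a k) * y' + y * s', ?_⟩
  rw [e1, ← sub_eq_zero]
  have e5 : s * s' = (∑ k ∈ Finset.range n, tt ^ k • a k) * (∑ k ∈ Finset.range n, tt ^ k • b k)
      + tt ^ n • ((∑ k ∈ Finset.range n, tt ^ k • a k) * y') + tt ^ n • (y * s') := by
    nth_rewrite 1 [hy]
    rw [add_mul, smul_mul_assoc]
    nth_rewrite 1 [hy']
    rw [mul_add, mul_smul_comm]
  rw [e5, e2, ← e3, hz, smul_add, smul_add]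
  abel

end SumAlg

namespace Comp

variable {A B D : Type*} [Ring A] [Algebra Rt A] [Ring B] [Algebra Rt B] [Ring D] [Algebra Rt D]

theorem ext {x y : Comp A} (h : ∀ n, proj n x = proj n y) : x = y :=
  Subtype.ext (funext h)

@[simp] theorem proj_of (n : ℕ) (a : A) : proj n (of a) = Ideal.Quotient.mk (tIdeal A n) a := rfl

theorem smul_quot_eq_zero {n : ℕ} (x : A ⧸ tIdeal A n) : tt ^ n • x = 0 := by
  obtain ⟨z, rfl⟩ := Ideal.Quotient.mk_surjective x
  exact Ideal.Quotient.eq_zero_iff_mem.2 (mem_tIdeal.2 ⟨z, rfl⟩)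

/-- The sum `∑ tᵏ aₖ`. -/
noncomputable def tsum (a : ℕ → Comp A) : Comp A :=
  ⟨fun n => ∑ k ∈ Finset.range n, tt ^ k • proj n (a k), by
    intro m n h
    change Ideal.Quotient.factorₐ Rt (tIdeal_le A h)
      (∑ k ∈ Finset.range n, tt ^ k • proj n (a k)) = ∑ k ∈ Finset.range m, tt ^ k • proj m (a k)
    simp only [map_sum, map_smul, factor_proj h]
    symm
    apply Finset.sum_subset (Finset.range_mono h)
    intro k _ hk
    have hmk : m ≤ k := by simpa using hk
    rw [← Nat.sub_add_cancel hmk, pow_add, mul_smul, smul_quot_eq_zero, smul_zero]⟩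

theorem proj_tsum (a : ℕ → Comp A) (n : ℕ) :
    proj n (tsum a) = ∑ k ∈ Finset.range n, tt ^ k • proj n (a k) := rfl

theorem proj_eq_zero_iff {n : ℕ} {x : Comp A} : proj n x = 0 ↔ ∃ y, x = tt ^ n • y := by
  constructor
  · intro hx
    choose a ha using fun k => Ideal.Quotient.mk_surjective (proj k x)
    have hd : ∀ k, ∃ y, a (k + 1) - a k = tt ^ k • y := by
      intro k
      rw [← mem_tIdeal, ← Ideal.Quotient.eq, ha k, ← factor_proj (Nat.le_succ k) x, ← ha (k + 1)]
      rfl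
    choose b hb using hd
    obtain ⟨b', hb'⟩ : ∃ y, a n = tt ^ n • y := by
      rw [← mem_tIdeal, ← Ideal.Quotient.eq_zero_iff_mem, ha n, hx]
    have ht : ∀ m, a (n + m) = tt ^ n • (b' + ∑ j ∈ Finset.range m, tt ^ j • b (n + j)) := by
      intro m
      induction m with
      | zero => simpa using hb'
      | succ m ih =>
        rw [Finset.sum_range_succ, ← add_assoc b', smul_add, ← ih, smul_smul, ← pow_add, ← hb,
          ← add_assoc n]
        abel
    refine ⟨of b' + tsum fun j => of (b (n + j)), ext fun m => ?_⟩
    rw [map_smul, map_add, proj_tsum]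
    have : proj m x = Ideal.Quotient.mk _ (a (n + m)) := by
      rw [← factor_proj (Nat.le_add_left m n) x, ← ha (n + m)]
      rfl
    rw [this, ht m]
    simp only [proj_of]
    change Ideal.Quotient.mkₐ Rt (tIdeal A m) _ = tt ^ n • (Ideal.Quotient.mkₐ Rt (tIdeal A m) _ +
      ∑ k ∈ Finset.range m, tt ^ k • Ideal.Quotient.mkₐ Rt (tIdeal A m) _)
    rw [map_smul, map_add, map_sum]
    simp only [map_smul]
  · rintro ⟨y, rfl⟩
    rw [map_smul, smul_quot_eq_zero]

theorem proj_eq_iff {n : ℕ} {x y : Comp A} : proj n x = proj n y ↔ ∃ z, x - y = tt ^ n • z := by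
  rw [← sub_eq_zero, ← map_sub, proj_eq_zero_iff]

theorem isSum_tsum (a : ℕ → Comp A) : IsSum a (tsum a) := by
  intro n
  rw [← proj_eq_iff, proj_tsum, map_sum]
  simp only [map_smul]

theorem sep : TSep (Comp A) := fun x hx => ext fun n => by
  rw [proj_eq_zero_iff.2 (hx n), map_zero]

theorem tComplete : TComplete (Comp A) := ⟨sep, fun a => ⟨tsum a, isSum_tsum a⟩⟩

theorem exists_of_add (n : ℕ) (x : Comp A) : ∃ (a : A) (y : Comp A), x = of a + tt ^ n • y := by
  obtain ⟨a, ha⟩ := Ideal.Quotient.mk_surjective (proj n x)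
  obtain ⟨y, hy⟩ := proj_eq_iff.1 (show proj n x = proj n (of a) by rw [proj_of, ha])
  exact ⟨a, y, by rw [← hy]; abel⟩

theorem dense_of (x : Comp A) :
    ∃ p ∈ LinearMap.range (of : A →ₐ[Rt] Comp A).toLinearMap, ∃ y, x = p + tt • y := by
  obtain ⟨a, y, h⟩ := exists_of_add 1 x
  exact ⟨of a, ⟨a, rfl⟩, y, by rwa [pow_one] at h⟩

theorem linear_ext {N : Type*} [AddCommGroup N] [Module Rt N] (hN : TSep N)
    {f g : Comp A →ₗ[Rt] N} (h : ∀ a, f (of a) = g (of a)) : f = g := by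
  refine linear_ext_of_dense hN dense_of ?_
  rintro _ ⟨a, rfl⟩
  exact h a

theorem of_eq_smul_iff {n : ℕ} {a : A} : (∃ y, of a = tt ^ n • y) ↔ ∃ b, a = tt ^ n • b := by
  rw [← proj_eq_zero_iff, proj_of, Ideal.Quotient.eq_zero_iff_mem, mem_tIdeal]

instance [Module.IsTorsionFree Rt A] : Module.IsTorsionFree Rt (Comp A) := by
  refine isTorsionFree_of_tt fun x hx => sep x fun n => ?_
  obtain ⟨a, y, rfl⟩ := exists_of_add (n + 1) x
  have h1 : of (tt • a) = tt ^ (n + 2) • (-y) := by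
    rw [map_smul, smul_neg, pow_succ', mul_smul, ← smul_neg, eq_comm, ← sub_eq_zero, ← smul_sub,
      ← neg_eq_zero, ← smul_neg]
    convert hx using 2
    abel
  obtain ⟨b, hb⟩ := of_eq_smul_iff.1 ⟨_, h1⟩
  have h2 : a = tt ^ (n + 1) • b := by
    refine smul_tt_cancel (n := 1) ?_
    rw [pow_one, hb, smul_smul, ← pow_succ']
  refine ⟨tt • (of b + y), ?_⟩
  rw [smul_smul, ← pow_succ, smul_add, h2, map_smul]

/-- Extension of an algebra homomorphism to the completion. -/
noncomputable def liftHom (f : A →ₐ[Rt] Comp B) : Comp A →ₐ[Rt] Comp B :=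
  AlgHom.ofLinearMap (extend f.toLinearMap)
    (by
      have := extend_of f.toLinearMap 1
      rw [map_one] at this
      rw [this]
      exact map_one f)
    (by
      intro x y
      refine ext fun n => ?_
      obtain ⟨a, x', rfl⟩ := exists_of_add n x
      obtain ⟨b, y', rfl⟩ := exists_of_add n y
      have e : ∀ z, proj n (tt ^ n • z : Comp B) = 0 := fun z => proj_eq_zero_iff.2 ⟨z, rfl⟩
      have : (of a + tt ^ n • x') * (of b + tt ^ n • y') = of (a * b) +
          tt ^ n • (of a * y' + x' * (of b + tt ^ n • y')) := by
        rw [map_mul, add_mul, mul_add, smul_mul_assoc, mul_smul_comm, smul_add]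
        abel
      rw [this]
      simp only [map_add, map_mul _ (_ : Comp B), map_smul, extend_of, AlgHom.toLinearMap_apply,
        smul_quot_eq_zero, add_zero]
      rw [map_mul f, map_mul])

@[simp] theorem liftHom_of (f : A →ₐ[Rt] Comp B) (a : A) : liftHom f (of a) = f a := rfl

@[simp] theorem map_of (f : A →ₗ[Rt] B) (a : A) : map f (of a) = of (f a) := rfl

/-- Functoriality of the completion for algebra homomorphisms. -/
noncomputable def mapHom (f : A →ₐ[Rt] B) : Comp A →ₐ[Rt] Comp B := liftHom (of.comp f)

@[simp] theorem mapHom_of (f : A →ₐ[Rt] B) (a : A) : mapHom f (of a) = of (f a) := rfl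

theorem algHom_ext {N : Type*} [Ring N] [Algebra Rt N] (hN : TSep N) {f g : Comp A →ₐ[Rt] N}
    (h : ∀ a, f (of a) = g (of a)) : f = g := by
  have := linear_ext hN (f := f.toLinearMap) (g := g.toLinearMap) h
  exact AlgHom.ext fun x => LinearMap.congr_fun this x

theorem map_map {E : Type*} [Ring E] [Algebra Rt E] (f : A →ₗ[Rt] B) (g : B →ₗ[Rt] E) (x : Comp A) :
    map g (map f x) = map (g ∘ₗ f) x :=
  LinearMap.congr_fun (linear_ext sep (f := map g ∘ₗ map f) (g := map (g ∘ₗ f)) fun _ => rfl) x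

theorem of_bijective (h : TComplete A) : Function.Bijective (of : A →ₐ[Rt] Comp A) := by
  constructor
  · rw [injective_iff_map_eq_zero]
    intro a ha
    refine h.sep a fun n => of_eq_smul_iff.1 ⟨0, by rw [ha, smul_zero]⟩
  · refine surjective_of_mod_tt h sep (of : A →ₐ[Rt] Comp A).toLinearMap fun y => ?_
    obtain ⟨a, z, hz⟩ := exists_of_add 1 y
    exact ⟨a, z, by rwa [pow_one] at hz⟩

/-- A complete algebra is its own completion. -/
noncomputable def ofEquiv (h : TComplete A) : A ≃ₐ[Rt] Comp A :=
  AlgEquiv.ofBijective of (of_bijective h)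

theorem ofEquiv_apply (h : TComplete A) (a : A) : ofEquiv h a = of a := rfl

theorem isUnit_one_add (y : Comp A) : IsUnit (1 + tt • y) := by
  have h := isSum_tsum fun k => (-y) ^ k
  set s := tsum fun k => (-y) ^ k
  have e1 : s = 1 - tt • (s * y) := by
    refine h.unique sep ?_
    have := (h.mul_right (-y)).cons 1
    have e : (1 : Comp A) + tt • (s * -y) = 1 - tt • (s * y) := by
      rw [mul_neg, smul_neg, sub_eq_add_neg]
    rw [e] at this
    convert this using 2 with k
    cases k with
    | zero => simp
    | succ k => exact pow_succ _ _
  have e2 : s = 1 - tt • (y * s) := by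
    refine h.unique sep ?_
    have := (h.mul_left (-y)).cons 1
    have e : (1 : Comp A) + tt • (-y * s) = 1 - tt • (y * s) := by
      rw [neg_mul, smul_neg, sub_eq_add_neg]
    rw [e] at this
    convert this using 2 with k
    cases k with
    | zero => simp
    | succ k => exact pow_succ' _ _
  refine ⟨⟨1 + tt • y, s, ?_, ?_⟩, rfl⟩
  · rw [add_mul, one_mul, smul_mul_assoc]
    nth_rewrite 1 [e2]
    abel
  · rw [mul_add, mul_one, mul_smul_comm]
    nth_rewrite 1 [e1]
    abel

end Comp

section Dense

variable {A B : Type*} [Ring A] [Algebra Rt A] [Ring B] [Algebra Rt B]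

/-- The subalgebra generated by `S` is `t`-adically dense. -/
def TDense (S : Set A) : Prop := ∀ x : A, ∃ p ∈ Algebra.adjoin Rt S, ∃ y, x = p + tt • y

theorem TDense.of_eq_top {S : Set A} (h : Algebra.adjoin Rt S = ⊤) : TDense S :=
  fun x => ⟨x, h ▸ Algebra.mem_top, 0, by simp⟩

theorem TDense.linear_ext {N : Type*} [AddCommGroup N] [Module Rt N] {S : Set A} (hS : TDense S)
    (hN : TSep N) {f g : A →ₗ[Rt] N} (h : ∀ p ∈ Algebra.adjoin Rt S, f p = g p) : f = g :=
  linear_ext_of_dense (P := Subalgebra.toSubmodule (Algebra.adjoin Rt S)) hN hS h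

theorem TDense.algHom_ext {S : Set A} (hS : TDense S) (hB : TSep B) {f g : A →ₐ[Rt] B}
    (h : ∀ p ∈ S, f p = g p) : f = g := by
  have : f.toLinearMap = g.toLinearMap := hS.linear_ext hB fun p hp =>
    AlgHom.adjoin_le_equalizer f g h hp
  exact AlgHom.ext fun x => LinearMap.congr_fun this x

theorem TDense.intertwine {S : Set A} (hS : TDense S) (hB : TSep B) {f g : A →ₐ[Rt] B} {r : B}
    (h : ∀ p ∈ S, r * f p = g p * r) (a : A) : r * f a = g a * r := by
  have : (LinearMap.mulLeft Rt r) ∘ₗ f.toLinearMap = (LinearMap.mulRight Rt r) ∘ₗ g.toLinearMap := by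
    refine hS.linear_ext hB fun p hp => ?_
    change r * f p = g p * r
    induction hp using Algebra.adjoin_induction with
    | mem x hx => exact h x hx
    | algebraMap r' => rw [AlgHom.commutes, AlgHom.commutes, Algebra.commutes]
    | add x y _ _ hx hy => rw [map_add, map_add, mul_add, add_mul, hx, hy]
    | mul x y _ _ hx hy => rw [map_mul, map_mul, ← mul_assoc, hx, mul_assoc, hy, mul_assoc]
  exact LinearMap.congr_fun this a

theorem TDense.commute {S : Set A} (hS : TDense S) (hB : TSep B) (f : A →ₐ[Rt] B) {r : B}
    (h : ∀ p ∈ S, r * f p = f p * r) (a : A) : r * f a = f a * r := hS.intertwine hB h a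

theorem TDense.image {S : Set A} (hS : TDense S) (f : A →ₐ[Rt] B) (hf : Function.Surjective f) :
    TDense (f '' S) := by
  intro x
  obtain ⟨a, rfl⟩ := hf x
  obtain ⟨p, hp, y, rfl⟩ := hS a
  refine ⟨f p, ?_, f y, by rw [map_add, map_smul]⟩
  rw [← AlgHom.map_adjoin]
  exact ⟨p, hp, rfl⟩

theorem TDense.comp {S : Set A} (hS : TDense S) : TDense (of '' S : Set (Comp A)) := by
  intro x
  obtain ⟨a, z, rfl⟩ := Comp.exists_of_add 1 x
  obtain ⟨p, hp, y, rfl⟩ := hS a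
  refine ⟨of p, ?_, of y + z, by
    rw [pow_one, map_add, map_smul, smul_add]; abel⟩
  rw [← AlgHom.map_adjoin]
  exact ⟨p, hp, rfl⟩

theorem TDense.of_forall {S S' : Set A} (hS : TDense S)
    (h : ∀ s ∈ S, ∃ p ∈ Algebra.adjoin Rt S', ∃ y, s = p + tt • y) : TDense S' := by
  have key : ∀ s ∈ Algebra.adjoin Rt S, ∃ p ∈ Algebra.adjoin Rt S', ∃ y, s = p + tt • y := by
    intro s hs
    induction hs using Algebra.adjoin_induction with
    | mem x hx => exact h x hx
    | algebraMap r => exact ⟨algebraMap _ _ r, Subalgebra.algebraMap_mem _ r, 0, by simp⟩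
    | add x y _ _ hx hy =>
      obtain ⟨p, hp, z, rfl⟩ := hx
      obtain ⟨p', hp', z', rfl⟩ := hy
      exact ⟨p + p', add_mem hp hp', z + z', by rw [smul_add]; abel⟩
    | mul x y _ _ hx hy =>
      obtain ⟨p, hp, z, rfl⟩ := hx
      obtain ⟨p', hp', z', rfl⟩ := hy
      refine ⟨p * p', mul_mem hp hp', p * z' + z * (p' + tt • z'), ?_⟩
      rw [smul_add, add_mul, mul_add, smul_mul_assoc, mul_smul_comm]
      abel
  intro x
  obtain ⟨p, hp, y, rfl⟩ := hS x
  obtain ⟨p', hp', y', rfl⟩ := key p hp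
  exact ⟨p', hp', y' + y, by rw [smul_add]; abel⟩

theorem TDense.tensor {S : Set A} {T : Set B} (hS : TDense S) (hT : TDense T) :
    TDense ((Algebra.TensorProduct.includeLeft : A →ₐ[Rt] A ⊗[Rt] B) '' S ∪
      (Algebra.TensorProduct.includeRight : B →ₐ[Rt] A ⊗[Rt] B) '' T) := by
  set U := (Algebra.TensorProduct.includeLeft : A →ₐ[Rt] A ⊗[Rt] B) '' S ∪
      (Algebra.TensorProduct.includeRight : B →ₐ[Rt] A ⊗[Rt] B) '' T
  intro x
  induction x with
  | zero => exact ⟨0, zero_mem _, 0, by simp⟩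
  | add x y hx hy =>
    obtain ⟨p, hp, z, rfl⟩ := hx
    obtain ⟨p', hp', z', rfl⟩ := hy
    exact ⟨p + p', add_mem hp hp', z + z', by rw [smul_add]; abel⟩
  | tmul a b =>
    obtain ⟨p, hp, y, rfl⟩ := hS a
    obtain ⟨p', hp', y', rfl⟩ := hT b
    refine ⟨p ⊗ₜ p', ?_, p ⊗ₜ y' + y ⊗ₜ (p' + tt • y'), ?_⟩
    · have h1 : (p ⊗ₜ[Rt] (1 : B)) ∈ Algebra.adjoin Rt U := by
        refine Algebra.adjoin_mono (s := Algebra.TensorProduct.includeLeft '' S)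
          Set.subset_union_left ?_
        rw [← AlgHom.map_adjoin]
        exact ⟨p, hp, rfl⟩
      have h2 : ((1 : A) ⊗ₜ[Rt] p') ∈ Algebra.adjoin Rt U := by
        refine Algebra.adjoin_mono (s := Algebra.TensorProduct.includeRight '' T)
          Set.subset_union_right ?_
        rw [← AlgHom.map_adjoin]
        exact ⟨p', hp', rfl⟩
      have := mul_mem h1 h2
      rwa [Algebra.TensorProduct.tmul_mul_tmul, one_mul, mul_one] at this
    · rw [TensorProduct.add_tmul, TensorProduct.tmul_add, TensorProduct.tmul_smul,
        ← TensorProduct.smul_tmul', smul_add, ← add_assoc]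

end Dense

section QCalculus

variable (c : ℂ)

theorem qs_add (a b : ℂ) : qs c (a + b) = qs c a * qs c b := by
  unfold qs
  rw [PowerSeries.exp_mul_exp_eq_exp_add, add_mul]

@[simp] theorem qs_zero : qs c 0 = 1 := by
  unfold qs
  rw [zero_mul, PowerSeries.rescale_zero]
  simp

theorem coeff_qs (a : ℂ) (n : ℕ) : PowerSeries.coeff n (qs c a) = (a * c) ^ n / n.factorial := by
  unfold qs
  rw [PowerSeries.coeff_rescale, PowerSeries.coeff_exp]
  simp [div_eq_mul_inv]

theorem constCoeff_qs (a : ℂ) : PowerSeries.constantCoeff (qs c a) = 1 := by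
  rw [← PowerSeries.coeff_zero_eq_constantCoeff_apply, coeff_qs]
  simp

theorem qs_pow (a : ℂ) (n : ℕ) : qs c a ^ n = qs c (n * a) := by
  induction n with
  | zero => simp
  | succ n ih => rw [pow_succ, ih, ← qs_add]; congr 1; push_cast; ring

theorem qs_mul_neg (a : ℂ) : qs c a * qs c (-a) = 1 := by rw [← qs_add]; simp
theorem qs_neg_mul (a : ℂ) : qs c (-a) * qs c a = 1 := by rw [← qs_add]; simp

/-- `(q ^ a - 1) / t`. -/
noncomputable def qd (a : ℂ) : Rt := PowerSeries.mk fun n => PowerSeries.coeff (n + 1) (qs c a)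

theorem tt_mul_qd (a : ℂ) : tt * qd c a = qs c a - 1 := by
  ext n
  cases n with
  | zero => simp [constCoeff_qs]
  | succ n => rw [PowerSeries.coeff_succ_X_mul]; simp [qd, PowerSeries.coeff_one]

theorem constCoeff_qd (a : ℂ) : PowerSeries.constantCoeff (qd c a) = a * c := by
  rw [← PowerSeries.coeff_zero_eq_constantCoeff_apply, qd, PowerSeries.coeff_mk, coeff_qs]
  simp

theorem isUnit_of_constCoeff {r : Rt} (h : PowerSeries.constantCoeff r ≠ 0) : IsUnit r :=
  PowerSeries.isUnit_iff_constantCoeff.2 (isUnit_iff_ne_zero.2 h)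

/-- `1 + p + ⋯ + p ^ (m - 1)`, where `p = q⁻²`. -/
noncomputable def nq (m : ℕ) : Rt := ∑ i ∈ Finset.range m, qs c (-2) ^ i

@[simp] theorem nq_zero : nq c 0 = 0 := by simp [nq]

theorem nq_succ (m : ℕ) : nq c (m + 1) = nq c m + qs c (-2) ^ m := Finset.sum_range_succ _ _

theorem nq_succ' (m : ℕ) : nq c (m + 1) = nq c m * qs c (-2) + 1 := by
  rw [nq, Finset.sum_range_succ', nq, Finset.sum_mul]
  simp [pow_succ]

theorem nq_add (i j : ℕ) : nq c (i + j) = nq c i + qs c (-2) ^ i * nq c j := by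
  induction j with
  | zero => simp
  | succ j ih => rw [← add_assoc, nq_succ, ih, nq_succ, pow_add]; ring

theorem isUnit_nq (m : ℕ) : IsUnit (nq c (m + 1)) := by
  refine isUnit_of_constCoeff ?_
  rw [nq, map_sum]
  simp only [map_pow, constCoeff_qs, one_pow, Finset.sum_const, Finset.card_range, nsmul_eq_mul,
    mul_one]
  exact_mod_cast m.succ_ne_zero

theorem qint_eq (m : ℕ) : qint c (m + 1) = qs c m * nq c (m + 1) := by
  rw [qint, nq, Finset.mul_sum]
  refine Finset.sum_congr rfl fun i _ => ?_
  rw [qs_pow, ← qs_add]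
  congr 1
  push_cast
  ring

theorem isUnit_qfact (m : ℕ) : IsUnit (qfact c m) := by
  rw [qfact]
  refine Finset.prod_induction _ IsUnit (fun _ _ => IsUnit.mul) isUnit_one fun i _ => ?_
  rw [qint_eq]
  exact (IsUnit.of_mul_eq_one _ (qs_mul_neg c i)).mul (isUnit_nq c i)

theorem qfact_mul_inv (m : ℕ) : qfact c m * (qfact c m)⁻¹ = 1 :=
  PowerSeries.mul_inv_cancel _
    (isUnit_iff_ne_zero.1 (PowerSeries.isUnit_iff_constantCoeff.1 (isUnit_qfact c m)))

/-- The coefficient of the `m`-th term of the universal R-matrix, divided by `tᵐ`. -/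
noncomputable def coefDiv (m : ℕ) : Rt :=
  (-qd c (-2)) ^ m * qs c ((m : ℂ) * ((m : ℂ) - 1) / 2) * (qfact c m)⁻¹

theorem coef_eq (m : ℕ) : Usl.coef c m = tt ^ m * coefDiv c m := by
  have : 1 - qs c (-2) = tt * -qd c (-2) := by rw [mul_neg, tt_mul_qd]; ring
  rw [Usl.coef, this, mul_pow, coefDiv]
  ring

@[simp] theorem coefDiv_zero : coefDiv c 0 = 1 := by simp [coefDiv, qfact]

theorem coefDiv_succ (m : ℕ) :
    coefDiv c (m + 1) * nq c (m + 1) = -qd c (-2) * coefDiv c m := by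
  have h1 := qfact_mul_inv c m
  have h2 := qfact_mul_inv c (m + 1)
  have h3 : qfact c (m + 1) = qfact c m * (qs c m * nq c (m + 1)) := by
    rw [qfact, Finset.prod_range_succ, ← qfact, qint_eq]
  have h4 : qs c (((m + 1 : ℕ) : ℂ) * (((m + 1 : ℕ) : ℂ) - 1) / 2)
      = qs c ((m : ℂ) * ((m : ℂ) - 1) / 2) * qs c m := by
    rw [← qs_add]; congr 1; push_cast; ring
  have h5 : (qfact c (m + 1))⁻¹ * (qs c m * nq c (m + 1)) = (qfact c m)⁻¹ := by
    rw [h3] at h2 ⊢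
    calc _ = (qfact c m * (qs c m * nq c (m + 1)))⁻¹ * (qs c m * nq c (m + 1)) *
          (qfact c m * (qfact c m)⁻¹) := by rw [h1, mul_one]
      _ = (qfact c m * (qs c m * nq c (m + 1)) * (qfact c m * (qs c m * nq c (m + 1)))⁻¹) *
          (qfact c m)⁻¹ := by ring
      _ = _ := by rw [h2, one_mul]
  rw [coefDiv, coefDiv, h4, ← h5]
  ring

theorem one_sub_qs : 1 - qs c (-2) = tt * -qd c (-2) := by rw [mul_neg, tt_mul_qd]; ring

end QCalculus

section QExp

variable {A B : Type*} [Ring A] [Algebra Rt A] [Ring B] [Algebra Rt B] (c : ℂ)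

theorem qpow_isSum (s : ℂ) (x : Comp A) :
    IsSum (fun k => (cst ((s * c) ^ k / (k.factorial : ℂ)) : Rt) • x ^ k)
      (qpow c s x) := by
  intro n
  rw [← Comp.proj_eq_iff, map_sum]
  change ∑ k ∈ Finset.range n, (cst ((s * c) ^ k / (k.factorial : ℂ)) * tt ^ k) •
    (Comp.proj n x) ^ k = _
  refine Finset.sum_congr rfl fun k _ => ?_
  rw [map_smul, map_smul, map_pow, smul_smul, mul_comm]

variable {c}

theorem qpow_intertwine {a b x : Comp A} {s : ℂ} (h : a * x = x * b) :
    qpow c s a * x = x * qpow c s b := by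
  refine ((qpow_isSum c s a).mul_right x).unique Comp.sep ?_
  convert (qpow_isSum c s b).mul_left x using 2 with k
  rw [smul_mul_assoc, mul_smul_comm]
  congr 1
  exact SemiconjBy.pow_right (show SemiconjBy x b a from h.symm) k |>.symm

theorem qpow_map (f : Comp A →ₐ[Rt] Comp B) (s : ℂ) (x : Comp A) :
    f (qpow c s x) = qpow c s (f x) := by
  refine ((qpow_isSum c s x).map f.toLinearMap).unique Comp.sep ?_
  simpa using qpow_isSum c s (f x)

theorem qpow_eq (s : ℂ) (x : Comp A) : qpow c s x = qpow c 1 ((cst s : Rt) • x) := by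
  refine (qpow_isSum c s x).unique Comp.sep ?_
  convert qpow_isSum c 1 ((cst s : Rt) • x) using 2 with k
  rw [smul_pow, smul_smul, ← map_pow, ← map_mul, one_mul, mul_pow]
  congr 2
  ring

theorem qpow_add {a b : Comp A} (h : Commute a b) (s : ℂ) :
    qpow c s (a + b) = qpow c s a * qpow c s b := by
  refine (qpow_isSum c s (a + b)).unique Comp.sep ?_
  convert (qpow_isSum c s a).mul (qpow_isSum c s b) using 2 with n
  rw [h.add_pow', Finset.smul_sum]
  refine Finset.sum_congr rfl fun p hp => ?_
  rw [Finset.HasAntidiagonal.mem_antidiagonal] at hp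
  rw [smul_mul_smul_comm, ← Nat.cast_smul_eq_nsmul Rt, smul_smul, ← map_mul]
  congr 1
  rw [← map_natCast (cst (R := ℂ)), ← map_mul]
  congr 1
  subst hp
  rw [Nat.cast_add_choose]
  have h1 : ((p.1.factorial : ℕ) : ℂ) ≠ 0 := by exact_mod_cast Nat.factorial_ne_zero _
  have h2 : ((p.2.factorial : ℕ) : ℂ) ≠ 0 := by exact_mod_cast Nat.factorial_ne_zero _
  have h3 : (((p.1 + p.2).factorial : ℕ) : ℂ) ≠ 0 := by exact_mod_cast Nat.factorial_ne_zero _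
  field_simp
  ring

@[simp] theorem qpow_zero (s : ℂ) : qpow c s (0 : Comp A) = 1 := by
  refine (qpow_isSum c s 0).unique Comp.sep ?_
  convert IsSum.of_single (1 : Comp A) using 2 with k
  cases k <;> simp

theorem qpow_mul_neg (s : ℂ) (x : Comp A) : qpow c s x * qpow c s (-x) = 1 := by
  rw [← qpow_add (Commute.neg_right (Commute.refl x)), add_neg_cancel, qpow_zero]

theorem qpow_neg_mul (s : ℂ) (x : Comp A) : qpow c s (-x) * qpow c s x = 1 := by
  rw [← qpow_add (Commute.neg_left (Commute.refl x)), neg_add_cancel, qpow_zero]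

theorem isUnit_qpow (s : ℂ) (x : Comp A) : IsUnit (qpow c s x) :=
  ⟨⟨_, _, qpow_mul_neg s x, qpow_neg_mul s x⟩, rfl⟩

theorem isSum_qs (a : ℂ) :
    IsSum (fun k => (cst ((a * c) ^ k / (k.factorial : ℂ)) : Rt)) (qs c a) := by
  intro n
  obtain ⟨y, hy⟩ : tt ^ n ∣ qs c a - ∑ k ∈ Finset.range n,
      tt ^ k • (cst ((a * c) ^ k / (k.factorial : ℂ)) : Rt) := by
    rw [PowerSeries.X_pow_dvd_iff]
    intro m hm
    rw [map_sub, map_sum, coeff_qs, Finset.sum_eq_single m]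
    · rw [smul_eq_mul, mul_comm (tt ^ m), PowerSeries.coeff_C_mul, PowerSeries.coeff_X_pow_self, mul_one,
        sub_self]
    · intro k _ hk
      rw [smul_eq_mul, mul_comm (tt ^ k), PowerSeries.coeff_C_mul, PowerSeries.coeff_X_pow,
        if_neg (Ne.symm hk), mul_zero]
    · intro h
      exact absurd (Finset.mem_range.2 hm) h
  exact ⟨y, hy⟩

theorem qpow_scalar (a : ℂ) :
    qpow c 1 ((cst a : Rt) • (1 : Comp A)) = qs c a • 1 := by
  refine (qpow_isSum c 1 _).unique Comp.sep ?_
  convert (isSum_qs (c := c) a).map (Algebra.linearMap Rt (Comp A)) using 2 with k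
  · rw [smul_pow, one_pow, smul_smul, ← map_pow, ← map_mul, Algebra.linearMap_apply,
      Algebra.algebraMap_eq_smul_one]
    congr 2
    ring
  · rw [Algebra.linearMap_apply, Algebra.algebraMap_eq_smul_one]

theorem qpow_add_scalar (a : ℂ) (x : Comp A) :
    qpow c 1 (x + (cst a : Rt) • 1) = qs c a • qpow c 1 x := by
  rw [qpow_add ((Commute.one_right x).smul_right _), qpow_scalar, mul_smul_comm, mul_one]

theorem qpow_mod (s : ℂ) (x : Comp A) : ∃ y, qpow c s x = 1 + tt • y := by
  obtain ⟨y, hy⟩ := (qpow_isSum c s x).tail 1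
  exact ⟨y, by simpa using hy⟩

theorem qpow_mod_two (x : Comp A) :
    ∃ y, qpow c 1 x = 1 + tt • ((cst c : Rt) • x) + tt ^ 2 • y := by
  obtain ⟨y, hy⟩ := (qpow_isSum c 1 x).tail 2
  exact ⟨y, by simpa [Finset.sum_range_succ] using hy⟩

theorem Commute.qpow_right {a b : Comp A} (h : Commute a b) (s : ℂ) : Commute a (qpow c s b) :=
  (qpow_intertwine (h.symm : Commute b a)).symm

theorem Commute.qpow_left {a b : Comp A} (h : Commute a b) (s : ℂ) : Commute (qpow c s a) b :=
  qpow_intertwine h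

theorem pow_mul_sub_mul_pow (a b x : Comp A) (k : ℕ) {n : ℕ} {z : Comp A}
    (h : a * x - x * b = tt ^ n • z) : ∃ w, a ^ k * x - x * b ^ k = tt ^ n • w := by
  induction k with
  | zero => exact ⟨0, by simp⟩
  | succ k ih =>
    obtain ⟨w, hw⟩ := ih
    refine ⟨a * w + z * b ^ k, ?_⟩
    rw [smul_add, ← mul_smul_comm, ← hw, ← smul_mul_assoc, ← h, pow_succ', pow_succ']
    noncomm_ring

theorem C_smul_cancel (hc : c ≠ 0) {M : Type*} [AddCommGroup M] [Module Rt M] (x : M) :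
    (cst c⁻¹ : Rt) • (cst c : Rt) • x = x := by
  rw [smul_smul, ← map_mul, inv_mul_cancel₀ hc, map_one, one_smul]

/-- The logarithm of an intertwiner relation. -/
theorem intertwine_of_qpow [Module.IsTorsionFree Rt A] (hc : c ≠ 0) {a b x : Comp A}
    (h : qpow c 1 a * x = x * qpow c 1 b) : a * x = x * b := by
  refine Comp.sep.eq_of fun n => ?_
  induction n with
  | zero => exact ⟨_, by rw [pow_zero, one_smul]⟩
  | succ n ih =>
    obtain ⟨z, hz⟩ := ih
    obtain ⟨y, hy⟩ := (((qpow_isSum c 1 a).mul_right x).sub ((qpow_isSum c 1 b).mul_left x)) (n + 2)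
    rw [h, sub_self, zero_sub, Finset.sum_range_succ', Finset.sum_range_succ'] at hy
    have hw := fun k => pow_mul_sub_mul_pow a b x k hz
    choose w hw using hw
    have e : ∀ k, (cst ((1 * c) ^ k / (k.factorial : ℂ)) : Rt) • a ^ k * x -
        x * (cst ((1 * c) ^ k / (k.factorial : ℂ)) : Rt) • b ^ k =
        tt ^ n • (cst ((1 * c) ^ k / (k.factorial : ℂ)) : Rt) • w k := by
      intro k
      rw [smul_mul_assoc, mul_smul_comm, ← smul_sub, hw, smul_comm]
    have e2 : ∑ k ∈ Finset.range n, tt ^ (k + 1 + 1) • (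
        (cst ((1 * c) ^ (k + 1 + 1) / ((k + 1 + 1).factorial : ℂ)) : Rt) •
        a ^ (k + 1 + 1) * x - x * (cst ((1 * c) ^ (k + 1 + 1) /
        ((k + 1 + 1).factorial : ℂ)) : Rt) • b ^ (k + 1 + 1)) =
        tt ^ (n + 2) • ∑ k ∈ Finset.range n, tt ^ k •
        (cst ((1 * c) ^ (k + 1 + 1) / ((k + 1 + 1).factorial : ℂ)) : Rt) •
          w (k + 1 + 1) := by
      rw [Finset.smul_sum]
      refine Finset.sum_congr rfl fun k _ => ?_
      rw [e, smul_smul _ (tt ^ n), smul_smul _ (tt ^ k), ← pow_add, ← pow_add]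
      congr 2
      omega
    rw [e2] at hy
    have e3 : tt ^ (0 + 1) • ((cst ((1 * c) ^ (0 + 1) / (((0 + 1 : ℕ).factorial : ℕ) : ℂ))
        : Rt) • a ^ (0 + 1) * x - x * (cst ((1 * c) ^ (0 + 1) /
        (((0 + 1 : ℕ).factorial : ℕ) : ℂ)) : Rt) • b ^ (0 + 1)) =
        tt ^ 1 • (cst c : Rt) • (a * x - x * b) := by
      simp [smul_sub]
    rw [e3] at hy
    simp only [pow_zero, smul_mul_assoc, mul_smul_comm, one_mul, mul_one, sub_self,
      smul_zero, add_zero] at hy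
    set W := ∑ k ∈ Finset.range n, tt ^ k •
        (cst ((c) ^ (k + 1 + 1) / ((k + 1 + 1).factorial : ℂ)) : Rt) • w (k + 1 + 1)
    have e4 : (cst c : Rt) • (a * x - x * b) = tt ^ (n + 1) • (-(W + y)) := by
      refine smul_tt_cancel (n := 1) ?_
      rw [smul_smul _ (tt ^ (n + 1)), ← pow_add, add_comm 1 (n + 1), smul_neg, smul_add, ← hy]
      abel
    refine ⟨(cst c⁻¹ : Rt) • (-(W + y)), ?_⟩
    rw [smul_comm, ← e4, C_smul_cancel hc]

end QExp

section Theta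

variable {A B : Type*} [Ring A] [Algebra Rt A] [Ring B] [Algebra Rt B] (c : ℂ)

/-- The `q`-exponential `∑ coef m zᵐ`. -/
noncomputable def theta (z : Comp A) : Comp A := Comp.tsum fun m => coefDiv c m • z ^ m

theorem theta_isSum (z : Comp A) : IsSum (fun m => coefDiv c m • z ^ m) (theta c z) :=
  Comp.isSum_tsum _

theorem theta_map (f : Comp A →ₐ[Rt] Comp B) (z : Comp A) : f (theta c z) = theta c (f z) := by
  refine ((theta_isSum c z).map f.toLinearMap).unique Comp.sep ?_
  simpa using theta_isSum c (f z)

theorem theta_intertwine {a b x : Comp A} (h : a * x = x * b) :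
    theta c a * x = x * theta c b := by
  refine ((theta_isSum c a).mul_right x).unique Comp.sep ?_
  convert (theta_isSum c b).mul_left x using 2 with k
  rw [smul_mul_assoc, mul_smul_comm]
  congr 1
  exact SemiconjBy.pow_right (show SemiconjBy x b a from h.symm) k |>.symm

theorem isUnit_theta (z : Comp A) : IsUnit (theta c z) := by
  obtain ⟨y, hy⟩ := (theta_isSum c z).tail 1
  have : theta c z = 1 + tt • y := by simpa using hy
  rw [this]
  exact Comp.isUnit_one_add y

@[simp] theorem theta_zero : theta c (0 : Comp A) = 1 := by
  refine (theta_isSum c 0).unique Comp.sep ?_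
  convert IsSum.of_single (1 : Comp A) using 2 with k
  cases k <;> simp

variable {c}

theorem mul_pow_of_qcomm {a b : Comp A} {r : Rt} (h : b * a = r • (a * b)) (i : ℕ) :
    b * a ^ i = r ^ i • (a ^ i * b) := by
  induction i with
  | zero => simp
  | succ i ih =>
    rw [pow_succ, ← mul_assoc, ih, smul_mul_assoc, mul_assoc, h, mul_smul_comm, smul_smul,
      ← mul_assoc, pow_succ]

theorem qbinom_sum_succ {a b : Comp A} (h : b * a = qs c (-2) • (a * b)) (n : ℕ) :
    nq c (n + 1) • ∑ p ∈ Finset.HasAntidiagonal.antidiagonal (n + 1),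
      (coefDiv c p.1 • a ^ p.1) * (coefDiv c p.2 • b ^ p.2) =
    (-qd c (-2)) • ((a + b) * ∑ p ∈ Finset.HasAntidiagonal.antidiagonal n,
      (coefDiv c p.1 • a ^ p.1) * (coefDiv c p.2 • b ^ p.2)) := by
  have e1 : nq c (n + 1) • ∑ p ∈ Finset.HasAntidiagonal.antidiagonal (n + 1),
      (coefDiv c p.1 • a ^ p.1) * (coefDiv c p.2 • b ^ p.2) =
      ∑ p ∈ Finset.HasAntidiagonal.antidiagonal (n + 1),
        (nq c p.1 * coefDiv c p.1 * coefDiv c p.2) • (a ^ p.1 * b ^ p.2) +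
      ∑ p ∈ Finset.HasAntidiagonal.antidiagonal (n + 1),
        (qs c (-2) ^ p.1 * coefDiv c p.1 * (nq c p.2 * coefDiv c p.2)) • (a ^ p.1 * b ^ p.2) := by
    rw [Finset.smul_sum, ← Finset.sum_add_distrib]
    refine Finset.sum_congr rfl fun p hp => ?_
    rw [Finset.HasAntidiagonal.mem_antidiagonal] at hp
    rw [smul_mul_smul_comm, ← hp, nq_add, smul_smul, ← add_smul]
    congr 1
    ring
  rw [e1, Finset.Nat.sum_antidiagonal_succ, Finset.Nat.sum_antidiagonal_succ', Finset.mul_sum,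
    Finset.smul_sum]
  simp only [nq_zero, zero_mul, mul_zero, zero_smul, zero_add]
  rw [← Finset.sum_add_distrib]
  refine Finset.sum_congr rfl fun p _ => ?_
  have h1 : nq c (p.1 + 1) * coefDiv c (p.1 + 1) = -qd c (-2) * coefDiv c p.1 := by
    rw [mul_comm, coefDiv_succ]
  have h2 : nq c (p.2 + 1) * coefDiv c (p.2 + 1) = -qd c (-2) * coefDiv c p.2 := by
    rw [mul_comm, coefDiv_succ]
  rw [h1, h2, smul_mul_smul_comm, mul_smul_comm, add_mul, ← mul_assoc, ← mul_assoc b,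
    mul_pow_of_qcomm h, smul_mul_assoc, mul_assoc (a ^ p.1) b, ← pow_succ', smul_add,
    smul_add, smul_smul, smul_smul, smul_smul, ← mul_assoc a (a ^ p.1),
    ← pow_succ']
  congr 2
  · ring
  · ring

/-- The `q`-exponential is multiplicative on `q`-commuting elements. -/
theorem theta_add {a b : Comp A} (h : b * a = qs c (-2) • (a * b)) :
    theta c (a + b) = theta c a * theta c b := by
  refine (theta_isSum c (a + b)).unique Comp.sep ?_
  convert (theta_isSum c a).mul (theta_isSum c b) using 2 with n
  induction n with
  | zero => simp
  | succ n ih =>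
    have h1 := qbinom_sum_succ h n
    rw [← ih] at h1
    refine (isUnit_nq c n).smul_left_cancel.1 ?_
    rw [h1, smul_smul, mul_comm, coefDiv_succ, mul_smul_comm, smul_smul, ← pow_succ']

theorem IsSum.of_shift {M : Type*} [AddCommGroup M] [Module Rt M] {a b : ℕ → M} {s : M}
    (hs : IsSum a s) (h0 : a 0 = 0) (h : ∀ k, tt • a (k + 1) = b k) : IsSum b s := by
  intro n
  obtain ⟨y, hy⟩ := hs (n + 1)
  refine ⟨tt • y, ?_⟩
  rw [smul_smul, ← pow_succ, ← hy, Finset.sum_range_succ', h0, smul_zero, add_zero]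
  congr 1
  refine Finset.sum_congr rfl fun k _ => ?_
  rw [← h, smul_smul, pow_succ]

theorem smul_coefDiv_succ {M : Type*} [AddCommGroup M] [Module Rt M] {x y : M} {m : ℕ}
    (h : (1 - qs c (-2)) • x = nq c (m + 1) • y) :
    tt • coefDiv c (m + 1) • x = coefDiv c m • y := by
  refine (isUnit_nq c m).smul_left_cancel.1 ?_
  rw [smul_smul, smul_smul, smul_comm (nq c (m + 1)), ← h, smul_smul, one_sub_qs]
  congr 1
  calc _ = tt * (coefDiv c (m + 1) * nq c (m + 1)) := by ring
    _ = _ := by rw [coefDiv_succ]; ring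

/-- The quasi-R-matrix intertwines the coproducts of the lowering generator. -/
theorem theta_lower {u x X g hi : Comp A} (xu : x * u = u * x) (xX : x * X = X * x)
    (xg : x * g = g * x) (xhi : x * hi = hi * x)
    (gu : g * u = qs c (-2) • (u * g)) (hu : u * hi = qs c (-2) • (hi * u))
    (uX : (1 - qs c (-2)) • (u * X - X * u) = hi - g) :
    theta c (u * x) * (X + g * x) = (X + hi * x) * theta c (u * x) := by
  set z := u * x
  have zx : z * x = x * z := by simp only [z]; rw [← mul_assoc, xu]
  have zhi : z * hi = qs c (-2) • (hi * z) := by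
    simp only [z]
    rw [mul_assoc, xhi, ← mul_assoc, hu, smul_mul_assoc, mul_assoc]
  have gz : g * z = qs c (-2) • (z * g) := by
    simp only [z]
    rw [← mul_assoc, gu, smul_mul_assoc, mul_assoc, ← xg, ← mul_assoc]
  have zX : (1 - qs c (-2)) • (z * X - X * z) = hi * x - g * x := by
    have : z * X - X * z = (u * X - X * u) * x := by
      simp only [z]; rw [mul_assoc, xX, sub_mul, mul_assoc, mul_assoc]
    rw [this, ← smul_mul_assoc, uX, sub_mul]
  have key : ∀ m, (1 - qs c (-2)) • (z ^ (m + 1) * X - X * z ^ (m + 1)) =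
      nq c (m + 1) • (hi * x * z ^ m - z ^ m * (g * x)) := by
    intro m
    induction m with
    | zero => simp [nq, zX]
    | succ m ih =>
      have e : z ^ (m + 1 + 1) * X - X * z ^ (m + 1 + 1) =
          z * (z ^ (m + 1) * X - X * z ^ (m + 1)) + (z * X - X * z) * z ^ (m + 1) := by
        rw [pow_succ' z (m + 1)]; noncomm_ring
      rw [e, smul_add, ← mul_smul_comm, ih, ← smul_mul_assoc, zX, mul_smul_comm, mul_sub,
        ← mul_assoc, ← mul_assoc z hi, zhi, ← mul_assoc z (z ^ m), ← pow_succ', smul_mul_assoc,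
        smul_mul_assoc, mul_assoc hi z x, zx, ← mul_assoc hi x z, mul_assoc (hi * x) z, ← pow_succ',
        sub_mul, mul_assoc g x, (Commute.pow_left (show Commute z x from zx) (m + 1)).eq.symm,
        ← mul_assoc g, mul_pow_of_qcomm gz, smul_mul_assoc, mul_assoc (z ^ (m + 1)) g x,
        smul_sub, smul_smul, smul_sub, nq_succ' c (m + 1), add_smul, one_smul, ← nq_succ' c (m + 1),
        nq_succ c (m + 1), add_smul]
      abel
  have hs : IsSum (fun m => coefDiv c m • (z ^ m * X - X * z ^ m))
      (theta c z * X - X * theta c z) := by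
    convert ((theta_isSum c z).mul_right X).sub ((theta_isSum c z).mul_left X) using 2 with m
    rw [smul_mul_assoc, mul_smul_comm, smul_sub]
  have hs' : IsSum (fun m => coefDiv c m • (hi * x * z ^ m - z ^ m * (g * x)))
      (hi * x * theta c z - theta c z * (g * x)) := by
    convert ((theta_isSum c z).mul_left (hi * x)).sub ((theta_isSum c z).mul_right (g * x))
      using 2 with m
    rw [smul_mul_assoc, mul_smul_comm, smul_sub]
  have := (hs.of_shift (by simp) fun m => smul_coefDiv_succ (key m)).unique Comp.sep hs'
  rw [mul_add, add_mul, ← sub_eq_zero]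
  rw [← sub_eq_zero] at this
  rw [← this]
  abel

/-- The quasi-R-matrix intertwines the coproducts of the raising generator. -/
theorem theta_raise {u x y h k : Comp A} (xu : x * u = u * x) (yu : y * u = u * y)
    (xh : x * h = h * x) (ku : k * u = u * k) (kh : k * h = h * k)
    (hu : u * h = qs c 2 • (h * u)) (xk : x * k = (qs c (-2)) ^ 2 • (k * x))
    (yx : (1 - qs c (-2)) • (y * x - qs c 2 • (x * y)) = 1 - k) :
    theta c (u * x) * (h * u + h * y) = (h * y + k * (h * u)) * theta c (u * x) := by
  set z := u * x
  have uz : u * z = z * u := by simp only [z]; rw [mul_assoc, xu]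
  have zh : z * h = qs c 2 • (h * z) := by
    simp only [z]
    rw [mul_assoc, xh, ← mul_assoc, hu, smul_mul_assoc, mul_assoc]
  have zk : z * k = qs c (-2) ^ 2 • (k * z) := by
    simp only [z]
    rw [mul_assoc, xk, mul_smul_comm, ← mul_assoc, ← ku, mul_assoc]
  have yz : (1 - qs c (-2)) • (y * z - qs c 2 • (z * y)) = u - k * u := by
    have : y * z - qs c 2 • (z * y) = u * (y * x - qs c 2 • (x * y)) := by
      simp only [z]; rw [← mul_assoc, yu, mul_sub, mul_assoc, mul_smul_comm, mul_assoc]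
    rw [this, ← mul_smul_comm, yx, mul_sub, mul_one, ku]
  have zmr : ∀ {w : Comp A} {r : Rt}, z * w = r • (w * z) → ∀ m, z ^ m * w = r ^ m • (w * z ^ m) := by
    intro w r h m
    induction m with
    | zero => simp
    | succ m ih =>
      rw [pow_succ, mul_assoc, h, mul_smul_comm, ← mul_assoc, ih, smul_mul_assoc, smul_smul,
        mul_assoc, ← pow_succ, ← pow_succ']
  have zmk := zmr zk
  have zmh := zmr zh
  have uzm : ∀ m, u * z ^ m = z ^ m * u := fun m => (show Commute u z from uz).pow_right m
  have pP : qs c 2 * qs c (-2) = 1 := qs_mul_neg c 2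
  have key : ∀ m, (1 - qs c (-2)) • (y * z ^ (m + 1) - qs c 2 ^ (m + 1) • (z ^ (m + 1) * y)) =
      nq c (m + 1) • (qs c 2 ^ m • (z ^ m * u) - k * (u * z ^ m)) := by
    intro m
    induction m with
    | zero => simp [nq, yz]
    | succ m ih =>
      have e : y * z ^ (m + 1 + 1) - qs c 2 ^ (m + 1 + 1) • (z ^ (m + 1 + 1) * y) =
          (y * z ^ (m + 1) - qs c 2 ^ (m + 1) • (z ^ (m + 1) * y)) * z +
          qs c 2 ^ (m + 1) • (z ^ (m + 1) * (y * z - qs c 2 • (z * y))) := by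
        rw [sub_mul, mul_sub, smul_sub, mul_smul_comm, smul_smul, ← pow_succ (qs c 2), mul_assoc,
          ← pow_succ, smul_mul_assoc, ← mul_assoc _ z y, ← pow_succ z (m + 1), mul_assoc]
        abel
      have e2 : qs c 2 ^ (m + 1) * (qs c (-2) ^ 2) ^ (m + 1) = qs c (-2) ^ (m + 1) := by
        rw [← mul_pow]
        congr 1
        calc _ = (qs c 2 * qs c (-2)) * qs c (-2) := by ring
          _ = _ := by rw [pP, one_mul]
      have e3 : nq c (m + 1) * qs c 2 ^ m + qs c 2 ^ (m + 1) = nq c (m + 1 + 1) * qs c 2 ^ (m + 1) := by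
        rw [nq_succ' c (m + 1), pow_succ]
        calc _ = nq c (m + 1) * qs c 2 ^ m * (qs c 2 * qs c (-2)) + qs c 2 ^ m * qs c 2 := by
              rw [pP, mul_one]
          _ = _ := by ring
      have e4 : z ^ (m + 1) * (u - k * u) =
          z ^ (m + 1) * u - (qs c (-2) ^ 2) ^ (m + 1) • (k * (u * z ^ (m + 1))) := by
        rw [mul_sub, ← mul_assoc, zmk, smul_mul_assoc, mul_assoc, ← uzm]
      have e5 : (qs c 2 ^ m • (z ^ m * u) - k * (u * z ^ m)) * z =
          qs c 2 ^ m • (z ^ (m + 1) * u) - k * (u * z ^ (m + 1)) := by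
        rw [sub_mul, smul_mul_assoc, mul_assoc, uz, ← mul_assoc, ← pow_succ, mul_assoc, mul_assoc,
          ← pow_succ]
      rw [e, smul_add, ← smul_mul_assoc, ih, smul_comm, ← mul_smul_comm (1 - qs c (-2)), yz,
        smul_mul_assoc, e4, e5,
        smul_sub, smul_sub, smul_sub, smul_smul, smul_smul, smul_smul, e2, ← e3, add_smul,
        nq_succ c (m + 1), add_smul]
      abel
  have hs : IsSum (fun m => coefDiv c m • (h * (y * z ^ m - qs c 2 ^ m • (z ^ m * y))))
      (h * y * theta c z - theta c z * (h * y)) := by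
    convert ((theta_isSum c z).mul_left (h * y)).sub ((theta_isSum c z).mul_right (h * y))
      using 2 with m
    rw [smul_mul_assoc, mul_smul_comm, ← smul_sub, ← mul_assoc (z ^ m), zmh]
    simp only [mul_sub, smul_mul_assoc, mul_smul_comm, mul_assoc]
  have hs' : IsSum (fun m => coefDiv c m • (h * (qs c 2 ^ m • (z ^ m * u) - k * (u * z ^ m))))
      (theta c z * (h * u) - k * (h * u) * theta c z) := by
    convert ((theta_isSum c z).mul_right (h * u)).sub ((theta_isSum c z).mul_left (k * (h * u)))
      using 2 with m
    rw [smul_mul_assoc, mul_smul_comm, ← smul_sub, ← mul_assoc (z ^ m), zmh, ← mul_assoc k h u, kh]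
    simp only [mul_sub, smul_mul_assoc, mul_smul_comm, mul_assoc]
  have := (hs.of_shift (by simp) fun m => smul_coefDiv_succ (by
    rw [← mul_smul_comm, key, mul_smul_comm])).unique Comp.sep hs'
  rw [mul_add, add_mul, ← sub_eq_zero]
  rw [eq_comm, ← sub_eq_zero] at this
  rw [← this]
  abel

end Theta

section Log

variable {A B : Type*} [Ring A] [Algebra Rt A] [Ring B] [Algebra Rt B]

theorem Line.mul_comm' (x y : Line) : x * y = y * x := by
  have h1 : ∀ p : Polynomial Rt, ∀ y : Line, of p * y = y * of p := by
    intro p y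
    exact LinearMap.congr_fun (Comp.linear_ext Comp.sep
      (f := LinearMap.mulLeft Rt (of p)) (g := LinearMap.mulRight Rt (of p)) fun a => by
        simp only [LinearMap.mulLeft_apply, LinearMap.mulRight_apply]
        rw [← map_mul, ← map_mul, mul_comm]) y
  exact LinearMap.congr_fun (Comp.linear_ext Comp.sep
      (f := LinearMap.mulRight Rt y) (g := LinearMap.mulLeft Rt y) fun a => h1 a y) x

variable (c : ℂ)

theorem qpow_tt_pow_smul (n : ℕ) (r : Comp A) :
    ∃ y, qpow c 1 (tt ^ n • r) = 1 + tt ^ (n + 1) • (cst c : Rt) • r + tt ^ (n + 2) • y := by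
  obtain ⟨y, hy⟩ := (qpow_isSum c 1 (tt ^ n • r)).tail (n + 2)
  refine ⟨∑ k ∈ Finset.range n, (tt ^ k * (cst ((1 * c) ^ (k + 1 + 1) /
    ((k + 1 + 1).factorial : ℂ)) : Rt)) • (r * (tt ^ n • r) ^ (k + 1)) + y, ?_⟩
  rw [hy, Finset.sum_range_succ', Finset.sum_range_succ', smul_add, Finset.smul_sum, ← add_assoc]
  congr 1
  rw [add_comm, add_comm _ (Finset.sum _ _)]
  have e0 : tt ^ 0 • (cst ((1 * c) ^ 0 / (((0 : ℕ).factorial : ℕ) : ℂ)) : Rt) •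
      (tt ^ n • r) ^ 0 = 1 := by simp
  have e1 : tt ^ (0 + 1) • (cst ((1 * c) ^ (0 + 1) / (((0 + 1 : ℕ).factorial : ℕ) : ℂ)) :
      Rt) • (tt ^ n • r) ^ (0 + 1) = tt ^ (n + 1) • (cst c : Rt) • r := by
    simp only [zero_add, pow_one, Nat.factorial_one, Nat.cast_one, one_mul, div_one]
    rw [smul_comm (cst c : Rt), smul_smul, ← pow_succ']
  rw [e0, e1]
  have e2 : ∀ k, tt ^ (k + 1 + 1) • (cst ((1 * c) ^ (k + 1 + 1) /
      ((k + 1 + 1).factorial : ℂ)) : Rt) • (tt ^ n • r) ^ (k + 1 + 1) = tt ^ (n + 2) •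
      (tt ^ k * (cst ((1 * c) ^ (k + 1 + 1) /
    ((k + 1 + 1).factorial : ℂ)) : Rt)) • (r * (tt ^ n • r) ^ (k + 1)) := by
    intro k
    rw [pow_succ' (tt ^ n • r), smul_mul_assoc, smul_smul, smul_smul, smul_smul]
    congr 1
    ring
  simp only [e2]
  abel

theorem Line.exists_log (hc : c ≠ 0) (v : Line) : ∃ L : Line, qpow c 1 L = 1 + tt • v := by
  have step : ∀ (n : ℕ) (w : Line), ∃ w' : Line, (1 + tt ^ (n + 1) • w) *
      qpow c 1 (-(tt ^ n • (cst c⁻¹ : Rt) • w)) = 1 + tt ^ (n + 2) • w' := by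
    intro n w
    obtain ⟨y, hy⟩ := qpow_tt_pow_smul c n (-((cst c⁻¹ : Rt) • w))
    rw [smul_neg] at hy
    have e : (cst c : Rt) • -((cst c⁻¹ : Rt) • w) = -w := by
      rw [smul_neg, smul_comm, C_smul_cancel hc]
    rw [hy, e]
    refine ⟨-(tt ^ n • (w * w)) + (1 + tt ^ (n + 1) • w) * y, ?_⟩
    rw [mul_add, mul_smul_comm, smul_add, ← add_assoc]
    congr 1
    have e3 : (tt ^ (n + 1) • w) * (tt ^ (n + 1) • w) = tt ^ (n + 2) • tt ^ n • (w * w) := by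
      rw [smul_mul_smul_comm, smul_smul]
      congr 1
      ring
    rw [smul_neg, smul_neg, ← e3, add_mul, one_mul, mul_add, mul_one, mul_neg]
    abel
  choose f hf using step
  let w : ℕ → Line := fun n => Nat.rec v (fun n w => f n w) n
  let r : ℕ → Line := fun n => (cst c⁻¹ : Rt) • w n
  have hw : ∀ n, (1 + tt • v) * qpow c 1 (-∑ k ∈ Finset.range n, tt ^ k • r k) =
      1 + tt ^ (n + 1) • w n := by
    intro n
    induction n with
    | zero => simp [w]
    | succ n ih =>
      rw [Finset.sum_range_succ, neg_add, qpow_add (Line.mul_comm' _ _), ← mul_assoc, ih]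
      exact hf n (w n)
  obtain ⟨L, hL⟩ := Comp.tComplete.sum r
  have h1 : (1 + tt • v) * qpow c 1 (-L) = 1 := by
    refine Comp.sep.eq_of fun n => ?_
    obtain ⟨y, hy⟩ := hL.tail n
    obtain ⟨z, hz⟩ := qpow_tt_pow_smul c n (-y)
    rw [hy, neg_add, qpow_add (Line.mul_comm' _ _), ← mul_assoc, hw, ← smul_neg, hz]
    refine ⟨tt • (w n) + (1 + tt ^ (n + 1) • w n) *
      (tt • (cst c : Rt) • (-y) + tt ^ 2 • z), ?_⟩
    rw [smul_add, ← mul_smul_comm, smul_add, smul_smul _ tt, smul_smul _ tt, smul_smul _ (tt ^ 2),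
      ← pow_succ, ← pow_add, add_assoc (1 : Line), mul_add, mul_one]
    abel
  refine ⟨L, ?_⟩
  have := congrArg (· * qpow c 1 L) h1
  simpa [mul_assoc, qpow_neg_mul, eq_comm] using this

end Log

section Legs

variable {A : Type*} [Ring A] [Algebra Rt A]

theorem inl_inr_comm {B : Type*} [Ring B] [Algebra Rt B] (a : A) (b : B) :
    inl A B a * inr A B b = inr A B b * inl A B a := by
  change of _ * of _ = of _ * of _
  rw [← map_mul, ← map_mul]
  simp

theorem of_tmul {B : Type*} [Ring B] [Algebra Rt B] (a : A) (b : B) :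
    of (a ⊗ₜ[Rt] b) = inl A B a * inr A B b := by
  change _ = of _ * of _
  rw [← map_mul]
  simp

/-- The inclusion of the first factor in the completed tensor cube. -/
noncomputable def in1 : A →ₐ[Rt] Comp ((A ⊗[Rt] A) ⊗[Rt] A) :=
  of.comp ((Algebra.TensorProduct.includeLeft :
    (A ⊗[Rt] A) →ₐ[Rt] ((A ⊗[Rt] A) ⊗[Rt] A)).comp Algebra.TensorProduct.includeLeft)

/-- The inclusion of the second factor in the completed tensor cube. -/
noncomputable def in2 : A →ₐ[Rt] Comp ((A ⊗[Rt] A) ⊗[Rt] A) :=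
  of.comp ((Algebra.TensorProduct.includeLeft :
    (A ⊗[Rt] A) →ₐ[Rt] ((A ⊗[Rt] A) ⊗[Rt] A)).comp Algebra.TensorProduct.includeRight)

/-- The inclusion of the third factor in the completed tensor cube. -/
noncomputable def in3 : A →ₐ[Rt] Comp ((A ⊗[Rt] A) ⊗[Rt] A) :=
  of.comp (Algebra.TensorProduct.includeRight : A →ₐ[Rt] ((A ⊗[Rt] A) ⊗[Rt] A))

theorem in12_comm (a b : A) : in1 a * in2 b = in2 b * in1 a := by
  change of _ * of _ = of _ * of _
  rw [← map_mul, ← map_mul]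
  simp

theorem in13_comm (a b : A) : in1 a * in3 b = in3 b * in1 a := by
  change of _ * of _ = of _ * of _
  rw [← map_mul, ← map_mul]
  simp

theorem in23_comm (a b : A) : in2 a * in3 b = in3 b * in2 a := by
  change of _ * of _ = of _ * of _
  rw [← map_mul, ← map_mul]
  simp

/-- `leg12` as an algebra homomorphism. -/
noncomputable def leg12Hom : Comp (A ⊗[Rt] A) →ₐ[Rt] Comp ((A ⊗[Rt] A) ⊗[Rt] A) :=
  Comp.mapHom Algebra.TensorProduct.includeLeft

/-- `leg13` as an algebra homomorphism. -/
noncomputable def leg13Hom : Comp (A ⊗[Rt] A) →ₐ[Rt] Comp ((A ⊗[Rt] A) ⊗[Rt] A) :=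
  Comp.mapHom (Algebra.TensorProduct.map Algebra.TensorProduct.includeLeft (AlgHom.id Rt A))

/-- `leg23` as an algebra homomorphism. -/
noncomputable def leg23Hom : Comp (A ⊗[Rt] A) →ₐ[Rt] Comp ((A ⊗[Rt] A) ⊗[Rt] A) :=
  Comp.mapHom (Algebra.TensorProduct.map Algebra.TensorProduct.includeRight (AlgHom.id Rt A))

/-- `leg21` as an algebra homomorphism. -/
noncomputable def leg21Hom : Comp (A ⊗[Rt] A) →ₐ[Rt] Comp (A ⊗[Rt] A) :=
  Comp.mapHom (Algebra.TensorProduct.comm Rt A A).toAlgHom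

theorem leg12_eq (x : Comp (A ⊗[Rt] A)) : leg12 x = leg12Hom x := rfl
theorem leg13_eq (x : Comp (A ⊗[Rt] A)) : leg13 x = leg13Hom x := rfl
theorem leg23_eq (x : Comp (A ⊗[Rt] A)) : leg23 x = leg23Hom x := rfl
theorem leg21_eq (x : Comp (A ⊗[Rt] A)) : leg21 x = leg21Hom x := rfl

theorem inl_apply {B : Type*} [Ring B] [Algebra Rt B] (a : A) :
    inl A B a = of (a ⊗ₜ[Rt] 1) := rfl
theorem inr_apply {B : Type*} [Ring B] [Algebra Rt B] (b : B) :
    inr A B b = of (1 ⊗ₜ[Rt] b) := rfl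
theorem in1_apply (a : A) : in1 a = of ((a ⊗ₜ[Rt] (1 : A)) ⊗ₜ[Rt] (1 : A)) := rfl
theorem in2_apply (a : A) : in2 a = of (((1 : A) ⊗ₜ[Rt] a) ⊗ₜ[Rt] (1 : A)) := rfl
theorem in3_apply (a : A) : in3 a = of ((1 : A ⊗[Rt] A) ⊗ₜ[Rt] a) := rfl

@[simp] theorem leg12_inl (a : A) : leg12Hom (inl A A a) = in1 a := by
  rw [inl_apply, in1_apply, leg12Hom, Comp.mapHom_of, Algebra.TensorProduct.includeLeft_apply]
@[simp] theorem leg12_inr (a : A) : leg12Hom (inr A A a) = in2 a := by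
  rw [inr_apply, in2_apply, leg12Hom, Comp.mapHom_of, Algebra.TensorProduct.includeLeft_apply]
@[simp] theorem leg13_inl (a : A) : leg13Hom (inl A A a) = in1 a := by
  rw [inl_apply, in1_apply, leg13Hom, Comp.mapHom_of, Algebra.TensorProduct.map_tmul,
    Algebra.TensorProduct.includeLeft_apply, map_one]
@[simp] theorem leg13_inr (a : A) : leg13Hom (inr A A a) = in3 a := by
  rw [inr_apply, in3_apply, leg13Hom, Comp.mapHom_of, Algebra.TensorProduct.map_tmul, map_one,
    AlgHom.id_apply]
@[simp] theorem leg23_inl (a : A) : leg23Hom (inl A A a) = in2 a := by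
  rw [inl_apply, in2_apply, leg23Hom, Comp.mapHom_of, Algebra.TensorProduct.map_tmul,
    Algebra.TensorProduct.includeRight_apply, map_one]
@[simp] theorem leg23_inr (a : A) : leg23Hom (inr A A a) = in3 a := by
  rw [inr_apply, in3_apply, leg23Hom, Comp.mapHom_of, Algebra.TensorProduct.map_tmul, map_one,
    AlgHom.id_apply]
@[simp] theorem leg21_inl (a : A) : leg21Hom (inl A A a) = inr A A a := by
  rw [inl_apply, inr_apply, leg21Hom, Comp.mapHom_of]
  exact congrArg of (TensorProduct.comm_tmul Rt A A a 1)
@[simp] theorem leg21_inr (a : A) : leg21Hom (inr A A a) = inl A A a := by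
  rw [inl_apply, inr_apply, leg21Hom, Comp.mapHom_of]
  exact congrArg of (TensorProduct.comm_tmul Rt A A 1 a)

theorem leg12_comm_in3 (x : Comp (A ⊗[Rt] A)) (b : A) :
    leg12Hom x * in3 b = in3 b * leg12Hom x := by
  refine LinearMap.congr_fun (Comp.linear_ext Comp.sep
    (f := LinearMap.mulRight Rt (in3 b) ∘ₗ leg12Hom.toLinearMap)
    (g := LinearMap.mulLeft Rt (in3 b) ∘ₗ leg12Hom.toLinearMap) fun a => ?_) x
  change of _ * of _ = of _ * of _
  rw [← map_mul, ← map_mul]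
  simp

theorem leg23_comm_in1 (x : Comp (A ⊗[Rt] A)) (b : A) :
    in1 b * leg23Hom x = leg23Hom x * in1 b := by
  refine LinearMap.congr_fun (Comp.linear_ext Comp.sep
    (f := LinearMap.mulLeft Rt (in1 b) ∘ₗ leg23Hom.toLinearMap)
    (g := LinearMap.mulRight Rt (in1 b) ∘ₗ leg23Hom.toLinearMap) fun a => ?_) x
  change in1 b * leg23Hom (of a) = leg23Hom (of a) * in1 b
  induction a with
  | zero => simp
  | add x y hx hy => rw [map_add, map_add, mul_add, add_mul, hx, hy]
  | tmul a a' =>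
    rw [of_tmul, map_mul, leg23_inl, leg23_inr, ← mul_assoc, in12_comm, mul_assoc, in13_comm,
      mul_assoc]

/-- Algebra maps on a completed tensor product are determined by the factors. -/
theorem tensor_algHom_ext {B N : Type*} [Ring B] [Algebra Rt B] [Ring N] [Algebra Rt N]
    (hN : TSep N) {f g : Comp (A ⊗[Rt] B) →ₐ[Rt] N}
    (h1 : ∀ a, f (inl A B a) = g (inl A B a)) (h2 : ∀ b, f (inr A B b) = g (inr A B b)) : f = g := by
  refine Comp.algHom_ext hN fun z => ?_
  induction z with
  | zero => simp
  | add x y hx hy => rw [map_add, map_add, map_add, hx, hy]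
  | tmul a b => rw [of_tmul, map_mul, map_mul, h1, h2]

/-- Linear maps on a completed tensor product are determined by pure tensors. -/
theorem tensor_linear_ext {B N : Type*} [Ring B] [Algebra Rt B] [AddCommGroup N] [Module Rt N]
    (hN : TSep N) {f g : Comp (A ⊗[Rt] B) →ₗ[Rt] N}
    (h : ∀ a b, f (of (a ⊗ₜ b)) = g (of (a ⊗ₜ b))) : f = g := by
  refine Comp.linear_ext hN fun z => ?_
  induction z with
  | zero => simp
  | add x y hx hy => rw [map_add, map_add, map_add, hx, hy]
  | tmul a b => exact h a b

/-- The algebra map on a completed tensor product given by commuting maps on the factors. -/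
noncomputable def tensorLift {B D : Type*} [Ring B] [Algebra Rt B] [Ring D] [Algebra Rt D]
    (f : A →ₐ[Rt] Comp D) (g : B →ₐ[Rt] Comp D) (h : ∀ a b, Commute (f a) (g b)) :
    Comp (A ⊗[Rt] B) →ₐ[Rt] Comp D :=
  Comp.liftHom (Algebra.TensorProduct.lift f g h)

theorem tensorLift_inl {B D : Type*} [Ring B] [Algebra Rt B] [Ring D] [Algebra Rt D]
    (f : A →ₐ[Rt] Comp D) (g : B →ₐ[Rt] Comp D) (h : ∀ a b, Commute (f a) (g b)) (a : A) :
    tensorLift f g h (inl A B a) = f a := by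
  change Algebra.TensorProduct.lift f g h (a ⊗ₜ 1) = _
  simp

theorem tensorLift_inr {B D : Type*} [Ring B] [Algebra Rt B] [Ring D] [Algebra Rt D]
    (f : A →ₐ[Rt] Comp D) (g : B →ₐ[Rt] Comp D) (h : ∀ a b, Commute (f a) (g b)) (b : B) :
    tensorLift f g h (inr A B b) = g b := by
  change Algebra.TensorProduct.lift f g h (1 ⊗ₜ b) = _
  simp

namespace QTData

variable (d : QTData A)

/-- `comulId` as an algebra homomorphism. -/
noncomputable def comulIdHom : Comp (A ⊗[Rt] A) →ₐ[Rt] Comp ((A ⊗[Rt] A) ⊗[Rt] A) :=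
  tensorLift (leg12Hom.comp d.comul) in3 fun a b => leg12_comm_in3 (d.comul a) b

/-- `idComul` as an algebra homomorphism. -/
noncomputable def idComulHom : Comp (A ⊗[Rt] A) →ₐ[Rt] Comp ((A ⊗[Rt] A) ⊗[Rt] A) :=
  tensorLift in1 (leg23Hom.comp d.comul) fun a b => leg23_comm_in1 (d.comul b) a

@[simp] theorem comulIdHom_inl (a : A) : d.comulIdHom (inl A A a) = leg12Hom (d.comul a) :=
  tensorLift_inl ..
@[simp] theorem comulIdHom_inr (a : A) : d.comulIdHom (inr A A a) = in3 a := tensorLift_inr ..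
@[simp] theorem idComulHom_inl (a : A) : d.idComulHom (inl A A a) = in1 a := tensorLift_inl ..
@[simp] theorem idComulHom_inr (a : A) : d.idComulHom (inr A A a) = leg23Hom (d.comul a) :=
  tensorLift_inr ..

theorem comulId_eq (x : Comp (A ⊗[Rt] A)) : d.comulId x = d.comulIdHom x := by
  refine LinearMap.congr_fun (tensor_linear_ext Comp.sep
    (f := d.comulId) (g := d.comulIdHom.toLinearMap) fun a b => ?_) x
  rw [AlgHom.toLinearMap_apply, of_tmul, map_mul d.comulIdHom, comulIdHom_inl, comulIdHom_inr, ← of_tmul,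
    comulId, Comp.extend_of]
  rfl

theorem idComul_eq (x : Comp (A ⊗[Rt] A)) : d.idComul x = d.idComulHom x := by
  refine LinearMap.congr_fun (tensor_linear_ext Comp.sep
    (f := d.idComul) (g := d.idComulHom.toLinearMap) fun a b => ?_) x
  rw [AlgHom.toLinearMap_apply, of_tmul, map_mul d.idComulHom, idComulHom_inl, idComulHom_inr, ← of_tmul,
    idComul, Comp.extend_of]
  rfl

/-- `counitId` as an algebra homomorphism. -/
noncomputable def counitIdHom : Comp (A ⊗[Rt] A) →ₐ[Rt] Comp A :=
  Comp.mapHom (Algebra.TensorProduct.lift ((Algebra.ofId Rt A).comp d.counit) (AlgHom.id Rt A)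
    fun a b => Algebra.commutes (d.counit a) b)

/-- `idCounit` as an algebra homomorphism. -/
noncomputable def idCounitHom : Comp (A ⊗[Rt] A) →ₐ[Rt] Comp A :=
  Comp.mapHom (Algebra.TensorProduct.lift (AlgHom.id Rt A) ((Algebra.ofId Rt A).comp d.counit)
    fun a b => (Algebra.commutes (d.counit b) a).symm)

@[simp] theorem counitIdHom_inl (a : A) :
    d.counitIdHom (inl A A a) = algebraMap Rt _ (d.counit a) := by
  have : d.counitIdHom (inl A A a) = of (algebraMap Rt A (d.counit a) * 1) := rfl
  rw [this, mul_one, AlgHom.commutes]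
@[simp] theorem counitIdHom_inr (a : A) : d.counitIdHom (inr A A a) = of a := by
  have : d.counitIdHom (inr A A a) = of (algebraMap Rt A (d.counit 1) * a) := rfl
  rw [this, map_one, map_one, one_mul]
@[simp] theorem idCounitHom_inr (a : A) :
    d.idCounitHom (inr A A a) = algebraMap Rt _ (d.counit a) := by
  have : d.idCounitHom (inr A A a) = of (1 * algebraMap Rt A (d.counit a)) := rfl
  rw [this, one_mul, AlgHom.commutes]
@[simp] theorem idCounitHom_inl (a : A) : d.idCounitHom (inl A A a) = of a := by
  have : d.idCounitHom (inl A A a) = of (a * algebraMap Rt A (d.counit 1)) := rfl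
  rw [this, map_one, map_one, mul_one]

theorem counitId_eq (x : Comp (A ⊗[Rt] A)) : d.counitId x = d.counitIdHom x := by
  refine LinearMap.congr_fun (tensor_linear_ext Comp.sep
    (f := d.counitId) (g := d.counitIdHom.toLinearMap) fun a b => ?_) x
  rw [AlgHom.toLinearMap_apply, of_tmul, map_mul d.counitIdHom, counitIdHom_inl, counitIdHom_inr, ← of_tmul]
  change of (d.counit a • b) = _
  rw [map_smul, Algebra.smul_def]

theorem idCounit_eq (x : Comp (A ⊗[Rt] A)) : d.idCounit x = d.idCounitHom x := by
  refine LinearMap.congr_fun (tensor_linear_ext Comp.sep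
    (f := d.idCounit) (g := d.idCounitHom.toLinearMap) fun a b => ?_) x
  rw [AlgHom.toLinearMap_apply, of_tmul, map_mul d.idCounitHom, idCounitHom_inl, idCounitHom_inr, ← of_tmul]
  change of (d.counit b • a) = _
  rw [map_smul, Algebra.smul_def, Algebra.commutes]

theorem antipodeMul_of (a b : A) :
    d.antipodeMul (of (a ⊗ₜ b)) = of (d.antipode a * b) := rfl
theorem mulAntipode_of (a b : A) :
    d.mulAntipode (of (a ⊗ₜ b)) = of (a * d.antipode b) := rfl

theorem antipodeMul_mul (hS : ∀ a b, d.antipode (a * b) = d.antipode b * d.antipode a)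
    (z : Comp (A ⊗[Rt] A)) (a b : A) : d.antipodeMul (z * of (a ⊗ₜ b)) =
      of (d.antipode a) * d.antipodeMul z * of b := by
  refine LinearMap.congr_fun (tensor_linear_ext Comp.sep
    (f := d.antipodeMul ∘ₗ LinearMap.mulRight Rt (of (a ⊗ₜ b)))
    (g := LinearMap.mulRight Rt (of b) ∘ₗ LinearMap.mulLeft Rt (of (d.antipode a)) ∘ₗ
      d.antipodeMul) fun x y => ?_) z
  simp only [LinearMap.comp_apply, LinearMap.mulRight_apply, LinearMap.mulLeft_apply]
  rw [← map_mul, Algebra.TensorProduct.tmul_mul_tmul, antipodeMul_of, antipodeMul_of, hS,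
    ← map_mul of, ← map_mul of]
  simp only [mul_assoc]

theorem mulAntipode_mul (hS : ∀ a b, d.antipode (a * b) = d.antipode b * d.antipode a)
    (z : Comp (A ⊗[Rt] A)) (a b : A) : d.mulAntipode (of (a ⊗ₜ b) * z) =
      of a * d.mulAntipode z * of (d.antipode b) := by
  refine LinearMap.congr_fun (tensor_linear_ext Comp.sep
    (f := d.mulAntipode ∘ₗ LinearMap.mulLeft Rt (of (a ⊗ₜ b)))
    (g := LinearMap.mulRight Rt (of (d.antipode b)) ∘ₗ LinearMap.mulLeft Rt (of a) ∘ₗ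
      d.mulAntipode) fun x y => ?_) z
  simp only [LinearMap.comp_apply, LinearMap.mulRight_apply, LinearMap.mulLeft_apply]
  rw [← map_mul, Algebra.TensorProduct.tmul_mul_tmul, mulAntipode_of, mulAntipode_of, hS,
    ← map_mul of, ← map_mul of]
  simp only [mul_assoc]

theorem antipodeMul_scalar (hS : ∀ a b, d.antipode (a * b) = d.antipode b * d.antipode a)
    {z : Comp (A ⊗[Rt] A)} {r : Rt} (hz : d.antipodeMul z = algebraMap Rt _ r)
    (w : Comp (A ⊗[Rt] A)) : d.antipodeMul (z * w) = r • d.antipodeMul w := by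
  refine LinearMap.congr_fun (tensor_linear_ext Comp.sep
    (f := d.antipodeMul ∘ₗ LinearMap.mulLeft Rt z) (g := r • d.antipodeMul) fun a b => ?_) w
  simp only [LinearMap.comp_apply, LinearMap.mulLeft_apply, LinearMap.smul_apply]
  rw [antipodeMul_mul d hS, hz, antipodeMul_of, ← Algebra.commutes, mul_assoc, ← map_mul,
    Algebra.smul_def]

theorem mulAntipode_scalar (hS : ∀ a b, d.antipode (a * b) = d.antipode b * d.antipode a)
    {z : Comp (A ⊗[Rt] A)} {r : Rt} (hz : d.mulAntipode z = algebraMap Rt _ r)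
    (w : Comp (A ⊗[Rt] A)) : d.mulAntipode (w * z) = r • d.mulAntipode w := by
  refine LinearMap.congr_fun (tensor_linear_ext Comp.sep
    (f := d.mulAntipode ∘ₗ LinearMap.mulRight Rt z) (g := r • d.mulAntipode) fun a b => ?_) w
  simp only [LinearMap.comp_apply, LinearMap.mulRight_apply, LinearMap.smul_apply]
  rw [mulAntipode_mul d hS, hz, mulAntipode_of, ← Algebra.commutes, mul_assoc, ← map_mul,
    Algebra.smul_def]

variable {d} {S : Set A} (hd : TDense S)
include hd

theorem coassoc_of_dense (h : ∀ a ∈ S, d.comulId (d.comul a) = d.idComul (d.comul a)) (a : A) :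
    d.comulId (d.comul a) = d.idComul (d.comul a) := by
  rw [comulId_eq, idComul_eq]
  refine DFunLike.congr_fun (hd.algHom_ext Comp.sep (f := d.comulIdHom.comp d.comul)
    (g := d.idComulHom.comp d.comul) fun p hp => ?_) a
  have := h p hp
  rwa [comulId_eq, idComul_eq] at this

theorem counit_left_of_dense (h : ∀ a ∈ S, d.counitId (d.comul a) = of a) (a : A) :
    d.counitId (d.comul a) = of a := by
  rw [counitId_eq]
  refine DFunLike.congr_fun (hd.algHom_ext Comp.sep (f := d.counitIdHom.comp d.comul)
    (g := of) fun p hp => ?_) a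
  have := h p hp
  rwa [counitId_eq] at this

theorem counit_right_of_dense (h : ∀ a ∈ S, d.idCounit (d.comul a) = of a) (a : A) :
    d.idCounit (d.comul a) = of a := by
  rw [idCounit_eq]
  refine DFunLike.congr_fun (hd.algHom_ext Comp.sep (f := d.idCounitHom.comp d.comul)
    (g := of) fun p hp => ?_) a
  have := h p hp
  rwa [idCounit_eq] at this

theorem antipode_left_of_dense (hS : ∀ a b, d.antipode (a * b) = d.antipode b * d.antipode a)
    (h1 : d.antipode 1 = 1)
    (h : ∀ a ∈ S, d.antipodeMul (d.comul a) = algebraMap Rt (Comp A) (d.counit a)) (a : A) :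
    d.antipodeMul (d.comul a) = algebraMap Rt (Comp A) (d.counit a) := by
  refine LinearMap.congr_fun (hd.linear_ext Comp.sep (f := d.antipodeMul ∘ₗ d.comul.toLinearMap)
    (g := Algebra.linearMap Rt (Comp A) ∘ₗ d.counit.toLinearMap) fun p hp => ?_) a
  change d.antipodeMul (d.comul p) = algebraMap Rt (Comp A) (d.counit p)
  induction hp using Algebra.adjoin_induction with
  | mem x hx => exact h x hx
  | algebraMap r =>
    rw [AlgHom.commutes, AlgHom.commutes, Algebra.algebraMap_eq_smul_one, map_smul]
    change r • d.antipodeMul (of (1 ⊗ₜ 1)) = algebraMap Rt _ r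
    rw [antipodeMul_of, h1, one_mul, map_one, Algebra.algebraMap_eq_smul_one]
  | add x y _ _ hx hy => rw [map_add, map_add, map_add, map_add, hx, hy]
  | mul x y _ _ hx hy =>
    rw [map_mul, antipodeMul_scalar d hS hx, hy, map_mul, map_mul, Algebra.smul_def]

theorem antipode_right_of_dense (hS : ∀ a b, d.antipode (a * b) = d.antipode b * d.antipode a)
    (h1 : d.antipode 1 = 1)
    (h : ∀ a ∈ S, d.mulAntipode (d.comul a) = algebraMap Rt (Comp A) (d.counit a)) (a : A) :
    d.mulAntipode (d.comul a) = algebraMap Rt (Comp A) (d.counit a) := by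
  refine LinearMap.congr_fun (hd.linear_ext Comp.sep (f := d.mulAntipode ∘ₗ d.comul.toLinearMap)
    (g := Algebra.linearMap Rt (Comp A) ∘ₗ d.counit.toLinearMap) fun p hp => ?_) a
  change d.mulAntipode (d.comul p) = algebraMap Rt (Comp A) (d.counit p)
  induction hp using Algebra.adjoin_induction with
  | mem x hx => exact h x hx
  | algebraMap r =>
    rw [AlgHom.commutes, AlgHom.commutes, Algebra.algebraMap_eq_smul_one, map_smul]
    change r • d.mulAntipode (of (1 ⊗ₜ 1)) = algebraMap Rt _ r
    rw [mulAntipode_of, h1, one_mul, map_one, Algebra.algebraMap_eq_smul_one]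
  | add x y _ _ hx hy => rw [map_add, map_add, map_add, map_add, hx, hy]
  | mul x y _ _ hx hy =>
    rw [map_mul, mulAntipode_scalar d hS hy, hx, map_mul, map_mul, Algebra.smul_def,
      Algebra.commutes]

theorem R_comul_of_dense (h : ∀ a ∈ S, d.R * d.comul a = leg21 (d.comul a) * d.R) (a : A) :
    d.R * d.comul a = leg21 (d.comul a) * d.R :=
  hd.intertwine Comp.sep (f := d.comul) (g := leg21Hom.comp d.comul) h a

end QTData

end Legs

section Form

variable {R T U : Type*} [CommRing R] [Ring T] [Algebra R T] [Ring U] [Algebra R U]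

/-- The bilinear form `r (H ⊗ H - C ⊗ C + s (C ⊗ H - H ⊗ C))`. -/
def qform (r s : R) (h₁ c₁ h₂ c₂ : T) : T :=
  r • (h₁ * h₂ - c₁ * c₂ + s • (c₁ * h₂ - h₁ * c₂))

theorem qform_map (f : T →ₐ[R] U) (r s : R) (h₁ c₁ h₂ c₂ : T) :
    f (qform r s h₁ c₁ h₂ c₂) = qform r s (f h₁) (f c₁) (f h₂) (f c₂) := by
  simp only [qform, map_smul, map_add, map_sub, map_mul]

theorem qform_add_left (r s : R) (h₁ c₁ h₁' c₁' h₂ c₂ : T) :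
    qform r s (h₁ + h₁') (c₁ + c₁') h₂ c₂ = qform r s h₁ c₁ h₂ c₂ + qform r s h₁' c₁' h₂ c₂ := by
  simp only [qform, add_mul]
  module

theorem qform_add_right (r s : R) (h₁ c₁ h₂ c₂ h₂' c₂' : T) :
    qform r s h₁ c₁ (h₂ + h₂') (c₂ + c₂') = qform r s h₁ c₁ h₂ c₂ + qform r s h₁ c₁ h₂' c₂' := by
  simp only [qform, mul_add]
  module

theorem commute_qform {r s : R} {x h₁ c₁ h₂ c₂ : T} (e1 : Commute x h₁) (e2 : Commute x c₁)
    (e3 : Commute x h₂) (e4 : Commute x c₂) : Commute x (qform r s h₁ c₁ h₂ c₂) :=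
  (((e1.mul_right e3).sub_right (e2.mul_right e4)).add_right
    (((e2.mul_right e3).sub_right (e1.mul_right e4)).smul_right s)).smul_right _

theorem mul_qform_left {r s w : R} {x h₁ c₁ h₂ c₂ : T}
    (e1 : x * h₁ = h₁ * x + w • x) (e2 : x * c₁ = c₁ * x)
    (e3 : x * h₂ = h₂ * x) (e4 : x * c₂ = c₂ * x) :
    x * qform r s h₁ c₁ h₂ c₂ =
      (qform r s h₁ c₁ h₂ c₂ + (r * w) • (h₂ - s • c₂)) * x := by
  have f1 : x * (h₁ * h₂) = h₁ * h₂ * x + w • (h₂ * x) := by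
    rw [← mul_assoc, e1, add_mul, smul_mul_assoc, mul_assoc, e3, mul_assoc]
  have f2 : x * (h₁ * c₂) = h₁ * c₂ * x + w • (c₂ * x) := by
    rw [← mul_assoc, e1, add_mul, smul_mul_assoc, mul_assoc, e4, mul_assoc]
  have f3 : x * (c₁ * h₂) = c₁ * h₂ * x := by rw [← mul_assoc, e2, mul_assoc, e3, mul_assoc]
  have f4 : x * (c₁ * c₂) = c₁ * c₂ * x := by rw [← mul_assoc, e2, mul_assoc, e4, mul_assoc]
  rw [qform]
  simp only [mul_smul_comm, mul_add, mul_sub, smul_mul_assoc, add_mul, sub_mul, f1, f2, f3, f4]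
  module

theorem mul_qform_right {r s w : R} {x h₁ c₁ h₂ c₂ : T}
    (e1 : x * h₁ = h₁ * x) (e2 : x * c₁ = c₁ * x)
    (e3 : x * h₂ = h₂ * x + w • x) (e4 : x * c₂ = c₂ * x) :
    x * qform r s h₁ c₁ h₂ c₂ =
      (qform r s h₁ c₁ h₂ c₂ + (r * w) • (h₁ + s • c₁)) * x := by
  have f1 : x * (h₁ * h₂) = h₁ * h₂ * x + w • (h₁ * x) := by
    rw [← mul_assoc, e1, mul_assoc, e3, mul_add, mul_smul_comm, ← mul_assoc]
  have f2 : x * (c₁ * h₂) = c₁ * h₂ * x + w • (c₁ * x) := by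
    rw [← mul_assoc, e2, mul_assoc, e3, mul_add, mul_smul_comm, ← mul_assoc]
  have f3 : x * (h₁ * c₂) = h₁ * c₂ * x := by rw [← mul_assoc, e1, mul_assoc, e4, mul_assoc]
  have f4 : x * (c₁ * c₂) = c₁ * c₂ * x := by rw [← mul_assoc, e2, mul_assoc, e4, mul_assoc]
  rw [qform]
  simp only [mul_smul_comm, mul_add, mul_sub, smul_mul_assoc, add_mul, sub_mul, f1, f2, f3, f4]
  module

end Form

section Cartan

variable {A B : Type*} [Ring A] [Algebra Rt A] [Ring B] [Algebra Rt B] {c : ℂ}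

theorem qpow_weight {a x : Comp A} {w : ℂ} (h : a * x = x * a + (cst w : Rt) • x) :
    qpow c 1 a * x = qs c w • (x * qpow c 1 a) := by
  have h' : a * x = x * (a + (cst w : Rt) • 1) := by
    rw [h, mul_add, mul_smul_comm, mul_one]
  rw [qpow_intertwine h', qpow_add_scalar, mul_smul_comm]

theorem qpow_shift {a b x : Comp A} (h : x * a = (a + b) * x) (hab : Commute a b) :
    x * qpow c 1 a = qpow c 1 a * (qpow c 1 b * x) := by
  rw [← qpow_intertwine h.symm, qpow_add hab, mul_assoc]

/-- The relations of the generators `H, C, X, X̄` of `U_q(sl₂) ⊗ U_{q⁻¹}(ℂ)`. -/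
structure CartanRels (c : ℂ) (H C X Y : Comp A) : Prop where
  CH : C * H = H * C
  CX : C * X = X * C
  CY : C * Y = Y * C
  HX : H * X = X * H + (cst (-2) : Rt) • X
  HY : H * Y = Y * H + (cst 2 : Rt) • Y
  XY : (1 - qs c (-2)) • (qs c 2 • (X * Y) - Y * X) = qpow c 1 ((cst (-2) : Rt) • H) - 1

theorem CartanRels.map {H C X Y : Comp A} (h : CartanRels c H C X Y) (f : Comp A →ₐ[Rt] Comp B) :
    CartanRels c (f H) (f C) (f X) (f Y) where
  CH := by rw [← map_mul, h.CH, map_mul]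
  CX := by rw [← map_mul, h.CX, map_mul]
  CY := by rw [← map_mul, h.CY, map_mul]
  HX := by rw [← map_mul, h.HX, map_add, map_mul, map_smul]
  HY := by rw [← map_mul, h.HY, map_add, map_mul, map_smul]
  XY := by
    rw [← map_mul, ← map_mul, ← map_smul, ← map_smul, ← map_sub, ← map_smul, h.XY, map_sub, qpow_map,
      map_one]

end Cartan

section CartanHopf

set_option linter.unusedSectionVars false

variable {A : Type*} [Ring A] [Algebra Rt A] {c : ℂ} (s : Rt) {H C X Y : Comp A}

/-- `g = q ^ (-H + s C)` -/
noncomputable def gG (c : ℂ) (H C : Comp A) : Comp A := qpow c 1 (-H + s • C)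
/-- `ḡ = q ^ (-H - s C)` -/
noncomputable def gB (c : ℂ) (H C : Comp A) : Comp A := qpow c 1 (-H - s • C)
/-- `g⁻¹` -/
noncomputable def gGi (c : ℂ) (H C : Comp A) : Comp A := qpow c 1 (H - s • C)
/-- `ḡ⁻¹` -/
noncomputable def gBi (c : ℂ) (H C : Comp A) : Comp A := qpow c 1 (H + s • C)

theorem gG_mul_gGi : gG s c H C * gGi s c H C = 1 := by
  rw [gG, gGi, ← qpow_mul_neg 1 (-H + s • C)]; congr 2; abel
theorem gGi_mul_gG : gGi s c H C * gG s c H C = 1 := by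
  rw [gG, gGi, ← qpow_neg_mul 1 (-H + s • C)]; congr 2; abel
theorem gB_mul_gBi : gB s c H C * gBi s c H C = 1 := by
  rw [gB, gBi, ← qpow_mul_neg 1 (-H - s • C)]; congr 2; abel
theorem gBi_mul_gB : gBi s c H C * gB s c H C = 1 := by
  rw [gB, gBi, ← qpow_neg_mul 1 (-H - s • C)]; congr 2; abel

namespace CartanRels

variable (hr : CartanRels c H C X Y)
include hr

theorem mul_comb {Z : Comp A} {w : ℂ} (hH : H * Z = Z * H + (cst w : Rt) • Z)
    (hC : C * Z = Z * C) (a b : Rt) :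
    (a • H + b • C) * Z = Z * (a • H + b • C) + (a * cst w) • Z := by
  have _ := hr
  rw [add_mul, smul_mul_assoc, smul_mul_assoc, hH, hC, mul_add, mul_smul_comm, mul_smul_comm,
    smul_add, smul_smul]
  abel

theorem XH : X * H = H * X + (cst 2 : Rt) • X := by
  rw [hr.HX, add_assoc, ← add_smul, ← map_add]
  simp

theorem YH : Y * H = H * Y + (cst (-2) : Rt) • Y := by
  rw [hr.HY, add_assoc, ← add_smul, ← map_add]
  simp

theorem commute_comb (a b a' b' : Rt) : Commute (a • H + b • C) (a' • H + b' • C) := by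
  have h : Commute H C := hr.CH.symm
  exact ((((Commute.refl H).smul_left a).smul_right a').add_right
    ((h.smul_left a).smul_right b')).add_left
    ((((h.symm).smul_left b).smul_right a').add_right
      (((Commute.refl C).smul_left b).smul_right b'))

theorem qpow_comb {Z : Comp A} {w v : ℂ} (hH : H * Z = Z * H + (cst w : Rt) • Z)
    (hC : C * Z = Z * C) (a b : Rt) (hv : a * cst w = cst v) :
    qpow c 1 (a • H + b • C) * Z = qs c v • (Z * qpow c 1 (a • H + b • C)) :=
  qpow_weight (by rw [hr.mul_comb hH hC, hv])

theorem gG_eq : gG s c H C = qpow c 1 ((-1 : Rt) • H + s • C) := by rw [gG, neg_one_smul]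
theorem gB_eq : gB s c H C = qpow c 1 ((-1 : Rt) • H + (-s) • C) := by
  rw [gB, neg_one_smul, neg_smul, sub_eq_add_neg]
theorem gGi_eq : gGi s c H C = qpow c 1 ((1 : Rt) • H + (-s) • C) := by
  rw [gGi, one_smul, neg_smul, sub_eq_add_neg]
theorem gBi_eq : gBi s c H C = qpow c 1 ((1 : Rt) • H + s • C) := by rw [gBi, one_smul]

theorem gX : gG s c H C * X = qs c 2 • (X * gG s c H C) := by
  rw [hr.gG_eq]; exact hr.qpow_comb hr.HX hr.CX _ _ (by rw [neg_one_mul, ← map_neg, neg_neg])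
theorem hX : gB s c H C * X = qs c 2 • (X * gB s c H C) := by
  rw [hr.gB_eq]; exact hr.qpow_comb hr.HX hr.CX _ _ (by rw [neg_one_mul, ← map_neg, neg_neg])
theorem gY : gG s c H C * Y = qs c (-2) • (Y * gG s c H C) := by
  rw [hr.gG_eq]; exact hr.qpow_comb hr.HY hr.CY _ _ (by rw [neg_one_mul, ← map_neg])
theorem hY : gB s c H C * Y = qs c (-2) • (Y * gB s c H C) := by
  rw [hr.gB_eq]; exact hr.qpow_comb hr.HY hr.CY _ _ (by rw [neg_one_mul, ← map_neg])
theorem hiX : gBi s c H C * X = qs c (-2) • (X * gBi s c H C) := by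
  rw [hr.gBi_eq]; exact hr.qpow_comb hr.HX hr.CX _ _ (one_mul _)
theorem hiY : gBi s c H C * Y = qs c 2 • (Y * gBi s c H C) := by
  rw [hr.gBi_eq]; exact hr.qpow_comb hr.HY hr.CY _ _ (one_mul _)

theorem commute_gG_gB : Commute (gG s c H C) (gB s c H C) := by
  rw [hr.gG_eq, hr.gB_eq]
  exact ((hr.commute_comb _ _ _ _).qpow_left 1).qpow_right 1

theorem commute_gG_gBi : Commute (gG s c H C) (gBi s c H C) := by
  rw [hr.gG_eq, hr.gBi_eq]
  exact ((hr.commute_comb _ _ _ _).qpow_left 1).qpow_right 1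

theorem gG_mul_gB : gG s c H C * gB s c H C = qpow c 1 ((cst (-2) : Rt) • H) := by
  rw [hr.gG_eq, hr.gB_eq, ← qpow_add (hr.commute_comb _ _ _ _)]
  congr 1
  have : (cst (-2) : Rt) = -1 + -1 := by
    rw [← map_one (cst (R := ℂ)), ← map_neg, ← map_add]; congr 1; norm_num
  rw [this, add_smul, neg_smul s]
  abel

theorem gu : gG s c H C * (gBi s c H C * Y) = qs c (-2) • (gBi s c H C * Y * gG s c H C) := by
  rw [← mul_assoc, hr.commute_gG_gBi, mul_assoc, hr.gY, mul_smul_comm, mul_assoc]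

theorem hu : gB s c H C * (gBi s c H C * Y) = qs c (-2) • (gBi s c H C * Y * gB s c H C) := by
  rw [← mul_assoc, gB_mul_gBi, ← gBi_mul_gB s, mul_assoc, hr.hY, mul_smul_comm, mul_assoc]

theorem uh : gBi s c H C * Y * gB s c H C = qs c 2 • (gB s c H C * (gBi s c H C * Y)) := by
  rw [hr.hu, smul_smul, qs_mul_neg, one_smul]

theorem u_hi : gBi s c H C * Y * gBi s c H C =
    qs c (-2) • (gBi s c H C * (gBi s c H C * Y)) := by
  have e : Y * gBi s c H C = qs c (-2) • (gBi s c H C * Y) := by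
    rw [hr.hiY, smul_smul, qs_neg_mul, one_smul]
  rw [mul_assoc, e, mul_smul_comm]

theorem Xg : X * gG s c H C = qs c (-2) • (gG s c H C * X) := by
  rw [hr.gX, smul_smul, qs_neg_mul, one_smul]

theorem X_hi : X * gBi s c H C = qs c 2 • (gBi s c H C * X) := by
  rw [hr.hiX, smul_smul, qs_mul_neg, one_smul]

theorem XY' : (1 - qs c (-2)) • (qs c 2 • (X * Y) - Y * X) = gG s c H C * gB s c H C - 1 := by
  rw [hr.XY, hr.gG_mul_gB]

theorem uX : (1 - qs c (-2)) • (gBi s c H C * Y * X - X * (gBi s c H C * Y)) =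
    gBi s c H C - gG s c H C := by
  have : gBi s c H C * Y * X - X * (gBi s c H C * Y) =
      gBi s c H C * -(qs c 2 • (X * Y) - Y * X) := by
    rw [← mul_assoc X, hr.X_hi, neg_sub, mul_sub, smul_mul_assoc, mul_smul_comm]
    simp only [mul_assoc]
  rw [this, ← mul_smul_comm, smul_neg, hr.XY' s, neg_sub, mul_sub, mul_one, ← mul_assoc,
    ← (hr.commute_gG_gBi s).eq, mul_assoc, gBi_mul_gB, mul_one]

theorem Xk : X * (gG s c H C * gB s c H C) =
    qs c (-2) ^ 2 • (gG s c H C * gB s c H C * X) := by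
  rw [mul_assoc, hr.hX, mul_smul_comm, ← mul_assoc (gG s c H C), hr.gX, smul_mul_assoc, smul_smul,
    smul_smul, sq]
  have : qs c (-2) * qs c (-2) * (qs c 2 * qs c 2) = 1 := by
    have := qs_neg_mul c 2
    calc _ = (qs c (-2) * qs c 2) * (qs c (-2) * qs c 2) := by ring
      _ = 1 := by rw [this, one_mul]
  simp only [← mul_assoc] at this ⊢
  rw [this, one_smul]

theorem commute_cartan (a b : Rt) :
    Commute (qpow c 1 (a • H + b • C)) H ∧ Commute (qpow c 1 (a • H + b • C)) C := by
  have h := hr.commute_comb a b 1 0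
  have h' := hr.commute_comb a b 0 1
  simp only [one_smul, zero_smul, add_zero, zero_add] at h h'
  exact ⟨h.qpow_left 1, h'.qpow_left 1⟩

end CartanRels

/-- The coproduct, counit, antipode and R-matrix of the `s`-th twist of
`U_q(sl₂) ⊗ U_{q⁻¹}(ℂ)`, given on generators. -/
structure IsCartanForm (c : ℂ) (s : Rt) (H C X Y : Comp A) (d : QTData (Comp A)) : Prop where
  comul_H : d.comul H = inl _ _ H + inr _ _ H
  comul_C : d.comul C = inl _ _ C + inr _ _ C
  comul_X : d.comul X = inl _ _ X + inl _ _ (gG s c H C) * inr _ _ X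
  comul_Y : d.comul Y = inl _ _ Y + inl _ _ (gB s c H C) * inr _ _ Y
  counit_H : d.counit H = 0
  counit_C : d.counit C = 0
  counit_X : d.counit X = 0
  counit_Y : d.counit Y = 0
  antipode_one : d.antipode 1 = 1
  antipode_mul : ∀ a b, d.antipode (a * b) = d.antipode b * d.antipode a
  antipode_H : d.antipode H = -H
  antipode_C : d.antipode C = -C
  antipode_X : d.antipode X = -(gGi s c H C * X)
  antipode_Y : d.antipode Y = -(gBi s c H C * Y)
  R : d.R = qpow c 1 (qform (cst (1 / 2)) s (inl _ _ H) (inl _ _ C) (inr _ _ H)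
    (inr _ _ C)) * theta c (inl _ _ (gBi s c H C * Y) * inr _ _ X)

section Pair

variable {B : Type*} [Ring B] [Algebra Rt B]

theorem gG_map (f : Comp A →ₐ[Rt] Comp B) : f (gG s c H C) = gG s c (f H) (f C) := by
  rw [gG, qpow_map, map_add, map_neg, map_smul, gG]
theorem gB_map (f : Comp A →ₐ[Rt] Comp B) : f (gB s c H C) = gB s c (f H) (f C) := by
  rw [gB, qpow_map, map_sub, map_neg, map_smul, gB]
theorem gGi_map (f : Comp A →ₐ[Rt] Comp B) : f (gGi s c H C) = gGi s c (f H) (f C) := by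
  rw [gGi, qpow_map, map_sub, map_smul, gGi]
theorem gBi_map (f : Comp A →ₐ[Rt] Comp B) : f (gBi s c H C) = gBi s c (f H) (f C) := by
  rw [gBi, qpow_map, map_add, map_smul, gBi]

/-- The Cartan part of the R-matrix placed in two factors. -/
noncomputable def rCartan (c : ℂ) (H C : Comp A) (f g : Comp A →ₐ[Rt] Comp B) : Comp B :=
  qpow c 1 (qform (cst (1 / 2)) s (f H) (f C) (g H) (g C))

/-- The R-matrix placed in two factors. -/
noncomputable def rMat (c : ℂ) (H C X Y : Comp A) (f g : Comp A →ₐ[Rt] Comp B) : Comp B :=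
  rCartan s c H C f g * theta c (f (gBi s c H C * Y) * g X)

theorem rMat_map {D : Type*} [Ring D] [Algebra Rt D] (f g : Comp A →ₐ[Rt] Comp B)
    (k : Comp B →ₐ[Rt] Comp D) :
    k (rMat s c H C X Y f g) = rMat s c H C X Y (k.comp f) (k.comp g) := by
  rw [rMat, rCartan, map_mul, qpow_map, qform_map, theta_map, map_mul]
  rfl

variable {f g : Comp A →ₐ[Rt] Comp B} (hfg : ∀ a b, f a * g b = g b * f a)
  (hr : CartanRels c H C X Y)
include hr hfg

theorem commute_rCartan {z : Comp B} (e1 : Commute z (f H)) (e2 : Commute z (f C))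
    (e3 : Commute z (g H)) (e4 : Commute z (g C)) : Commute z (rCartan s c H C f g) := by
  have _ := hr
  have _ := hfg
  exact (commute_qform e1 e2 e3 e4).qpow_right 1

theorem inr_rCartan {Z : Comp A} {w : ℂ} {r : Rt} (hH : Z * H = H * Z + (cst w : Rt) • Z)
    (hC : C * Z = Z * C) (hw : cst (1 / 2) * cst w = r) : g Z * rCartan s c H C f g =
      rCartan s c H C f g * (qpow c 1 (r • (f H + s • f C)) * g Z) := by
  have e := mul_qform_right (r := cst (1 / 2)) (s := s) (h₂ := g H) (c₂ := g C) (hfg H Z).symm (hfg C Z).symm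
    (by rw [← map_mul, hH, map_add, map_smul, map_mul]) (by rw [← map_mul, ← hC, map_mul])
  have hc : Commute (f C) (f H) := (hr.map f).CH
  rw [hw] at e
  exact qpow_shift e ((commute_qform (.refl _) hc.symm (hfg _ H) (hfg _ C)).add_left
    ((commute_qform hc (.refl _) (hfg _ _) (hfg _ _)).smul_left s) |>.symm.smul_right r)

theorem inl_rCartan {Z : Comp A} {w : ℂ} {r : Rt} (hH : Z * H = H * Z + (cst w : Rt) • Z)
    (hC : C * Z = Z * C) (hw : cst (1 / 2) * cst w = r) : f Z * rCartan s c H C f g =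
      rCartan s c H C f g * (qpow c 1 (r • (g H - s • g C)) * f Z) := by
  have e := mul_qform_left (r := cst (1 / 2)) (s := s) (h₁ := f H) (c₁ := f C)
    (by rw [← map_mul, hH, map_add, map_smul, map_mul]) (by rw [← map_mul, ← hC, map_mul])
    (hfg Z H) (hfg Z C)
  have hc : Commute (g C) (g H) := (hr.map g).CH
  have c1 : ∀ a b, Commute (g a) (f b) := fun a b => (hfg b a).symm
  rw [hw] at e
  exact qpow_shift e ((commute_qform (c1 _ H) (c1 _ C) (.refl _) hc.symm).sub_left
    ((commute_qform (c1 _ _) (c1 _ _) hc (.refl _)).smul_left s) |>.symm.smul_right r)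

omit hfg hr in
theorem cst_half_mul (w : ℂ) : (cst (1 / 2) * cst (2 * w) : Rt) = cst w := by
  rw [← map_mul]; congr 1; ring

theorem inr_X_rCartan : g X * rCartan s c H C f g =
    rCartan s c H C f g * (f (gBi s c H C) * g X) := by
  rw [inr_rCartan s hfg hr (r := 1) hr.XH hr.CX (by simpa using cst_half_mul 1), one_smul, gBi_map,
    gBi]

theorem inl_X_rCartan : f X * rCartan s c H C f g =
    rCartan s c H C f g * (g (gGi s c H C) * f X) := by
  rw [inl_rCartan s hfg hr (r := 1) hr.XH hr.CX (by simpa using cst_half_mul 1), one_smul, gGi_map,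
    gGi]

theorem inr_Y_rCartan : g Y * rCartan s c H C f g =
    rCartan s c H C f g * (f (gB s c H C) * g Y) := by
  rw [inr_rCartan s hfg hr (r := -1) hr.YH hr.CY (by simpa using cst_half_mul (-1)), neg_one_smul,
    gB_map, gB, neg_add']

theorem inl_Y_rCartan : f Y * rCartan s c H C f g =
    rCartan s c H C f g * (g (gG s c H C) * f Y) := by
  rw [inl_rCartan s hfg hr (r := -1) hr.YH hr.CY (by simpa using cst_half_mul (-1)), neg_one_smul,
    gG_map, gG, neg_sub', sub_neg_eq_add]

theorem inl_commute_rCartan {z : Comp A} (hH : Commute z H) (hC : Commute z C) :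
    Commute (f z) (rCartan s c H C f g) :=
  commute_rCartan s hfg hr (hH.map f) (hC.map f) (hfg _ _) (hfg _ _)

theorem inr_commute_rCartan {z : Comp A} (hH : Commute z H) (hC : Commute z C) :
    Commute (g z) (rCartan s c H C f g) :=
  commute_rCartan s hfg hr (hfg _ _).symm (hfg _ _).symm (hH.map g) (hC.map g)

theorem rMat_mul_X : rMat s c H C X Y f g * (f X + f (gG s c H C) * g X) =
    (g X + g (gG s c H C) * f X) * rMat s c H C X Y f g := by
  have key := theta_lower (c := c) (u := f (gBi s c H C * Y)) (x := g X) (X := f X)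
    (g := f (gG s c H C)) (hi := f (gBi s c H C)) (hfg _ _).symm (hfg _ _).symm (hfg _ _).symm
    (hfg _ _).symm
    (by rw [← map_mul, hr.gu, map_smul, map_mul])
    (by rw [← map_mul, hr.u_hi, map_smul, map_mul])
    (by rw [← map_mul, ← map_mul, ← map_sub, ← map_smul, hr.uX, map_sub])
  have e1 := inr_X_rCartan s hfg hr
  have e2 := inl_X_rCartan s hfg hr
  have hg : Commute (g (gG s c H C)) (rCartan s c H C f g) := by
    rw [hr.gG_eq]
    have := hr.commute_cartan (-1) s
    exact inr_commute_rCartan s hfg hr this.1 this.2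
  have e3 : rCartan s c H C f g * f X = g (gG s c H C) * f X * rCartan s c H C f g := by
    rw [mul_assoc, e2, ← mul_assoc, hg.eq, mul_assoc, ← mul_assoc (g _) (g _), ← map_mul,
      gG_mul_gGi, map_one, one_mul]
  rw [rMat, mul_assoc, key, ← mul_assoc, mul_add, ← e1, e3, ← add_mul, mul_assoc, add_comm]

theorem rMat_mul_Y : rMat s c H C X Y f g * (f Y + f (gB s c H C) * g Y) =
    (g Y + g (gB s c H C) * f Y) * rMat s c H C X Y f g := by
  have key := theta_raise (c := c) (u := f (gBi s c H C * Y)) (x := g X) (y := g Y)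
    (h := f (gB s c H C)) (k := g (gG s c H C * gB s c H C)) (hfg _ _).symm (hfg _ _).symm
    (hfg _ _).symm (hfg _ _).symm (hfg _ _).symm
    (by rw [← map_mul, hr.uh, map_smul, map_mul])
    (by rw [← map_mul, hr.Xk, map_smul, map_mul])
    (by
      rw [← map_mul, ← map_mul, ← map_smul, ← map_sub, ← map_smul, ← neg_sub (qs c 2 • (X * Y)),
        smul_neg, hr.XY' s, neg_sub, map_sub, map_one])
  have hY : f (gB s c H C) * f (gBi s c H C * Y) = f Y := by
    rw [← map_mul, ← mul_assoc, gB_mul_gBi, one_mul]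
  rw [hY] at key
  have e1 := inr_Y_rCartan s hfg hr
  have e2 := inl_Y_rCartan s hfg hr
  have hg : Commute (g (gB s c H C)) (rCartan s c H C f g) := by
    rw [hr.gB_eq]
    have := hr.commute_cartan (-1) (-s)
    exact inr_commute_rCartan s hfg hr this.1 this.2
  have e3 : rCartan s c H C f g * (g (gG s c H C * gB s c H C) * f Y) =
      g (gB s c H C) * f Y * rCartan s c H C f g := by
    rw [mul_assoc (g (gB s c H C)), e2, ← mul_assoc (g (gB s c H C)), hg.eq,
      (hr.commute_gG_gB s).eq, map_mul]
    simp only [mul_assoc]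
  rw [rMat, mul_assoc, key, ← mul_assoc, mul_add, ← e1, e3, ← add_mul, mul_assoc]

theorem rMat_commute {z w : Comp A} (zH : Commute z H) (zC : Commute z C) {r : Rt}
    (zY : z * Y = Y * z + r • Y) (zX : z * X = X * z - r • X) (zw : w = z) :
    Commute (rMat s c H C X Y f g) (f z + g w) := by
  subst zw
  have h1 : Commute (f w + g w) (rCartan s c H C f g) :=
    (inl_commute_rCartan s hfg hr zH zC).add_left (inr_commute_rCartan s hfg hr zH zC)
  have hu : w * (gBi s c H C * Y) = gBi s c H C * Y * w + r • (gBi s c H C * Y) := by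
    have : Commute w (gBi s c H C) := by
      rw [gBi]; exact (zH.add_right (zC.smul_right s)).qpow_right 1
    rw [← mul_assoc, this.eq, mul_assoc, zY, mul_add, mul_smul_comm, mul_assoc]
  have h2 : (f w + g w) * (f (gBi s c H C * Y) * g X) =
      (f (gBi s c H C * Y) * g X) * (f w + g w) := by
    have a1 : f w * (f (gBi s c H C * Y) * g X) = f (gBi s c H C * Y) * g X * f w +
        r • (f (gBi s c H C * Y) * g X) := by
      rw [← mul_assoc, ← map_mul, hu, map_add, map_smul, map_mul, add_mul, smul_mul_assoc,
        mul_assoc (f _) (f _), hfg, mul_assoc]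
    have a2 : g w * (f (gBi s c H C * Y) * g X) = f (gBi s c H C * Y) * g X * g w -
        r • (f (gBi s c H C * Y) * g X) := by
      rw [← mul_assoc, ← hfg, mul_assoc, ← map_mul, zX, map_sub, map_smul, map_mul, mul_sub,
        mul_smul_comm, map_mul g X w, ← mul_assoc]
    rw [add_mul, a1, a2, mul_add]
    abel
  exact (h1.mul_right (theta_intertwine c (a := f (gBi s c H C * Y) * g X) h2.symm).symm).symm

end Pair

namespace IsCartanForm

variable {s} {d : QTData (Comp A)} (hd : IsCartanForm c s H C X Y d)
include hd

theorem R_eq : d.R = rMat s c H C X Y (inl _ _) (inr _ _) := hd.R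

omit hd in
theorem comul_qpow {z : Comp A} (hz : d.comul z = inl _ _ z + inr _ _ z) (r : ℂ) :
    d.comul (qpow c r z) = inl _ _ (qpow c r z) * inr _ _ (qpow c r z) := by
  rw [qpow_map, hz, qpow_add (inl_inr_comm _ _), qpow_map, qpow_map]

theorem comul_gG : d.comul (gG s c H C) = inl _ _ (gG s c H C) * inr _ _ (gG s c H C) :=
  comul_qpow (by simp only [map_add, map_neg, map_smul, hd.comul_H, hd.comul_C, smul_add]; abel) 1

theorem comul_gB : d.comul (gB s c H C) = inl _ _ (gB s c H C) * inr _ _ (gB s c H C) :=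
  comul_qpow (by simp only [map_sub, map_neg, map_smul, hd.comul_H, hd.comul_C, smul_add]; abel) 1

theorem comul_gBi : d.comul (gBi s c H C) = inl _ _ (gBi s c H C) * inr _ _ (gBi s c H C) :=
  comul_qpow (by simp only [map_add, map_smul, hd.comul_H, hd.comul_C, smul_add]; abel) 1

end IsCartanForm

end CartanHopf

section Hexagon

theorem qcomm_left {R T : Type*} [CommRing R] [Ring T] [Algebra R T] {r : R} {u₁ u₂ k₂ x₃ : T}
    (c12 : Commute u₁ u₂) (c13 : Commute u₁ x₃) (c23 : Commute u₂ x₃)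
    (c23' : Commute k₂ x₃) (h : u₂ * k₂ = r • (k₂ * u₂)) :
    u₂ * x₃ * (u₁ * k₂ * x₃) = r • (u₁ * k₂ * x₃ * (u₂ * x₃)) := by
  calc u₂ * x₃ * (u₁ * k₂ * x₃) = u₂ * (x₃ * u₁) * k₂ * x₃ := by simp only [mul_assoc]
    _ = u₂ * u₁ * (x₃ * k₂) * x₃ := by rw [← c13.eq]; simp only [mul_assoc]
    _ = u₁ * (u₂ * k₂) * x₃ * x₃ := by rw [← c23'.eq, ← c12.eq]; simp only [mul_assoc]
    _ = r • (u₁ * k₂ * (u₂ * x₃) * x₃) := by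
      rw [h, mul_smul_comm, smul_mul_assoc, smul_mul_assoc]; simp only [mul_assoc]
    _ = _ := by
      simp only [mul_assoc]
      rw [show u₂ * (x₃ * x₃) = x₃ * (u₂ * x₃) by rw [← mul_assoc x₃, ← c23.eq, mul_assoc]]

theorem mul_swap_mid {T : Type*} [Ring T] {e₁ e₂ t t₁ t₂ : T} (h : t * e₂ = e₂ * t₁) :
    e₁ * e₂ * (t₁ * t₂) = e₁ * t * (e₂ * t₂) := by
  rw [mul_assoc e₁ t, ← mul_assoc t, h]
  simp only [mul_assoc]

theorem qcomm_right {R T : Type*} [CommRing R] [Ring T] [Algebra R T] {r : R} {u₁ x₂ g₂ x₃ : T}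
    (c12 : Commute u₁ x₂) (c12' : Commute u₁ g₂) (c13 : Commute u₁ x₃) (c23 : Commute x₂ x₃)
    (h : x₂ * g₂ = r • (g₂ * x₂)) :
    u₁ * x₂ * (u₁ * g₂ * x₃) = r • (u₁ * g₂ * x₃ * (u₁ * x₂)) := by
  calc u₁ * x₂ * (u₁ * g₂ * x₃) = u₁ * (x₂ * u₁) * g₂ * x₃ := by simp only [mul_assoc]
    _ = u₁ * u₁ * (x₂ * g₂) * x₃ := by rw [← c12.eq]; simp only [mul_assoc]
    _ = r • (u₁ * (u₁ * g₂) * (x₂ * x₃)) := by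
      rw [h, mul_smul_comm, smul_mul_assoc]; simp only [mul_assoc]
    _ = r • (u₁ * g₂ * (u₁ * x₃) * x₂) := by
      rw [c12'.eq, c23.eq, ← c12'.eq]
      simp only [mul_assoc]
      rw [← mul_assoc u₁ g₂, c12'.eq, mul_assoc]
    _ = _ := by rw [c13.eq]; simp only [mul_assoc]

variable {A B : Type*} [Ring A] [Algebra Rt A] [Ring B] [Algebra Rt B] {c : ℂ} {s : Rt}
  {H C X Y : Comp A} (hr : CartanRels c H C X Y) {f₁ f₂ f₃ : Comp A →ₐ[Rt] Comp B}
  (h12 : ∀ a b, f₁ a * f₂ b = f₂ b * f₁ a) (h13 : ∀ a b, f₁ a * f₃ b = f₃ b * f₁ a)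
  (h23 : ∀ a b, f₂ a * f₃ b = f₃ b * f₂ a)
include hr h12 h13 h23

theorem commute_qforms :
    Commute (qform (cst (1 / 2)) s (f₁ H) (f₁ C) (f₃ H) (f₃ C))
      (qform (cst (1 / 2)) s (f₂ H) (f₂ C) (f₃ H) (f₃ C)) ∧
    Commute (qform (cst (1 / 2)) s (f₁ H) (f₁ C) (f₃ H) (f₃ C))
      (qform (cst (1 / 2)) s (f₁ H) (f₁ C) (f₂ H) (f₂ C)) := by
  have cc : ∀ f : Comp A →ₐ[Rt] Comp B, Commute (f C) (f H) := fun f => (hr.map f).CH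
  constructor <;>
  refine commute_qform (.symm ?_) (.symm ?_) (.symm ?_) (.symm ?_) <;>
  refine commute_qform ?_ ?_ ?_ ?_ <;>
  first
  | exact Commute.refl _
  | exact cc _
  | exact (cc _).symm
  | exact h12 _ _
  | exact (h12 _ _).symm
  | exact h13 _ _
  | exact (h13 _ _).symm
  | exact h23 _ _

theorem rMat_hexagon_left :
    qpow c 1 (qform (cst (1 / 2)) s (f₁ H + f₂ H) (f₁ C + f₂ C) (f₃ H) (f₃ C)) *
      theta c ((f₁ (gBi s c H C * Y) * f₂ (gBi s c H C) + f₂ (gBi s c H C * Y)) * f₃ X) =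
    rMat s c H C X Y f₁ f₃ * rMat s c H C X Y f₂ f₃ := by
  have hE := inr_X_rCartan s h23 hr
  rw [qform_add_left, add_mul, qpow_add (commute_qforms hr h12 h13 h23).1,
    theta_add (qcomm_left (h12 _ _) (h13 _ _) (h23 _ _) (h23 _ _)
      (by rw [← map_mul, hr.u_hi s, map_smul, map_mul])), rMat, rMat, ← rCartan, ← rCartan]
  have key : theta c (f₁ (gBi s c H C * Y) * f₃ X) * rCartan s c H C f₂ f₃ =
      rCartan s c H C f₂ f₃ * theta c (f₁ (gBi s c H C * Y) * f₂ (gBi s c H C) * f₃ X) := by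
    refine theta_intertwine c ?_
    rw [mul_assoc, hE, ← mul_assoc,
      (commute_rCartan s h23 hr (h12 _ _) (h12 _ _) (h13 _ _) (h13 _ _)).eq]
    simp only [mul_assoc]
  exact mul_swap_mid key

theorem rMat_hexagon_right :
    qpow c 1 (qform (cst (1 / 2)) s (f₁ H) (f₁ C) (f₂ H + f₃ H) (f₂ C + f₃ C)) *
      theta c (f₁ (gBi s c H C * Y) * (f₂ X + f₂ (gG s c H C) * f₃ X)) =
    rMat s c H C X Y f₁ f₃ * rMat s c H C X Y f₁ f₂ := by
  have hE := inl_Y_rCartan s h12 hr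
  have hB : Commute (f₁ (gBi s c H C)) (rCartan s c H C f₁ f₂) := by
    rw [hr.gBi_eq]
    have := hr.commute_cartan 1 s
    exact inl_commute_rCartan s h12 hr this.1 this.2
  have e : f₁ (gBi s c H C * Y) * (f₂ X + f₂ (gG s c H C) * f₃ X) =
      f₁ (gBi s c H C * Y) * f₂ (gG s c H C) * f₃ X + f₁ (gBi s c H C * Y) * f₂ X := by
    rw [mul_add, mul_assoc, add_comm]
  rw [qform_add_right, e, add_comm (qform _ _ _ _ _ _), qpow_add (commute_qforms hr h12 h13 h23).2,
    theta_add (qcomm_right (h12 _ _) (h12 _ _) (h13 _ _) (h23 _ _)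
      (by rw [← map_mul, hr.Xg s, map_smul, map_mul])), rMat, rMat, ← rCartan, ← rCartan]
  have key : theta c (f₁ (gBi s c H C * Y) * f₃ X) * rCartan s c H C f₁ f₂ =
      rCartan s c H C f₁ f₂ * theta c (f₁ (gBi s c H C * Y) * f₂ (gG s c H C) * f₃ X) := by
    refine theta_intertwine c ?_
    have : Commute (f₃ X) (rCartan s c H C f₁ f₂) :=
      commute_rCartan s h12 hr (h13 _ _).symm (h13 _ _).symm (h23 _ _).symm (h23 _ _).symm
    calc f₁ (gBi s c H C * Y) * f₃ X * rCartan s c H C f₁ f₂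
        = f₁ (gBi s c H C) * (f₁ Y * rCartan s c H C f₁ f₂) * f₃ X := by
          rw [mul_assoc, this.eq, map_mul]; simp only [mul_assoc]
      _ = rCartan s c H C f₁ f₂ * (f₁ (gBi s c H C) * (f₂ (gG s c H C) * f₁ Y) * f₃ X) := by
          rw [hE, ← mul_assoc, hB.eq]; simp only [mul_assoc]
      _ = _ := by rw [← h12, map_mul]; simp only [mul_assoc]
  exact mul_swap_mid key

end Hexagon

theorem tsep_powerSeries : TSep Rt := by
  intro x hx
  ext n
  obtain ⟨y, rfl⟩ := hx (n + 1)
  rw [map_zero, smul_eq_mul]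
  exact PowerSeries.X_pow_dvd_iff.1 (Dvd.intro y rfl) n (Nat.lt_succ_self n)

section LegComp

variable {A : Type*} [Ring A] [Algebra Rt A]

theorem leg12_comp_inl : leg12Hom.comp (inl A A) = in1 := AlgHom.ext leg12_inl
theorem leg12_comp_inr : leg12Hom.comp (inr A A) = in2 := AlgHom.ext leg12_inr
theorem leg13_comp_inl : leg13Hom.comp (inl A A) = in1 := AlgHom.ext leg13_inl
theorem leg13_comp_inr : leg13Hom.comp (inr A A) = in3 := AlgHom.ext leg13_inr
theorem leg23_comp_inl : leg23Hom.comp (inl A A) = in2 := AlgHom.ext leg23_inl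
theorem leg23_comp_inr : leg23Hom.comp (inr A A) = in3 := AlgHom.ext leg23_inr

end LegComp

namespace IsCartanForm

variable {A : Type*} [Ring A] [Algebra Rt A] {c : ℂ} {s : Rt} {H C X Y : Comp A}
  {d : QTData (Comp A)} (hd : IsCartanForm c s H C X Y d) (hr : CartanRels c H C X Y)
include hd hr

omit hr in
theorem comul_u : d.comul (gBi s c H C * Y) =
    inl _ _ (gBi s c H C * Y) * inr _ _ (gBi s c H C) + inr _ _ (gBi s c H C * Y) := by
  rw [map_mul d.comul, hd.comul_gBi, hd.comul_Y, mul_add]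
  have h : inl (Comp A) (Comp A) (gBi s c H C) * inl _ _ (gB s c H C) = 1 := by
    rw [← map_mul, gBi_mul_gB, map_one]
  generalize hk : gBi s c H C = k at *
  generalize gB s c H C = b at *
  rw [map_mul, map_mul]
  congr 1
  · rw [mul_assoc, ← inl_inr_comm, mul_assoc]
  · rw [mul_assoc, ← mul_assoc (inr _ _ k), ← inl_inr_comm, mul_assoc, ← mul_assoc, h, one_mul]

theorem comul_R_left : d.comulId d.R = leg13 d.R * leg23 d.R := by
  rw [QTData.comulId_eq, leg13_eq, leg23_eq, hd.R_eq, rMat_map, rMat_map, rMat_map]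
  rw [leg13_comp_inl, leg13_comp_inr, leg23_comp_inl, leg23_comp_inr]
  have c3 : (d.comulIdHom.comp (inr (Comp A) (Comp A)) : Comp A →ₐ[Rt] _) = in3 :=
    AlgHom.ext d.comulIdHom_inr
  rw [rMat, c3, ← rMat_hexagon_left hr in12_comm in13_comm in23_comm]
  have cH : d.comulIdHom.comp (inl (Comp A) (Comp A)) H = in1 H + in2 H := by
    rw [AlgHom.comp_apply, QTData.comulIdHom_inl, hd.comul_H, map_add, leg12_inl, leg12_inr]
  have cC : d.comulIdHom.comp (inl (Comp A) (Comp A)) C = in1 C + in2 C := by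
    rw [AlgHom.comp_apply, QTData.comulIdHom_inl, hd.comul_C, map_add, leg12_inl, leg12_inr]
  have cu : d.comulIdHom.comp (inl (Comp A) (Comp A)) (gBi s c H C * Y) =
      in1 (gBi s c H C * Y) * in2 (gBi s c H C) + in2 (gBi s c H C * Y) := by
    rw [AlgHom.comp_apply, QTData.comulIdHom_inl, hd.comul_u, map_add, map_mul leg12Hom,
      leg12_inl, leg12_inr, leg12_inr]
  rw [rCartan, cH, cC, cu]

theorem comul_R_right : d.idComul d.R = leg13 d.R * leg12 d.R := by
  rw [QTData.idComul_eq, leg13_eq, leg12_eq, hd.R_eq, rMat_map, rMat_map, rMat_map]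
  rw [leg13_comp_inl, leg13_comp_inr, leg12_comp_inl, leg12_comp_inr]
  have c1 : (d.idComulHom.comp (inl (Comp A) (Comp A)) : Comp A →ₐ[Rt] _) = in1 :=
    AlgHom.ext d.idComulHom_inl
  rw [rMat, c1, ← rMat_hexagon_right hr in12_comm in13_comm in23_comm]
  have cH : d.idComulHom.comp (inr (Comp A) (Comp A)) H = in2 H + in3 H := by
    rw [AlgHom.comp_apply, QTData.idComulHom_inr, hd.comul_H, map_add, leg23_inl, leg23_inr]
  have cC : d.idComulHom.comp (inr (Comp A) (Comp A)) C = in2 C + in3 C := by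
    rw [AlgHom.comp_apply, QTData.idComulHom_inr, hd.comul_C, map_add, leg23_inl, leg23_inr]
  have cX : d.idComulHom.comp (inr (Comp A) (Comp A)) X = in2 X + in2 (gG s c H C) * in3 X := by
    rw [AlgHom.comp_apply, QTData.idComulHom_inr, hd.comul_X, map_add, map_mul leg23Hom,
      leg23_inl, leg23_inr, leg23_inl]
  rw [rCartan, cH, cC, cX]

theorem R_mul_comul (hS : TDense {H, C, X, Y}) (a : Comp A) :
    d.R * d.comul a = leg21 (d.comul a) * d.R := by
  refine QTData.R_comul_of_dense hS (fun z hz => ?_) a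
  rw [leg21_eq, hd.R_eq]
  have h := hr.commute_comb 1 0 0 1
  simp only [one_smul, zero_smul, add_zero, zero_add] at h
  rcases hz with rfl | rfl | rfl | rfl
  · rw [hd.comul_H, map_add, leg21_inl, leg21_inr, add_comm (inr _ _ _)]
    exact rMat_commute s inl_inr_comm hr (Commute.refl _) h (r := cst 2) hr.HY
      (by rw [hr.HX, sub_eq_add_neg, ← neg_smul, ← map_neg]) rfl
  · rw [hd.comul_C, map_add, leg21_inl, leg21_inr, add_comm (inr _ _ _)]
    exact rMat_commute s inl_inr_comm hr h.symm (Commute.refl _) (r := 0)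
      (by rw [hr.CY, zero_smul, add_zero]) (by rw [hr.CX, zero_smul, sub_zero]) rfl
  · rw [hd.comul_X, map_add, map_mul leg21Hom, leg21_inl, leg21_inr, leg21_inl]
    exact rMat_mul_X s inl_inr_comm hr
  · rw [hd.comul_Y, map_add, map_mul leg21Hom, leg21_inl, leg21_inr, leg21_inl]
    exact rMat_mul_Y s inl_inr_comm hr

omit hr in
theorem antipode_qpow (z : Comp A) : d.antipode (qpow c 1 z) = qpow c 1 (d.antipode z) := by
  refine ((qpow_isSum c 1 z).map d.antipode).unique Comp.sep ?_
  convert qpow_isSum c 1 (d.antipode z) using 2 with k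
  rw [map_smul]
  congr 1
  induction k with
  | zero => rw [pow_zero, pow_zero, hd.antipode_one]
  | succ n ih => rw [pow_succ', hd.antipode_mul, ih, pow_succ]

omit hr in
theorem antipode_gG : d.antipode (gG s c H C) = gGi s c H C := by
  rw [gG, hd.antipode_qpow, map_add, map_neg, map_smul, hd.antipode_H, hd.antipode_C, gGi, neg_neg,
    smul_neg, sub_eq_add_neg]

omit hr in
theorem antipode_gB : d.antipode (gB s c H C) = gBi s c H C := by
  rw [gB, hd.antipode_qpow, map_sub, map_neg, map_smul, hd.antipode_H, hd.antipode_C, gBi, neg_neg,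
    smul_neg, sub_neg_eq_add]

omit hd hr in
theorem counit_qpow (z : Comp A) (h : d.counit z = 0) : d.counit (qpow c 1 z) = 1 := by
  have h1 := (qpow_isSum c 1 z).map d.counit.toLinearMap
  refine h1.unique tsep_powerSeries ?_
  have e : (fun k => d.counit.toLinearMap
      ((cst ((1 * c) ^ k / (k.factorial : ℂ)) : Rt) • z ^ k)) =
      fun k => if k = 0 then 1 else 0 := by
    funext k
    rcases k with _ | k <;> simp [h]
  rw [e]
  exact IsSum.of_single 1

omit hr in
theorem antipode_left (hS : TDense {H, C, X, Y}) (a : Comp A) :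
    d.antipodeMul (d.comul a) = algebraMap Rt (Comp (Comp A)) (d.counit a) := by
  have key : ∀ {z g : Comp A}, d.comul z = inl _ _ z + inl _ _ g * inr _ _ z → d.counit z = 0 →
      d.antipode z = -(d.antipode g * z) →
      d.antipodeMul (d.comul z) = algebraMap Rt (Comp (Comp A)) (d.counit z) := by
    intro z g h1 h2 h3
    rw [h1, h2, map_add, ← of_tmul, inl_apply, QTData.antipodeMul_of, QTData.antipodeMul_of, h3,
      ← map_add]
    simp
  refine QTData.antipode_left_of_dense hS hd.antipode_mul hd.antipode_one (fun z hz => ?_) a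
  rcases hz with rfl | rfl | rfl | rfl
  · exact key (g := 1) (by simp [hd.comul_H]) hd.counit_H (by simp [hd.antipode_H, hd.antipode_one])
  · exact key (g := 1) (by simp [hd.comul_C]) hd.counit_C (by simp [hd.antipode_C, hd.antipode_one])
  · exact key hd.comul_X hd.counit_X (by rw [hd.antipode_X, hd.antipode_gG])
  · exact key hd.comul_Y hd.counit_Y (by rw [hd.antipode_Y, hd.antipode_gB])

omit hr in
theorem antipode_right (hS : TDense {H, C, X, Y}) (a : Comp A) :
    d.mulAntipode (d.comul a) = algebraMap Rt (Comp (Comp A)) (d.counit a) := by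
  have key : ∀ {z g g' : Comp A}, d.comul z = inl _ _ z + inl _ _ g * inr _ _ z → d.counit z = 0 →
      d.antipode z = -(g' * z) → g * g' = 1 →
      d.mulAntipode (d.comul z) = algebraMap Rt (Comp (Comp A)) (d.counit z) := by
    intro z g g' h1 h2 h3 h4
    rw [h1, h2, map_add, ← of_tmul, inl_apply, QTData.mulAntipode_of, QTData.mulAntipode_of, h3,
      hd.antipode_one, ← map_add, mul_neg, ← mul_assoc, h4]
    simp
  refine QTData.antipode_right_of_dense hS hd.antipode_mul hd.antipode_one (fun z hz => ?_) a
  rcases hz with rfl | rfl | rfl | rfl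
  · exact key (by simp [hd.comul_H]) hd.counit_H (by simp [hd.antipode_H]) (one_mul 1)
  · exact key (by simp [hd.comul_C]) hd.counit_C (by simp [hd.antipode_C]) (one_mul 1)
  · exact key hd.comul_X hd.counit_X hd.antipode_X (gG_mul_gGi s)
  · exact key hd.comul_Y hd.counit_Y hd.antipode_Y (gB_mul_gBi s)

omit hr in
theorem counit_gG : d.counit (gG s c H C) = 1 :=
  counit_qpow _ (by simp [hd.counit_H, hd.counit_C])
omit hr in
theorem counit_gB : d.counit (gB s c H C) = 1 :=
  counit_qpow _ (by simp [hd.counit_H, hd.counit_C])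

omit hr in
theorem counit_left (hS : TDense {H, C, X, Y}) (a : Comp A) :
    d.counitId (d.comul a) = of a := by
  refine QTData.counit_left_of_dense hS (fun z hz => ?_) a
  rw [QTData.counitId_eq]
  rcases hz with rfl | rfl | rfl | rfl
  · simp [hd.comul_H, hd.counit_H]
  · simp [hd.comul_C, hd.counit_C]
  · simp [hd.comul_X, hd.counit_X, hd.counit_gG]
  · simp [hd.comul_Y, hd.counit_Y, hd.counit_gB]

omit hr in
theorem counit_right (hS : TDense {H, C, X, Y}) (a : Comp A) :
    d.idCounit (d.comul a) = of a := by
  refine QTData.counit_right_of_dense hS (fun z hz => ?_) a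
  rw [QTData.idCounit_eq]
  rcases hz with rfl | rfl | rfl | rfl
  · simp [hd.comul_H, hd.counit_H]
  · simp [hd.comul_C, hd.counit_C]
  · simp [hd.comul_X, hd.counit_X]
  · simp [hd.comul_Y, hd.counit_Y]

theorem coassoc (hS : TDense {H, C, X, Y}) (a : Comp A) :
    d.comulId (d.comul a) = d.idComul (d.comul a) := by
  have key : ∀ {z g : Comp A}, d.comul z = inl _ _ z + inl _ _ g * inr _ _ z →
      d.comul g = inl _ _ g * inr _ _ g → d.comulId (d.comul z) = d.idComul (d.comul z) := by
    intro z g h1 h2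
    rw [QTData.comulId_eq, QTData.idComul_eq, h1, map_add, map_add d.idComulHom,
      map_mul d.comulIdHom, map_mul d.idComulHom, QTData.comulIdHom_inl, QTData.comulIdHom_inr,
      QTData.idComulHom_inl, QTData.idComulHom_inr, QTData.comulIdHom_inl, QTData.idComulHom_inl,
      h1, h2, map_add, map_add, map_mul leg12Hom, map_mul leg12Hom, map_mul leg23Hom, leg12_inl,
      leg12_inr, leg12_inl, leg12_inr, leg23_inl, leg23_inr, leg23_inl, mul_add, add_assoc,
      mul_assoc]
  refine QTData.coassoc_of_dense hS (fun z hz => ?_) a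
  rcases hz with rfl | rfl | rfl | rfl
  · exact key (g := 1) (by simp [hd.comul_H]) (by simp)
  · exact key (g := 1) (by simp [hd.comul_C]) (by simp)
  · exact key hd.comul_X (hd.comul_gG)
  · exact key hd.comul_Y (hd.comul_gB)

/-- Data given on generators by the `s`-th twist is a quasitriangular Hopf algebra. -/
theorem isQTHopf (hS : TDense {H, C, X, Y}) : d.IsQTHopf where
  complete := Comp.tComplete.isAdicComplete
  coassoc := hd.coassoc hr hS
  counit_left := hd.counit_left hS
  counit_right := hd.counit_right hS
  antipode_left := hd.antipode_left hS
  antipode_right := hd.antipode_right hS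
  R_unit := by
    rw [hd.R]
    exact (isUnit_qpow _ _).mul (isUnit_theta c _)
  R_comul := hd.R_mul_comul hr hS
  comul_R_left := hd.comul_R_left hr
  comul_R_right := hd.comul_R_right hr

end IsCartanForm

section Quotient

variable {A B : Type*} [Ring A] [Algebra Rt A] [Ring B] [Algebra Rt B] (p : A →ₐ[Rt] B)

/-- The map of completed tensor squares induced by an algebra map. -/
noncomputable def sqHom : Comp (A ⊗[Rt] A) →ₐ[Rt] Comp (B ⊗[Rt] B) :=
  Comp.mapHom (Algebra.TensorProduct.map p p)

/-- The map of completed tensor cubes induced by an algebra map. -/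
noncomputable def cubeHom :
    Comp ((A ⊗[Rt] A) ⊗[Rt] A) →ₐ[Rt] Comp ((B ⊗[Rt] B) ⊗[Rt] B) :=
  Comp.mapHom (Algebra.TensorProduct.map (Algebra.TensorProduct.map p p) p)

theorem sqHom_eq (x : Comp (A ⊗[Rt] A)) :
    Comp.map (TensorProduct.map p.toLinearMap p.toLinearMap) x = sqHom p x := rfl

theorem sqHom_inl (a : A) : sqHom p (inl A A a) = inl B B (p a) := by
  rw [inl_apply, inl_apply, sqHom, Comp.mapHom_of, Algebra.TensorProduct.map_tmul, map_one]
theorem sqHom_inr (a : A) : sqHom p (inr A A a) = inr B B (p a) := by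
  rw [inr_apply, inr_apply, sqHom, Comp.mapHom_of, Algebra.TensorProduct.map_tmul, map_one]
theorem sqHom_of_tmul (a b : A) : sqHom p (of (a ⊗ₜ b)) = of (p a ⊗ₜ p b) := by
  rw [sqHom, Comp.mapHom_of, Algebra.TensorProduct.map_tmul]
theorem cubeHom_in1 (a : A) : cubeHom p (in1 a) = in1 (p a) := by
  rw [in1_apply, in1_apply, cubeHom, Comp.mapHom_of, Algebra.TensorProduct.map_tmul,
    Algebra.TensorProduct.map_tmul, map_one]
theorem cubeHom_in2 (a : A) : cubeHom p (in2 a) = in2 (p a) := by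
  rw [in2_apply, in2_apply, cubeHom, Comp.mapHom_of, Algebra.TensorProduct.map_tmul,
    Algebra.TensorProduct.map_tmul, map_one]
theorem cubeHom_in3 (a : A) : cubeHom p (in3 a) = in3 (p a) := by
  rw [in3_apply, in3_apply, cubeHom, Comp.mapHom_of, Algebra.TensorProduct.map_tmul, map_one]

theorem leg12_sqHom (x : Comp (A ⊗[Rt] A)) : leg12Hom (sqHom p x) = cubeHom p (leg12Hom x) :=
  DFunLike.congr_fun (tensor_algHom_ext Comp.sep (f := leg12Hom.comp (sqHom p))
    (g := (cubeHom p).comp leg12Hom)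
    (fun a => by
      rw [AlgHom.comp_apply, AlgHom.comp_apply, sqHom_inl, leg12_inl, leg12_inl, cubeHom_in1])
    (fun a => by
      rw [AlgHom.comp_apply, AlgHom.comp_apply, sqHom_inr, leg12_inr, leg12_inr, cubeHom_in2])) x

theorem leg13_sqHom (x : Comp (A ⊗[Rt] A)) : leg13Hom (sqHom p x) = cubeHom p (leg13Hom x) :=
  DFunLike.congr_fun (tensor_algHom_ext Comp.sep (f := leg13Hom.comp (sqHom p))
    (g := (cubeHom p).comp leg13Hom)
    (fun a => by
      rw [AlgHom.comp_apply, AlgHom.comp_apply, sqHom_inl, leg13_inl, leg13_inl, cubeHom_in1])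
    (fun a => by
      rw [AlgHom.comp_apply, AlgHom.comp_apply, sqHom_inr, leg13_inr, leg13_inr, cubeHom_in3])) x

theorem leg23_sqHom (x : Comp (A ⊗[Rt] A)) : leg23Hom (sqHom p x) = cubeHom p (leg23Hom x) :=
  DFunLike.congr_fun (tensor_algHom_ext Comp.sep (f := leg23Hom.comp (sqHom p))
    (g := (cubeHom p).comp leg23Hom)
    (fun a => by
      rw [AlgHom.comp_apply, AlgHom.comp_apply, sqHom_inl, leg23_inl, leg23_inl, cubeHom_in2])
    (fun a => by
      rw [AlgHom.comp_apply, AlgHom.comp_apply, sqHom_inr, leg23_inr, leg23_inr, cubeHom_in3])) x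

theorem leg21_sqHom (x : Comp (A ⊗[Rt] A)) : leg21Hom (sqHom p x) = sqHom p (leg21Hom x) :=
  DFunLike.congr_fun (tensor_algHom_ext Comp.sep (f := leg21Hom.comp (sqHom p))
    (g := (sqHom p).comp leg21Hom)
    (fun a => by
      rw [AlgHom.comp_apply, AlgHom.comp_apply, sqHom_inl, leg21_inl, leg21_inl, sqHom_inr])
    (fun a => by
      rw [AlgHom.comp_apply, AlgHom.comp_apply, sqHom_inr, leg21_inr, leg21_inr, sqHom_inl])) x

namespace QTData

variable {p} {d : QTData A} {e : QTData B}

section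
variable (hc : ∀ a, e.comul (p a) = sqHom p (d.comul a))
include hc

theorem comulIdHom_sqHom (x : Comp (A ⊗[Rt] A)) :
    e.comulIdHom (sqHom p x) = cubeHom p (d.comulIdHom x) :=
  DFunLike.congr_fun (tensor_algHom_ext Comp.sep (f := e.comulIdHom.comp (sqHom p))
    (g := (cubeHom p).comp d.comulIdHom)
    (fun a => by
      rw [AlgHom.comp_apply, AlgHom.comp_apply, sqHom_inl, comulIdHom_inl, comulIdHom_inl, hc,
        leg12_sqHom])
    (fun a => by
      rw [AlgHom.comp_apply, AlgHom.comp_apply, sqHom_inr, comulIdHom_inr, comulIdHom_inr,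
        cubeHom_in3])) x

theorem idComulHom_sqHom (x : Comp (A ⊗[Rt] A)) :
    e.idComulHom (sqHom p x) = cubeHom p (d.idComulHom x) :=
  DFunLike.congr_fun (tensor_algHom_ext Comp.sep (f := e.idComulHom.comp (sqHom p))
    (g := (cubeHom p).comp d.idComulHom)
    (fun a => by
      rw [AlgHom.comp_apply, AlgHom.comp_apply, sqHom_inl, idComulHom_inl, idComulHom_inl,
        cubeHom_in1])
    (fun a => by
      rw [AlgHom.comp_apply, AlgHom.comp_apply, sqHom_inr, idComulHom_inr, idComulHom_inr, hc,
        leg23_sqHom])) x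

end

section
variable (hc : ∀ a, e.counit (p a) = d.counit a)
include hc

theorem counitIdHom_sqHom (x : Comp (A ⊗[Rt] A)) :
    e.counitIdHom (sqHom p x) = Comp.mapHom p (d.counitIdHom x) :=
  DFunLike.congr_fun (tensor_algHom_ext Comp.sep (f := e.counitIdHom.comp (sqHom p))
    (g := (Comp.mapHom p).comp d.counitIdHom)
    (fun a => by
      rw [AlgHom.comp_apply, AlgHom.comp_apply, sqHom_inl, counitIdHom_inl, counitIdHom_inl, hc,
        AlgHom.commutes])
    (fun a => by
      rw [AlgHom.comp_apply, AlgHom.comp_apply, sqHom_inr, counitIdHom_inr, counitIdHom_inr,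
        Comp.mapHom_of])) x

theorem idCounitHom_sqHom (x : Comp (A ⊗[Rt] A)) :
    e.idCounitHom (sqHom p x) = Comp.mapHom p (d.idCounitHom x) :=
  DFunLike.congr_fun (tensor_algHom_ext Comp.sep (f := e.idCounitHom.comp (sqHom p))
    (g := (Comp.mapHom p).comp d.idCounitHom)
    (fun a => by
      rw [AlgHom.comp_apply, AlgHom.comp_apply, sqHom_inl, idCounitHom_inl, idCounitHom_inl,
        Comp.mapHom_of])
    (fun a => by
      rw [AlgHom.comp_apply, AlgHom.comp_apply, sqHom_inr, idCounitHom_inr, idCounitHom_inr, hc,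
        AlgHom.commutes])) x

end

section
variable (hc : ∀ a, e.antipode (p a) = p (d.antipode a))
include hc

theorem antipodeMul_sqHom (x : Comp (A ⊗[Rt] A)) :
    e.antipodeMul (sqHom p x) = Comp.mapHom p (d.antipodeMul x) :=
  LinearMap.congr_fun (tensor_linear_ext Comp.sep (f := e.antipodeMul ∘ₗ (sqHom p).toLinearMap)
    (g := (Comp.mapHom p).toLinearMap ∘ₗ d.antipodeMul)
    (fun a b => by
      rw [LinearMap.comp_apply, LinearMap.comp_apply, AlgHom.toLinearMap_apply,
        AlgHom.toLinearMap_apply, sqHom_of_tmul, antipodeMul_of, antipodeMul_of, hc,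
        Comp.mapHom_of, map_mul p])) x

theorem mulAntipode_sqHom (x : Comp (A ⊗[Rt] A)) :
    e.mulAntipode (sqHom p x) = Comp.mapHom p (d.mulAntipode x) :=
  LinearMap.congr_fun (tensor_linear_ext Comp.sep (f := e.mulAntipode ∘ₗ (sqHom p).toLinearMap)
    (g := (Comp.mapHom p).toLinearMap ∘ₗ d.mulAntipode)
    (fun a b => by
      rw [LinearMap.comp_apply, LinearMap.comp_apply, AlgHom.toLinearMap_apply,
        AlgHom.toLinearMap_apply, sqHom_of_tmul, mulAntipode_of, mulAntipode_of, hc,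
        Comp.mapHom_of, map_mul p])) x

end

/-- A quotient of a quasitriangular Hopf algebra is a quasitriangular Hopf algebra. -/
theorem IsQTHopf.of_surjective (hd : d.IsQTHopf) (hp : Function.Surjective p)
    (hB : IsAdicComplete (Ideal.span {tt}) B)
    (h1 : ∀ a, e.comul (p a) = sqHom p (d.comul a)) (h2 : ∀ a, e.counit (p a) = d.counit a)
    (h3 : ∀ a, e.antipode (p a) = p (d.antipode a)) (h4 : e.R = sqHom p d.R) : e.IsQTHopf where
  complete := hB
  coassoc b := by
    obtain ⟨a, rfl⟩ := hp b
    have := hd.coassoc a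
    rw [comulId_eq, idComul_eq] at this ⊢
    rw [h1, comulIdHom_sqHom h1, idComulHom_sqHom h1, this]
  counit_left b := by
    obtain ⟨a, rfl⟩ := hp b
    have := hd.counit_left a
    rw [counitId_eq] at this ⊢
    rw [h1, counitIdHom_sqHom h2, this, Comp.mapHom_of]
  counit_right b := by
    obtain ⟨a, rfl⟩ := hp b
    have := hd.counit_right a
    rw [idCounit_eq] at this ⊢
    rw [h1, idCounitHom_sqHom h2, this, Comp.mapHom_of]
  antipode_left b := by
    obtain ⟨a, rfl⟩ := hp b
    rw [h1, antipodeMul_sqHom h3, hd.antipode_left, h2, AlgHom.commutes]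
  antipode_right b := by
    obtain ⟨a, rfl⟩ := hp b
    rw [h1, mulAntipode_sqHom h3, hd.antipode_right, h2, AlgHom.commutes]
  R_unit := by rw [h4]; exact hd.R_unit.map _
  R_comul b := by
    obtain ⟨a, rfl⟩ := hp b
    have := hd.R_comul a
    rw [leg21_eq] at this ⊢
    rw [h1, h4, ← map_mul, this, map_mul, leg21_sqHom]
  comul_R_left := by
    have := hd.comul_R_left
    rw [comulId_eq, leg13_eq, leg23_eq] at this ⊢
    rw [h4, comulIdHom_sqHom h1, this, map_mul, leg13_sqHom, leg23_sqHom]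
  comul_R_right := by
    have := hd.comul_R_right
    rw [idComul_eq, leg13_eq, leg12_eq] at this ⊢
    rw [h4, idComulHom_sqHom h1, this, map_mul, leg13_sqHom, leg12_sqHom]

end QTData

end Quotient

section SlRels

variable {A B : Type*} [Ring A] [Algebra Rt A] [Ring B] [Algebra Rt B] {c : ℂ}

/-- The relations of the generators `H, C, X₊, X₋` of `U_q(sl₂) ⊗ U_{q⁻¹}(ℂ)`. -/
structure SlRels (c : ℂ) (H C E F : Comp A) : Prop where
  CH : C * H = H * C
  CE : C * E = E * C
  CF : C * F = F * C
  HE : H * E = E * H + (cst 2 : Rt) • E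
  HF : H * F = F * H + (cst (-2) : Rt) • F
  EF : (qs c 1 - qs c (-1)) • (E * F - F * E) = qpow c 1 H - qpow c (-1) H

theorem qpow_mul_weight {H Z : Comp A} {w : ℂ} (h : H * Z = Z * H + (cst w : Rt) • Z)
    (s : ℂ) : qpow c s H * Z = qs c (s * w) • (Z * qpow c s H) := by
  rw [qpow_eq]
  exact qpow_weight (by rw [smul_mul_assoc, h, smul_add, mul_smul_comm, smul_smul, map_mul])

theorem mul_qpow_weight {H Z : Comp A} {w : ℂ} (h : H * Z = Z * H + (cst w : Rt) • Z)
    (s : ℂ) : Z * qpow c s H = qs c (-(s * w)) • (qpow c s H * Z) := by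
  rw [qpow_mul_weight h, smul_smul, qs_neg_mul, one_smul]

theorem qpow_mul_qpow (H : Comp A) (s r : ℂ) : qpow c s H * qpow c r H = qpow c (s + r) H := by
  rw [qpow_eq s, qpow_eq r, qpow_eq (s + r), map_add, add_smul, qpow_add]
  exact ((Commute.refl H).smul_left _).smul_right _

theorem qpow_zero' (H : Comp A) : qpow c 0 H = 1 := by
  rw [qpow_eq, map_zero, zero_smul, qpow_zero]

theorem smul_qs_sub : (1 - qs c (-2)) * qs c 1 = qs c 1 - qs c (-1) := by
  rw [sub_mul, one_mul, ← qs_add]; norm_num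

theorem SlRels.cartanRels {H C E F : Comp A} (h : SlRels c H C E F) :
    CartanRels c H C (qpow c (-1 / 2) H * F) (qpow c (-1 / 2) H * E) where
  CH := h.CH
  CX := by
    rw [← mul_assoc, (Commute.qpow_right (show Commute C H from h.CH) _).eq, mul_assoc, h.CF,
      mul_assoc]
  CY := by
    rw [← mul_assoc, (Commute.qpow_right (show Commute C H from h.CH) _).eq, mul_assoc, h.CE,
      mul_assoc]
  HX := by
    rw [← mul_assoc, (Commute.qpow_right (Commute.refl H) _).eq, mul_assoc, h.HF, mul_add,
      mul_smul_comm, mul_assoc]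
  HY := by
    rw [← mul_assoc, (Commute.qpow_right (Commute.refl H) _).eq, mul_assoc, h.HE, mul_add,
      mul_smul_comm, mul_assoc]
  XY := by
    have e1 : qpow c (-1 / 2) H * F * (qpow c (-1 / 2) H * E) =
        qs c (-1) • (qpow c (-1) H * (F * E)) := by
      rw [mul_assoc, ← mul_assoc F, mul_qpow_weight h.HF, smul_mul_assoc, mul_smul_comm,
        mul_assoc, ← mul_assoc, qpow_mul_qpow]
      norm_num
    have e2 : qpow c (-1 / 2) H * E * (qpow c (-1 / 2) H * F) =
        qs c 1 • (qpow c (-1) H * (E * F)) := by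
      rw [mul_assoc, ← mul_assoc E, mul_qpow_weight h.HE, smul_mul_assoc, mul_smul_comm,
        mul_assoc, ← mul_assoc, qpow_mul_qpow]
      norm_num
    have e3 : qs c 2 * qs c (-1) = qs c 1 := by rw [← qs_add]; norm_num
    rw [e1, e2, smul_smul, e3, ← smul_sub, smul_smul, smul_qs_sub, ← mul_sub, ← mul_smul_comm,
      ← neg_sub (E * F), smul_neg, h.EF, neg_sub, mul_sub, qpow_mul_qpow, qpow_mul_qpow,
      ← qpow_eq]
    norm_num [qpow_zero']

theorem CartanRels.slRels {H C X Y : Comp A} (h : CartanRels c H C X Y) :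
    SlRels c H C (qpow c (1 / 2) H * Y) (qpow c (1 / 2) H * X) where
  CH := h.CH
  CE := by
    rw [← mul_assoc, (Commute.qpow_right (show Commute C H from h.CH) _).eq, mul_assoc, h.CY,
      mul_assoc]
  CF := by
    rw [← mul_assoc, (Commute.qpow_right (show Commute C H from h.CH) _).eq, mul_assoc, h.CX,
      mul_assoc]
  HE := by
    rw [← mul_assoc, (Commute.qpow_right (Commute.refl H) _).eq, mul_assoc, h.HY, mul_add,
      mul_smul_comm, mul_assoc]
  HF := by
    rw [← mul_assoc, (Commute.qpow_right (Commute.refl H) _).eq, mul_assoc, h.HX, mul_add,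
      mul_smul_comm, mul_assoc]
  EF := by
    have e1 : qpow c (1 / 2) H * Y * (qpow c (1 / 2) H * X) =
        qs c (-1) • (qpow c 1 H * (Y * X)) := by
      rw [mul_assoc, ← mul_assoc Y, mul_qpow_weight h.HY, smul_mul_assoc, mul_smul_comm,
        mul_assoc, ← mul_assoc, qpow_mul_qpow]
      norm_num
    have e2 : qpow c (1 / 2) H * X * (qpow c (1 / 2) H * Y) =
        qs c 1 • (qpow c 1 H * (X * Y)) := by
      rw [mul_assoc, ← mul_assoc X, mul_qpow_weight h.HX, smul_mul_assoc, mul_smul_comm,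
        mul_assoc, ← mul_assoc, qpow_mul_qpow]
      norm_num
    have e3 : qs c 1 = qs c (-1) * qs c 2 := by rw [← qs_add]; norm_num
    have e4 : (qs c 1 - qs c (-1)) * qs c (-1) = 1 - qs c (-2) := by
      rw [sub_mul, ← qs_add, ← qs_add]; norm_num [qs_zero]
    rw [e1, e2]
    nth_rw 2 [e3]
    rw [mul_smul, ← smul_sub, smul_smul, e4, ← mul_smul_comm (qs c 2), ← mul_sub, ← mul_smul_comm,
      ← neg_sub (qs c 2 • _), smul_neg, h.XY, neg_sub, mul_sub, ← qpow_eq, qpow_mul_qpow, mul_one]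
    norm_num

end SlRels

section UslLift

variable {A B : Type*} [Ring A] [Algebra Rt A] [Ring B] [Algebra Rt B] {c : ℂ}

theorem isUnit_qd (hc : c ≠ 0) {a : ℂ} (ha : a ≠ 0) : IsUnit (qd c a) :=
  isUnit_of_constCoeff (by rw [constCoeff_qd]; exact mul_ne_zero ha hc)

theorem qs_sub_qs (hc : c ≠ 0) : ∃ u : Rt, IsUnit u ∧ qs c 1 - qs c (-1) = tt * u := by
  refine ⟨qd c 1 - qd c (-1), isUnit_of_constCoeff ?_, ?_⟩
  · rw [map_sub, constCoeff_qd, constCoeff_qd]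
    intro h
    apply hc
    linear_combination h / 2
  · rw [mul_sub, tt_mul_qd, tt_mul_qd]; ring

theorem qs_sub_qs_cancel (hc : c ≠ 0) [Module.IsTorsionFree Rt A] {x y : A}
    (h : (qs c 1 - qs c (-1)) • x = (qs c 1 - qs c (-1)) • y) : x = y := by
  obtain ⟨u, hu, e⟩ := qs_sub_qs hc
  rw [e, mul_comm, mul_smul, mul_smul] at h
  have h' := hu.smul_left_cancel.1 h
  rw [← pow_one tt] at h'
  exact smul_tt_cancel h'

theorem exists_qint_qpow (hc : c ≠ 0) (x : Comp A) :
    ∃ y, (qs c 1 - qs c (-1)) • y = qpow c 1 x - qpow c (-1) x := by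
  obtain ⟨u, hu, e⟩ := qs_sub_qs hc
  obtain ⟨v, rfl⟩ := hu
  obtain ⟨y1, h1⟩ := qpow_mod (c := c) 1 x
  obtain ⟨y2, h2⟩ := qpow_mod (c := c) (-1) x
  refine ⟨(↑v⁻¹ : Rt) • (y1 - y2), ?_⟩
  rw [e, h1, h2, smul_smul, mul_assoc, Units.mul_inv, mul_one, smul_sub]
  abel

theorem SFree.dense : TDense (Set.range SFree.gen) := by
  have := (TDense.of_eq_top (FreeAlgebra.adjoin_range_ι Rt SGen)).comp
  rwa [← Set.range_comp] at this

theorem Usl.dense : TDense (Set.range (Usl.gen c)) := by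
  have := (SFree.dense.image (RingQuot.mkAlgHom Rt (SRel c))
    (RingQuot.mkAlgHom_surjective Rt (SRel c))).comp
  rwa [← Set.range_comp, ← Set.range_comp] at this

theorem Line.dense : TDense {Line.C} := by
  have := (TDense.of_eq_top (Polynomial.adjoin_X (R := Rt))).comp
  rwa [Set.image_singleton] at this

/-- The map of the completed free algebra given by images of the generators. -/
noncomputable def SFree.lift (H E F : Comp B) : SFree →ₐ[Rt] Comp B :=
  Comp.liftHom (FreeAlgebra.lift Rt fun y => match y with
    | SGen.H => H
    | SGen.E => E
    | SGen.F => F)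

theorem SFree.lift_gen (H E F : Comp B) (y : SGen) : SFree.lift H E F (SFree.gen y) = match y with
    | SGen.H => H
    | SGen.E => E
    | SGen.F => F := by
  rw [SFree.lift, SFree.gen, Comp.liftHom_of, FreeAlgebra.lift_ι_apply]

/-- The map of `U_q(sl₂)` given by images of the generators. -/
noncomputable def Usl.lift (hc : c ≠ 0) [Module.IsTorsionFree Rt B] {H C E F : Comp B}
    (h : SlRels c H C E F) : Usl c →ₐ[Rt] Comp B :=
  Comp.liftHom (RingQuot.liftAlgHom Rt ⟨SFree.lift H E F, by
    intro a b hab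
    cases hab with
    | HE =>
      rw [map_sub, map_mul, map_mul, map_mul, map_ofNat, SFree.lift_gen, SFree.lift_gen]
      dsimp only
      rw [h.HE, map_ofNat, ofNat_smul_eq_nsmul]
      simp [two_mul, two_smul]
    | HF =>
      rw [map_sub, map_mul, map_mul, map_neg, map_mul, map_ofNat, SFree.lift_gen, SFree.lift_gen]
      dsimp only
      rw [h.HF, map_neg, neg_smul, map_ofNat, ofNat_smul_eq_nsmul]
      simp [two_mul, two_smul]
    | EF _ hy =>
      refine qs_sub_qs_cancel hc ?_
      rw [← map_smul (SFree.lift H E F) _ b, hy, map_sub, map_sub, map_mul, map_mul, qpow_map, qpow_map,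
        SFree.lift_gen, SFree.lift_gen, SFree.lift_gen]
      exact h.EF⟩)

theorem Usl.lift_gen (hc : c ≠ 0) [Module.IsTorsionFree Rt B] {H C E F : Comp B}
    (h : SlRels c H C E F) (y : SGen) : Usl.lift hc h (Usl.gen c y) = match y with
    | SGen.H => H
    | SGen.E => E
    | SGen.F => F := by
  rw [Usl.lift, Usl.gen, Comp.liftHom_of, RingQuot.liftAlgHom_mkAlgHom_apply, SFree.lift_gen]

/-- The map of the quantum line given by the image of the generator. -/
noncomputable def Line.lift (C : Comp B) : Line →ₐ[Rt] Comp B := Comp.liftHom (Polynomial.aeval C)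

theorem Line.lift_C (C : Comp B) : Line.lift C Line.C = C := by
  rw [Line.lift, Line.C, Comp.liftHom_of, Polynomial.aeval_X]

theorem UL.commute_lift (hc : c ≠ 0) [Module.IsTorsionFree Rt B] {H C E F : Comp B}
    (h : SlRels c H C E F) (a : Usl c) (b : Line) : Commute (Usl.lift hc h a) (Line.lift C b) := by
  refine (Line.dense.commute Comp.sep (Line.lift C) (fun p hp => ?_) b :)
  obtain rfl := hp
  refine (Usl.dense.commute Comp.sep (Usl.lift hc h) (fun p hp => ?_) a :).symm
  obtain ⟨y, rfl⟩ := hp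
  rw [Line.lift_C, Usl.lift_gen]
  cases y
  exacts [h.CH, h.CE, h.CF]

/-- The map of `U_q(sl₂) ⊗ U_{q⁻¹}(ℂ)` given by images of the generators. -/
noncomputable def UL.lift (hc : c ≠ 0) [Module.IsTorsionFree Rt B] {H C E F : Comp B}
    (h : SlRels c H C E F) : UL c →ₐ[Rt] Comp B :=
  tensorLift (Usl.lift hc h) (Line.lift C) (UL.commute_lift hc h)

section
variable (hc : c ≠ 0) [Module.IsTorsionFree Rt B] {H C E F : Comp B} (h : SlRels c H C E F)

theorem UL.lift_H : UL.lift hc h (UL.H c) = H :=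
  (tensorLift_inl ..).trans (Usl.lift_gen hc h SGen.H)
theorem UL.lift_E : UL.lift hc h (UL.E c) = E :=
  (tensorLift_inl ..).trans (Usl.lift_gen hc h SGen.E)
theorem UL.lift_F : UL.lift hc h (UL.F c) = F :=
  (tensorLift_inl ..).trans (Usl.lift_gen hc h SGen.F)
theorem UL.lift_C : UL.lift hc h (UL.C c) = C := (tensorLift_inr ..).trans (Line.lift_C C)

end

theorem Usl.rel {a b : SFree} (h : SRel c a b) :
    (of (RingQuot.mkAlgHom Rt (SRel c) a) : Usl c) = of (RingQuot.mkAlgHom Rt (SRel c) b) :=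
  congrArg of (RingQuot.mkAlgHom_rel Rt h)

/-- The map of the completed free algebra to `U_q(sl₂)`. -/
noncomputable def Usl.ofFree (c : ℂ) : SFree →ₐ[Rt] Usl c := of.comp (RingQuot.mkAlgHom Rt (SRel c))

theorem Usl.slRels (hc : c ≠ 0) : SlRels c (Usl.H c) 0 (Usl.E c) (Usl.F c) where
  CH := by simp
  CE := by simp
  CF := by simp
  HE := by
    have h : Usl.ofFree c _ = Usl.ofFree c _ := Usl.rel SRel.HE
    rw [map_sub, map_mul, map_mul, map_mul, map_ofNat, sub_eq_iff_eq_add', ← map_ofNat (algebraMap Rt (Usl c)), ← Algebra.smul_def] at h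
    rw [map_ofNat]
    exact h
  HF := by
    have h : Usl.ofFree c _ = Usl.ofFree c _ := Usl.rel SRel.HF
    rw [map_sub, map_mul, map_mul, map_neg, map_mul, map_ofNat, sub_eq_iff_eq_add', ← map_ofNat (algebraMap Rt (Usl c)), ← Algebra.smul_def,
      ← neg_smul] at h
    rw [map_neg, map_ofNat]
    exact h
  EF := by
    obtain ⟨y, hy⟩ := exists_qint_qpow hc (SFree.gen SGen.H)
    have h : Usl.ofFree c _ = Usl.ofFree c _ := Usl.rel (SRel.EF y hy)
    rw [map_sub, map_mul, map_mul] at h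
    have h2 := congrArg (Usl.ofFree c) hy
    rw [map_smul, ← h, map_sub, qpow_map, qpow_map] at h2
    exact h2

namespace UL

/-- `X = q ^ (-H/2) X₋` -/
noncomputable def X (c : ℂ) : UL c := qpow c (-1 / 2) (UL.H c) * UL.F c
/-- `X̄ = q ^ (-H/2) X₊` -/
noncomputable def Y (c : ℂ) : UL c := qpow c (-1 / 2) (UL.H c) * UL.E c

theorem slRels (hc : c ≠ 0) : SlRels c (UL.H c) (UL.C c) (UL.E c) (UL.F c) where
  CH := (inl_inr_comm _ _).symm
  CE := (inl_inr_comm _ _).symm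
  CF := (inl_inr_comm _ _).symm
  HE := by
    rw [H, E, ← map_mul, (Usl.slRels hc).HE, map_add, map_mul, map_smul]
  HF := by
    rw [H, F, ← map_mul, (Usl.slRels hc).HF, map_add, map_mul, map_smul]
  EF := by
    rw [E, F, ← map_mul, ← map_mul, ← map_sub, ← map_smul, (Usl.slRels hc).EF, map_sub, qpow_map,
      qpow_map, H]

theorem cartanRels (hc : c ≠ 0) : CartanRels c (UL.H c) (UL.C c) (X c) (Y c) :=
  (slRels hc).cartanRels

theorem qpow_mul_X : qpow c (1 / 2) (UL.H c) * X c = UL.F c := by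
  rw [X, ← mul_assoc, qpow_mul_qpow]; norm_num [qpow_zero']
theorem qpow_mul_Y : qpow c (1 / 2) (UL.H c) * Y c = UL.E c := by
  rw [Y, ← mul_assoc, qpow_mul_qpow]; norm_num [qpow_zero']

theorem dense : TDense {UL.H c, UL.C c, X c, Y c} := by
  refine ((Usl.dense (c := c)).tensor Line.dense).comp.of_forall ?_
  rintro _ ⟨_, ⟨_, ⟨y, rfl⟩, rfl⟩ | ⟨_, rfl, rfl⟩, rfl⟩
  · cases y
    · exact ⟨UL.H c, Algebra.subset_adjoin (by simp), 0, by rw [smul_zero, add_zero]; rfl⟩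
    · obtain ⟨z, hz⟩ := qpow_mod (c := c) (1 / 2) (UL.H c)
      refine ⟨Y c, Algebra.subset_adjoin (by simp), z * Y c, ?_⟩
      change UL.E c = _
      rw [← qpow_mul_Y, hz, add_mul, one_mul, smul_mul_assoc]
    · obtain ⟨z, hz⟩ := qpow_mod (c := c) (1 / 2) (UL.H c)
      refine ⟨X c, Algebra.subset_adjoin (by simp), z * X c, ?_⟩
      change UL.F c = _
      rw [← qpow_mul_X, hz, add_mul, one_mul, smul_mul_assoc]
  · exact ⟨UL.C c, Algebra.subset_adjoin (by simp), 0, by rw [smul_zero, add_zero]; rfl⟩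

end UL

/-- The map of `U_q(sl₂) ⊗ U_{q⁻¹}(ℂ)` given by images of `H, C, X, X̄`. -/
noncomputable def UL.cartanLift (hc : c ≠ 0) [Module.IsTorsionFree Rt B] {H C X Y : Comp B}
    (h : CartanRels c H C X Y) : UL c →ₐ[Rt] Comp B := UL.lift hc h.slRels

section
variable (hc : c ≠ 0) [Module.IsTorsionFree Rt B] {H C X Y : Comp B} (h : CartanRels c H C X Y)

theorem UL.cartanLift_H : UL.cartanLift hc h (UL.H c) = H := UL.lift_H ..
theorem UL.cartanLift_C : UL.cartanLift hc h (UL.C c) = C := UL.lift_C ..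
theorem UL.cartanLift_X : UL.cartanLift hc h (UL.X c) = X := by
  rw [UL.X, map_mul, qpow_map, UL.cartanLift, UL.lift_H, UL.lift_F, ← mul_assoc, qpow_mul_qpow]
  norm_num [qpow_zero']
theorem UL.cartanLift_Y : UL.cartanLift hc h (UL.Y c) = Y := by
  rw [UL.Y, map_mul, qpow_map, UL.cartanLift, UL.lift_H, UL.lift_E, ← mul_assoc, qpow_mul_qpow]
  norm_num [qpow_zero']

end

end UslLift

section Span

variable {R Q : Type*} [CommRing R] [Ring Q] [Algebra R Q] {x y G B : Q} {r : R}
  (GB : G * B = B * G) (Gy : G * y = y * (G - 2)) (By : B * y = y * (B - 2))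
  (xG : x * G = (G - 2) * x) (xB : x * B = (B - 2) * x) (xy : x * y = y * x + r • (G + B))

theorem exists_mul_pow_right {K : Subalgebra R Q} {y : Q} (hy : ∀ p ∈ K, ∃ p' ∈ K, p * y = y * p')
    (a : ℕ) : ∀ p ∈ K, ∃ p' ∈ K, p * y ^ a = y ^ a * p' := by
  induction a with
  | zero => intro p hp; exact ⟨p, hp, by simp⟩
  | succ n ih =>
    intro p hp
    obtain ⟨p1, h1, e1⟩ := ih p hp
    obtain ⟨p2, h2, e2⟩ := hy p1 h1
    exact ⟨p2, h2, by rw [pow_succ, ← mul_assoc, e1, mul_assoc, e2, mul_assoc]⟩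

theorem exists_mul_right_of_adjoin {S : Set Q} {y : Q}
    (hS : ∀ s ∈ S, ∃ p' ∈ Algebra.adjoin R S, s * y = y * p') :
    ∀ p ∈ Algebra.adjoin R S, ∃ p' ∈ Algebra.adjoin R S, p * y = y * p' := by
  intro p hp
  induction hp using Algebra.adjoin_induction with
  | mem s hs => exact hS s hs
  | algebraMap s => exact ⟨algebraMap R Q s, Subalgebra.algebraMap_mem _ _, Algebra.commutes _ _⟩
  | add a b _ _ ha hb =>
    obtain ⟨a', ha', ea⟩ := ha
    obtain ⟨b', hb', eb⟩ := hb
    exact ⟨a' + b', add_mem ha' hb', by rw [add_mul, ea, eb, mul_add]⟩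
  | mul a b _ _ ha hb =>
    obtain ⟨a', ha', ea⟩ := ha
    obtain ⟨b', hb', eb⟩ := hb
    exact ⟨a' * b', mul_mem ha' hb', by rw [mul_assoc, eb, ← mul_assoc, ea, mul_assoc]⟩

theorem exists_mul_left_of_adjoin {S : Set Q} {x : Q}
    (hS : ∀ s ∈ S, ∃ p' ∈ Algebra.adjoin R S, x * s = p' * x) :
    ∀ p ∈ Algebra.adjoin R S, ∃ p' ∈ Algebra.adjoin R S, x * p = p' * x := by
  intro p hp
  induction hp using Algebra.adjoin_induction with
  | mem s hs => exact hS s hs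
  | algebraMap s => exact ⟨algebraMap R Q s, Subalgebra.algebraMap_mem _ _, (Algebra.commutes _ _).symm⟩
  | add a b _ _ ha hb =>
    obtain ⟨a', ha', ea⟩ := ha
    obtain ⟨b', hb', eb⟩ := hb
    exact ⟨a' + b', add_mem ha' hb', by rw [mul_add, ea, eb, add_mul]⟩
  | mul a b _ _ ha hb =>
    obtain ⟨a', ha', ea⟩ := ha
    obtain ⟨b', hb', eb⟩ := hb
    exact ⟨a' * b', mul_mem ha' hb', by rw [← mul_assoc, ea, mul_assoc, eb, mul_assoc]⟩

theorem adjoin_pair_le_span (GB : G * B = B * G) : Subalgebra.toSubmodule (Algebra.adjoin R {G, B}) ≤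
    Submodule.span R (Set.range fun i : ℕ × ℕ => G ^ i.1 * B ^ i.2) := by
  rw [Algebra.adjoin_eq_span]
  refine Submodule.span_mono fun p hp => ?_
  induction hp using Submonoid.closure_induction with
  | mem s hs =>
    rcases hs with rfl | rfl
    · exact ⟨(1, 0), by simp⟩
    · exact ⟨(0, 1), by simp⟩
  | one => exact ⟨(0, 0), by simp⟩
  | mul u v _ _ hu hv =>
    obtain ⟨i, rfl⟩ := hu
    obtain ⟨j, rfl⟩ := hv
    refine ⟨(i.1 + j.1, i.2 + j.2), ?_⟩
    have : Commute (G ^ j.1) (B ^ i.2) := (show Commute G B from GB).pow_pow _ _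
    dsimp only
    rw [pow_add, pow_add, mul_assoc, mul_assoc, ← mul_assoc (G ^ j.1), this.eq, mul_assoc]

include GB Gy By xG xB xy in
theorem span_monomials (h : Algebra.adjoin R {G, B, x, y} = ⊤) :
    Submodule.span R (Set.range fun i : (ℕ × ℕ) × (ℕ × ℕ) =>
      y ^ i.1.1 * (G ^ i.2.1 * B ^ i.2.2) * x ^ i.1.2) = ⊤ := by
  set P := Submodule.span R (Set.range fun i : (ℕ × ℕ) × (ℕ × ℕ) =>
      y ^ i.1.1 * (G ^ i.2.1 * B ^ i.2.2) * x ^ i.1.2) with hP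
  set K := Algebra.adjoin R {G, B} with hK
  have hG : G ∈ K := Algebra.subset_adjoin (by simp)
  have hB : B ∈ K := Algebra.subset_adjoin (by simp)
  have h2 : (2 : Q) ∈ K := by
    have := Subalgebra.algebraMap_mem K (2 : R)
    rwa [map_ofNat] at this
  have mem : ∀ (a e : ℕ), ∀ p ∈ K, y ^ a * p * x ^ e ∈ P := by
    intro a e p hp
    have := adjoin_pair_le_span GB hp
    clear hp
    induction this using Submodule.span_induction with
    | mem z hz =>
      obtain ⟨i, rfl⟩ := hz
      exact Submodule.subset_span ⟨((a, e), i), rfl⟩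
    | zero => simp
    | add u v _ _ hu hv => rw [mul_add, add_mul]; exact add_mem hu hv
    | smul s u _ hu => rw [mul_smul_comm, smul_mul_assoc]; exact P.smul_mem _ hu
  have Ky := exists_mul_pow_right (K := K) (exists_mul_right_of_adjoin (R := R) (S := {G, B}) (y := y) (by
    rintro s (rfl | rfl)
    · exact ⟨_, sub_mem hG h2, Gy⟩
    · exact ⟨_, sub_mem hB h2, By⟩))
  have Kx := exists_mul_left_of_adjoin (R := R) (S := {G, B}) (x := x) (by
    rintro s (rfl | rfl)
    · exact ⟨_, sub_mem hG h2, xG⟩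
    · exact ⟨_, sub_mem hB h2, xB⟩)
  have xpow : ∀ a : ℕ, ∃ k ∈ K, x * y ^ (a + 1) = y ^ (a + 1) * x + y ^ a * k := by
    intro a
    induction a with
    | zero =>
      exact ⟨r • (G + B), K.smul_mem (add_mem hG hB) r, by rw [zero_add, pow_one, pow_zero, one_mul, xy]⟩
    | succ n ih =>
      obtain ⟨k, hk, e⟩ := ih
      obtain ⟨k', hk', e'⟩ := Ky (n + 1) _ (K.smul_mem (add_mem hG hB) r)
      refine ⟨k + k', add_mem hk hk', ?_⟩
      have hp : y * y ^ n = y ^ (n + 1) := (pow_succ' y n).symm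
      rw [pow_succ' y (n + 1), ← mul_assoc, xy, add_mul, mul_assoc y x, e, e', mul_add, ← mul_assoc,
        ← mul_assoc, hp, mul_add, add_assoc]
  have stab : ∀ s ∈ ({G, B, x, y} : Set Q), ∀ z ∈ P, s * z ∈ P := by
    intro s hs z hz
    induction hz using Submodule.span_induction with
    | zero => simp
    | add u v _ _ hu hv => rw [mul_add]; exact add_mem hu hv
    | smul s u _ hu => rw [mul_smul_comm]; exact P.smul_mem _ hu
    | mem z hz =>
      obtain ⟨⟨⟨a, e⟩, b, d⟩, rfl⟩ := hz
      have hp : G ^ b * B ^ d ∈ K := mul_mem (pow_mem hG _) (pow_mem hB _)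
      dsimp only
      generalize G ^ b * B ^ d = p at hp
      have hKs : ∀ s ∈ K, s * (y ^ a * p * x ^ e) ∈ P := by
        intro s hs
        obtain ⟨s', hs', es⟩ := Ky a s hs
        rw [← mul_assoc, ← mul_assoc, es, mul_assoc (y ^ a)]
        exact mem a e _ (mul_mem hs' hp)
      rcases hs with rfl | rfl | rfl | rfl
      · exact hKs _ hG
      · exact hKs _ hB
      · obtain ⟨p', hp', ep⟩ := Kx p hp
        rcases a with _ | a
        · rw [pow_zero, one_mul, ← mul_assoc, ep, mul_assoc, ← pow_succ']
          have := mem 0 (e + 1) p' hp'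
          rwa [pow_zero, one_mul] at this
        · obtain ⟨k, hk, ek⟩ := xpow a
          rw [← mul_assoc, ← mul_assoc, ek, add_mul, add_mul, mul_assoc (y ^ (a + 1)), ep,
            ← mul_assoc (y ^ (a + 1)), mul_assoc _ s, ← pow_succ', mul_assoc (y ^ a)]
          exact add_mem (mem _ _ _ hp') (mem _ _ _ (mul_mem hk hp))
      · rw [← mul_assoc, ← mul_assoc, ← pow_succ']
        exact mem _ _ _ hp
  have one : (1 : Q) ∈ P := by
    have := mem 0 0 1 (one_mem K)
    simpa using this
  rw [eq_top_iff]
  rintro z -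
  have hz : z ∈ Algebra.adjoin R {G, B, x, y} := h ▸ Algebra.mem_top
  have : ∀ w ∈ P, z * w ∈ P := by
    induction hz using Algebra.adjoin_induction with
    | mem s hs => exact stab s hs
    | algebraMap s => intro w hw; rw [← Algebra.smul_def]; exact P.smul_mem _ hw
    | add a b _ _ ha hb => intro w hw; rw [add_mul]; exact add_mem (ha w hw) (hb w hw)
    | mul a b _ _ ha hb => intro w hw; rw [mul_assoc]; exact ha _ (hb w hw)
  simpa using this 1 one

end Span

section ULSpan

variable {c : ℂ}

theorem qd_eq (c a : ℂ) : ∃ r, qd c a = cst (a * c) + tt * r := by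
  refine ⟨PowerSeries.mk fun n => PowerSeries.coeff (n + 1) (qd c a), ?_⟩
  rw [← constCoeff_qd c a, add_comm]
  exact PowerSeries.eq_X_mul_shift_add_const _

theorem exists_qint_qpow_mod (hc : c ≠ 0) {A : Type*} [Ring A] [Algebra Rt A] (x : Comp A) :
    ∃ z, (qs c 1 - qs c (-1)) • (x + tt • z) = qpow c 1 x - qpow c (-1) x := by
  obtain ⟨y1, h1⟩ := qpow_mod_two (c := c) x
  obtain ⟨y2, h2⟩ := qpow_mod_two (c := c) (-x)
  obtain ⟨r1, e1⟩ := qd_eq c 1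
  obtain ⟨r2, e2⟩ := qd_eq c (-1)
  have hu : IsUnit (qd c 1 - qd c (-1)) := by
    refine isUnit_of_constCoeff ?_
    rw [map_sub, constCoeff_qd, constCoeff_qd]
    intro h
    apply hc
    linear_combination h / 2
  have e : qs c 1 - qs c (-1) = tt * (qd c 1 - qd c (-1)) := by
    rw [mul_sub, tt_mul_qd, tt_mul_qd]; ring
  have e3 : qd c 1 - qd c (-1) = 2 * cst c + tt * (r1 - r2) := by
    rw [e1, e2]; simp; ring
  obtain ⟨u, hu⟩ := hu
  refine ⟨(↑u⁻¹ : Rt) • ((y1 - y2) - (r1 - r2) • x), ?_⟩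
  have hn : qpow c (-1) x = qpow c 1 (-x) := by rw [qpow_eq (-1)]; simp
  rw [hn, h1, h2, e, mul_smul, smul_add, smul_comm _ tt ((↑u⁻¹ : Rt) • _), ← hu, smul_smul (u : Rt),
    Units.mul_inv, one_smul, hu, e3]
  have : (2 * cst c + tt * (r1 - r2)) • x = (cst c : Rt) • x +
      (cst c : Rt) • x + tt • ((r1 - r2) • x) := by
    rw [add_smul, two_mul, add_smul, mul_smul]
  rw [this, smul_neg]
  simp only [smul_add, smul_sub, smul_neg, pow_two, mul_smul]
  abel

namespace UL

theorem EF_mod (hc : c ≠ 0) : ∃ z, UL.E c * UL.F c - UL.F c * UL.E c = UL.H c + tt • z := by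
  obtain ⟨z, hz⟩ := exists_qint_qpow_mod hc (SFree.gen SGen.H)
  have h : Usl.ofFree c _ = Usl.ofFree c _ := Usl.rel (SRel.EF _ hz)
  have h' := congrArg (QTData.inl (Usl c) Line) h
  rw [map_sub, map_mul, map_mul, map_add, map_smul, map_sub, map_mul, map_mul, map_add, map_smul] at h'
  exact ⟨_, h'⟩

/-- The monomials that span `U_q(sl₂) ⊗ U_{q⁻¹}(ℂ)` modulo `t`. -/
noncomputable def mono (c : ℂ) (i : (ℕ × ℕ) × (ℕ × ℕ)) : UL c :=
  Y c ^ i.1.1 * ((-UL.H c + UL.C c) ^ i.2.1 * (-UL.H c - UL.C c) ^ i.2.2) * X c ^ i.1.2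

theorem exists_mono (hc : c ≠ 0) (x : UL c) : ∃ (f : ((ℕ × ℕ) × (ℕ × ℕ)) →₀ Rt) (y : UL c),
    x = f.sum (fun i r => r • mono c i) + tt • y := by
  have hmk : ∀ a b : UL c, (∃ y, a = b + tt • y) ↔
      Ideal.Quotient.mkₐ Rt (tIdeal (UL c) 1) a = Ideal.Quotient.mkₐ Rt (tIdeal (UL c) 1) b := by
    intro a b
    rw [Ideal.Quotient.mkₐ_eq_mk, Ideal.Quotient.eq, mem_tIdeal]
    simp only [pow_one, sub_eq_iff_eq_add']
  set m := Ideal.Quotient.mkₐ Rt (tIdeal (UL c) 1) with hm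
  have hr := cartanRels (c := c) hc
  have two : ∀ a : UL c, (cst 2 : Rt) • a = a * 2 := by
    intro a
    rw [map_ofNat, ofNat_smul_eq_nsmul]
    simp [mul_two, two_smul]
  have ntwo : ∀ a : UL c, (cst (-2) : Rt) • a = -(a * 2) := by
    intro a
    rw [map_neg, neg_smul, two]
  have e1 : m (UL.E c) = m (Y c) := by
    refine (hmk _ _).1 ?_
    obtain ⟨z, hz⟩ := qpow_mod (c := c) (1 / 2) (UL.H c)
    exact ⟨z * Y c, by rw [← qpow_mul_Y, hz, add_mul, one_mul, smul_mul_assoc]⟩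
  have e2 : m (UL.F c) = m (X c) := by
    refine (hmk _ _).1 ?_
    obtain ⟨z, hz⟩ := qpow_mod (c := c) (1 / 2) (UL.H c)
    exact ⟨z * X c, by rw [← qpow_mul_X, hz, add_mul, one_mul, smul_mul_assoc]⟩
  have e3 : m (Y c) * m (X c) - m (X c) * m (Y c) = m (UL.H c) := by
    rw [← e1, ← e2, ← map_mul, ← map_mul, ← map_sub]
    exact (hmk _ _).1 (EF_mod hc)
  have e4 : (cst (1 / 2) : Rt) • ((-UL.H c + UL.C c) + (-UL.H c - UL.C c)) = -UL.H c := by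
    have : (-UL.H c + UL.C c) + (-UL.H c - UL.C c) = (cst 2 : Rt) • -UL.H c := by
      rw [two]; noncomm_ring
    rw [this, smul_smul, ← map_mul]; norm_num
  have e5 : (cst (1 / 2) : Rt) • ((-UL.H c + UL.C c) - (-UL.H c - UL.C c)) = UL.C c := by
    have : (-UL.H c + UL.C c) - (-UL.H c - UL.C c) = (cst 2 : Rt) • UL.C c := by
      rw [two]; noncomm_ring
    rw [this, smul_smul, ← map_mul]; norm_num
  have key := span_monomials (R := Rt) (x := m (X c)) (y := m (Y c)) (G := m (-UL.H c + UL.C c))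
    (B := m (-UL.H c - UL.C c)) (r := cst (1 / 2))
    (by
      rw [← map_mul, ← map_mul]; congr 1
      have := hr.commute_comb (-1) 1 (-1) (-1)
      simp only [neg_smul, one_smul, ← sub_eq_add_neg] at this
      exact this)
    (by
      rw [← map_ofNat m, ← map_sub, ← map_mul, ← map_mul]; congr 1
      rw [add_mul, neg_mul, hr.HY, hr.CY, two]; noncomm_ring)
    (by
      rw [← map_ofNat m, ← map_sub, ← map_mul, ← map_mul]; congr 1
      rw [sub_mul, neg_mul, hr.HY, hr.CY, two]; noncomm_ring)
    (by
      rw [← map_ofNat m, ← map_sub, ← map_mul, ← map_mul]; congr 1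
      rw [sub_mul, add_mul, neg_mul, hr.HX, hr.CX, ntwo]; noncomm_ring)
    (by
      rw [← map_ofNat m, ← map_sub, ← map_mul, ← map_mul]; congr 1
      rw [sub_mul, sub_mul, neg_mul, hr.HX, hr.CX, ntwo]; noncomm_ring)
    (by
      rw [← map_add, ← map_smul, e4, map_neg, ← e3]; abel)
    (by
      rw [eq_top_iff]
      rintro z -
      obtain ⟨w, rfl⟩ := Ideal.Quotient.mkₐ_surjective Rt (tIdeal (UL c) 1) z
      obtain ⟨p, hp, y, rfl⟩ := dense (c := c) w
      have hpm : m (p + tt • y) = m p := (hmk _ _).1 ⟨y, rfl⟩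
      rw [← hm, hpm]
      have : m p ∈ Subalgebra.map m (Algebra.adjoin Rt {UL.H c, UL.C c, X c, Y c}) := ⟨p, hp, rfl⟩
      rw [AlgHom.map_adjoin] at this
      refine Algebra.adjoin_le ?_ this
      have hG := Algebra.subset_adjoin (R := Rt)
        (show m (-UL.H c + UL.C c) ∈ ({m (-UL.H c + UL.C c), m (-UL.H c - UL.C c), m (X c), m (Y c)} : Set _) by simp)
      have hB := Algebra.subset_adjoin (R := Rt)
        (show m (-UL.H c - UL.C c) ∈ ({m (-UL.H c + UL.C c), m (-UL.H c - UL.C c), m (X c), m (Y c)} : Set _) by simp)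
      rintro _ ⟨s, rfl | rfl | rfl | rfl, rfl⟩
      · have := neg_mem (Subalgebra.smul_mem _ (add_mem hG hB) (cst (1 / 2)))
        rwa [← map_add, ← map_smul, e4, ← map_neg, neg_neg] at this
      · have := Subalgebra.smul_mem _ (sub_mem hG hB) (cst (1 / 2))
        rwa [← map_sub, ← map_smul, e5] at this
      · exact Algebra.subset_adjoin (by simp)
      · exact Algebra.subset_adjoin (by simp))
  have hx : m x ∈ Submodule.span Rt (Set.range fun i => m (mono c i)) := by
    have : (fun i => m (mono c i)) = fun i : (ℕ × ℕ) × (ℕ × ℕ) =>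
        m (Y c) ^ i.1.1 * (m (-UL.H c + UL.C c) ^ i.2.1 * m (-UL.H c - UL.C c) ^ i.2.2) * m (X c) ^ i.1.2 := by
      funext i
      simp only [mono, map_mul, map_pow]
    rw [this, key]
    trivial
  obtain ⟨f, hf⟩ := Finsupp.mem_span_range_iff_exists_finsupp.1 hx
  obtain ⟨y, hy⟩ := (hmk x (f.sum fun i r => r • mono c i)).2 (by
    rw [← hf, Finsupp.sum, Finsupp.sum, map_sum]
    simp only [map_smul])
  exact ⟨f, y, hy⟩

end UL

end ULSpan

section Log

variable {B : Type*} [Ring B] [Algebra Rt B] {c : ℂ}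

theorem exists_log (hc : c ≠ 0) (v : Comp B) : ∃ L : Comp B, qpow c 1 L = 1 + tt • v := by
  obtain ⟨L, hL⟩ := Line.exists_log c hc Line.C
  exact ⟨Line.lift v L, by rw [← qpow_map, hL, map_add, map_one, map_smul, Line.lift_C]⟩

end Log

section BaseRing

variable {k S : Type*} [Field k] [CommRing S] [Algebra S k] (q : kˣ)

theorem Dq.base_smul (r : S) (x : Dq q) : r • x = algebraMap S k r • x := by
  rw [Algebra.smul_def, Algebra.smul_def]
  rfl
theorem Ub.base_smul (r : S) (x : Ub q) : r • x = algebraMap S k r • x := by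
  rw [Algebra.smul_def, Algebra.smul_def]
  rfl

variable {q}

theorem Dq.base_smul_eq_zero {r : S} (hr : algebraMap S k r ≠ 0) {x : Dq q} (h : r • x = 0) :
    x = 0 := by
  rw [Dq.base_smul] at h
  exact (smul_eq_zero_iff_right hr).1 h
theorem Ub.base_smul_eq_zero {r : S} (hr : algebraMap S k r ≠ 0) {x : Ub q} (h : r • x = 0) :
    x = 0 := by
  rw [Ub.base_smul] at h
  exact (smul_eq_zero_iff_right hr).1 h

theorem Dq.base_smul_inv {r : S} {a : k} (hr : algebraMap S k r = a) (ha : a ≠ 0) (x : Dq q) :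
    r • (a⁻¹ • x) = x := by
  rw [Dq.base_smul, hr, smul_smul, mul_inv_cancel₀ ha, one_smul]
theorem Ub.base_smul_inv {r : S} {a : k} (hr : algebraMap S k r = a) (ha : a ≠ 0) (x : Ub q) :
    r • (a⁻¹ • x) = x := by
  rw [Ub.base_smul, hr, smul_smul, mul_inv_cancel₀ ha, one_smul]

variable (q) {r r' : S} (hr : algebraMap S k r = (q : k) ^ 2) (hr' : r' * r = 1)
include hr

theorem Dq.base_gX : g q * X q = r • (X q * g q) := by rw [Dq.base_smul, hr, Dq.gX]
theorem Dq.base_hX : h q * X q = r • (X q * h q) := by rw [Dq.base_smul, hr, Dq.hX]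
theorem Ub.base_gX : g q * X q = r • (X q * g q) := by rw [Ub.base_smul, hr, Ub.gX]

include hr'

theorem algebraMap_inv_sq : algebraMap S k r' = ((q : k) ^ 2)⁻¹ := by
  refine eq_inv_of_mul_eq_one_left ?_
  rw [← hr, ← map_mul, hr', map_one]
theorem Dq.base_gY : g q * Y q = r' • (Y q * g q) := by
  rw [Dq.base_smul, algebraMap_inv_sq q hr hr', Dq.gY]
theorem Dq.base_hY : h q * Y q = r' • (Y q * h q) := by
  rw [Dq.base_smul, algebraMap_inv_sq q hr hr', Dq.hY]

theorem Dq.base_XY (hq : (q : k) ^ 2 ≠ 1) :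
    (1 - r') • (r • (X q * Y q) - Y q * X q) = g q * h q - 1 := by
  have h0 := q_ne q
  have h2 := congrArg (fun z => ((q : k) ^ 2 - 1) • z) (Dq.XY q)
  rw [smul_smul ((q : k) ^ 2 - 1) _ (_ - 1), mul_inv_cancel₀ (sub_ne_zero.2 hq), one_smul,
    ← Dq.gh] at h2
  rw [← h2, Dq.base_smul _ (1 - r'), Dq.base_smul _ r, map_sub, map_one, algebraMap_inv_sq q hr hr', hr, smul_sub,
    smul_sub, smul_smul, smul_smul]
  congr 2
  · field_simp
  · field_simp

end BaseRing

section DR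

variable (c : ℂ)

theorem qK_sq : algebraMap Rt Kt (qs c 2) = (qK c : Kt) ^ 2 := by
  change _ = (algebraMap Rt Kt (qs c 1)) ^ 2
  rw [← map_pow, qs_pow]
  norm_num

theorem qK_sub_one : algebraMap Rt Kt (qs c 1 - 1) = (qK c : Kt) - 1 := by
  rw [map_sub, map_one]; rfl

theorem algebraMap_Kt_injective : Function.Injective (algebraMap Rt Kt) :=
  IsFractionRing.injective Rt Kt

variable {c}

theorem qs_sub_one_ne_zero (hc : c ≠ 0) {a : ℂ} (ha : a ≠ 0) : qs c a - 1 ≠ 0 := by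
  rw [← tt_mul_qd]
  exact mul_ne_zero tt_ne_zero (isUnit_qd hc ha).ne_zero

theorem qK_sub_one_ne (hc : c ≠ 0) : (qK c : Kt) - 1 ≠ 0 := by
  rw [← qK_sub_one, Ne, map_eq_zero_iff _ algebraMap_Kt_injective]
  exact qs_sub_one_ne_zero hc one_ne_zero

theorem qK_sq_ne (hc : c ≠ 0) : (qK c : Kt) ^ 2 ≠ 1 := by
  rw [← qK_sq, ← map_one (algebraMap Rt Kt), algebraMap_Kt_injective.ne_iff]
  exact fun h => qs_sub_one_ne_zero hc two_ne_zero (sub_eq_zero.2 h)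

theorem algebraMap_tt_ne : algebraMap Rt Kt tt ≠ 0 := by
  rw [Ne, map_eq_zero_iff _ algebraMap_Kt_injective]
  exact tt_ne_zero

instance : Module.IsTorsionFree Rt (DR c) :=
  isTorsionFree_of_tt fun _ hx =>
    Subtype.ext (Dq.base_smul_eq_zero algebraMap_tt_ne (congrArg Subtype.val hx))

instance : Module.IsTorsionFree Rt (HR c) :=
  isTorsionFree_of_tt fun _ hx =>
    Subtype.ext (Ub.base_smul_eq_zero algebraMap_tt_ne (congrArg Subtype.val hx))

namespace DR

variable (c)

/-- A generator of the double over `ℂ[[t]]`. -/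
noncomputable def gen (z : DGen) : DR c := ⟨Dq.gen (qK c) z, Algebra.subset_adjoin (Or.inl ⟨z, rfl⟩)⟩

/-- `(g - 1)/(q - 1)` -/
noncomputable def lg : DR c :=
  ⟨((qK c : Kt) - 1)⁻¹ • (Dq.g (qK c) - 1), Algebra.subset_adjoin (Or.inr (Or.inl rfl))⟩

/-- `(ḡ - 1)/(q - 1)` -/
noncomputable def lh : DR c :=
  ⟨((qK c : Kt) - 1)⁻¹ • (Dq.h (qK c) - 1), Algebra.subset_adjoin (Or.inr (Or.inr rfl))⟩

theorem adjoin_gen : Algebra.adjoin Rt (Set.range (gen c) ∪ {lg c, lh c}) = ⊤ := by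
  have h : (DR c).val '' (Set.range (gen c) ∪ {lg c, lh c}) =
      Set.range (Dq.gen (qK c)) ∪ {(((qK c : Kt) - 1)⁻¹ • (Dq.g (qK c) - 1)),
        (((qK c : Kt) - 1)⁻¹ • (Dq.h (qK c) - 1))} := by
    rw [Set.image_union, ← Set.range_comp, Set.image_pair]
    rfl
  have h2 : Subalgebra.map (DR c).val (Algebra.adjoin Rt (Set.range (gen c) ∪ {lg c, lh c})) =
      Subalgebra.map (DR c).val ⊤ := by
    rw [AlgHom.map_adjoin, h, Algebra.map_top, Subalgebra.range_val]
    rfl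
  exact Subalgebra.map_injective Subtype.val_injective h2

variable {c}

theorem g_eq (hc : c ≠ 0) : gen c DGen.g = 1 + (qs c 1 - 1) • lg c := by
  have h := Dq.base_smul_inv (qK_sub_one c) (qK_sub_one_ne hc) (Dq.g (qK c) - 1)
  exact Subtype.ext (eq_add_of_sub_eq' h.symm)

theorem h_eq (hc : c ≠ 0) : gen c DGen.h = 1 + (qs c 1 - 1) • lh c := by
  have h := Dq.base_smul_inv (qK_sub_one c) (qK_sub_one_ne hc) (Dq.h (qK c) - 1)
  exact Subtype.ext (eq_add_of_sub_eq' h.symm)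

theorem gX : gen c DGen.g * gen c DGen.X = qs c 2 • (gen c DGen.X * gen c DGen.g) :=
  Subtype.ext (Dq.base_gX (qK c) (qK_sq c))
theorem hX : gen c DGen.h * gen c DGen.X = qs c 2 • (gen c DGen.X * gen c DGen.h) :=
  Subtype.ext (Dq.base_hX (qK c) (qK_sq c))
theorem gY : gen c DGen.g * gen c DGen.Y = qs c (-2) • (gen c DGen.Y * gen c DGen.g) :=
  Subtype.ext (Dq.base_gY (qK c) (qK_sq c) (qs_neg_mul c 2))
theorem hY : gen c DGen.h * gen c DGen.Y = qs c (-2) • (gen c DGen.Y * gen c DGen.h) :=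
  Subtype.ext (Dq.base_hY (qK c) (qK_sq c) (qs_neg_mul c 2))
theorem gh : gen c DGen.g * gen c DGen.h = gen c DGen.h * gen c DGen.g :=
  Subtype.ext (Dq.gh (qK c))
theorem g_gi : gen c DGen.g * gen c DGen.gi = 1 := Subtype.ext (Dq.g_gi (qK c))
theorem gi_g : gen c DGen.gi * gen c DGen.g = 1 := Subtype.ext (Dq.gi_g (qK c))
theorem h_hi : gen c DGen.h * gen c DGen.hi = 1 := Subtype.ext (Dq.h_hi (qK c))
theorem hi_h : gen c DGen.hi * gen c DGen.h = 1 := Subtype.ext (Dq.hi_h (qK c))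
theorem XY (hc : c ≠ 0) : (1 - qs c (-2)) • (qs c 2 • (gen c DGen.X * gen c DGen.Y) - gen c DGen.Y * gen c DGen.X) =
    gen c DGen.g * gen c DGen.h - 1 :=
  Subtype.ext (Dq.base_XY (qK c) (qK_sq c) (qs_neg_mul c 2) (qK_sq_ne hc))

end DR

namespace Dhat

theorem gen_eq (z : DGen) : gen c z = of (DR.gen c z) := rfl

theorem exists_log_g (hc : c ≠ 0) : ∃ G : Dhat c, qpow c 1 G = gen c DGen.g := by
  obtain ⟨G, hG⟩ := exists_log hc (of (qd c 1 • DR.lg c))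
  refine ⟨G, ?_⟩
  rw [hG, gen_eq, DR.g_eq hc, ← tt_mul_qd, map_add, map_one, mul_smul, map_smul of tt]

theorem exists_log_h (hc : c ≠ 0) : ∃ G : Dhat c, qpow c 1 G = gen c DGen.h := by
  obtain ⟨G, hG⟩ := exists_log hc (of (qd c 1 • DR.lh c))
  refine ⟨G, ?_⟩
  rw [hG, gen_eq, DR.h_eq hc, ← tt_mul_qd, map_add, map_one, mul_smul, map_smul of tt]

/-- The logarithm of `g`. -/
noncomputable def G (hc : c ≠ 0) : Dhat c := (exists_log_g hc).choose
/-- The logarithm of `ḡ`. -/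
noncomputable def Gb (hc : c ≠ 0) : Dhat c := (exists_log_h hc).choose

theorem qpow_G (hc : c ≠ 0) : qpow c 1 (G hc) = gen c DGen.g := (exists_log_g hc).choose_spec
theorem qpow_Gb (hc : c ≠ 0) : qpow c 1 (Gb hc) = gen c DGen.h := (exists_log_h hc).choose_spec

theorem log_weight {A : Type*} [Ring A] [Algebra Rt A] [Module.IsTorsionFree Rt A] (hc : c ≠ 0)
    {L x : Comp A} {w : ℂ} (h : qpow c 1 L * x = qs c w • (x * qpow c 1 L)) :
    L * x = x * L + (cst w : Rt) • x := by
  have := intertwine_of_qpow hc (a := L) (b := L + (cst w : Rt) • 1) (x := x)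
    (by rw [h, qpow_add_scalar, mul_smul_comm])
  rw [this, mul_add, mul_smul_comm, mul_one]

theorem commute_G_Gb (hc : c ≠ 0) : G hc * Gb hc = Gb hc * G hc := by
  have h1 : qpow c 1 (G hc) * qpow c 1 (Gb hc) = qpow c 1 (Gb hc) * qpow c 1 (G hc) := by
    rw [qpow_G, qpow_Gb, gen_eq, gen_eq, ← map_mul, ← map_mul, DR.gh]
  have h2 := intertwine_of_qpow hc h1
  exact (intertwine_of_qpow hc h2.symm).symm

/-- The element corresponding to `H`. -/
noncomputable def H (hc : c ≠ 0) : Dhat c := (cst (-1 / 2) : Rt) • (G hc + Gb hc)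
/-- The element corresponding to `C`. -/
noncomputable def C (hc : c ≠ 0) : Dhat c := (cst (1 / 2) : Rt) • (G hc - Gb hc)

theorem neg_H_add_C (hc : c ≠ 0) : -H hc + C hc = G hc := by
  have e : (cst (-1 / 2) : Rt) = - cst (1 / 2) := by rw [← map_neg]; norm_num
  have e' : (cst (1 / 2) + cst (1 / 2) : Rt) = 1 := by rw [← map_add]; norm_num
  rw [H, C, e, neg_smul, neg_neg, ← smul_add, add_add_sub_cancel, smul_add, ← add_smul, e', one_smul]
theorem neg_H_sub_C (hc : c ≠ 0) : -H hc - C hc = Gb hc := by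
  have e : (cst (-1 / 2) : Rt) = - cst (1 / 2) := by rw [← map_neg]; norm_num
  have e' : (cst (1 / 2) + cst (1 / 2) : Rt) = 1 := by rw [← map_add]; norm_num
  rw [H, C, e, neg_smul, neg_neg, ← smul_sub, add_sub_sub_cancel, smul_add, ← add_smul, e', one_smul]

theorem cartanRels (hc : c ≠ 0) : CartanRels c (H hc) (C hc) (gen c DGen.X) (gen c DGen.Y) := by
  have gX : G hc * gen c DGen.X = gen c DGen.X * G hc + (cst 2 : Rt) • gen c DGen.X := by
    refine log_weight hc ?_
    rw [qpow_G, gen_eq, gen_eq, ← map_mul, ← map_mul, DR.gX, map_smul]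
  have hX : Gb hc * gen c DGen.X = gen c DGen.X * Gb hc + (cst 2 : Rt) • gen c DGen.X := by
    refine log_weight hc ?_
    rw [qpow_Gb, gen_eq, gen_eq, ← map_mul, ← map_mul, DR.hX, map_smul]
  have gY : G hc * gen c DGen.Y = gen c DGen.Y * G hc + (cst (-2) : Rt) • gen c DGen.Y := by
    refine log_weight hc ?_
    rw [qpow_G, gen_eq, gen_eq, ← map_mul, ← map_mul, DR.gY, map_smul]
  have hY : Gb hc * gen c DGen.Y = gen c DGen.Y * Gb hc + (cst (-2) : Rt) • gen c DGen.Y := by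
    refine log_weight hc ?_
    rw [qpow_Gb, gen_eq, gen_eq, ← map_mul, ← map_mul, DR.hY, map_smul]
  constructor
  · rw [C, H, smul_mul_assoc, mul_smul_comm, smul_mul_assoc, mul_smul_comm, smul_comm]
    congr 2
    rw [add_mul, sub_mul, mul_add, mul_add, mul_sub, mul_sub, commute_G_Gb]
    abel
  · rw [C, smul_mul_assoc, mul_smul_comm, sub_mul, mul_sub, gX, hX, add_sub_add_right_eq_sub]
  · rw [C, smul_mul_assoc, mul_smul_comm, sub_mul, mul_sub, gY, hY, add_sub_add_right_eq_sub]
  · rw [H, smul_mul_assoc, mul_smul_comm, add_mul, mul_add, gX, hX, add_add_add_comm, smul_add,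
      ← add_smul, smul_smul, ← map_add, ← map_mul]
    norm_num
  · rw [H, smul_mul_assoc, mul_smul_comm, add_mul, mul_add, gY, hY, add_add_add_comm, smul_add,
      ← add_smul, smul_smul, ← map_add, ← map_mul]
    norm_num
  · have : (cst (-2) : Rt) • H hc = G hc + Gb hc := by
      rw [H, smul_smul, ← map_mul]; norm_num
    rw [this, qpow_add (commute_G_Gb hc), qpow_G, qpow_Gb]
    simp only [gen_eq]
    rw [← map_mul, ← map_mul, ← map_mul, ← map_smul, ← map_sub, ← map_smul, DR.XY hc, map_sub,
      map_one]

end Dhat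

end DR

section Verma

variable {k : Type*} [Field k] [Algebra Rt k] (c : ℂ) (lam mu : ℂ)

/-- The weights of a universal lowering module. -/
noncomputable def wt (a e : ℕ) : Rt := qs c (lam - 2 * a + 2 * e)

/-- The structure constants of a universal lowering module. -/
noncomputable def vcoef : ℕ → ℕ → Rt
  | 0, _ => 0
  | a + 1, e => qs c (-2) * vcoef a e + qd c (lam + mu - 4 * a + 4 * e) * (qd c 2)⁻¹

variable (k)

/-- The action of `g`. -/
noncomputable def opG : Module.End k (ℕ → ℕ → k) where
  toFun f := fun a e => algebraMap Rt k (wt c lam a e) * f a e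
  map_add' f f' := by funext a e; simp [mul_add]
  map_smul' s f := by funext a e; simp [mul_left_comm]

/-- The action of `g⁻¹`. -/
noncomputable def opGi : Module.End k (ℕ → ℕ → k) where
  toFun f := fun a e => algebraMap Rt k (qs c (-(lam - 2 * a + 2 * e))) * f a e
  map_add' f f' := by funext a e; simp [mul_add]
  map_smul' s f := by funext a e; simp [mul_left_comm]

/-- The action of `X̄`. -/
noncomputable def opY : Module.End k (ℕ → ℕ → k) where
  toFun f := fun a e => match a with
    | 0 => 0
    | a + 1 => f a e
  map_add' f f' := by funext a e; cases a <;> simp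
  map_smul' s f := by funext a e; cases a <;> simp

/-- The action of `X`. -/
noncomputable def opX : Module.End k (ℕ → ℕ → k) where
  toFun f := fun a e => (match e with
    | 0 => 0
    | e + 1 => algebraMap Rt k (qs c (-2)) ^ a * f a e) +
      algebraMap Rt k (vcoef c lam mu (a + 1) e) * f (a + 1) e
  map_add' f f' := by funext a e; cases e <;> simp [mul_add] <;> ring
  map_smul' s f := by funext a e; cases e <;> simp [mul_add] <;> ring

variable {k c}

theorem opRels (hc : c ≠ 0) (q : kˣ) (hq : algebraMap Rt k (qs c 2) = (q : k) ^ 2)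
    (hq2 : (q : k) ^ 2 ≠ 1) :
    Dq.Rels q (opX k c lam mu) (opG k c lam) (opGi k c lam) (opY k) (opG k c mu) (opGi k c mu) := by
  have hp : ((q : k) ^ 2)⁻¹ = algebraMap Rt k (qs c (-2)) :=
    (algebraMap_inv_sq q hq (qs_neg_mul c 2)).symm
  have hpq : algebraMap Rt k (qs c 2) * algebraMap Rt k (qs c (-2)) = 1 := by
    rw [← map_mul, qs_mul_neg, map_one]
  have w1 : ∀ l a e, algebraMap Rt k (wt c l a (e + 1)) =
      algebraMap Rt k (qs c 2) * algebraMap Rt k (wt c l a e) := by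
    intro l a e
    rw [← map_mul, wt, wt, ← qs_add]; congr 2; push_cast; ring
  have w2 : ∀ l a e, algebraMap Rt k (wt c l (a + 1) e) =
      algebraMap Rt k (qs c (-2)) * algebraMap Rt k (wt c l a e) := by
    intro l a e
    rw [← map_mul, wt, wt, ← qs_add]; congr 2; push_cast; ring
  have hGX : ∀ l, opG k c l * opX k c lam mu = (q : k) ^ 2 • (opX k c lam mu * opG k c l) := by
    intro l
    rw [← hq]
    ext f a e
    change algebraMap Rt k (wt c l a e) * ((match e with
      | 0 => 0
      | e + 1 => algebraMap Rt k (qs c (-2)) ^ a * f a e) + _ * f (a + 1) e) =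
      algebraMap Rt k (qs c 2) * ((match e with
      | 0 => 0
      | e + 1 => algebraMap Rt k (qs c (-2)) ^ a * (algebraMap Rt k (wt c l a e) * f a e)) +
        _ * (algebraMap Rt k (wt c l (a + 1) e) * f (a + 1) e))
    rw [w2]
    cases e with
    | zero =>
      dsimp only
      linear_combination (-(algebraMap Rt k (vcoef c lam mu (a + 1) 0) *
        algebraMap Rt k (wt c l a 0) * f (a + 1) 0)) * hpq
    | succ e =>
      dsimp only
      rw [w1]
      linear_combination (-(algebraMap Rt k (vcoef c lam mu (a + 1) (e + 1)) *
        algebraMap Rt k (qs c 2) * algebraMap Rt k (wt c l a e) * f (a + 1) (e + 1))) * hpq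
  have hGY : ∀ l, opG k c l * opY k = ((q : k) ^ 2)⁻¹ • (opY k * opG k c l) := by
    intro l
    rw [hp]
    ext f a e
    cases a with
    | zero => simp [opG, opY]
    | succ a =>
      change algebraMap Rt k (wt c l (a + 1) e) * f a e = algebraMap Rt k (qs c (-2)) *
        (algebraMap Rt k (wt c l a e) * f a e)
      rw [w2, mul_assoc]
  have hGi : ∀ l, opG k c l * opGi k c l = 1 := by
    intro l
    ext f a e
    change algebraMap Rt k (wt c l a e) * (algebraMap Rt k (qs c _) * f a e) = f a e
    rw [← mul_assoc, ← map_mul, wt, qs_mul_neg, map_one, one_mul]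
  have hiG : ∀ l, opGi k c l * opG k c l = 1 := by
    intro l
    ext f a e
    change algebraMap Rt k (qs c _) * (algebraMap Rt k (wt c l a e) * f a e) = f a e
    rw [← mul_assoc, ← map_mul, wt, qs_neg_mul, map_one, one_mul]
  refine ⟨hGi _, hiG _, hGi _, hiG _, ?_, hGX _, hGX _, hGY _, hGY _, ?_⟩
  · ext f a e
    change _ * (_ * f a e) = _ * (_ * f a e)
    ring
  · ext f a e
    have hu : qd c 2 * (qd c 2)⁻¹ = 1 := PowerSeries.mul_inv_cancel _ (by
      rw [constCoeff_qd]; exact mul_ne_zero two_ne_zero hc)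
    have hn : (q : k) ^ 2 - 1 ≠ 0 := sub_ne_zero.2 hq2
    have hw : algebraMap Rt k (wt c mu a e) * algebraMap Rt k (wt c lam a e) - 1 =
        ((q : k) ^ 2 - 1) * algebraMap Rt k (qd c (lam + mu - 4 * a + 4 * e) * (qd c 2)⁻¹) := by
      rw [← hq, ← map_one (algebraMap Rt k), ← map_sub, ← map_mul, ← map_mul, ← map_sub, wt, wt,
        ← qs_add, ← tt_mul_qd, ← tt_mul_qd]
      congr 1
      have : mu - 2 * a + 2 * e + (lam - 2 * a + 2 * e) = lam + mu - 4 * a + 4 * (e : ℂ) := by ring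
      rw [this]
      linear_combination -(tt * qd c (lam + mu - 4 * a + 4 * e)) * hu
    have hR : (((q : k) ^ 2 - 1)⁻¹ • (opG k c mu * opG k c lam - 1) : Module.End k (ℕ → ℕ → k)) f a e =
        ((q : k) ^ 2 - 1)⁻¹ * ((algebraMap Rt k (wt c mu a e) * algebraMap Rt k (wt c lam a e) - 1)
          * f a e) := by
      change ((q : k) ^ 2 - 1)⁻¹ * (algebraMap Rt k (wt c mu a e) * (algebraMap Rt k (wt c lam a e)
        * f a e) - f a e) = _
      ring
    rw [hR, hw, hp]
    have hv : algebraMap Rt k (vcoef c lam mu (a + 1) e) = algebraMap Rt k (qs c (-2)) *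
        algebraMap Rt k (vcoef c lam mu a e) +
        algebraMap Rt k (qd c (lam + mu - 4 * a + 4 * e) * (qd c 2)⁻¹) := by
      rw [vcoef, map_add, map_mul]
    have h0 : algebraMap Rt k (vcoef c lam mu 0 e) = 0 := by rw [vcoef, map_zero]
    rw [← mul_assoc, ← mul_assoc, inv_mul_cancel₀ hn, one_mul]
    clear hR hw
    simp only [LinearMap.sub_apply, Pi.sub_apply, LinearMap.smul_apply, Pi.smul_apply, smul_eq_mul,
      Module.End.mul_apply]
    rcases a with _ | a <;> rcases e with _ | e <;>
    simp only [opX, opY, LinearMap.coe_mk, AddHom.coe_mk, hv, h0] <;> ring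

/-- A function with values in `ℂ[[t]]`. -/
def IsIntegral' (f : ℕ → ℕ → k) : Prop := ∀ a e, ∃ r : Rt, f a e = algebraMap Rt k r

/-- The function supported at one point. -/
def dl (k : Type*) [Field k] (a₀ e₀ : ℕ) : ℕ → ℕ → k := fun a e => if a = a₀ ∧ e = e₀ then 1 else 0

/-- The representation of the double on the universal lowering module. -/
noncomputable def verma (hc : c ≠ 0) (q : kˣ) (hq : algebraMap Rt k (qs c 2) = (q : k) ^ 2)
    (hq2 : (q : k) ^ 2 ≠ 1) : Dq q →ₐ[k] Module.End k (ℕ → ℕ → k) :=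
  Dq.lift q _ _ _ _ _ _ (opRels lam mu hc q hq hq2)

variable (hc : c ≠ 0) (q : kˣ) (hq : algebraMap Rt k (qs c 2) = (q : k) ^ 2)
    (hq2 : (q : k) ^ 2 ≠ 1) (hq1 : algebraMap Rt k (qs c 1 - 1) = (q : k) - 1)

theorem lgOp_apply (hc : c ≠ 0) (q : kˣ) (hq1 : algebraMap Rt k (qs c 1 - 1) = (q : k) - 1)
    (h1 : (q : k) - 1 ≠ 0) (l : ℂ) (f : ℕ → ℕ → k) (a e : ℕ) :
    (((q : k) - 1)⁻¹ • (opG k c l - 1)) f a e =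
      algebraMap Rt k (qd c (l - 2 * a + 2 * e) * (qd c 1)⁻¹) * f a e := by
  have hu : qd c 1 * (qd c 1)⁻¹ = 1 := PowerSeries.mul_inv_cancel _ (by
    rw [constCoeff_qd]; exact mul_ne_zero one_ne_zero hc)
  change ((q : k) - 1)⁻¹ * (algebraMap Rt k (wt c l a e) * f a e - f a e) = _
  have : algebraMap Rt k (wt c l a e) - 1 =
      ((q : k) - 1) * algebraMap Rt k (qd c (l - 2 * a + 2 * e) * (qd c 1)⁻¹) := by
    rw [← hq1, ← map_one (algebraMap Rt k), ← map_sub, ← map_mul, wt, ← tt_mul_qd, ← tt_mul_qd]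
    congr 1
    linear_combination -(tt * qd c (l - 2 * a + 2 * e)) * hu
  rw [← sub_one_mul, this, ← mul_assoc, ← mul_assoc, inv_mul_cancel₀ h1, one_mul]

include hq1 in
theorem verma_integral (h1 : (q : k) - 1 ≠ 0) {z : Dq q}
    (hz : z ∈ Algebra.adjoin Rt (Set.range (Dq.gen q) ∪
      {(((q : k) - 1)⁻¹ • (Dq.g q - 1)), (((q : k) - 1)⁻¹ • (Dq.h q - 1))})) (f : ℕ → ℕ → k)
    (hf : IsIntegral' f) : IsIntegral' (verma lam mu hc q hq hq2 z f) := by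
  have hG : ∀ l f, IsIntegral' f → IsIntegral' (opG k c l f) := by
    intro l f hf a e
    obtain ⟨r, hr⟩ := hf a e
    exact ⟨wt c l a e * r, by rw [map_mul, ← hr]; rfl⟩
  have hGi : ∀ l f, IsIntegral' f → IsIntegral' (opGi k c l f) := by
    intro l f hf a e
    obtain ⟨r, hr⟩ := hf a e
    exact ⟨qs c (-(l - 2 * a + 2 * e)) * r, by rw [map_mul, ← hr]; rfl⟩
  have hL : ∀ l f, IsIntegral' f → IsIntegral' ((((q : k) - 1)⁻¹ • (opG k c l - 1)) f) := by
    intro l f hf a e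
    obtain ⟨r, hr⟩ := hf a e
    exact ⟨_ * r, by rw [lgOp_apply hc q hq1 h1, hr, ← map_mul]⟩
  induction hz using Algebra.adjoin_induction generalizing f with
  | mem z hz =>
    rcases hz with ⟨y, rfl⟩ | rfl | rfl
    · rw [verma, Dq.lift_gen]
      cases y
      · intro a e
        obtain ⟨r, hr⟩ := hf (a + 1) e
        rcases e with _ | e
        · exact ⟨vcoef c lam mu (a + 1) 0 * r, by rw [map_mul, ← hr]; exact zero_add _⟩
        · obtain ⟨r', hr'⟩ := hf a e
          exact ⟨qs c (-2) ^ a * r' + vcoef c lam mu (a + 1) (e + 1) * r, by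
            rw [map_add, map_mul, map_mul, map_pow, ← hr, ← hr']; rfl⟩
      · exact hG _ _ hf
      · exact hGi _ _ hf
      · intro a e
        rcases a with _ | a
        · exact ⟨0, by rw [map_zero]; rfl⟩
        · exact hf a e
      · exact hG _ _ hf
      · exact hGi _ _ hf
    · rw [map_smul, map_sub, map_one, verma, Dq.lift_gen]
      exact hL _ _ hf
    · rw [map_smul, map_sub, map_one, verma, Dq.lift_gen]
      exact hL _ _ hf
  | algebraMap r =>
    intro a e
    obtain ⟨r', hr'⟩ := hf a e
    refine ⟨r * r', ?_⟩
    rw [Algebra.algebraMap_eq_smul_one, Dq.base_smul, map_smul, map_one, map_mul, ← hr']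
    rfl
  | add x y _ _ hx hy =>
    intro a e
    obtain ⟨r, hr⟩ := hx f hf a e
    obtain ⟨r', hr'⟩ := hy f hf a e
    exact ⟨r + r', by rw [map_add, map_add, ← hr, ← hr']; rfl⟩
  | mul x y _ _ hx hy =>
    rw [map_mul]
    exact hx _ (hy f hf)

include hq1 in
theorem verma_mono (h1 : (q : k) - 1 ≠ 0) (a₀ e₀ b d : ℕ) :
    verma lam mu hc q hq hq2 (Dq.Y q ^ a₀ * ((((q : k) - 1)⁻¹ • (Dq.g q - 1)) ^ b *
      (((q : k) - 1)⁻¹ • (Dq.h q - 1)) ^ d) * Dq.X q ^ e₀) (dl k 0 0) =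
    algebraMap Rt k ((qd c (lam + 2 * e₀) * (qd c 1)⁻¹) ^ b * (qd c (mu + 2 * e₀) * (qd c 1)⁻¹) ^ d)
      • dl k a₀ e₀ := by
  have hX : ∀ n : ℕ, (opX k c lam mu ^ n) (dl k 0 0) = dl k 0 n := by
    intro n
    induction n with
    | zero => rfl
    | succ n ih =>
      rw [pow_succ', Module.End.mul_apply, ih]
      funext a e
      rcases e with _ | e <;> rcases a with _ | a <;> simp [opX, dl]
  have hY : ∀ n e : ℕ, (opY k ^ n) (dl k 0 e) = dl k n e := by
    intro n e₁
    induction n with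
    | zero => rfl
    | succ n ih =>
      rw [pow_succ', Module.End.mul_apply, ih]
      funext a e
      rcases a with _ | a <;> simp [opY, dl]
  have hL : ∀ l (n e : ℕ), ((((q : k) - 1)⁻¹ • (opG k c l - 1)) ^ n) (dl k 0 e) =
      algebraMap Rt k ((qd c (l + 2 * e) * (qd c 1)⁻¹) ^ n) • dl k 0 e := by
    intro l n e₁
    induction n with
    | zero => simp
    | succ n ih =>
      rw [pow_succ', Module.End.mul_apply, ih, map_smul]
      funext a e
      rw [Pi.smul_apply, Pi.smul_apply, lgOp_apply hc q hq1 h1, Pi.smul_apply, Pi.smul_apply,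
        smul_eq_mul, smul_eq_mul, pow_succ, map_mul _ (_ ^ n), mul_assoc]
      congr 1
      by_cases h : a = 0 ∧ e = e₁
      · rw [h.1, h.2]; simp
      · simp [dl, h]
  simp only [map_mul, map_pow, map_smul, map_sub, map_one]
  rw [verma, Dq.lift_gen, Dq.lift_gen, Dq.lift_gen, Dq.lift_gen]
  dsimp only
  rw [Module.End.mul_apply, Module.End.mul_apply, Module.End.mul_apply, hX, hL, map_smul, hL,
    map_smul, map_smul, hY, smul_smul, mul_comm]
  simp only [map_mul, map_pow]

end Verma

section Indep

theorem coeff_eq_zero_of_eval {ι : Type*} [DecidableEq ι] (s : Finset (ι × (ℕ × ℕ)))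
    (f : ι × (ℕ × ℕ) → ℂ) (j : ι)
    (h : ∀ u v : ℂ, ∑ i ∈ s, (if i.1 = j then f i * (u ^ i.2.1 * v ^ i.2.2) else 0) = 0)
    (b d : ℕ) (hs : (j, (b, d)) ∈ s) : f (j, (b, d)) = 0 := by
  set mon : ℕ × ℕ → (Fin 2 →₀ ℕ) := fun i => Finsupp.single 0 i.1 + Finsupp.single 1 i.2 with hmon
  have inj : ∀ i i', mon i = mon i' → i = i' := by
    intro i i' h
    have h0 := DFunLike.congr_fun h 0
    have h1 := DFunLike.congr_fun h 1
    simp [hmon] at h0 h1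
    exact Prod.ext h0 h1
  set P : MvPolynomial (Fin 2) ℂ :=
    ∑ i ∈ s, (if i.1 = j then MvPolynomial.monomial (mon i.2) (f i) else 0) with hP
  have hP0 : P = 0 := by
    apply MvPolynomial.funext
    intro x
    rw [map_zero, hP, map_sum, ← h (x 0) (x 1)]
    refine Finset.sum_congr rfl fun i _ => ?_
    split_ifs
    · rw [MvPolynomial.eval_monomial, Finsupp.prod_fintype _ _ (by simp), Fin.prod_univ_two]
      simp [hmon]
    · simp
  have hc := congrArg (MvPolynomial.coeff (mon (b, d))) hP0
  rw [hP, MvPolynomial.coeff_sum, MvPolynomial.coeff_zero, Finset.sum_eq_single (j, (b, d))] at hc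
  · simpa using hc
  · rintro ⟨i, i'⟩ _ hne
    by_cases hi : i = j
    · subst hi
      rw [if_pos rfl, MvPolynomial.coeff_monomial, if_neg]
      intro e
      have e' : i' = (b, d) := inj _ _ e
      exact hne (by rw [e'])
    · rw [if_neg hi, MvPolynomial.coeff_zero]
  · intro h; exact absurd hs h

variable {k : Type*} [Field k] [Algebra Rt k] {c : ℂ}

theorem constCoeff_qd_div (hc : c ≠ 0) (l : ℂ) :
    PowerSeries.constantCoeff (qd c l * (qd c 1)⁻¹) = l := by
  rw [map_mul, PowerSeries.constantCoeff_inv, constCoeff_qd, constCoeff_qd, one_mul, mul_assoc,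
    mul_inv_cancel₀ hc, mul_one]

theorem Dq.mono_independent (hc : c ≠ 0) (q : kˣ) (hq : algebraMap Rt k (qs c 2) = (q : k) ^ 2)
    (hq2 : (q : k) ^ 2 ≠ 1) (hq1 : algebraMap Rt k (qs c 1 - 1) = (q : k) - 1)
    (h1 : (q : k) - 1 ≠ 0) (hinj : Function.Injective (algebraMap Rt k))
    (f : ((ℕ × ℕ) × (ℕ × ℕ)) →₀ Rt) (z : Dq q)
    (hz : z ∈ Algebra.adjoin Rt (Set.range (Dq.gen q) ∪
      {(((q : k) - 1)⁻¹ • (Dq.g q - 1)), (((q : k) - 1)⁻¹ • (Dq.h q - 1))}))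
    (h : ∑ i ∈ f.support, f i • (Dq.Y q ^ i.1.1 * ((((q : k) - 1)⁻¹ • (Dq.g q - 1)) ^ i.2.1 *
      (((q : k) - 1)⁻¹ • (Dq.h q - 1)) ^ i.2.2) * Dq.X q ^ i.1.2) = tt • z)
    (i : (ℕ × ℕ) × (ℕ × ℕ)) : PowerSeries.constantCoeff (f i) = 0 := by
  by_cases hi : i ∈ f.support
  swap
  · rw [Finsupp.notMem_support_iff.1 hi, map_zero]
  obtain ⟨⟨a, e⟩, b, d⟩ := i
  refine coeff_eq_zero_of_eval f.support (fun i => PowerSeries.constantCoeff (f i)) (a, e)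
    (fun u v => ?_) b d hi
  set lam : ℂ := u - 2 * e with hlam
  set mu : ℂ := v - 2 * e with hmu
  have hd : IsIntegral' (dl k 0 0) := by
    intro a e
    by_cases h : a = 0 ∧ e = 0
    · exact ⟨1, by rw [map_one, dl, if_pos h]⟩
    · exact ⟨0, by rw [map_zero, dl, if_neg h]⟩
  obtain ⟨r, hr⟩ := verma_integral lam mu hc q hq hq2 hq1 h1 hz _ hd a e
  have h2 := congrArg (fun w => verma lam mu hc q hq hq2 w (dl k 0 0) a e) h
  have hb : ∀ (r : Rt) (x : Dq q), verma lam mu hc q hq hq2 (r • x) =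
      algebraMap Rt k r • verma lam mu hc q hq hq2 x := fun r x => by
    rw [Dq.base_smul, map_smul]
  simp only [hb, map_sum, LinearMap.sum_apply, LinearMap.smul_apply,
    verma_mono lam mu hc q hq hq2 hq1 h1, Finset.sum_apply, Pi.smul_apply] at h2
  rw [hr, smul_eq_mul, ← map_mul] at h2
  have h3 : ∑ i ∈ f.support, (if i.1 = (a, e) then f i * ((qd c (lam + 2 * e) * (qd c 1)⁻¹) ^ i.2.1 *
      (qd c (mu + 2 * e) * (qd c 1)⁻¹) ^ i.2.2) else 0) = tt * r := by
    apply hinj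
    rw [← h2, map_sum]
    refine Finset.sum_congr rfl fun i _ => ?_
    obtain ⟨⟨a', e'⟩, i⟩ := i
    by_cases hi : (a', e') = (a, e)
    · rw [if_pos hi]
      obtain ⟨rfl, rfl⟩ := Prod.mk.inj hi
      rw [dl, if_pos ⟨rfl, rfl⟩, map_mul, smul_eq_mul, smul_eq_mul, mul_one]
    · rw [if_neg hi, dl, if_neg, smul_zero, smul_zero, map_zero]
      rintro ⟨rfl, rfl⟩
      exact hi rfl
  have h4 := congrArg PowerSeries.constantCoeff h3
  rw [map_sum, map_mul, PowerSeries.constantCoeff_X, zero_mul] at h4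
  refine Eq.trans ?_ h4
  refine Finset.sum_congr rfl fun i _ => ?_
  split_ifs
  · rw [map_mul, map_mul, map_pow, map_pow, constCoeff_qd_div hc, constCoeff_qd_div hc, hlam, hmu,
      sub_add_cancel, sub_add_cancel]
  · rw [map_zero]

end Indep

section Iso

variable {c : ℂ} (hc : c ≠ 0)

theorem log_mod {A : Type*} [Ring A] [Algebra Rt A] [Module.IsTorsionFree Rt A] (hc : c ≠ 0)
    {L v : Comp A} (h : qpow c 1 L = 1 + (qs c 1 - 1) • v) : ∃ w, L = v + tt • w := by
  obtain ⟨y, hy⟩ := qpow_mod_two (c := c) L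
  obtain ⟨r, hr⟩ := qd_eq c 1
  rw [h, add_assoc, add_right_inj, ← tt_mul_qd, mul_smul, pow_two, mul_smul, ← smul_add] at hy
  have e := smul_tt_cancel (n := 1) ((congrArg (· • _) (pow_one tt)).trans
    (hy.trans (congrArg (· • _) (pow_one tt).symm)))
  rw [hr, one_mul, add_smul, mul_smul, ← sub_eq_iff_eq_add, add_sub_assoc, ← smul_sub] at e
  refine ⟨(cst c⁻¹ : Rt) • (r • v - y), ?_⟩
  rw [← C_smul_cancel hc L, ← e, smul_add, C_smul_cancel hc, smul_comm]

/-- The change of variables as an algebra map. -/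
noncomputable def thetaHom : UL c →ₐ[Rt] Dhat c := UL.cartanLift hc (Dhat.cartanRels hc)

theorem thetaHom_H : thetaHom hc (UL.H c) = Dhat.H hc := UL.cartanLift_H ..
theorem thetaHom_C : thetaHom hc (UL.C c) = Dhat.C hc := UL.cartanLift_C ..
theorem thetaHom_X : thetaHom hc (UL.X c) = Dhat.gen c DGen.X := UL.cartanLift_X ..
theorem thetaHom_Y : thetaHom hc (UL.Y c) = Dhat.gen c DGen.Y := UL.cartanLift_Y ..
theorem thetaHom_G : thetaHom hc (-UL.H c + UL.C c) = Dhat.G hc := by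
  rw [map_add, map_neg, thetaHom_H, thetaHom_C, Dhat.neg_H_add_C]
theorem thetaHom_Gb : thetaHom hc (-UL.H c - UL.C c) = Dhat.Gb hc := by
  rw [map_sub, map_neg, thetaHom_H, thetaHom_C, Dhat.neg_H_sub_C]

theorem Dhat.G_mod : ∃ w, Dhat.G hc = of (DR.lg c) + tt • w := by
  refine log_mod hc ?_
  rw [Dhat.qpow_G, Dhat.gen_eq, DR.g_eq hc, map_add, map_one, map_smul]
theorem Dhat.Gb_mod : ∃ w, Dhat.Gb hc = of (DR.lh c) + tt • w := by
  refine log_mod hc ?_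
  rw [Dhat.qpow_Gb, Dhat.gen_eq, DR.h_eq hc, map_add, map_one, map_smul]

theorem thetaHom_surjective : Function.Surjective (thetaHom hc) := by
  refine surjective_of_mod_tt Comp.tComplete Comp.sep (thetaHom hc).toLinearMap ?_
  have key : TDense ((thetaHom hc).range : Set (Dhat c)) := by
    refine (TDense.of_eq_top (DR.adjoin_gen c)).comp.of_forall ?_
    have mem : ∀ {x : Dhat c} (y : UL c), thetaHom hc y = x →
        ∃ p ∈ Algebra.adjoin Rt ((thetaHom hc).range : Set (Dhat c)), ∃ z, x = p + tt • z := by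
      intro x y h
      exact ⟨x, Algebra.subset_adjoin ⟨y, h⟩, 0, by rw [smul_zero, add_zero]⟩
    have inv : ∀ {L u v : Dhat c} (y : UL c), thetaHom hc y = L → qpow c 1 L = u → u * v = 1 →
        thetaHom hc (qpow c 1 (-y)) = v := by
      intro L u v y h1 h2 h3
      rw [qpow_map, map_neg, h1]
      have := qpow_neg_mul (c := c) 1 L
      rw [h2] at this
      rw [← mul_one (qpow c 1 (-L)), ← h3, ← mul_assoc, this, one_mul]
    have pos : ∀ {L u : Dhat c} (y : UL c), thetaHom hc y = L → qpow c 1 L = u →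
        thetaHom hc (qpow c 1 y) = u := by
      intro L u y h1 h2
      rw [qpow_map, h1, h2]
    rintro _ ⟨_, ⟨z, rfl⟩ | rfl | rfl, rfl⟩
    · cases z
      · exact mem _ (thetaHom_X hc)
      · exact mem _ (pos _ (thetaHom_G hc) (Dhat.qpow_G hc))
      · exact mem _ (inv _ (thetaHom_G hc) (Dhat.qpow_G hc)
          (by rw [Dhat.gen_eq, ← map_mul, DR.g_gi, map_one]))
      · exact mem _ (thetaHom_Y hc)
      · exact mem _ (pos _ (thetaHom_Gb hc) (Dhat.qpow_Gb hc))
      · exact mem _ (inv _ (thetaHom_Gb hc) (Dhat.qpow_Gb hc)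
          (by rw [Dhat.gen_eq, ← map_mul, DR.h_hi, map_one]))
    · obtain ⟨w, hw⟩ := Dhat.G_mod hc
      exact ⟨Dhat.G hc, Algebra.subset_adjoin ⟨_, thetaHom_G hc⟩, -w, by rw [hw, smul_neg]; abel⟩
    · obtain ⟨w, hw⟩ := Dhat.Gb_mod hc
      exact ⟨Dhat.Gb hc, Algebra.subset_adjoin ⟨_, thetaHom_Gb hc⟩, -w, by rw [hw, smul_neg]; abel⟩
  intro y
  obtain ⟨p, hp, z, rfl⟩ := key y
  rw [Algebra.adjoin_eq] at hp
  obtain ⟨x, rfl⟩ := hp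
  exact ⟨x, z, rfl⟩

/-- The monomials of the double that correspond to `UL.mono` modulo `t`. -/
noncomputable def DR.mono (c : ℂ) (i : (ℕ × ℕ) × (ℕ × ℕ)) : DR c :=
  DR.gen c DGen.Y ^ i.1.1 * (DR.lg c ^ i.2.1 * DR.lh c ^ i.2.2) * DR.gen c DGen.X ^ i.1.2

include hc in
theorem DR.mono_independent (f : ((ℕ × ℕ) × (ℕ × ℕ)) →₀ Rt) (z : DR c)
    (h : f.sum (fun i r => r • DR.mono c i) = tt • z) (i : (ℕ × ℕ) × (ℕ × ℕ)) :
    PowerSeries.constantCoeff (f i) = 0 := by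
  refine Dq.mono_independent hc (qK c) (qK_sq c) (qK_sq_ne hc) (qK_sub_one c) (qK_sub_one_ne hc)
    algebraMap_Kt_injective f z.1 z.2 ?_ i
  have := congrArg (DR c).val h
  rw [Finsupp.sum, map_sum] at this
  exact this

theorem thetaHom_mono (i : (ℕ × ℕ) × (ℕ × ℕ)) :
    ∃ w, thetaHom hc (UL.mono c i) = of (DR.mono c i) + tt • w := by
  have hmk : ∀ a b : Dhat c, (∃ y, a = b + tt • y) ↔
      Ideal.Quotient.mkₐ Rt (tIdeal (Dhat c) 1) a = Ideal.Quotient.mkₐ Rt (tIdeal (Dhat c) 1) b := by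
    intro a b
    rw [Ideal.Quotient.mkₐ_eq_mk, Ideal.Quotient.eq, mem_tIdeal]
    simp only [pow_one, sub_eq_iff_eq_add']
  rw [hmk]
  have h1 := (hmk _ _).1 (Dhat.G_mod hc)
  have h2 := (hmk _ _).1 (Dhat.Gb_mod hc)
  rw [UL.mono, DR.mono]
  simp only [map_mul, map_pow]
  rw [thetaHom_G, thetaHom_Gb, thetaHom_X, thetaHom_Y, h1, h2]
  rfl

theorem thetaHom_injective : Function.Injective (thetaHom hc) := by
  refine injective_of_mod_tt Comp.sep (thetaHom hc).toLinearMap ?_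
  intro x z hz
  obtain ⟨f, y, rfl⟩ := UL.exists_mono hc x
  choose w hw using thetaHom_mono hc
  rw [AlgHom.toLinearMap_apply, map_add, map_smul, Finsupp.sum, map_sum] at hz
  simp only [map_smul, hw, smul_add, Finset.sum_add_distrib] at hz
  have hs : ∃ b, f.sum (fun i r => r • DR.mono c i) = tt ^ 1 • b := by
    refine Comp.of_eq_smul_iff.1 ⟨z - thetaHom hc y - ∑ i ∈ f.support, f i • w i, ?_⟩
    rw [Finsupp.sum, map_sum, pow_one, smul_sub, smul_sub, ← hz, Finset.smul_sum]
    simp only [map_smul, smul_comm tt]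
    abel
  obtain ⟨b, hb⟩ := hs
  rw [pow_one] at hb
  have h0 := DR.mono_independent hc f b hb
  have hd : ∀ i, ∃ r, f i = tt * r := fun i =>
    PowerSeries.X_dvd_iff.2 (h0 i)
  choose r hr using hd
  refine ⟨∑ i ∈ f.support, r i • UL.mono c i + y, ?_⟩
  rw [smul_add, Finset.smul_sum, Finsupp.sum]
  congr 1
  refine Finset.sum_congr rfl fun i _ => ?_
  rw [hr i, mul_smul]

/-- The change of variables. -/
noncomputable def thetaEquiv : UL c ≃ₐ[Rt] Dhat c :=
  AlgEquiv.ofBijective (thetaHom hc) ⟨thetaHom_injective hc, thetaHom_surjective hc⟩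

include hc in
theorem UL.isTorsionFree : Module.IsTorsionFree Rt (UL c) := by
  refine isTorsionFree_of_tt fun x hx => thetaHom_injective hc ?_
  have h := congrArg (thetaHom hc) hx
  rw [map_smul, map_zero] at h
  rw [map_zero]
  exact smul_tt_cancel (n := 1) (by rw [pow_one, h, smul_zero])

end Iso

section Base

theorem tComplete_powerSeries : TComplete Rt where
  sep := tsep_powerSeries
  sum := by
    intro a
    refine ⟨PowerSeries.mk fun n => ∑ k ∈ Finset.range (n + 1), PowerSeries.coeff (n - k) (a k),
      fun n => ?_⟩
    have h : tt ^ n ∣ PowerSeries.mk (fun n => ∑ k ∈ Finset.range (n + 1),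
        PowerSeries.coeff (n - k) (a k)) - ∑ k ∈ Finset.range n, tt ^ k • a k := by
      rw [PowerSeries.X_pow_dvd_iff]
      intro m hm
      rw [map_sub, PowerSeries.coeff_mk, map_sum, sub_eq_zero]
      simp only [smul_eq_mul, PowerSeries.coeff_X_pow_mul']
      rw [← Finset.sum_filter]
      refine Finset.sum_congr ?_ fun _ _ => rfl
      ext k
      simp only [Finset.mem_range, Finset.mem_filter]
      omega
    obtain ⟨y, hy⟩ := h
    exact ⟨y, hy⟩

instance isTorsionFree_op {A : Type*} [Ring A] [Algebra Rt A] [Module.IsTorsionFree Rt A] :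
    Module.IsTorsionFree Rt Aᵐᵒᵖ := by
  refine isTorsionFree_of_tt fun x hx => unop_injective ?_
  refine smul_tt_cancel (n := 1) ?_
  rw [pow_one, ← unop_smul, hx, unop_zero, smul_zero]

end Base

section RelConstructions

variable {A B : Type*} [Ring A] [Algebra Rt A] [Ring B] [Algebra Rt B] {c : ℂ} (s : Rt)
  {H C X Y : Comp A}

theorem CartanRels.zero : CartanRels c (0 : Comp A) 0 0 0 := by
  constructor <;> simp

namespace CartanRels

variable (hr : CartanRels c H C X Y)
include hr

theorem sum {f g : Comp A →ₐ[Rt] Comp B} (hfg : ∀ a b, f a * g b = g b * f a) :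
    CartanRels c (f H + g H) (f C + g C) (f X + f (gG s c H C) * g X)
      (f Y + f (gB s c H C) * g Y) := by
  have hf := hr.map f
  have hg := hr.map g
  have gH : H * gG s c H C = gG s c H C * H := by
    rw [hr.gG_eq]; exact (hr.commute_cartan _ _).1.symm
  have gC : C * gG s c H C = gG s c H C * C := by
    rw [hr.gG_eq]; exact (hr.commute_cartan _ _).2.symm
  have bH : H * gB s c H C = gB s c H C * H := by
    rw [hr.gB_eq]; exact (hr.commute_cartan _ _).1.symm
  have bC : C * gB s c H C = gB s c H C * C := by
    rw [hr.gB_eq]; exact (hr.commute_cartan _ _).2.symm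
  have sw : ∀ {z w x : Comp A}, z * w = w * z → f z * (f w * g x) = f w * g x * f z := by
    intro z w x h
    rw [← mul_assoc, ← map_mul, h, map_mul, mul_assoc, hfg, mul_assoc]
  have sw' : ∀ {z w x : Comp A}, g z * (f w * g x) = f w * (g z * g x) := by
    intro z w x
    rw [← mul_assoc, ← hfg, mul_assoc]
  constructor
  · simp only [mul_add, add_mul]
    rw [hf.CH, hg.CH, ← hfg H C, hfg C H]; abel
  · rw [mul_add, add_mul, add_mul, add_mul, mul_add, mul_add, hf.CX, sw gC, sw', hg.CX, hfg X C,
      mul_assoc (f _) (g X) (g C)]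
  · rw [mul_add, add_mul, add_mul, add_mul, mul_add, mul_add, hf.CY, sw bC, sw', hg.CY, hfg Y C,
      mul_assoc (f _) (g Y) (g C)]
  · rw [mul_add, add_mul, add_mul, add_mul, mul_add, mul_add, hf.HX, sw gH, sw', hg.HX, hfg X H,
      mul_assoc (f _) (g X) (g H), mul_add, mul_smul_comm, smul_add]; abel
  · rw [mul_add, add_mul, add_mul, add_mul, mul_add, mul_add, hf.HY, sw bH, sw', hg.HY, hfg Y H,
      mul_assoc (f _) (g Y) (g H), mul_add, mul_smul_comm, smul_add]; abel
  · have q2 : qs c 2 • (f X * (f (gB s c H C) * g Y)) = f (gB s c H C) * g Y * f X := by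
      rw [← mul_assoc, ← map_mul, ← smul_mul_assoc, ← map_smul, ← hr.hX, map_mul, mul_assoc, hfg,
        mul_assoc]
    have q3 : qs c 2 • (f (gG s c H C) * g X * f Y) = f Y * (f (gG s c H C) * g X) := by
      rw [mul_assoc, ← hfg, ← mul_assoc, ← map_mul, hr.gY, map_smul, smul_mul_assoc, smul_smul,
        qs_mul_neg, one_smul, map_mul, mul_assoc]
    have q4 : f (gG s c H C) * g X * (f (gB s c H C) * g Y) =
        f (gG s c H C * gB s c H C) * g (X * Y) := by
      rw [mul_assoc, sw', ← mul_assoc, ← map_mul, ← map_mul]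
    have q5 : f (gB s c H C) * g Y * (f (gG s c H C) * g X) =
        f (gG s c H C * gB s c H C) * g (Y * X) := by
      rw [mul_assoc, sw', ← mul_assoc, ← map_mul, ← map_mul, (hr.commute_gG_gB s).eq]
    have e : qs c 2 • ((f X + f (gG s c H C) * g X) * (f Y + f (gB s c H C) * g Y)) -
        (f Y + f (gB s c H C) * g Y) * (f X + f (gG s c H C) * g X) =
        f (qs c 2 • (X * Y) - Y * X) +
          f (gG s c H C * gB s c H C) * g (qs c 2 • (X * Y) - Y * X) := by
      rw [add_mul, mul_add, mul_add, add_mul, mul_add, mul_add, q4, q5, smul_add, smul_add,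
        smul_add, q2, q3, map_sub f, map_smul f, map_mul f X, map_mul f Y, map_sub g, map_smul g,
        mul_sub, mul_smul_comm]
      abel
    rw [e, smul_add, ← mul_smul_comm (1 - qs c (-2)) (f _), ← map_smul f, ← map_smul g, hr.XY, hr.gG_mul_gB, smul_add,
      qpow_add (a := (cst (-2) : Rt) • f H) (b := (cst (-2) : Rt) • g H),
      map_sub, map_sub, qpow_map, qpow_map, map_smul, map_smul, map_one, map_one, mul_sub, mul_one]
    · abel
    · exact (((show Commute (f H) (g H) from hfg _ _).smul_left _).smul_right _)

theorem opRels : CartanRels c (of (op (-H)) : Comp (Comp A)ᵐᵒᵖ)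
    (of (op (-C))) (of (op (-(gGi s c H C * X))))
    (of (op (-(gBi s c H C * Y)))) := by
  have com : ∀ a b : Rt, H * qpow c 1 (a • H + b • C) = qpow c 1 (a • H + b • C) * H :=
    fun a b => (hr.commute_cartan a b).1.symm.eq
  have com' : ∀ a b : Rt, C * qpow c 1 (a • H + b • C) = qpow c 1 (a • H + b • C) * C :=
    fun a b => (hr.commute_cartan a b).2.symm.eq
  have giH : H * gGi s c H C = gGi s c H C * H := by rw [hr.gGi_eq, com]
  have giC : C * gGi s c H C = gGi s c H C * C := by rw [hr.gGi_eq, com']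
  have biH : H * gBi s c H C = gBi s c H C * H := by rw [hr.gBi_eq, com]
  have biC : C * gBi s c H C = gBi s c H C * C := by rw [hr.gBi_eq, com']
  have Ygi : Y * gGi s c H C = qs c (-2) • (gGi s c H C * Y) := by
    calc Y * gGi s c H C = gGi s c H C * (gG s c H C * Y) * gGi s c H C := by
          rw [← mul_assoc, gGi_mul_gG, one_mul]
      _ = _ := by
        rw [hr.gY, mul_smul_comm, smul_mul_assoc, mul_assoc, mul_assoc, gG_mul_gGi, mul_one]
  have bb : gGi s c H C * gBi s c H C = qpow c 1 ((cst (-2) : Rt) • -H) := by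
    rw [hr.gGi_eq, hr.gBi_eq, ← qpow_add (hr.commute_comb _ _ _ _)]
    congr 1
    rw [add_add_add_comm, ← add_smul, ← add_smul, neg_add_cancel, zero_smul, add_zero, smul_neg,
      ← neg_smul, ← map_neg, neg_neg]
    congr 1
    rw [← map_one (cst (R := ℂ)), ← map_add]
    norm_num
  have cg : gBi s c H C * gGi s c H C = gGi s c H C * gBi s c H C := by
    rw [hr.gGi_eq, hr.gBi_eq, ← qpow_add (hr.commute_comb _ _ _ _),
      ← qpow_add (hr.commute_comb _ _ _ _), add_comm]
  have hE : qpow c 1 ((cst (-2) : Rt) • (of (op (-H)) :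
      Comp (Comp A)ᵐᵒᵖ)) = of (op
        (qpow c 1 ((cst (-2) : Rt) • -H))) := by
    refine ((qpow_isSum c 1 _).unique Comp.sep ?_)
    have := (qpow_isSum c 1 ((cst (-2) : Rt) • -H)).map
      ((of (A := (Comp A)ᵐᵒᵖ)).toLinearMap ∘ₗ (opLinearEquiv Rt).toLinearMap)
    convert this using 2 with k
    · simp only [LinearMap.comp_apply, LinearEquiv.coe_coe, coe_opLinearEquiv,
        AlgHom.toLinearMap_apply, op_smul, op_pow, map_smul, map_pow]
    · rfl
  have mm : ∀ a b : Comp A, (of (op (-a)) * of (op (-b)) :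
      Comp (Comp A)ᵐᵒᵖ) = of (op (b * a)) := fun a b => by
    rw [← map_mul, ← op_mul, neg_mul_neg]
  constructor
  · rw [mm, mm, hr.CH]
  · rw [mm, mm, mul_assoc, ← hr.CX, ← mul_assoc, ← mul_assoc, giC]
  · rw [mm, mm, mul_assoc, ← hr.CY, ← mul_assoc, ← mul_assoc, biC]
  · rw [mm, mm, ← map_smul, ← op_smul, ← map_add, ← op_add, ← mul_assoc,
      giH, mul_assoc (gGi s c H C) H, hr.HX, mul_add, mul_smul_comm, smul_neg, mul_assoc,
      add_neg_cancel_right]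
  · rw [mm, mm, ← map_smul, ← op_smul, ← map_add, ← op_add, ← mul_assoc,
      biH, mul_assoc (gBi s c H C) H, hr.HY, mul_add, mul_smul_comm, smul_neg, mul_assoc,
      add_neg_cancel_right]
  · have t1 : gBi s c H C * Y * (gGi s c H C * X) =
        qs c (-2) • (gGi s c H C * gBi s c H C * (Y * X)) := by
      rw [mul_assoc, ← mul_assoc Y, Ygi, smul_mul_assoc, mul_smul_comm, ← cg]
      simp only [mul_assoc]
    have t2 : gGi s c H C * X * (gBi s c H C * Y) =
        qs c 2 • (gGi s c H C * gBi s c H C * (X * Y)) := by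
      rw [mul_assoc, ← mul_assoc X, hr.X_hi, smul_mul_assoc, mul_smul_comm]
      simp only [mul_assoc]
    have t3 : gGi s c H C * gBi s c H C * (gG s c H C * gB s c H C) = 1 := by
      rw [(hr.commute_gG_gB s).eq, mul_assoc, ← mul_assoc (gBi s c H C), gBi_mul_gB, one_mul,
        gGi_mul_gG]
    rw [hE, mm, mm, ← map_smul, ← map_sub, ← map_smul, ← op_smul, ← op_sub,
      ← op_smul, ← map_one of, ← map_sub, ← op_one,
      ← op_sub, t1, t2, smul_smul, qs_mul_neg, one_smul, ← mul_smul_comm (qs c 2),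
      ← mul_sub, ← neg_sub (qs c 2 • (X * Y)), mul_neg, smul_neg, ← mul_smul_comm, hr.XY', mul_sub, t3, mul_one, bb,
      neg_sub]

end CartanRels

end RelConstructions

section Family

variable {c : ℂ} (hc : c ≠ 0) (s : Rt)

/-- A family of quasitriangular Hopf structures on `U_q(sl₂) ⊗ U_{q⁻¹}(ℂ)` that joins the tensor
product structure (`s = 0`) to its twist (`s = 1`). -/
noncomputable def UL.data : QTData (UL c) :=
  haveI := UL.isTorsionFree hc
  { comul := UL.cartanLift hc ((UL.cartanRels hc).sum s
      (f := inl (UL c) (UL c)) (g := inr (UL c) (UL c)) inl_inr_comm)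
    counit := (Comp.ofEquiv tComplete_powerSeries).symm.toAlgHom.comp
      (UL.cartanLift hc (B := Rt) CartanRels.zero)
    antipode := (opLinearEquiv Rt).symm.toLinearMap ∘ₗ
      (((Comp.ofEquiv (A := (UL c)ᵐᵒᵖ) (Comp.tComplete.of_equiv
        (opLinearEquiv Rt))).symm.toAlgHom.comp
      (UL.cartanLift hc (B := (UL c)ᵐᵒᵖ) ((UL.cartanRels hc).opRels s))).toLinearMap)
    R := qpow c 1 (qform (cst (1 / 2)) s (inl (UL c) (UL c) (UL.H c)) (inl _ _ (UL.C c))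
      (inr _ _ (UL.H c)) (inr _ _ (UL.C c))) *
      theta c (inl _ _ (gBi s c (UL.H c) (UL.C c) * UL.Y c) * inr _ _ (UL.X c)) }

theorem UL.isCartanForm :
    IsCartanForm c s (UL.H c) (UL.C c) (UL.X c) (UL.Y c) (UL.data hc s) := by
  have := UL.isTorsionFree hc
  have ha : ∀ x y : UL c, UL.cartanLift hc (B := (UL c)ᵐᵒᵖ) ((UL.cartanRels hc).opRels s) x =
      of (op y) → (UL.data hc s).antipode x = y := by
    intro x y h
    have : (UL.data hc s).antipode x = unop ((Comp.ofEquiv (A := (UL c)ᵐᵒᵖ)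
        (Comp.tComplete.of_equiv (opLinearEquiv Rt))).symm
        (UL.cartanLift hc (B := (UL c)ᵐᵒᵖ) ((UL.cartanRels hc).opRels s) x)) := rfl
    rw [this, h, ← Comp.ofEquiv_apply (Comp.tComplete.of_equiv (opLinearEquiv Rt)),
      AlgEquiv.symm_apply_apply, unop_op]
  have he : ∀ x : UL c, UL.cartanLift hc (B := Rt) CartanRels.zero x = 0 →
      (UL.data hc s).counit x = 0 := by
    intro x h
    have : (UL.data hc s).counit x = (Comp.ofEquiv tComplete_powerSeries).symm
      (UL.cartanLift hc (B := Rt) CartanRels.zero x) := rfl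
    rw [this, h, map_zero]
  constructor
  · exact UL.cartanLift_H hc ((UL.cartanRels hc).sum s inl_inr_comm)
  · exact UL.cartanLift_C hc ((UL.cartanRels hc).sum s inl_inr_comm)
  · exact UL.cartanLift_X hc ((UL.cartanRels hc).sum s inl_inr_comm)
  · exact UL.cartanLift_Y hc ((UL.cartanRels hc).sum s inl_inr_comm)
  · exact he _ (UL.cartanLift_H hc CartanRels.zero)
  · exact he _ (UL.cartanLift_C hc CartanRels.zero)
  · exact he _ (UL.cartanLift_X hc CartanRels.zero)
  · exact he _ (UL.cartanLift_Y hc CartanRels.zero)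
  · exact ha _ _ (by rw [map_one, op_one, map_one])
  · intro a b
    change unop (((Comp.ofEquiv (A := (UL c)ᵐᵒᵖ) (Comp.tComplete.of_equiv
        (opLinearEquiv Rt))).symm.toAlgHom.comp
      (UL.cartanLift hc (B := (UL c)ᵐᵒᵖ) ((UL.cartanRels hc).opRels s))) (a * b)) = _
    rw [map_mul]
    rfl
  · exact ha _ _ (UL.cartanLift_H hc ((UL.cartanRels hc).opRels s))
  · exact ha _ _ (UL.cartanLift_C hc ((UL.cartanRels hc).opRels s))
  · exact ha _ _ (UL.cartanLift_X hc ((UL.cartanRels hc).opRels s))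
  · exact ha _ _ (UL.cartanLift_Y hc ((UL.cartanRels hc).opRels s))
  · rfl

theorem UL.isQTHopf : (UL.data hc s).IsQTHopf :=
  (UL.isCartanForm hc s).isQTHopf (UL.cartanRels hc) UL.dense

end Family

section Anti

variable {A B : Type*} [Ring A] [Algebra Rt A] [Ring B] [Algebra Rt B]

theorem TSep.op (h : TSep B) : TSep Bᵐᵒᵖ := by
  intro x hx
  refine unop_injective (h _ fun n => ?_)
  obtain ⟨y, rfl⟩ := hx n
  exact ⟨y.unop, rfl⟩

/-- An anti-homomorphism as a homomorphism to the opposite algebra. -/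
noncomputable def antiHom (f : A →ₗ[Rt] B) (f1 : f 1 = 1) (fm : ∀ a b, f (a * b) = f b * f a) : A →ₐ[Rt] Bᵐᵒᵖ :=
  AlgHom.ofLinearMap ((opLinearEquiv Rt).toLinearMap ∘ₗ f)
    (congrArg op f1) (fun a b => congrArg op (fm a b))

theorem TDense.antiIntertwine {S : Set A} (hS : TDense S) (hB : TSep B) {f g : A →ₗ[Rt] B} {r : B}
    (f1 : f 1 = 1) (fm : ∀ a b, f (a * b) = f b * f a)
    (g1 : g 1 = 1) (gm : ∀ a b, g (a * b) = g b * g a)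
    (h : ∀ p ∈ S, r * f p = g p * r) (a : A) : r * f a = g a * r :=
  (op_injective (hS.intertwine hB.op (r := op r)
    (f := antiHom g g1 gm) (g := antiHom f f1 fm)
    (fun p hp => congrArg op (h p hp).symm) a)).symm

theorem TDense.antiHom_ext {S : Set A} (hS : TDense S) (hB : TSep B) {f g : A →ₗ[Rt] B}
    (f1 : f 1 = 1) (fm : ∀ a b, f (a * b) = f b * f a)
    (g1 : g 1 = 1) (gm : ∀ a b, g (a * b) = g b * g a)
    (h : ∀ p ∈ S, f p = g p) (a : A) : f a = g a := by
  simpa using hS.antiIntertwine hB (r := 1) f1 fm g1 gm (by simpa using h) a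

end Anti

section Retract

variable {A B : Type*} [Ring A] [Algebra Rt A] [Ring B] [Algebra Rt B]

namespace QTData

variable (d : QTData A) (p : A →ₐ[Rt] B) (ι : B →ₐ[Rt] A)

/-- The structure maps induced on `B` by those on `A`, an algebra map `p : A → B` and
a section `ι` of it. -/
noncomputable def retract : QTData B where
  comul := (sqHom p).comp (d.comul.comp ι)
  counit := d.counit.comp ι
  antipode := p.toLinearMap ∘ₗ d.antipode ∘ₗ ι.toLinearMap
  R := sqHom p d.R

/-- `p` maps the structure maps of `d` to those of the retract, on the elements of `S`. -/
def RetractsOn (S : Set A) : Prop :=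
  ∀ z ∈ S, ι (p z) = z ∨
    (p z = 0 ∧ sqHom p (d.comul z) = 0 ∧ d.counit z = 0 ∧ p (d.antipode z) = 0)

variable {d p ι} {S : Set A} (hS : TDense S) (h : d.RetractsOn p ι S)
include hS h

theorem retract_comul (a : A) : (d.retract p ι).comul (p a) = sqHom p (d.comul a) := by
  have := hS.algHom_ext Comp.sep (f := (d.retract p ι).comul.comp p)
    (g := (sqHom p).comp d.comul) (fun z hz => by
      change sqHom p (d.comul (ι (p z))) = sqHom p (d.comul z)
      rcases h z hz with e | ⟨e, e1, -, -⟩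
      · rw [e]
      · rw [e, e1, map_zero, map_zero, map_zero])
  exact DFunLike.congr_fun this a

theorem retract_counit (a : A) : (d.retract p ι).counit (p a) = d.counit a := by
  have := hS.algHom_ext tsep_powerSeries (f := (d.retract p ι).counit.comp p)
    (g := d.counit) (fun z hz => by
      change d.counit (ι (p z)) = d.counit z
      rcases h z hz with e | ⟨e, -, e1, -⟩
      · rw [e]
      · rw [e, e1, map_zero, map_zero])
  exact DFunLike.congr_fun this a

theorem retract_antipode (hB : TSep B) (h1 : d.antipode 1 = 1)
    (hm : ∀ a b, d.antipode (a * b) = d.antipode b * d.antipode a) (a : A) :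
    (d.retract p ι).antipode (p a) = p (d.antipode a) := by
  refine hS.antiHom_ext hB (f := (d.retract p ι).antipode ∘ₗ p.toLinearMap)
    (g := p.toLinearMap ∘ₗ d.antipode) ?_ ?_ ?_ ?_ ?_ a
  · change p (d.antipode (ι (p 1))) = 1
    rw [map_one, map_one, h1, map_one]
  · intro a b
    change p (d.antipode (ι (p (a * b)))) = p (d.antipode (ι (p b))) * p (d.antipode (ι (p a)))
    rw [map_mul, map_mul, hm, map_mul]
  · change p (d.antipode 1) = 1
    rw [h1, map_one]
  · intro a b
    change p (d.antipode (a * b)) = p (d.antipode b) * p (d.antipode a)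
    rw [hm, map_mul]
  · intro z hz
    change p (d.antipode (ι (p z))) = p (d.antipode z)
    rcases h z hz with e | ⟨e, -, -, e1⟩
    · rw [e]
    · rw [e, e1, map_zero, map_zero, map_zero]

theorem IsQTHopf.retract (hd : d.IsQTHopf) (hp : ∀ b, p (ι b) = b) (hB : TComplete B)
    (h1 : d.antipode 1 = 1) (hm : ∀ a b, d.antipode (a * b) = d.antipode b * d.antipode a) :
    (d.retract p ι).IsQTHopf :=
  hd.of_surjective (fun b => ⟨ι b, hp b⟩) hB.isAdicComplete (retract_comul hS h)
    (retract_counit hS h) (retract_antipode hS h hB.sep h1 hm) rfl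

end QTData

end Retract

section Factors

variable {c : ℂ}

/-- `id ⊗ ε : U_q(sl₂) ⊗ U_{q⁻¹}(ℂ) → U_q(sl₂)`. -/
noncomputable def UL.fst (c : ℂ) : UL c →ₐ[Rt] Usl c :=
  tensorLift (AlgHom.id Rt (Usl c)) (Line.lift (0 : Usl c)) fun a =>
    Line.dense.commute Comp.sep (Line.lift (0 : Usl c)) (r := a) (by
      rintro _ rfl
      rw [Line.lift_C, mul_zero, zero_mul])

theorem UL.fst_inl (u : Usl c) : UL.fst c (inl _ _ u) = u := tensorLift_inl ..
theorem UL.fst_H : UL.fst c (UL.H c) = Usl.H c := UL.fst_inl _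
theorem UL.fst_E : UL.fst c (UL.E c) = Usl.E c := UL.fst_inl _
theorem UL.fst_F : UL.fst c (UL.F c) = Usl.F c := UL.fst_inl _
theorem UL.fst_C : UL.fst c (UL.C c) = 0 := (tensorLift_inr ..).trans (Line.lift_C _)
theorem UL.fst_X : UL.fst c (UL.X c) = qpow c (-1 / 2) (Usl.H c) * Usl.F c := by
  rw [UL.X, map_mul, qpow_map, UL.fst_H, UL.fst_F]
theorem UL.fst_Y : UL.fst c (UL.Y c) = qpow c (-1 / 2) (Usl.H c) * Usl.E c := by
  rw [UL.Y, map_mul, qpow_map, UL.fst_H, UL.fst_E]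
theorem UL.inl_fst_H : inl _ _ (UL.fst c (UL.H c)) = UL.H c := by rw [UL.fst_H]; rfl
theorem UL.inl_fst_X : inl _ _ (UL.fst c (UL.X c)) = UL.X c := by
  rw [UL.fst_X, map_mul, qpow_map]; rfl
theorem UL.inl_fst_Y : inl _ _ (UL.fst c (UL.Y c)) = UL.Y c := by
  rw [UL.fst_Y, map_mul, qpow_map]; rfl

theorem SlRels.zero {A : Type*} [Ring A] [Algebra Rt A] : SlRels c (0 : Comp A) 0 0 0 := by
  constructor <;> simp

/-- `ε ⊗ id : U_q(sl₂) ⊗ U_{q⁻¹}(ℂ) → U_{q⁻¹}(ℂ)`. -/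
noncomputable def UL.snd (hc : c ≠ 0) : UL c →ₐ[Rt] Line :=
  tensorLift (Usl.lift hc (B := Polynomial Rt) SlRels.zero) (AlgHom.id Rt Line) fun _ _ =>
    Line.mul_comm' _ _

variable (hc : c ≠ 0)

theorem UL.snd_inl (x : SGen) : UL.snd hc (inl _ _ (Usl.gen c x)) = 0 := by
  refine (tensorLift_inl ..).trans ?_
  rw [Usl.lift_gen]
  cases x <;> rfl
theorem UL.snd_inr (u : Line) : UL.snd hc (inr _ _ u) = u := tensorLift_inr ..
theorem UL.snd_H : UL.snd hc (UL.H c) = 0 := UL.snd_inl hc _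
theorem UL.snd_C : UL.snd hc (UL.C c) = Line.C := UL.snd_inr hc _
theorem UL.snd_X : UL.snd hc (UL.X c) = 0 := by
  rw [UL.X, map_mul]
  refine (congrArg _ (UL.snd_inl hc SGen.F)).trans (mul_zero _)
theorem UL.snd_Y : UL.snd hc (UL.Y c) = 0 := by
  rw [UL.Y, map_mul]
  refine (congrArg _ (UL.snd_inl hc SGen.E)).trans (mul_zero _)
theorem UL.inr_snd_C : inr _ _ (UL.snd hc (UL.C c)) = UL.C c := by rw [UL.snd_C]; rfl

theorem UL.retracts_fst (s : Rt) :
    (UL.data hc s).RetractsOn (UL.fst c) (inl _ _) {UL.H c, UL.C c, UL.X c, UL.Y c} := by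
  have hd := UL.isCartanForm hc s
  rintro _ (rfl | rfl | rfl | rfl)
  · exact Or.inl UL.inl_fst_H
  · refine Or.inr ⟨UL.fst_C, ?_, hd.counit_C, ?_⟩
    · rw [hd.comul_C, map_add, sqHom_inl, sqHom_inr, UL.fst_C, map_zero, map_zero, add_zero]
    · rw [hd.antipode_C, map_neg, UL.fst_C, neg_zero]
  · exact Or.inl UL.inl_fst_X
  · exact Or.inl UL.inl_fst_Y

theorem UL.retracts_snd (s : Rt) :
    (UL.data hc s).RetractsOn (UL.snd hc) (inr _ _) {UL.H c, UL.C c, UL.X c, UL.Y c} := by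
  have hd := UL.isCartanForm hc s
  rintro _ (rfl | rfl | rfl | rfl)
  · refine Or.inr ⟨UL.snd_H hc, ?_, hd.counit_H, ?_⟩
    · rw [hd.comul_H, map_add, sqHom_inl, sqHom_inr, UL.snd_H, map_zero, map_zero, add_zero]
    · rw [hd.antipode_H, map_neg, UL.snd_H, neg_zero]
  · exact Or.inl (UL.inr_snd_C hc)
  · refine Or.inr ⟨UL.snd_X hc, ?_, hd.counit_X, ?_⟩
    · rw [hd.comul_X, map_add, map_mul, sqHom_inl, sqHom_inr, UL.snd_X, map_zero, map_zero,
        mul_zero, add_zero]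
    · rw [hd.antipode_X, map_neg, map_mul, UL.snd_X, mul_zero, neg_zero]
  · refine Or.inr ⟨UL.snd_Y hc, ?_, hd.counit_Y, ?_⟩
    · rw [hd.comul_Y, map_add, map_mul, sqHom_inl, sqHom_inr, UL.snd_Y, map_zero, map_zero,
        mul_zero, add_zero]
    · rw [hd.antipode_Y, map_neg, map_mul, UL.snd_Y, mul_zero, neg_zero]

/-- The structure maps of `U_q(sl₂)`. -/
noncomputable def Usl.data : QTData (Usl c) := (UL.data hc 0).retract (UL.fst c) (inl _ _)

/-- The structure maps of `U_{q⁻¹}(ℂ)`. -/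
noncomputable def Line.data : QTData Line := (UL.data hc 0).retract (UL.snd hc) (inr _ _)

theorem Usl.isQTHopf : (Usl.data hc).IsQTHopf :=
  (UL.isQTHopf hc 0).retract UL.dense (UL.retracts_fst hc 0) UL.fst_inl Comp.tComplete
    (UL.isCartanForm hc 0).antipode_one (UL.isCartanForm hc 0).antipode_mul

theorem Line.isQTHopf : (Line.data hc).IsQTHopf :=
  (UL.isQTHopf hc 0).retract UL.dense (UL.retracts_snd hc 0) (UL.snd_inr hc) Comp.tComplete
    (UL.isCartanForm hc 0).antipode_one (UL.isCartanForm hc 0).antipode_mul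

variable (s : Rt)

include hc in
theorem UL.qpow_gB : qpow c (1 / 2) (UL.H c) * gB s c (UL.H c) (UL.C c) =
    qpow c (-1 / 2) (UL.H c) * qpow c 1 (-(s • UL.C c)) := by
  have e : Commute (-UL.H c) (-(s • UL.C c)) :=
    ((Commute.smul_right ((UL.cartanRels hc).CH.symm : Commute _ _) s).neg_left).neg_right
  rw [gB, sub_eq_add_neg, qpow_add e, ← mul_assoc]
  congr 1
  have h1 : qpow c 1 (-UL.H c) = qpow c (-1) (UL.H c) := by
    rw [qpow_eq (-1), map_neg, map_one, neg_one_smul]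
  rw [h1, qpow_mul_qpow]
  norm_num

include hc in
theorem UL.qpow_gG : qpow c (1 / 2) (UL.H c) * gG s c (UL.H c) (UL.C c) =
    qpow c (-1 / 2) (UL.H c) * qpow c 1 (s • UL.C c) := by
  have := UL.qpow_gB hc (-s)
  rw [neg_smul, neg_neg] at this
  rw [← this, gB, gG, neg_smul, sub_neg_eq_add]

theorem mul_mul_add {T : Type*} [Ring T] {a b y h z : T} (e1 : b * y = y * b)
    (e2 : b * h = h * b) : a * b * (y + h * z) = a * y * b + a * h * (b * z) := by
  rw [mul_add, mul_assoc, e1, ← mul_assoc, mul_assoc a b, ← mul_assoc b, e2, mul_assoc h,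
    ← mul_assoc a]

theorem UL.comul_E : (UL.data hc s).comul (UL.E c) =
    inl (UL c) (UL c) (UL.E c) * inr (UL c) (UL c) (qpow c (1 / 2) (UL.H c)) +
      inl (UL c) (UL c) (qpow c (-1 / 2) (UL.H c) * qpow c 1 (-(s • UL.C c))) * inr (UL c) (UL c) (UL.E c) := by
  rw [← UL.qpow_gB hc, ← UL.qpow_mul_Y, map_mul, IsCartanForm.comul_qpow (UL.isCartanForm hc s).comul_H, (UL.isCartanForm hc s).comul_Y,
    mul_mul_add (inl_inr_comm _ _).symm (inl_inr_comm _ _).symm, map_mul, map_mul, map_mul]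

theorem UL.comul_F : (UL.data hc s).comul (UL.F c) =
    inl (UL c) (UL c) (UL.F c) * inr (UL c) (UL c) (qpow c (1 / 2) (UL.H c)) +
      inl (UL c) (UL c) (qpow c (-1 / 2) (UL.H c) * qpow c 1 (s • UL.C c)) * inr (UL c) (UL c) (UL.F c) := by
  rw [← UL.qpow_gG hc, ← UL.qpow_mul_X, map_mul, IsCartanForm.comul_qpow (UL.isCartanForm hc s).comul_H, (UL.isCartanForm hc s).comul_X,
    mul_mul_add (inl_inr_comm _ _).symm (inl_inr_comm _ _).symm, map_mul, map_mul, map_mul]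

end Factors

section Standard

variable {c : ℂ} (hc : c ≠ 0)

theorem UL.antipode_E (s : Rt) : (UL.data hc s).antipode (UL.E c) =
    -(qpow c 1 (UL.H c + s • UL.C c) * UL.Y c) * qpow c (-1 / 2) (UL.H c) := by
  have hd := UL.isCartanForm hc s
  have e : (UL.data hc s).antipode (qpow c (1 / 2) (UL.H c)) = qpow c (-1 / 2) (UL.H c) := by
    rw [qpow_eq, hd.antipode_qpow, map_smul, hd.antipode_H, smul_neg, ← neg_smul, ← map_neg,
      ← qpow_eq, neg_div]
  rw [← UL.qpow_mul_Y, hd.antipode_mul, e, hd.antipode_Y]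
  rfl

theorem UL.antipode_F (s : Rt) : (UL.data hc s).antipode (UL.F c) =
    -(qpow c 1 (UL.H c - s • UL.C c) * UL.X c) * qpow c (-1 / 2) (UL.H c) := by
  have hd := UL.isCartanForm hc s
  have e : (UL.data hc s).antipode (qpow c (1 / 2) (UL.H c)) = qpow c (-1 / 2) (UL.H c) := by
    rw [qpow_eq, hd.antipode_qpow, map_smul, hd.antipode_H, smul_neg, ← neg_smul, ← map_neg,
      ← qpow_eq, neg_div]
  rw [← UL.qpow_mul_X, hd.antipode_mul, e, hd.antipode_X]
  rfl

theorem qpow_conj {A : Type*} [Ring A] [Algebra Rt A] {H Z : Comp A} {w : ℂ}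
    (h : H * Z = Z * H + (cst w : Rt) • Z) :
    qpow c 1 H * (qpow c (-1 / 2) H * Z) * qpow c (-1 / 2) H = qs c (w / 2) • Z := by
  rw [mul_assoc, mul_assoc, mul_qpow_weight h, mul_smul_comm, mul_smul_comm, ← mul_assoc,
    ← mul_assoc, qpow_mul_qpow, qpow_mul_qpow]
  norm_num
  rw [qpow_zero', one_mul]
  congr 2
  ring

theorem sqHom_sqHom {A B D : Type*} [Ring A] [Algebra Rt A] [Ring B] [Algebra Rt B] [Ring D]
    [Algebra Rt D] (p : A →ₐ[Rt] B) (r : B →ₐ[Rt] D) (x : Comp (A ⊗[Rt] A)) :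
    sqHom r (sqHom p x) = sqHom (r.comp p) x := by
  have := tensor_algHom_ext Comp.sep (f := (sqHom r).comp (sqHom p)) (g := sqHom (r.comp p))
    (fun a => by
      rw [AlgHom.comp_apply, sqHom_inl, sqHom_inl, sqHom_inl]; rfl)
    (fun a => by
      rw [AlgHom.comp_apply, sqHom_inr, sqHom_inr, sqHom_inr]; rfl)
  exact DFunLike.congr_fun this x

theorem gG_zero {A : Type*} [Ring A] [Algebra Rt A] (H C : Comp A) :
    gG 0 c H C = qpow c 1 (-H) := by rw [gG, zero_smul, add_zero]
theorem gB_zero {A : Type*} [Ring A] [Algebra Rt A] (H C : Comp A) :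
    gB 0 c H C = qpow c 1 (-H) := by rw [gB, zero_smul, sub_zero]
theorem gGi_zero {A : Type*} [Ring A] [Algebra Rt A] (H C : Comp A) :
    gGi 0 c H C = qpow c 1 H := by rw [gGi, zero_smul, sub_zero]
theorem gBi_zero {A : Type*} [Ring A] [Algebra Rt A] (H C : Comp A) :
    gBi 0 c H C = qpow c 1 H := by rw [gBi, zero_smul, add_zero]

theorem antiHom_comp_ext {A B : Type*} [Ring A] [Algebra Rt A] [Ring B] [Algebra Rt B] {S : Set A}
    (hS : TDense S) (hB : TSep B) {f : B →ₗ[Rt] B} (f1 : f 1 = 1)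
    (fm : ∀ a b, f (a * b) = f b * f a) {i : A →ₐ[Rt] B} {p : B →ₐ[Rt] B}
    (h : ∀ a ∈ S, f (i a) = p (f (i a))) (a : A) : f (i a) = p (f (i a)) :=
  hS.antiHom_ext hB (f := f ∘ₗ i.toLinearMap) (g := p.toLinearMap ∘ₗ f ∘ₗ i.toLinearMap)
    (by simp [f1]) (by simp [fm]) (by simp [f1]) (by simp [fm]) h a

section Split

variable {A : Type*} [Ring A] [Algebra Rt A] {H C X Y : Comp A} {d : QTData (Comp A)}
  {e f : Comp A →ₐ[Rt] Comp A}

theorem IsCartanForm.comul_fst (hd : IsCartanForm c 0 H C X Y d) (eH : e H = H) (eC : e C = 0)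
    (eX : e X = X) (eY : e Y = Y) :
    ∀ z ∈ ({H, C, X, Y} : Set (Comp A)), d.comul (e z) = sqHom e (d.comul (e z)) ∧
      d.antipode (e z) = e (d.antipode (e z)) := by
  rintro _ (rfl | rfl | rfl | rfl)
  · rw [eH, hd.comul_H, map_add, sqHom_inl, sqHom_inr, eH, hd.antipode_H, map_neg, eH]
    exact ⟨rfl, rfl⟩
  · rw [eC, map_zero, map_zero, map_zero, map_zero]
    exact ⟨rfl, rfl⟩
  · rw [eX, hd.comul_X, map_add, map_mul, sqHom_inl, sqHom_inr, sqHom_inl, eX, gG_zero, qpow_map e,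
      map_neg, eH, hd.antipode_X, gGi_zero, map_neg, map_mul, eX, qpow_map e, eH]
    exact ⟨rfl, rfl⟩
  · rw [eY, hd.comul_Y, map_add, map_mul, sqHom_inl, sqHom_inr, sqHom_inl, eY, gB_zero, qpow_map e,
      map_neg, eH, hd.antipode_Y, gBi_zero, map_neg, map_mul, eY, qpow_map e, eH]
    exact ⟨rfl, rfl⟩

theorem IsCartanForm.comul_snd (hd : IsCartanForm c 0 H C X Y d) (fH : f H = 0) (fC : f C = C)
    (fX : f X = 0) (fY : f Y = 0) :
    ∀ z ∈ ({H, C, X, Y} : Set (Comp A)), d.comul (f z) = sqHom f (d.comul (f z)) ∧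
      d.antipode (f z) = f (d.antipode (f z)) := by
  have h0 : d.comul 0 = sqHom f (d.comul 0) ∧ d.antipode 0 = f (d.antipode 0) := by
    rw [map_zero, map_zero, map_zero, map_zero]
    exact ⟨rfl, rfl⟩
  rintro _ (rfl | rfl | rfl | rfl)
  · rwa [fH]
  · rw [fC, hd.comul_C, map_add, sqHom_inl, sqHom_inr, fC, hd.antipode_C, map_neg, fC]
    exact ⟨rfl, rfl⟩
  · rwa [fX]
  · rwa [fY]

theorem IsCartanForm.sqHom_R {B : Type*} [Ring B] [Algebra Rt B] {s : Rt}
    (hd : IsCartanForm c s H C X Y d) (p : Comp A →ₐ[Rt] B) : sqHom p d.R =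
    qpow c 1 (qform (cst (1 / 2)) s (inl _ _ (p H)) (inl _ _ (p C)) (inr _ _ (p H))
      (inr _ _ (p C))) * theta c (inl _ _ (p (gBi s c H C * Y)) * inr _ _ (p X)) := by
  rw [hd.R, map_mul, qpow_map, theta_map, qform_map, map_mul, sqHom_inl, sqHom_inl, sqHom_inl,
    sqHom_inr, sqHom_inr, sqHom_inr]

theorem IsCartanForm.R_split (hd : IsCartanForm c 0 H C X Y d) (hC : ∀ z, Commute C z)
    (eH : e H = H) (eC : e C = 0) (eX : e X = X) (eY : e Y = Y)
    (fH : f H = 0) (fC : f C = C) (fX : f X = 0) : d.R = sqHom e d.R * sqHom f d.R := by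
  have hu : e (gBi 0 c H C * Y) = gBi 0 c H C * Y := by
    rw [map_mul, gBi_zero, qpow_map, eH, eY]
  rw [hd.sqHom_R e, hd.sqHom_R f, hu, eH, eC, eX, fH, fC, fX, hd.R]
  simp only [map_zero, mul_zero, theta_zero, mul_one]
  set z := inl (Comp A) (Comp A) (gBi 0 c H C * Y) * inr _ _ X
  have c1 : ∀ y : Comp A, Commute (inl (Comp A) (Comp A) C) (inl _ _ y) := fun y => by
    rw [commute_iff_eq, ← map_mul, (hC y).eq, map_mul]
  have c2 : ∀ y : Comp A, Commute (inr (Comp A) (Comp A) C) (inr _ _ y) := fun y => by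
    rw [commute_iff_eq, ← map_mul, (hC y).eq, map_mul]
  have c12 : ∀ x y : Comp A, Commute (inl (Comp A) (Comp A) x) (inr _ _ y) := inl_inr_comm
  have h1 : Commute z (inl _ _ C) := ((c1 _).mul_right (c12 _ _)).symm
  have h2 : Commute z (inr _ _ C) := (((c12 _ _).symm).mul_right (c2 _)).symm
  have hz : Commute z (qform (cst (1 / 2) : Rt) 0 0 (inl _ _ C) 0 (inr _ _ C)) :=
    commute_qform (Commute.zero_right _) h1 (Commute.zero_right _) h2
  have hq : Commute (qform (cst (1 / 2) : Rt) 0 (inl _ _ H) 0 (inr _ _ H) 0)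
      (qform (cst (1 / 2) : Rt) 0 0 (inl (Comp A) (Comp A) C) 0 (inr _ _ C)) := by
    refine commute_qform (Commute.zero_right _) ?_ (Commute.zero_right _) ?_
    · exact (commute_qform (c1 _) (Commute.zero_right _) (c12 _ _) (Commute.zero_right _)).symm
    · exact (commute_qform (c12 _ _).symm (Commute.zero_right _) (c2 _)
        (Commute.zero_right _)).symm
  rw [mul_assoc, theta_intertwine c (hz.qpow_right 1).eq, ← mul_assoc, ← qpow_add hq]
  congr 2
  simp [qform, sub_eq_add_neg]

end Split

theorem Usl.isStandard : Usl.IsStandard c (Usl.data hc) := by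
  have hd := UL.isCartanForm hc 0
  have hs := Usl.slRels hc
  constructor
  · change sqHom (UL.fst c) ((UL.data hc 0).comul (UL.H c)) = _
    rw [hd.comul_H, map_add, sqHom_inl, sqHom_inr, UL.fst_H]
    rfl
  · change sqHom (UL.fst c) ((UL.data hc 0).comul (UL.E c)) = _
    rw [UL.comul_E, map_add, map_mul, map_mul, sqHom_inl, sqHom_inr, sqHom_inl, sqHom_inr,
      of_tmul, of_tmul, zero_smul, neg_zero, qpow_zero, mul_one, UL.fst_E,
      qpow_map (UL.fst c), qpow_map (UL.fst c), UL.fst_H]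
  · change sqHom (UL.fst c) ((UL.data hc 0).comul (UL.F c)) = _
    rw [UL.comul_F, map_add, map_mul, map_mul, sqHom_inl, sqHom_inr, sqHom_inl, sqHom_inr,
      of_tmul, of_tmul, zero_smul, qpow_zero, mul_one, UL.fst_F,
      qpow_map (UL.fst c), qpow_map (UL.fst c), UL.fst_H]
  · have h1 : (Usl.data hc).counit (Usl.H c) = 0 := hd.counit_H
    have h2 : (UL.data hc 0).counit (UL.E c) = 0 := by
      rw [← UL.qpow_mul_Y, map_mul, hd.counit_Y, mul_zero]
    have h3 : (UL.data hc 0).counit (UL.F c) = 0 := by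
      rw [← UL.qpow_mul_X, map_mul, hd.counit_X, mul_zero]
    rintro (_ | _ | _)
    exacts [h1, h2, h3]
  · change UL.fst c ((UL.data hc 0).antipode (UL.H c)) = _
    rw [hd.antipode_H, map_neg, UL.fst_H]
  · change UL.fst c ((UL.data hc 0).antipode (UL.E c)) = _
    rw [UL.antipode_E, map_mul, map_neg, map_mul, qpow_map, qpow_map, zero_smul, add_zero,
      UL.fst_Y, UL.fst_H, neg_mul, qpow_conj hs.HE, div_self two_ne_zero]
  · change UL.fst c ((UL.data hc 0).antipode (UL.F c)) = _
    rw [UL.antipode_F, map_mul, map_neg, map_mul, qpow_map, qpow_map, zero_smul, sub_zero,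
      UL.fst_X, UL.fst_H, neg_mul, qpow_conj hs.HF, neg_div, div_self two_ne_zero]
  · have e : (Usl.data hc).R = qpow c (1 / 2) (of (Usl.H c ⊗ₜ[Rt] Usl.H c)) *
        theta c (of ((qpow c (1 / 2) (Usl.H c) * Usl.E c) ⊗ₜ[Rt]
          (qpow c (-1 / 2) (Usl.H c) * Usl.F c))) := by
      have hu : UL.fst c (gBi 0 c (UL.H c) (UL.C c) * UL.Y c) =
          qpow c (1 / 2) (Usl.H c) * Usl.E c := by
        rw [map_mul, UL.fst_Y, gBi_zero, qpow_map, UL.fst_H, ← mul_assoc, qpow_mul_qpow]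
        norm_num
      refine (hd.sqHom_R (UL.fst c)).trans ?_
      rw [hu, UL.fst_C, UL.fst_H, UL.fst_X, of_tmul, of_tmul, qpow_eq (1 / 2) (_ * _)]
      congr 2
      simp [qform]
    rw [e]
    have := ((theta_isSum c (of ((qpow c (1 / 2) (Usl.H c) * Usl.E c) ⊗ₜ[Rt]
          (qpow c (-1 / 2) (Usl.H c) * Usl.F c)))).mul_left
            (qpow c (1 / 2) (of (Usl.H c ⊗ₜ[Rt] Usl.H c)))).hasTSum
    simp only [mul_smul_comm, smul_smul, ← coef_eq] at this
    exact this

theorem Line.isStandard : Line.IsStandard c (Line.data hc) := by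
  have hd := UL.isCartanForm hc 0
  constructor
  · change sqHom (UL.snd hc) ((UL.data hc 0).comul (UL.C c)) = _
    rw [hd.comul_C, map_add, sqHom_inl, sqHom_inr, UL.snd_C]
    rfl
  · exact hd.counit_C
  · change UL.snd hc ((UL.data hc 0).antipode (UL.C c)) = _
    rw [hd.antipode_C, map_neg, UL.snd_C]
  · change sqHom (UL.snd hc) (UL.data hc 0).R = _
    refine (hd.sqHom_R (UL.snd hc)).trans ?_
    rw [UL.snd_C, UL.snd_H, UL.snd_X, map_zero, map_zero, mul_zero,
      theta_zero, mul_one, qform, zero_mul, zero_mul, mul_zero, zero_sub, sub_zero, smul_zero,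
      add_zero, smul_neg, ← neg_smul, ← map_neg, ← qpow_eq, of_tmul, neg_div]

theorem Usl.isTensor : (Usl.data hc).IsTensor (Line.data hc) (UL.data hc 0) := by
  have hd := UL.isCartanForm hc 0
  have hr := UL.cartanRels hc
  have dU : TDense (UL.fst c '' {UL.H c, UL.C c, UL.X c, UL.Y c}) :=
    UL.dense.image _ fun u => ⟨_, UL.fst_inl u⟩
  have dL : TDense (UL.snd hc '' {UL.H c, UL.C c, UL.X c, UL.Y c}) :=
    UL.dense.image _ fun u => ⟨_, UL.snd_inr hc u⟩
  have eC : (inl (Usl c) Line).comp (UL.fst c) (UL.C c) = 0 := by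
    rw [AlgHom.comp_apply, UL.fst_C, map_zero]
  have fH : (inr (Usl c) Line).comp (UL.snd hc) (UL.H c) = 0 := by
    rw [AlgHom.comp_apply, UL.snd_H, map_zero]
  have fX : (inr (Usl c) Line).comp (UL.snd hc) (UL.X c) = 0 := by
    rw [AlgHom.comp_apply, UL.snd_X, map_zero]
  have fY : (inr (Usl c) Line).comp (UL.snd hc) (UL.Y c) = 0 := by
    rw [AlgHom.comp_apply, UL.snd_Y, map_zero]
  have hU := hd.comul_fst UL.inl_fst_H eC UL.inl_fst_X UL.inl_fst_Y
  have hL := hd.comul_snd fH (UL.inr_snd_C hc) fX fY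
  have hC : ∀ z : UL c, Commute (UL.C c) z :=
    UL.dense.commute Comp.sep (AlgHom.id Rt _) (r := UL.C c) (by
      rintro _ (rfl | rfl | rfl | rfl)
      exacts [hr.CH, rfl, hr.CX, hr.CY])
  constructor
  · intro a
    rw [sqHom_eq]
    refine Eq.trans ?_ (sqHom_sqHom (UL.fst c) (inl (Usl c) Line) _).symm
    have := dU.algHom_ext Comp.sep (f := (UL.data hc 0).comul.comp (inl (Usl c) Line))
      (g := (sqHom ((inl (Usl c) Line).comp (UL.fst c))).comp
        ((UL.data hc 0).comul.comp (inl (Usl c) Line))) (by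
        rintro _ ⟨z, hz, rfl⟩
        exact (hU z hz).1)
    exact DFunLike.congr_fun this a
  · intro a
    rw [sqHom_eq]
    refine Eq.trans ?_ (sqHom_sqHom (UL.snd hc) (inr (Usl c) Line) _).symm
    have := dL.algHom_ext Comp.sep (f := (UL.data hc 0).comul.comp (inr (Usl c) Line))
      (g := (sqHom ((inr (Usl c) Line).comp (UL.snd hc))).comp
        ((UL.data hc 0).comul.comp (inr (Usl c) Line))) (by
        rintro _ ⟨z, hz, rfl⟩
        exact (hL z hz).1)
    exact DFunLike.congr_fun this a
  · exact fun _ => rfl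
  · exact fun _ => rfl
  · refine antiHom_comp_ext dU Comp.sep hd.antipode_one hd.antipode_mul
      (p := (inl (Usl c) Line).comp (UL.fst c)) ?_
    rintro _ ⟨z, hz, rfl⟩
    exact (hU z hz).2
  · refine antiHom_comp_ext dL Comp.sep hd.antipode_one hd.antipode_mul
      (p := (inr (Usl c) Line).comp (UL.snd hc)) ?_
    rintro _ ⟨z, hz, rfl⟩
    exact (hL z hz).2
  · rw [sqHom_eq, sqHom_eq]
    refine (hd.R_split hC UL.inl_fst_H eC UL.inl_fst_X UL.inl_fst_Y fH (UL.inr_snd_C hc) fX).trans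
      ?_
    exact congrArg₂ _ (sqHom_sqHom (UL.fst c) (inl (Usl c) Line) _).symm
      (sqHom_sqHom (UL.snd hc) (inr (Usl c) Line) _).symm

end Standard

section Twist

variable {A : Type*} [Ring A] [Algebra Rt A] {c : ℂ} {H C X Y : Comp A}

/-- `q ^ (-½ C ⊗ H)` -/
noncomputable def cartanTwist (c : ℂ) (H C : Comp A) : Comp (Comp A ⊗[Rt] Comp A) :=
  qpow c (-1 / 2) (inl _ _ C * inr _ _ H)

theorem commute_mul_mul {T : Type*} [Ring T] {a b a' b' : T} (h1 : Commute a a')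
    (h2 : Commute a b') (h3 : Commute b a') (h4 : Commute b b') : Commute (a * b) (a' * b') :=
  (h1.mul_right h2).mul_left (h3.mul_right h4)

theorem CartanRels.cocycle {s : Rt} {d : QTData (Comp A)} (hr : CartanRels c H C X Y)
    (hd : IsCartanForm c s H C X Y d) : d.IsCocycle (cartanTwist c H C) where
  unit := isUnit_qpow ..
  cocycle := by
    have hCC : ∀ {f : Comp A →ₐ[Rt] Comp ((Comp A ⊗[Rt] Comp A) ⊗[Rt] Comp A)},
      Commute (f C) (f H) := fun {f} => (hr.map f).CH
    have c12 : ∀ x y : Comp A, Commute (in1 x) (in2 y) := in12_comm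
    have c13 : ∀ x y : Comp A, Commute (in1 x) (in3 y) := in13_comm
    have c23 : ∀ x y : Comp A, Commute (in2 x) (in3 y) := in23_comm
    rw [leg23_eq, leg12_eq, QTData.idComul_eq, QTData.comulId_eq, cartanTwist, qpow_map, qpow_map,
      qpow_map, qpow_map, map_mul, map_mul, map_mul, map_mul, QTData.idComulHom_inl,
      QTData.idComulHom_inr, QTData.comulIdHom_inl, QTData.comulIdHom_inr, hd.comul_H, hd.comul_C,
      map_add, map_add]
    simp only [leg23_inl, leg23_inr, leg12_inl, leg12_inr]
    rw [← qpow_add, ← qpow_add, mul_add, add_mul]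
    · congr 1
      abel
    · rw [add_mul]
      exact (commute_mul_mul (Commute.refl _) (c13 _ _) (c12 _ _).symm (c23 _ _)).add_right
        (commute_mul_mul (c12 _ _) (c13 _ _) hCC.symm (c23 _ _))
    · rw [mul_add]
      exact (commute_mul_mul (c12 _ _).symm hCC (c13 _ _).symm (c23 _ _).symm).add_right
        (commute_mul_mul (c12 _ _).symm (c23 _ _) (c13 _ _).symm (Commute.refl _))
  counit := by
    rw [QTData.counitId_eq, cartanTwist, qpow_map, map_mul, QTData.counitIdHom_inl, hd.counit_C,
      map_zero, zero_mul, qpow_zero]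

variable {d d' : QTData (Comp A)} (hr : CartanRels c H C X Y) (hC : ∀ z, Commute C z)
  (hd : IsCartanForm c 0 H C X Y d) (hd' : IsCartanForm c 1 H C X Y d')

/-- `Z₂ χ = χ q^(w/2 C₁) Z₂` if `Z` has weight `w`. -/
theorem inr_mul_cartanTwist {Z : Comp A} {w : ℂ}
    (h : H * Z = Z * H + (cst w : Rt) • Z) :
    inr (Comp A) (Comp A) Z * cartanTwist c H C =
      cartanTwist c H C * (inl _ _ (qpow c (w / 2) C) * inr _ _ Z) := by
  have c12 : ∀ x y : Comp A, Commute (inl (Comp A) (Comp A) x) (inr _ _ y) := inl_inr_comm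
  have hZ : Z * H = H * Z - (cst w : Rt) • Z := by rw [h]; abel
  rw [cartanTwist, qpow_eq, qpow_map, qpow_eq (w / 2)]
  refine qpow_shift ?_ ?_
  · rw [mul_smul_comm, ← mul_assoc, ← inl_inr_comm, mul_assoc, ← map_mul (inr _ _), hZ, map_sub,
      map_smul, mul_sub, mul_smul_comm, smul_sub, add_mul, smul_mul_assoc, smul_mul_assoc, map_mul,
      mul_assoc, smul_smul, ← map_mul cst, sub_eq_add_neg, ← neg_smul, ← map_neg]
    congr 3
    ring
  · refine Commute.smul_left (Commute.smul_right (Commute.mul_left (Commute.refl _) ?_) _) _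
    exact (c12 _ _).symm

theorem inl_commute_cartanTwist (hC : ∀ z, Commute C z) (Z : Comp A) :
    Commute (inl (Comp A) (Comp A) Z) (cartanTwist c H C) := by
  have c12 : ∀ x y : Comp A, Commute (inl (Comp A) (Comp A) x) (inr _ _ y) := inl_inr_comm
  refine Commute.qpow_right (Commute.mul_right ?_ (c12 _ _)) _
  rw [commute_iff_eq, ← map_mul, ← (hC Z).eq, map_mul]

theorem inr_commute_cartanTwist {Z : Comp A} (hZ : Commute Z H) :
    Commute (inr (Comp A) (Comp A) Z) (cartanTwist c H C) := by
  have c12 : ∀ x y : Comp A, Commute (inl (Comp A) (Comp A) x) (inr _ _ y) := inl_inr_comm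
  refine Commute.qpow_right (Commute.mul_right (c12 _ _).symm ?_) _
  rw [commute_iff_eq, ← map_mul, hZ.eq, map_mul]

theorem gG_one (hC : ∀ z, Commute C z) :
    gG 1 c H C * qpow c (-1) C = gG 0 c H C := by
  rw [gG_zero, gG, one_smul, qpow_eq (-1), ← qpow_add, map_neg, map_one, neg_one_smul,
    add_neg_cancel_right]
  exact ((hC _).symm.smul_right _)

theorem gB_one (hC : ∀ z, Commute C z) :
    gB 1 c H C * qpow c 1 C = gB 0 c H C := by
  rw [gB_zero, gB, one_smul, ← qpow_add, sub_add_cancel]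
  exact (hC _).symm

theorem gGi_one (hC : ∀ z, Commute C z) :
    gGi 1 c H C * qpow c 1 C = gGi 0 c H C := by
  rw [gGi_zero, gGi, one_smul, ← qpow_add, sub_add_cancel]
  exact (hC _).symm

theorem gBi_one (hC : ∀ z, Commute C z) :
    gBi 1 c H C * qpow c (-1) C = gBi 0 c H C := by
  rw [gBi_zero, gBi, one_smul, qpow_eq (-1), ← qpow_add, map_neg, map_one, neg_one_smul,
    add_neg_cancel_right]
  exact ((hC _).symm.smul_right _)

include hr hC hd hd' in
theorem CartanRels.twist_comul (hS : TDense {H, C, X, Y}) (a : Comp A) :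
    d'.comul a * cartanTwist c H C = cartanTwist c H C * d.comul a := by
  refine (hS.intertwine Comp.sep (f := d.comul) (g := d'.comul) ?_ a).symm
  have hl := fun Z => (inl_commute_cartanTwist (c := c) (H := H) hC Z).eq
  rintro _ (rfl | rfl | rfl | rfl)
  · rw [hd.comul_H, hd'.comul_H, mul_add, add_mul, hl,
      (inr_commute_cartanTwist (Commute.refl _)).eq]
  · rw [hd.comul_C, hd'.comul_C, mul_add, add_mul, hl,
      (inr_commute_cartanTwist (hC _)).eq]
  · rw [hd.comul_X, hd'.comul_X, mul_add, add_mul, hl, mul_assoc, inr_mul_cartanTwist hr.HX,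
      ← mul_assoc (inl _ _ (gG 1 c H C)), hl, mul_assoc (cartanTwist c H C),
      ← mul_assoc (inl _ _ (gG 1 c H C)), ← map_mul (inl _ _), neg_div,
      div_self two_ne_zero, gG_one hC]
  · rw [hd.comul_Y, hd'.comul_Y, mul_add, add_mul, hl, mul_assoc, inr_mul_cartanTwist hr.HY,
      ← mul_assoc (inl _ _ (gB 1 c H C)), hl, mul_assoc (cartanTwist c H C),
      ← mul_assoc (inl _ _ (gB 1 c H C)), ← map_mul (inl _ _),
      div_self two_ne_zero, gB_one hC]

include hC hd in
theorem IsCartanForm.mulAntipode_twist : d.mulAntipode (cartanTwist c H C) =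
    of (qpow c (1 / 2) (C * H)) := by
  refine ((qpow_isSum c _ _).map d.mulAntipode).unique Comp.sep ?_
  have := (qpow_isSum c (1 / 2) (C * H)).map (of (A := Comp A)).toLinearMap
  convert this using 2 with k
  have hk : d.antipode (H ^ k) = (-H) ^ k := by
    induction k with
    | zero => rw [pow_zero, pow_zero, hd.antipode_one]
    | succ n ih => rw [pow_succ', hd.antipode_mul, ih, hd.antipode_H, pow_succ]
  · have hk' : C ^ k * (-H) ^ k = (cst (-1) : Rt) ^ k • (C * H) ^ k := by
      rw [← (hC (-H)).mul_pow, mul_neg, ← smul_pow, map_neg, map_one, neg_one_smul]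
    rw [map_smul, Commute.mul_pow (inl_inr_comm _ _), ← map_pow, ← map_pow, ← of_tmul,
      QTData.mulAntipode_of, hk, AlgHom.toLinearMap_apply, map_smul, hk', map_smul, smul_smul,
      ← map_pow, ← map_mul, div_mul_eq_mul_div, ← mul_pow]
    congr 4
    ring
  · rfl

include hr hC hd hd' in
theorem CartanRels.twist_antipode (hS : TDense {H, C, X, Y}) (a : Comp A) :
    of (d'.antipode a) * d.mulAntipode (cartanTwist c H C) =
      d.mulAntipode (cartanTwist c H C) * of (d.antipode a) := by
  rw [hd.mulAntipode_twist hC, ← map_mul, ← map_mul]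
  congr 1
  refine (hS.antiIntertwine Comp.sep hd.antipode_one hd.antipode_mul hd'.antipode_one
    hd'.antipode_mul (r := qpow c (1 / 2) (C * H)) ?_ a).symm
  have sh : ∀ {Z : Comp A} {w : ℂ}, H * Z = Z * H + (cst w : Rt) • Z →
      Z * qpow c (1 / 2) (C * H) = qpow c (1 / 2) (C * H) * (qpow c (- w / 2) C * Z) := by
    intro Z w h
    have hZ : Z * H = H * Z - (cst w : Rt) • Z := by rw [h]; abel
    rw [qpow_eq, qpow_eq (- w / 2)]
    refine qpow_shift ?_ ?_
    · rw [mul_smul_comm, ← mul_assoc, ← (hC Z).eq, mul_assoc, hZ, mul_sub, mul_smul_comm, smul_sub,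
        add_mul, smul_mul_assoc, smul_mul_assoc, mul_assoc, smul_smul, ← map_mul cst,
        sub_eq_add_neg, ← neg_smul, ← map_neg]
      congr 3
      ring
    · exact ((hC _).symm.smul_left _).smul_right _
  have cH : Commute (qpow c (1 / 2) (C * H)) H :=
    Commute.qpow_left ((hC H).mul_left (Commute.refl H)) _
  have cc : ∀ a b : Rt, Commute (qpow c (1 / 2) (C * H)) (qpow c 1 (a • H + b • C)) := fun a b =>
    Commute.qpow_right ((cH.smul_right a).add_right ((hC _).symm.smul_right b)) 1
  rintro _ (rfl | rfl | rfl | rfl)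
  · rw [hd.antipode_H, hd'.antipode_H, cH.neg_right.eq]
  · rw [hd.antipode_C, hd'.antipode_C, (hC _).symm.neg_right.eq]
  · rw [hd.antipode_X, hd'.antipode_X, mul_neg, neg_mul, neg_inj, mul_assoc, sh hr.HX,
      ← mul_assoc (gGi 1 c H C), hr.gGi_eq 1, ← (cc _ _).eq, mul_assoc, ← mul_assoc (qpow c 1 _),
      ← hr.gGi_eq 1, neg_neg, div_self two_ne_zero, gGi_one hC]
  · rw [hd.antipode_Y, hd'.antipode_Y, mul_neg, neg_mul, neg_inj, mul_assoc, sh hr.HY,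
      ← mul_assoc (gBi 1 c H C), hr.gBi_eq 1, ← (cc _ _).eq, mul_assoc, ← mul_assoc (qpow c 1 _),
      ← hr.gBi_eq 1, neg_div, div_self two_ne_zero, gBi_one hC]

include hr hC hd hd' in
theorem CartanRels.twist_R : d'.R * cartanTwist c H C = leg21 (cartanTwist c H C) * d.R := by
  have hl := fun Z => (inl_commute_cartanTwist (c := c) (H := H) hC Z).eq
  rw [hd.R, hd'.R, leg21_eq]
  have h1 : inl (Comp A) (Comp A) (gBi 1 c H C * Y) * inr _ _ X * cartanTwist c H C =
      cartanTwist c H C * (inl (Comp A) (Comp A) (gBi 0 c H C * Y) * inr _ _ X) := by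
    rw [mul_assoc, inr_mul_cartanTwist hr.HX, ← mul_assoc, hl, mul_assoc, ← mul_assoc (inl _ _ _),
      ← map_mul, mul_assoc (gBi _ _ _ _), ← ((hC Y).qpow_left _).eq, ← mul_assoc (gBi _ _ _ _), neg_div,
      div_self two_ne_zero, gBi_one hC]
  rw [mul_assoc, theta_intertwine c h1, ← mul_assoc, ← mul_assoc]
  congr 1
  have c12 : ∀ x y : Comp A, Commute (inl (Comp A) (Comp A) x) (inr _ _ y) := inl_inr_comm
  have c1 : ∀ y : Comp A, Commute (inl (Comp A) (Comp A) C) (inl _ _ y) := fun y => by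
    rw [commute_iff_eq, ← map_mul, (hC y).eq, map_mul]
  have c2 : ∀ y : Comp A, Commute (inr (Comp A) (Comp A) C) (inr _ _ y) := fun y => by
    rw [commute_iff_eq, ← map_mul, (hC y).eq, map_mul]
  rw [cartanTwist, qpow_map, map_mul, leg21_inl, leg21_inr, qpow_eq (-1 / 2), qpow_eq (-1 / 2),
    ← qpow_add, ← qpow_add]
  · congr 1
    rw [qform, qform, one_smul, zero_smul, add_zero, ← inl_inr_comm, neg_div, map_neg, neg_smul,
      neg_smul, smul_add, smul_sub, smul_sub]
    abel
  · exact Commute.smul_left (commute_qform ((c12 H C).symm.mul_left (Commute.refl _))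
      ((c12 C C).symm.mul_left (c1 H).symm) ((c2 H).mul_left (c12 H H))
      ((Commute.refl _).mul_left (c12 H C))) _
  · exact (Commute.smul_left (commute_qform ((c1 H).mul_left (c12 H H).symm)
      ((Commute.refl _).mul_left (c12 C H).symm) ((c12 C H).mul_left (Commute.refl _))
      ((c12 C C).mul_left (c2 H).symm)) _).symm

include hr hC hd hd' in
theorem CartanRels.isTwist (hS : TDense {H, C, X, Y}) : d.IsTwist (cartanTwist c H C) d' where
  comul := hr.twist_comul hC hd hd' hS
  counit := by
    have := hS.algHom_ext tsep_powerSeries (f := d'.counit) (g := d.counit) (by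
      rintro _ (rfl | rfl | rfl | rfl)
      · rw [hd.counit_H, hd'.counit_H]
      · rw [hd.counit_C, hd'.counit_C]
      · rw [hd.counit_X, hd'.counit_X]
      · rw [hd.counit_Y, hd'.counit_Y])
    exact DFunLike.congr_fun this
  antipode_unit := by
    rw [hd.mulAntipode_twist hC]
    exact (isUnit_qpow _ _).map _
  antipode := hr.twist_antipode hC hd hd' hS
  R := hr.twist_R hC hd hd'

end Twist

section Transport

variable {A B : Type*} [Ring A] [Algebra Rt A] [Ring B] [Algebra Rt B] {c : ℂ} {s : Rt}
  {H C X Y : Comp A}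

theorem IsCartanForm.map {d : QTData (Comp A)} {e : QTData (Comp B)} {p : Comp A →ₐ[Rt] Comp B}
    (hd : IsCartanForm c s H C X Y d) (hp : Function.Surjective p)
    (h1 : ∀ a, e.comul (p a) = sqHom p (d.comul a)) (h2 : ∀ a, e.counit (p a) = d.counit a)
    (h3 : ∀ a, e.antipode (p a) = p (d.antipode a)) (h4 : e.R = sqHom p d.R) :
    IsCartanForm c s (p H) (p C) (p X) (p Y) e where
  comul_H := by rw [h1, hd.comul_H, map_add, sqHom_inl, sqHom_inr]
  comul_C := by rw [h1, hd.comul_C, map_add, sqHom_inl, sqHom_inr]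
  comul_X := by
    rw [h1, hd.comul_X, map_add, map_mul, sqHom_inl, sqHom_inl, sqHom_inr, gG_map]
  comul_Y := by
    rw [h1, hd.comul_Y, map_add, map_mul, sqHom_inl, sqHom_inl, sqHom_inr, gB_map]
  counit_H := by rw [h2, hd.counit_H]
  counit_C := by rw [h2, hd.counit_C]
  counit_X := by rw [h2, hd.counit_X]
  counit_Y := by rw [h2, hd.counit_Y]
  antipode_one := by rw [← map_one p, h3, hd.antipode_one]
  antipode_mul := by
    intro a b
    obtain ⟨a, rfl⟩ := hp a
    obtain ⟨b, rfl⟩ := hp b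
    rw [← map_mul, h3, h3, h3, hd.antipode_mul, map_mul]
  antipode_H := by rw [h3, hd.antipode_H, map_neg]
  antipode_C := by rw [h3, hd.antipode_C, map_neg]
  antipode_X := by rw [h3, hd.antipode_X, map_neg, map_mul, gGi_map]
  antipode_Y := by rw [h3, hd.antipode_Y, map_neg, map_mul, gBi_map]
  R := by rw [h4, hd.sqHom_R p, map_mul, gBi_map]

end Transport

section DhatData

variable {c : ℂ} (hc : c ≠ 0)

/-- The structure maps of the quantum double over `ℂ[[t]]`. -/
noncomputable def Dhat.data : QTData (Dhat c) :=
  (UL.data hc 1).retract (thetaEquiv hc).toAlgHom (thetaEquiv hc).symm.toAlgHom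

theorem thetaEquiv_retracts :
    (UL.data hc 1).RetractsOn (thetaEquiv hc).toAlgHom (thetaEquiv hc).symm.toAlgHom
      {UL.H c, UL.C c, UL.X c, UL.Y c} :=
  fun z _ => Or.inl ((thetaEquiv hc).symm_apply_apply z)

theorem Dhat.isQTHopf : (Dhat.data hc).IsQTHopf :=
  (UL.isQTHopf hc 1).retract UL.dense (thetaEquiv_retracts hc) (thetaEquiv hc).apply_symm_apply
    Comp.tComplete (UL.isCartanForm hc 1).antipode_one (UL.isCartanForm hc 1).antipode_mul

theorem Dhat.comul_theta (a : UL c) : (Dhat.data hc).comul (thetaEquiv hc a) =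
    sqHom (thetaEquiv hc).toAlgHom ((UL.data hc 1).comul a) :=
  QTData.retract_comul UL.dense (thetaEquiv_retracts hc) a

theorem Dhat.counit_theta (a : UL c) : (Dhat.data hc).counit (thetaEquiv hc a) =
    (UL.data hc 1).counit a :=
  QTData.retract_counit UL.dense (thetaEquiv_retracts hc) a

theorem Dhat.antipode_theta (a : UL c) : (Dhat.data hc).antipode (thetaEquiv hc a) =
    thetaEquiv hc ((UL.data hc 1).antipode a) :=
  QTData.retract_antipode UL.dense (thetaEquiv_retracts hc) Comp.sep
    (UL.isCartanForm hc 1).antipode_one (UL.isCartanForm hc 1).antipode_mul a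

theorem thetaEquiv_isIso : (UL.data hc 1).IsIso (Dhat.data hc) (thetaEquiv hc) where
  comul a := (Dhat.comul_theta hc a).trans (sqHom_eq (thetaEquiv hc).toAlgHom _).symm
  counit := Dhat.counit_theta hc
  antipode := Dhat.antipode_theta hc
  R := (sqHom_eq (thetaEquiv hc).toAlgHom _).symm

theorem Dhat.isCartanForm : IsCartanForm c 1 (Dhat.H hc) (Dhat.C hc) (Dhat.gen c DGen.X)
    (Dhat.gen c DGen.Y) (Dhat.data hc) := by
  have := (UL.isCartanForm hc 1).map (e := Dhat.data hc) (p := (thetaEquiv hc).toAlgHom)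
    (thetaEquiv hc).surjective (Dhat.comul_theta hc) (Dhat.counit_theta hc)
    (Dhat.antipode_theta hc) rfl
  have h1 : (thetaEquiv hc).toAlgHom (UL.H c) = Dhat.H hc := thetaHom_H hc
  have h2 : (thetaEquiv hc).toAlgHom (UL.C c) = Dhat.C hc := thetaHom_C hc
  have h3 : (thetaEquiv hc).toAlgHom (UL.X c) = Dhat.gen c DGen.X := thetaHom_X hc
  have h4 : (thetaEquiv hc).toAlgHom (UL.Y c) = Dhat.gen c DGen.Y := thetaHom_Y hc
  rwa [h1, h2, h3, h4] at this

theorem Dhat.gG_eq : gG 1 c (Dhat.H hc) (Dhat.C hc) = Dhat.gen c DGen.g := by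
  rw [gG, one_smul, Dhat.neg_H_add_C, Dhat.qpow_G]
theorem Dhat.gB_eq : gB 1 c (Dhat.H hc) (Dhat.C hc) = Dhat.gen c DGen.h := by
  rw [gB, one_smul, Dhat.neg_H_sub_C, Dhat.qpow_Gb]
theorem Dhat.gGi_eq : gGi 1 c (Dhat.H hc) (Dhat.C hc) = Dhat.gen c DGen.gi := by
  refine left_inv_eq_right_inv (gGi_mul_gG 1) ?_
  rw [Dhat.gG_eq, Dhat.gen_eq, Dhat.gen_eq, ← map_mul, DR.g_gi, map_one]
theorem Dhat.gBi_eq : gBi 1 c (Dhat.H hc) (Dhat.C hc) = Dhat.gen c DGen.hi := by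
  refine left_inv_eq_right_inv (gBi_mul_gB 1) ?_
  rw [Dhat.gB_eq, Dhat.gen_eq, Dhat.gen_eq, ← map_mul, DR.h_hi, map_one]

theorem theta_formulas :
    thetaEquiv hc (qpow c (-1 / 2) (UL.H c) * UL.F c) = Dhat.gen c DGen.X ∧
      thetaEquiv hc (qpow c (-1 / 2) (UL.H c) * UL.E c) = Dhat.gen c DGen.Y ∧
      thetaEquiv hc (qpow c (-1) (UL.H c) * qpow c 1 (UL.C c)) = Dhat.gen c DGen.g ∧
      thetaEquiv hc (qpow c (-1) (UL.H c) * qpow c (-1) (UL.C c)) = Dhat.gen c DGen.h := by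
  have hn : ∀ x : UL c, qpow c (-1) x = qpow c 1 (-x) := fun x => by
    rw [qpow_eq, map_neg, map_one, neg_one_smul]
  have hCH : Commute (UL.H c) (UL.C c) := ((UL.cartanRels hc).CH).symm
  refine ⟨thetaHom_X hc, thetaHom_Y hc, ?_, ?_⟩
  · rw [hn, ← qpow_add hCH.neg_left]
    refine (qpow_map (thetaHom hc) 1 _).trans ?_
    rw [thetaHom_G, Dhat.qpow_G]
  · rw [hn, hn, ← qpow_add hCH.neg_left.neg_right, ← sub_eq_add_neg]
    refine (qpow_map (thetaHom hc) 1 _).trans ?_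
    rw [thetaHom_Gb, Dhat.qpow_Gb]

end DhatData

section Base

variable {k : Type*} [Field k] {q : kˣ}

theorem Dq.comul_mul_sum {ι κ : Type*} [Fintype ι] [Fintype κ] {x y : Dq q} {a b : ι → Dq q}
    {a' b' : κ → Dq q} (hx : Coalgebra.comul (R := k) x = ∑ i, a i ⊗ₜ[k] b i)
    (hy : Coalgebra.comul (R := k) y = ∑ i, a' i ⊗ₜ[k] b' i) :
    Coalgebra.comul (R := k) (x * y) =
      ∑ p : ι × κ, (a p.1 * a' p.2) ⊗ₜ[k] (b p.1 * b' p.2) := by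
  rw [Bialgebra.comul_mul, hx, hy, Finset.sum_mul_sum, Fintype.sum_prod_type]
  simp only [Algebra.TensorProduct.tmul_mul_tmul]

theorem Dq.comul_add_sum {ι κ : Type*} [Fintype ι] [Fintype κ] {x y : Dq q} {a b : ι → Dq q}
    {a' b' : κ → Dq q} (hx : Coalgebra.comul (R := k) x = ∑ i, a i ⊗ₜ[k] b i)
    (hy : Coalgebra.comul (R := k) y = ∑ i, a' i ⊗ₜ[k] b' i) :
    Coalgebra.comul (R := k) (x + y) =
      ∑ p : ι ⊕ κ, (Sum.elim a a' p) ⊗ₜ[k] (Sum.elim b b' p) := by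
  rw [map_add, hx, hy, Fintype.sum_sum_type]
  simp only [Sum.elim_inl, Sum.elim_inr]

theorem Dq.comul_log {r : k} {g : Dq q} (hg : Coalgebra.comul (R := k) g = g ⊗ₜ[k] g) :
    Coalgebra.comul (R := k) (r • (g - 1)) =
      (r • (g - 1)) ⊗ₜ[k] 1 + g ⊗ₜ[k] (r • (g - 1)) := by
  rw [map_smul, map_sub, hg, Bialgebra.comul_one, Algebra.TensorProduct.one_def,
    ← TensorProduct.smul_tmul', TensorProduct.tmul_smul, ← smul_add, TensorProduct.sub_tmul,
    TensorProduct.tmul_sub]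
  congr 1
  abel

theorem Dq.comul_base {S : Type*} [CommRing S] [Algebra S k] (r : S) :
    Coalgebra.comul (R := k) (algebraMap S (Dq q) r) = algebraMap S (Dq q) r ⊗ₜ[k] 1 := by
  rw [Algebra.algebraMap_eq_smul_one, Dq.base_smul, map_smul, Bialgebra.comul_one,
    Algebra.TensorProduct.one_def, TensorProduct.smul_tmul']

theorem Dq.counit_base {S : Type*} [CommRing S] [Algebra S k] (r : S) :
    Coalgebra.counit (R := k) (algebraMap S (Dq q) r) = algebraMap S k r := by
  rw [Algebra.algebraMap_eq_smul_one, Dq.base_smul, map_smul, Bialgebra.counit_one, smul_eq_mul,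
    mul_one]

theorem Dq.counit_log {r : k} {g : Dq q} (hg : Coalgebra.counit (R := k) g = 1) :
    Coalgebra.counit (R := k) (r • (g - 1)) = 0 := by
  rw [map_smul, map_sub, hg, Bialgebra.counit_one, sub_self, smul_zero]

theorem Dq.antipode_mul (x y : Dq q) : HopfAlgebra.antipode k (x * y) =
    HopfAlgebra.antipode k y * HopfAlgebra.antipode k x :=
  congrArg unop (map_mul (Dq.antipodeHom q) x y)

theorem Dq.antipode_one : HopfAlgebra.antipode k (1 : Dq q) = 1 :=
  congrArg unop (map_one (Dq.antipodeHom q))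

theorem Dq.antipode_gen (z : DGen) : HopfAlgebra.antipode k (Dq.gen q z) = match z with
    | DGen.X => -(Dq.gi q * Dq.X q)
    | DGen.g => Dq.gi q
    | DGen.gi => Dq.g q
    | DGen.Y => -(Dq.hi q * Dq.Y q)
    | DGen.h => Dq.hi q
    | DGen.hi => Dq.h q := by
  refine (congrArg unop (Dq.lift_gen ..)).trans ?_
  cases z <;> rfl

theorem Dq.antipode_base {S : Type*} [CommRing S] [Algebra S k] (r : S) :
    HopfAlgebra.antipode k (algebraMap S (Dq q) r) = algebraMap S (Dq q) r := by
  rw [Algebra.algebraMap_eq_smul_one, Dq.base_smul, map_smul, Dq.antipode_one]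

theorem Dq.antipode_log {r : k} {g gi : Dq q} (hg : HopfAlgebra.antipode k g = gi)
    (h : gi * g = 1) : HopfAlgebra.antipode k (r • (g - 1)) = -(gi * (r • (g - 1))) := by
  rw [map_smul, map_sub, hg, Dq.antipode_one, mul_smul_comm, mul_sub, h, mul_one, ← smul_neg,
    neg_sub]

end Base

section Extends

variable {c : ℂ} (hc : c ≠ 0)

theorem Dhat.comul_inv {u v : DR c} (h1 : u * v = 1) (h2 : v * u = 1)
    (hu : (Dhat.data hc).comul (of u) =
      inl (Dhat c) (Dhat c) (of u) * inr _ _ (of u)) :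
    (Dhat.data hc).comul (of v) =
      inl (Dhat c) (Dhat c) (of v) * inr _ _ (of v) := by
  refine left_inv_eq_right_inv (a := (Dhat.data hc).comul (of u)) ?_ ?_
  · rw [← map_mul, ← map_mul, h2, map_one, map_one]
  · rw [hu, mul_assoc, ← mul_assoc (inr _ _ _), ← inl_inr_comm, mul_assoc, ← map_mul (inr _ _),
      ← map_mul of, ← mul_assoc, ← map_mul (inl _ _), ← map_mul of, h1]
    simp only [map_one, mul_one]

/-- The coproduct of an element of `DR` in the double over `ℂ((t))` agrees with that in `Dhat`. -/
def Dhat.ComulCompat (x : DR c) : Prop :=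
  ∃ (ι : Type) (_ : Fintype ι) (a b : ι → DR c),
    Coalgebra.comul (R := Kt) (x : Dq (qK c)) =
      ∑ i, (a i : Dq (qK c)) ⊗ₜ[Kt] (b i : Dq (qK c)) ∧
    (Dhat.data hc).comul (of x) =
      ∑ i, inl (Dhat c) (Dhat c) (of (a i)) * inr _ _ (of (b i))

namespace Dhat.ComulCompat

variable {hc}

theorem add {x y : DR c} (hx : ComulCompat hc x) (hy : ComulCompat hc y) :
    ComulCompat hc (x + y) := by
  obtain ⟨ι, _, a, b, h1, h2⟩ := hx
  obtain ⟨κ, _, a', b', h3, h4⟩ := hy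
  refine ⟨ι ⊕ κ, inferInstance, Sum.elim a a', Sum.elim b b', ?_, ?_⟩
  · refine (Dq.comul_add_sum h1 h3).trans (Finset.sum_congr rfl fun p _ => ?_)
    cases p <;> rfl
  · rw [map_add, map_add, h2, h4, Fintype.sum_sum_type]
    rfl

theorem mul {x y : DR c} (hx : ComulCompat hc x) (hy : ComulCompat hc y) :
    ComulCompat hc (x * y) := by
  obtain ⟨ι, _, a, b, h1, h2⟩ := hx
  obtain ⟨κ, _, a', b', h3, h4⟩ := hy
  refine ⟨ι × κ, inferInstance, fun p => a p.1 * a' p.2, fun p => b p.1 * b' p.2,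
    Dq.comul_mul_sum h1 h3, ?_⟩
  rw [map_mul, map_mul, h2, h4, Finset.sum_mul_sum, Fintype.sum_prod_type]
  refine Finset.sum_congr rfl fun i _ => Finset.sum_congr rfl fun j _ => ?_
  rw [map_mul, map_mul, map_mul, map_mul, mul_assoc, ← mul_assoc (inr _ _ _), ← inl_inr_comm,
    mul_assoc, mul_assoc]

theorem base (r : Rt) : ComulCompat hc (algebraMap Rt (DR c) r) := by
  refine ⟨Unit, inferInstance, fun _ => algebraMap Rt (DR c) r, fun _ => 1, ?_, ?_⟩
  · refine (Dq.comul_base (k := Kt) (q := qK c) r).trans ?_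
    simp only [Finset.univ_unique, Finset.sum_singleton]
    rfl
  · simp only [Finset.univ_unique, Finset.sum_singleton, AlgHom.commutes, map_one, mul_one]

theorem single {x a b : DR c}
    (h1 : Coalgebra.comul (R := Kt) (x : Dq (qK c)) = (a : Dq (qK c)) ⊗ₜ[Kt] (b : Dq (qK c)))
    (h2 : (Dhat.data hc).comul (of x) =
      inl (Dhat c) (Dhat c) (of a) * inr _ _ (of b)) : ComulCompat hc x := by
  refine ⟨Unit, inferInstance, fun _ => a, fun _ => b, ?_, ?_⟩
  · rw [h1, Finset.univ_unique, Finset.sum_singleton]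
  · rw [h2, Finset.univ_unique, Finset.sum_singleton]

theorem pair {x a g : DR c}
    (h1 : Coalgebra.comul (R := Kt) (x : Dq (qK c)) = (a : Dq (qK c)) ⊗ₜ[Kt] 1 +
      (g : Dq (qK c)) ⊗ₜ[Kt] (a : Dq (qK c)))
    (h2 : (Dhat.data hc).comul (of x) = inl (Dhat c) (Dhat c) (of a) +
      inl (Dhat c) (Dhat c) (of g) * inr _ _ (of a)) : ComulCompat hc x := by
  refine ⟨Bool, inferInstance, fun i => cond i a g, fun i => cond i 1 a, ?_, ?_⟩
  · rw [h1, Fintype.sum_bool]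
    rfl
  · rw [h2, Fintype.sum_bool]
    simp only [cond_true, cond_false, map_one, mul_one]

end Dhat.ComulCompat

theorem Dhat.comul_g : (Dhat.data hc).comul (of (DR.gen c DGen.g)) =
    inl (Dhat c) (Dhat c) (of (DR.gen c DGen.g)) * inr _ _ (of (DR.gen c DGen.g)) := by
  have := (Dhat.isCartanForm hc).comul_gG
  rw [Dhat.gG_eq] at this
  exact this

theorem Dhat.comul_h : (Dhat.data hc).comul (of (DR.gen c DGen.h)) =
    inl (Dhat c) (Dhat c) (of (DR.gen c DGen.h)) * inr _ _ (of (DR.gen c DGen.h)) := by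
  have := (Dhat.isCartanForm hc).comul_gB
  rw [Dhat.gB_eq] at this
  exact this

include hc in
theorem smul_sub_one_cancel {M : Type*} [AddCommGroup M] [Module Rt M] [Module.IsTorsionFree Rt M]
    {x y : M} (h : (qs c 1 - 1) • x = (qs c 1 - 1) • y) : x = y :=
  smul_right_injective M (qs_sub_one_ne_zero hc one_ne_zero) h

theorem Dhat.comul_log {g l : DR c} (hg : g = 1 + (qs c 1 - 1) • l)
    (h : (Dhat.data hc).comul (of g) =
      inl (Dhat c) (Dhat c) (of g) * inr _ _ (of g)) :
    (Dhat.data hc).comul (of l) = inl (Dhat c) (Dhat c) (of l) +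
      inl (Dhat c) (Dhat c) (of g) * inr _ _ (of l) := by
  refine smul_sub_one_cancel hc ?_
  have e : (qs c 1 - 1) • l = g - 1 := by rw [hg, add_sub_cancel_left]
  rw [smul_add, ← mul_smul_comm, ← map_smul, ← map_smul, ← map_smul, ← map_smul, ← map_smul,
    ← map_smul, e, map_sub, map_sub, h]
  simp only [map_sub, map_one]
  rw [mul_sub, mul_one]
  abel

theorem Dhat.comulCompat (x : DR c) : Dhat.ComulCompat hc x := by
  have hd := Dhat.isCartanForm hc
  have hg := Dhat.comul_g hc
  have hh := Dhat.comul_h hc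
  have hx : x ∈ Algebra.adjoin Rt (Set.range (DR.gen c) ∪ {DR.lg c, DR.lh c}) := by
    rw [DR.adjoin_gen]; exact Algebra.mem_top
  induction hx using Algebra.adjoin_induction with
  | algebraMap r => exact .base r
  | add x y _ _ hx hy => exact hx.add hy
  | mul x y _ _ hx hy => exact hx.mul hy
  | mem x hx =>
    rcases hx with ⟨z, rfl⟩ | rfl | rfl
    · have hz := Dq.comul_gen (qK c) z
      cases z
      · refine .pair (a := DR.gen c DGen.X) (g := DR.gen c DGen.g) hz ?_
        have := hd.comul_X
        rw [Dhat.gG_eq] at this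
        exact this
      · exact .single (a := DR.gen c DGen.g) (b := DR.gen c DGen.g) hz
          hg
      · exact .single (a := DR.gen c DGen.gi) (b := DR.gen c DGen.gi) hz
          (Dhat.comul_inv hc DR.g_gi DR.gi_g hg)
      · refine .pair (a := DR.gen c DGen.Y) (g := DR.gen c DGen.h) hz ?_
        have := hd.comul_Y
        rw [Dhat.gB_eq] at this
        exact this
      · exact .single (a := DR.gen c DGen.h) (b := DR.gen c DGen.h) hz
          hh
      · exact .single (a := DR.gen c DGen.hi) (b := DR.gen c DGen.hi) hz
          (Dhat.comul_inv hc DR.h_hi DR.hi_h hh)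
    · exact .pair (g := DR.gen c DGen.g) (Dq.comul_log (Dq.comul_gen (qK c) DGen.g))
        (Dhat.comul_log hc (DR.g_eq hc) hg)
    · exact .pair (g := DR.gen c DGen.h) (Dq.comul_log (Dq.comul_gen (qK c) DGen.h))
        (Dhat.comul_log hc (DR.h_eq hc) hh)

theorem Dhat.counit_inv {u v : DR c} (h : u * v = 1)
    (hu : (Dhat.data hc).counit (of u) = 1) : (Dhat.data hc).counit (of v) = 1 := by
  rw [← one_mul ((Dhat.data hc).counit _), ← hu, ← map_mul, ← map_mul, h, map_one, map_one]
  exact hu.symm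

theorem Dhat.counit_log {g l : DR c} (hg : g = 1 + (qs c 1 - 1) • l)
    (h : (Dhat.data hc).counit (of g) = 1) : (Dhat.data hc).counit (of l) = 0 := by
  refine smul_sub_one_cancel hc ?_
  have e : (qs c 1 - 1) • l = g - 1 := by rw [hg, add_sub_cancel_left]
  rw [← map_smul, ← map_smul, e, map_sub, map_sub, h, map_one, map_one, sub_self, smul_zero]

theorem Dhat.counitCompat (x : DR c) :
    algebraMap Rt Kt ((Dhat.data hc).counit (of x)) =
      Coalgebra.counit (R := Kt) (x : Dq (qK c)) := by
  have hd := Dhat.isCartanForm hc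
  have hg : (Dhat.data hc).counit (of (DR.gen c DGen.g)) = 1 := by
    have := hd.counit_gG
    rw [Dhat.gG_eq] at this
    exact this
  have hh : (Dhat.data hc).counit (of (DR.gen c DGen.h)) = 1 := by
    have := hd.counit_gB
    rw [Dhat.gB_eq] at this
    exact this
  have h0 : ∀ {r : Rt} {w : Kt}, r = 0 → w = 0 → algebraMap Rt Kt r = w := by
    rintro _ _ rfl rfl; exact map_zero _
  have h1 : ∀ {r : Rt} {w : Kt}, r = 1 → w = 1 → algebraMap Rt Kt r = w := by
    rintro _ _ rfl rfl; exact map_one _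
  have hx : x ∈ Algebra.adjoin Rt (Set.range (DR.gen c) ∪ {DR.lg c, DR.lh c}) := by
    rw [DR.adjoin_gen]; exact Algebra.mem_top
  induction hx using Algebra.adjoin_induction with
  | algebraMap r =>
    rw [AlgHom.commutes, AlgHom.commutes]
    exact (Dq.counit_base (k := Kt) (q := qK c) r).symm
  | add x y _ _ hx hy =>
    rw [map_add, map_add, map_add, hx, hy]
    exact (map_add (Coalgebra.counit (R := Kt) (A := Dq (qK c))) _ _).symm
  | mul x y _ _ hx hy =>
    rw [map_mul, map_mul, map_mul, hx, hy]
    exact (Bialgebra.counit_mul (R := Kt) (A := Dq (qK c)) _ _).symm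
  | mem x hx =>
    rcases hx with ⟨z, rfl⟩ | rfl | rfl
    · have hz := Dq.counit_gen (qK c) z
      cases z
      · exact h0 hd.counit_X hz
      · exact h1 hg hz
      · exact h1 (Dhat.counit_inv hc DR.g_gi hg) hz
      · exact h0 hd.counit_Y hz
      · exact h1 hh hz
      · exact h1 (Dhat.counit_inv hc DR.h_hi hh) hz
    · exact h0 (Dhat.counit_log hc (DR.g_eq hc) hg)
        (Dq.counit_log (Dq.counit_gen (qK c) DGen.g))
    · exact h0 (Dhat.counit_log hc (DR.h_eq hc) hh)
        (Dq.counit_log (Dq.counit_gen (qK c) DGen.h))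

theorem Dhat.antipode_inv {u v : DR c} (h : u * v = 1) (h' : v * u = 1)
    (hu : (Dhat.data hc).antipode (of u) = of v) :
    (Dhat.data hc).antipode (of v) = of u := by
  have hd := Dhat.isCartanForm hc
  refine left_inv_eq_right_inv (a := of v) ?_ ?_
  · nth_rewrite 2 [← hu]
    rw [← hd.antipode_mul, ← map_mul, h, map_one, hd.antipode_one]
  · rw [← map_mul, h', map_one]

theorem Dhat.antipode_log {g gi l : DR c} (hg : g = 1 + (qs c 1 - 1) • l) (hgi : gi * g = 1)
    (h : (Dhat.data hc).antipode (of g) = of gi) :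
    (Dhat.data hc).antipode (of l) = of (-(gi * l)) := by
  refine smul_sub_one_cancel hc ?_
  have e : (qs c 1 - 1) • l = g - 1 := by rw [hg, add_sub_cancel_left]
  rw [← map_smul, ← map_smul, ← map_smul, smul_neg, ← mul_smul_comm, e, map_sub, map_sub, h,
    map_one, (Dhat.isCartanForm hc).antipode_one, mul_sub, hgi, mul_one, neg_sub, map_sub, map_one]

theorem Dhat.antipodeCompat (x : DR c) :
    ∃ s : DR c, (s : Dq (qK c)) = HopfAlgebra.antipode Kt (x : Dq (qK c)) ∧
      (Dhat.data hc).antipode (of x) = of s := by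
  have hd := Dhat.isCartanForm hc
  have hg : (Dhat.data hc).antipode (of (DR.gen c DGen.g)) = of (DR.gen c DGen.gi) := by
    have := hd.antipode_gG
    rw [Dhat.gG_eq, Dhat.gGi_eq] at this
    exact this
  have hh : (Dhat.data hc).antipode (of (DR.gen c DGen.h)) = of (DR.gen c DGen.hi) := by
    have := hd.antipode_gB
    rw [Dhat.gB_eq, Dhat.gBi_eq] at this
    exact this
  have hx : x ∈ Algebra.adjoin Rt (Set.range (DR.gen c) ∪ {DR.lg c, DR.lh c}) := by
    rw [DR.adjoin_gen]; exact Algebra.mem_top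
  induction hx using Algebra.adjoin_induction with
  | algebraMap r =>
    refine ⟨algebraMap Rt (DR c) r, (Dq.antipode_base (k := Kt) (q := qK c) r).symm, ?_⟩
    rw [AlgHom.commutes, Algebra.algebraMap_eq_smul_one, map_smul, hd.antipode_one]
  | add x y _ _ hx hy =>
    obtain ⟨s, h1, h2⟩ := hx
    obtain ⟨s', h3, h4⟩ := hy
    refine ⟨s + s', ?_, by rw [map_add, map_add, map_add, h2, h4]⟩
    exact (congrArg₂ _ h1 h3).trans
      (map_add (HopfAlgebra.antipode Kt (A := Dq (qK c))) _ _).symm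
  | mul x y _ _ hx hy =>
    obtain ⟨s, h1, h2⟩ := hx
    obtain ⟨s', h3, h4⟩ := hy
    refine ⟨s' * s, ?_, by
      rw [map_mul of, hd.antipode_mul, h2, h4, map_mul of]⟩
    exact (congrArg₂ _ h3 h1).trans (Dq.antipode_mul (k := Kt) (q := qK c) _ _).symm
  | mem x hx =>
    rcases hx with ⟨z, rfl⟩ | rfl | rfl
    · have hz := Dq.antipode_gen (q := qK c) z
      cases z
      · refine ⟨-(DR.gen c DGen.gi * DR.gen c DGen.X), hz.symm, ?_⟩
        have := hd.antipode_X
        rw [Dhat.gGi_eq] at this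
        rw [map_neg, map_mul]
        exact this
      · exact ⟨_, hz.symm, hg⟩
      · exact ⟨_, hz.symm, Dhat.antipode_inv hc DR.g_gi DR.gi_g hg⟩
      · refine ⟨-(DR.gen c DGen.hi * DR.gen c DGen.Y), hz.symm, ?_⟩
        have := hd.antipode_Y
        rw [Dhat.gBi_eq] at this
        rw [map_neg, map_mul]
        exact this
      · exact ⟨_, hz.symm, hh⟩
      · exact ⟨_, hz.symm, Dhat.antipode_inv hc DR.h_hi DR.hi_h hh⟩
    · exact ⟨-(DR.gen c DGen.gi * DR.lg c), (Dq.antipode_log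
        (Dq.antipode_gen (q := qK c) DGen.g) (Dq.gi_g (qK c))).symm,
        Dhat.antipode_log hc (DR.g_eq hc) DR.gi_g hg⟩
    · exact ⟨-(DR.gen c DGen.hi * DR.lh c), (Dq.antipode_log
        (Dq.antipode_gen (q := qK c) DGen.h) (Dq.hi_h (qK c))).symm,
        Dhat.antipode_log hc (DR.h_eq hc) DR.hi_h hh⟩

theorem Dhat.extendsDouble : Dhat.ExtendsDouble c (Dhat.data hc) where
  comul x := by
    obtain ⟨ι, _, a, b, h1, h2⟩ := Dhat.comulCompat hc x
    let e := Fintype.equivFin ι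
    refine ⟨Fintype.card ι, a ∘ e.symm, b ∘ e.symm, h1.trans ?_, h2.trans ?_⟩
    · exact (e.symm.sum_comp fun i => (a i : Dq (qK c)) ⊗ₜ[Kt] (b i : Dq (qK c))).symm
    · rw [← e.symm.sum_comp]
      exact Finset.sum_congr rfl fun i _ => (of_tmul _ _).symm
  counit := Dhat.counitCompat hc
  antipode := Dhat.antipodeCompat hc

end Extends

end QDbl

namespace QDbl

open PowerSeries renaming C → cst
open _root_.QDbl.Comp (of)
open MulOpposite
open Coalgebra (comul counit)

section BorelPairing

variable {k : Type*} [Field k] {q : kˣ}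

namespace Ub

variable {A B : Type*} [Ring A] [Algebra k A] [Ring B] [Algebra k B]

theorem induction_gen {p : Ub q → Prop} (hX : p (X q)) (hg : p (g q)) (hgi : p (gi q))
    (hr : ∀ r, p (algebraMap k (Ub q) r)) (ha : ∀ x y, p x → p y → p (x + y))
    (hm : ∀ x y, p x → p y → p (x * y)) (x : Ub q) : p x := by
  have hx : x ∈ Algebra.adjoin k (Set.range (gen q)) := adjoin_gen q ▸ Algebra.mem_top
  induction hx using Algebra.adjoin_induction with
  | mem x hx => obtain ⟨y, rfl⟩ := hx; cases y <;> assumption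
  | algebraMap r => exact hr r
  | add x y _ _ hx hy => exact ha x y hx hy
  | mul x y _ _ hx hy => exact hm x y hx hy

theorem hom_ext_of_g {f h : Ub q →ₐ[k] A} (hX : f (X q) = h (X q)) (hg : f (g q) = h (g q)) :
    f = h := by
  refine hom_ext hX hg ?_
  calc f (gi q) = f (gi q) * (h (g q) * h (gi q)) := by
        rw [← map_mul h, g_gi, _root_.map_one, mul_one]
    _ = h (gi q) := by rw [← hg, ← mul_assoc, ← map_mul, gi_g, map_one, one_mul]

/-- `D` is an `(f₁, f₂)`-skew derivation. -/
def IsSkew (f₁ f₂ : Ub q →ₐ[k] A) (D : Ub q →ₗ[k] A) : Prop :=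
  ∀ a b, D (a * b) = f₁ a * D b + D a * f₂ b

theorem IsSkew.map_one {f₁ f₂ : Ub q →ₐ[k] A} {D : Ub q →ₗ[k] A} (h : IsSkew f₁ f₂ D) :
    D 1 = 0 := by
  have := h 1 1
  simpa using this

theorem IsSkew.map_gi {f₁ f₂ : Ub q →ₐ[k] A} {D : Ub q →ₗ[k] A} (h : IsSkew f₁ f₂ D) :
    D (gi q) = -(f₁ (gi q) * D (g q) * f₂ (gi q)) := by
  have h1 := h (gi q) (g q)
  rw [gi_g, h.map_one] at h1
  have h2 : D (gi q) * f₂ (g q) * f₂ (gi q) = D (gi q) := by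
    rw [mul_assoc, ← map_mul, g_gi, _root_.map_one, mul_one]
  rw [← h2, eq_neg_iff_add_eq_zero, ← add_mul, add_comm, ← h1, zero_mul]

theorem IsSkew.ext {f₁ f₂ : Ub q →ₐ[k] A} {D D' : Ub q →ₗ[k] A} (h : IsSkew f₁ f₂ D)
    (h' : IsSkew f₁ f₂ D') (hX : D (X q) = D' (X q)) (hg : D (g q) = D' (g q)) : D = D' := by
  refine LinearMap.ext fun x => ?_
  induction x using induction_gen with
  | hX => exact hX
  | hg => exact hg
  | hgi => rw [h.map_gi, h'.map_gi, hg]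
  | hr r => rw [Algebra.algebraMap_eq_smul_one, map_smul, map_smul, h.map_one, h'.map_one]
  | ha x y hx hy => rw [map_add, map_add, hx, hy]
  | hm x y hx hy => rw [h, h', hx, hy]

theorem exists_isSkew (f₁ f₂ : Ub q →ₐ[k] A) (v : A) (hv : f₁ (g q) * v = (q : k) ^ 2 • (v * f₂ (g q))) :
    ∃ D : Ub q →ₗ[k] A, IsSkew f₁ f₂ D ∧ D (X q) = v ∧ D (g q) = 0 := by
  have e1 : ∀ (f : Ub q →ₐ[k] A), f (g q) * f (gi q) = 1 := fun f => by
    rw [← map_mul, g_gi, map_one]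
  have e2 : ∀ (f : Ub q →ₐ[k] A), f (gi q) * f (g q) = 1 := fun f => by
    rw [← map_mul, gi_g, map_one]
  have e3 : ∀ (f : Ub q →ₐ[k] A), f (g q) * f (X q) = (q : k) ^ 2 • (f (X q) * f (g q)) := fun f => by
    rw [← map_mul, gX, map_smul, map_mul]
  let F : Ub q →ₐ[k] Matrix (Fin 2) (Fin 2) A :=
    lift q !![f₁ (X q), v; 0, f₂ (X q)] !![f₁ (g q), 0; 0, f₂ (g q)]
      !![f₁ (gi q), 0; 0, f₂ (gi q)]
      (by simp [e1, Matrix.one_fin_two]) (by simp [e2, Matrix.one_fin_two])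
      (by simp [e3, hv])
  have hF : ∀ x, F x 0 0 = f₁ x ∧ F x 1 0 = 0 ∧ F x 1 1 = f₂ x := by
    intro x
    induction x using induction_gen with
    | hX => simp [F]
    | hg => simp [F]
    | hgi => simp [F]
    | hr r => simp [Matrix.algebraMap_matrix_apply]
    | ha x y hx hy => simp [hx, hy]
    | hm x y hx hy => simp [hx, hy, Matrix.mul_apply]
  refine ⟨{ toFun := fun x => F x 0 1, map_add' := fun x y => by simp, map_smul' := fun r x => by simp }, ?_, ?_, ?_⟩
  · intro a b
    simp [Matrix.mul_apply, hF]
  · simp [F]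
  · simp [F]

/-- `x ↦ x₁ ⟨x₂, g⟩` -/
noncomputable def actG (q : kˣ) : Ub q →ₐ[k] Ub q :=
  lift q (X q) ((q : k) ^ 2 • g q) (((q : k) ^ 2)⁻¹ • gi q)
    (by simp [g_gi, smul_smul, -inv_pow]) (by simp [gi_g, smul_smul, -inv_pow])
    (by simp [gX])

/-- `x ↦ x₁ ⟨x₂, g⁻¹⟩` -/
noncomputable def actGi (q : kˣ) : Ub q →ₐ[k] Ub q :=
  lift q (X q) (((q : k) ^ 2)⁻¹ • g q) ((q : k) ^ 2 • gi q)
    (by simp [g_gi, smul_smul, -inv_pow]) (by simp [gi_g, smul_smul, -inv_pow])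
    (by simp [gX, smul_smul, -inv_pow])

/-- The value of `⟨X, X⟩`. -/
noncomputable def sXX (q : kˣ) : k := (1 - ((q : k) ^ 2)⁻¹)⁻¹

theorem exists_actX (q : kˣ) : ∃ D : Ub q →ₗ[k] Ub q, IsSkew (actG q) (AlgHom.id k _) D ∧
    D (X q) = sXX q • g q ∧ D (g q) = 0 :=
  exists_isSkew _ _ _ (by simp [actG, smul_smul, mul_comm])

/-- `x ↦ x₁ ⟨x₂, X⟩` -/
noncomputable def actX (q : kˣ) : Ub q →ₗ[k] Ub q := (exists_actX q).choose
theorem actX_isSkew : IsSkew (actG q) (AlgHom.id k _) (actX q) := (exists_actX q).choose_spec.1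
@[simp] theorem actX_X : actX q (X q) = sXX q • g q := (exists_actX q).choose_spec.2.1
@[simp] theorem actX_g : actX q (g q) = 0 := (exists_actX q).choose_spec.2.2
@[simp] theorem actG_X : actG q (X q) = X q := by simp [actG]
@[simp] theorem actG_g : actG q (g q) = (q : k) ^ 2 • g q := by simp [actG]
@[simp] theorem actGi_X : actGi q (X q) = X q := by simp [actGi]
@[simp] theorem actG_gi : actG q (gi q) = ((q : k) ^ 2)⁻¹ • gi q := by simp [actG]
@[simp] theorem actGi_gi : actGi q (gi q) = (q : k) ^ 2 • gi q := by simp [actGi]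
@[simp] theorem actGi_g : actGi q (g q) = ((q : k) ^ 2)⁻¹ • g q := by simp [actGi]

theorem IsSkew.comp {f₁ f₂ : Ub q →ₐ[k] A} {D : Ub q →ₗ[k] A} (h : IsSkew f₁ f₂ D) (u : A →ₐ[k] B) :
    IsSkew (u.comp f₁) (u.comp f₂) (u.toLinearMap ∘ₗ D) := by
  intro a b
  simp [h a b]

theorem IsSkew.precomp {f₁ f₂ : Ub q →ₐ[k] A} {D : Ub q →ₗ[k] A} (h : IsSkew f₁ f₂ D)
    (u : Ub q →ₐ[k] Ub q) : IsSkew (f₁.comp u) (f₂.comp u) (D ∘ₗ u.toLinearMap) := by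
  intro a b
  simp [h _ _]

theorem IsSkew.smul {f₁ f₂ : Ub q →ₐ[k] A} {D : Ub q →ₗ[k] A} (h : IsSkew f₁ f₂ D) (r : k) :
    IsSkew f₁ f₂ (r • D) := by
  intro a b
  simp [h a b]

theorem actG_actX : (actG q).toLinearMap ∘ₗ actX q = (q : k) ^ 2 • (actX q ∘ₗ (actG q).toLinearMap) := by
  refine (actX_isSkew.comp (actG q)).ext ((actX_isSkew.precomp (actG q)).smul _) ?_ ?_
  · simp [smul_smul, mul_comm]
  · simp

/-- The right action `x ↦ x₁ ⟨x₂, a⟩` of `a`. -/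
noncomputable def act (q : kˣ) : Ub q →ₐ[k] Module.End k (Ub q) :=
  lift q (actX q) (actG q).toLinearMap (actGi q).toLinearMap
    (by
      change ((actG q).comp (actGi q)).toLinearMap = (AlgHom.id k _).toLinearMap
      congr 1
      apply hom_ext_of_g <;> simp [smul_smul, -inv_pow])
    (by
      change ((actGi q).comp (actG q)).toLinearMap = (AlgHom.id k _).toLinearMap
      congr 1
      apply hom_ext_of_g <;> simp [smul_smul, -inv_pow])
    actG_actX

@[simp] theorem act_X : act q (X q) = actX q := lift_X ..
@[simp] theorem act_g : act q (g q) = (actG q).toLinearMap := lift_g ..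
@[simp] theorem act_gi : act q (gi q) = (actGi q).toLinearMap := lift_gi ..

theorem comul_act (a : Ub q) : comul (R := k) ∘ₗ act q a =
    (act q a).lTensor (Ub q) ∘ₗ comul (R := k) := by
  have hom : ∀ f : Ub q →ₐ[k] Ub q, comul (R := k) (f (X q)) =
      f.toLinearMap.lTensor (Ub q) (comul (X q)) →
      comul (R := k) (f (g q)) = f.toLinearMap.lTensor (Ub q) (comul (g q)) →
      comul (R := k) ∘ₗ f.toLinearMap =
        f.toLinearMap.lTensor (Ub q) ∘ₗ comul (R := k) := by
    intro f hX hg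
    have : (Bialgebra.comulAlgHom k (Ub q)).comp f =
        (Algebra.TensorProduct.map (AlgHom.id k _) f).comp (Bialgebra.comulAlgHom k (Ub q)) :=
      hom_ext_of_g hX hg
    exact congrArg AlgHom.toLinearMap this
  induction a using induction_gen with
  | hX =>
    rw [act_X]
    refine (actX_isSkew.comp (Bialgebra.comulAlgHom k (Ub q))).ext ?_ ?_ ?_
    · intro a b
      have key : ∀ z w : Ub q ⊗[k] Ub q, (actX q).lTensor (Ub q) (z * w) =
          (actG q).toLinearMap.lTensor (Ub q) z * (actX q).lTensor (Ub q) w +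
          (actX q).lTensor (Ub q) z * w := by
        intro z w
        induction z with
        | zero => simp
        | add z₁ z₂ h₁ h₂ => simp only [add_mul, map_add, h₁, h₂]; abel
        | tmul a b =>
        induction w with
        | zero => simp
        | add z₁ z₂ h₁ h₂ => simp only [mul_add, map_add, h₁, h₂]; abel
        | tmul c d => simp [actX_isSkew b d, TensorProduct.tmul_add]
      have h2 := LinearMap.congr_fun (hom (actG q) (by simp [comul_X, actG_X]) (by simp [comul_g])) a
      simp only [LinearMap.comp_apply, Bialgebra.comul_mul, key] at h2 ⊢
      rw [← h2]
      rfl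
    · simp [comul_X, comul_g, actX_isSkew.map_one]
    · simp [comul_g]
  | hg => rw [act_g]; exact hom _ (by simp [comul_X]) (by simp [comul_g])
  | hgi => rw [act_gi]; exact hom _ (by simp [comul_X]) (by simp [comul_g])
  | hr r =>
    ext x
    simp [Module.algebraMap_end_eq_smul_id, LinearMap.lTensor_smul]
  | ha x y hx hy => rw [map_add, LinearMap.comp_add, hx, hy, LinearMap.lTensor_add, LinearMap.add_comp]
  | hm x y hx hy =>
    rw [map_mul, Module.End.mul_eq_comp, ← LinearMap.comp_assoc, hx, LinearMap.comp_assoc, hy,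
      LinearMap.lTensor_comp, LinearMap.comp_assoc]

/-- The action of `a₁ ⊗ a₂` on the tensor square. -/
noncomputable def act₂ (q : kˣ) : Ub q →ₐ[k] Module.End k (Ub q ⊗[k] Ub q) :=
  (Module.endTensorEndAlgHom (R := k) (S := k) (A := k)).comp
    ((Algebra.TensorProduct.map (act q) (act q)).comp (Bialgebra.comulAlgHom k (Ub q)))

theorem endTensor_tmul (f h : Module.End k (Ub q)) (x y : Ub q) :
    Module.endTensorEndAlgHom (R := k) (S := k) (A := k) (f ⊗ₜ h) (x ⊗ₜ y) = f x ⊗ₜ h y := rfl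

theorem act_mul (a : Ub q) : act q a ∘ₗ LinearMap.mul' k (Ub q) =
    LinearMap.mul' k (Ub q) ∘ₗ act₂ q a := by
  induction a using induction_gen with
  | hX =>
    ext x y
    simp [act₂, comul_X, actX_isSkew x y, add_comm, endTensor_tmul]
  | hg => ext x y; simp [act₂, comul_g, endTensor_tmul]
  | hgi => ext x y; simp [act₂, comul_gi, endTensor_tmul]
  | hr r => ext x y; simp [Module.algebraMap_end_eq_smul_id]
  | ha x y hx hy => rw [map_add, map_add, LinearMap.add_comp, hx, hy, LinearMap.comp_add]
  | hm x y hx hy =>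
    rw [map_mul, map_mul, Module.End.mul_eq_comp, Module.End.mul_eq_comp, LinearMap.comp_assoc, hy,
      ← LinearMap.comp_assoc, hx, LinearMap.comp_assoc]

theorem act_one (a : Ub q) : act q a 1 = algebraMap k _ (counit (R := k) a) := by
  induction a using induction_gen with
  | hX => simp [actX_isSkew.map_one, counit_X]
  | hg => simp [counit_g]
  | hgi => simp [counit_gi]
  | hr r => simp [Algebra.algebraMap_eq_smul_one]
  | ha x y hx hy => simp [hx, hy]
  | hm x y hx hy => rw [map_mul, Module.End.mul_apply, hy, Algebra.algebraMap_eq_smul_one, map_smul, hx]; simp [Algebra.algebraMap_eq_smul_one, smul_smul, mul_comm]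

/-- The self-pairing of `U_q(b₋)`. -/
noncomputable def pairing (q : kˣ) : Ub q →ₗ[k] Ub q →ₗ[k] k :=
  LinearMap.mk₂ k (fun x a => counit (R := k) (act q a x))
    (by simp) (by simp) (by simp) (by simp)

theorem pairing_apply (x a : Ub q) : pairing q x a = counit (R := k) (act q a x) := rfl

theorem act_eq (x a : Ub q) : act q a x =
    TensorProduct.rid k _ (((pairing q).flip a).lTensor (Ub q) (comul (R := k) x)) := by
  have h : (pairing q).flip a = counit (R := k) ∘ₗ act q a := rfl
  have h1 := LinearMap.congr_fun (comul_act a) x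
  rw [LinearMap.comp_apply, LinearMap.comp_apply] at h1
  rw [h, LinearMap.lTensor_comp, LinearMap.comp_apply, ← h1, Coalgebra.lTensor_counit_comul]
  simp

theorem pairing_mul_right (x a b : Ub q) : pairing q x (a * b) = LinearMap.mul' k k
    (TensorProduct.map ((pairing q).flip a) ((pairing q).flip b) (comul (R := k) x)) := by
  rw [pairing_apply, map_mul, Module.End.mul_apply, ← pairing_apply, act_eq x b]
  generalize comul (R := k) x = z
  induction z with
  | zero => simp
  | add z₁ z₂ h₁ h₂ => simp only [map_add, h₁, h₂, LinearMap.add_apply]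
  | tmul u v => simp [mul_comm]

theorem pairing_mul_left (x y a : Ub q) : pairing q (x * y) a = LinearMap.mul' k k
    (TensorProduct.map (pairing q x) (pairing q y) (comul (R := k) a)) := by
  have h := LinearMap.congr_fun (act_mul a) (x ⊗ₜ y)
  rw [LinearMap.comp_apply, LinearMap.mul'_apply] at h
  rw [pairing_apply, h]
  simp only [act₂, AlgHom.comp_apply, Bialgebra.comulAlgHom_apply, LinearMap.comp_apply]
  generalize comul (R := k) a = z
  induction z with
  | zero => simp
  | add z₁ z₂ h₁ h₂ => simp only [map_add, h₁, h₂, LinearMap.add_apply]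
  | tmul u v => simp [pairing_apply, endTensor_tmul]

end Ub

end BorelPairing

section BorelPairing

variable {k : Type*} [Field k] {q : kˣ}

namespace Ub

theorem pairing_g_g : pairing q (g q) (g q) = (q : k) ^ 2 := by simp [pairing_apply, counit_g]
theorem pairing_g_X : pairing q (g q) (X q) = 0 := by simp [pairing_apply]
theorem pairing_X_g : pairing q (X q) (g q) = 0 := by simp [pairing_apply, counit_X]
theorem pairing_X_X : pairing q (X q) (X q) = sXX q := by simp [pairing_apply, counit_g]

theorem pairing_one_left (a : Ub q) : pairing q 1 a = counit (R := k) a := by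
  simp [pairing_apply, act_one]
theorem pairing_one_right (x : Ub q) : pairing q x 1 = counit (R := k) x := by
  simp [pairing_apply]

open WithConv

/-- The pairing as a map to the functionals in the second argument. -/
noncomputable def pairingL (q : kˣ) : Ub q →ₐ[k] WithConv (Ub q →ₗ[k] k) :=
  AlgHom.ofLinearMap ((WithConv.linearEquiv k _).symm.toLinearMap ∘ₗ pairing q)
    (by ext a; exact pairing_one_left a) (by intro x y; ext a; exact pairing_mul_left x y a)

theorem pairing_antipode (x a : Ub q) : pairing q (HopfAlgebra.antipode k x) a =
    pairing q x (HopfAlgebra.antipode k a) := by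
  let f : WithConv (Ub q →ₗ[k] WithConv (Ub q →ₗ[k] k)) :=
    toConv ((pairingL q).toLinearMap ∘ₗ HopfAlgebra.antipode k)
  let m : WithConv (Ub q →ₗ[k] WithConv (Ub q →ₗ[k] k)) := toConv (pairingL q).toLinearMap
  let h : WithConv (Ub q →ₗ[k] WithConv (Ub q →ₗ[k] k)) :=
    toConv ((WithConv.linearEquiv k _).symm.toLinearMap ∘ₗ
      (pairing q).compl₂ (HopfAlgebra.antipode k))
  have h1 : f * m = 1 := by
    ext x : 2
    have := congrArg (pairingL q) (HopfAlgebra.mul_antipode_rTensor_comul_apply (R := k) x)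
    rw [AlgHom.commutes] at this
    rw [LinearMap.convOne_apply, LinearMap.convMul_apply, ← this]
    generalize comul (R := k) x = z
    induction z with
    | zero => simp
    | add z₁ z₂ h₁ h₂ => simp only [map_add, h₁, h₂]
    | tmul u v => simp [f, m]
  have h2 : m * h = 1 := by
    ext x a
    have h3 := congrArg (fun b => pairing q x b)
      (HopfAlgebra.sum_mul_antipode_eq_algebraMap_counit (R := k) (Coalgebra.Repr.arbitrary k a))
    simp only [map_sum, pairing_mul_right, Algebra.algebraMap_eq_smul_one, map_smul,
      pairing_one_right] at h3
    have e1 : (1 : WithConv (Ub q →ₗ[k] WithConv (Ub q →ₗ[k] k))) x a =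
      counit (R := k) a * counit (R := k) x := by
      simp [LinearMap.convAlgebraMap_apply, mul_comm]
    change (m * h) x a = (1 : WithConv (Ub q →ₗ[k] WithConv (Ub q →ₗ[k] k))) x a
    rw [smul_eq_mul] at h3
    rw [e1, ← h3, LinearMap.convMul_apply]
    generalize comul (R := k) x = z
    induction z with
    | zero => simp
    | add z₁ z₂ h₁ h₂ =>
      simp only [map_add, WithConv.ofConv_add, LinearMap.add_apply, h₁, h₂, Finset.sum_add_distrib]
    | tmul u v => 
      rw [TensorProduct.map_tmul, LinearMap.mul'_apply]
      refine ((Coalgebra.Repr.arbitrary k a).convMul_apply _ _).trans ?_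
      simp only [TensorProduct.map_tmul, LinearMap.mul'_apply]
      rfl
  have := left_inv_eq_right_inv
    (M := WithConv (Ub q →ₗ[k] WithConv (Ub q →ₗ[k] k))) h1 h2
  have := congrArg (fun u : WithConv (Ub q →ₗ[k] WithConv (Ub q →ₗ[k] k)) => u x a) this
  exact this

theorem isBorelPairing (q : kˣ) : IsBorelPairing q (pairing q) where
  pairing := ⟨pairing_mul_left, pairing_mul_right, pairing_one_left, pairing_one_right,
    pairing_antipode⟩
  gg := pairing_g_g
  gX := pairing_g_X
  Xg := pairing_X_g
  XX := pairing_X_X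

theorem _root_.QDbl.IsBorelPairing.ext {σ τ : Ub q →ₗ[k] Ub q →ₗ[k] k} (hσ : IsBorelPairing q σ)
    (hτ : IsBorelPairing q τ) : σ = τ := by
  have grp : ∀ {σ : Ub q →ₗ[k] Ub q →ₗ[k] k}, IsBorelPairing q σ → ∀ a : Ub q,
      comul (R := k) a = a ⊗ₜ a → counit (R := k) a = 1 →
      ∃ f : Ub q →ₐ[k] k, f.toLinearMap = σ.flip a := fun {σ} h a ha ha' =>
    ⟨AlgHom.ofLinearMap (σ.flip a) ((h.pairing.one_left a).trans ha') fun x y => by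
      simp [h.pairing.mul_left, ha], rfl⟩
  have skew : ∀ {σ : Ub q →ₗ[k] Ub q →ₗ[k] k}, IsBorelPairing q σ → ∀ f : Ub q →ₐ[k] k,
      f.toLinearMap = σ.flip (g q) → IsSkew f (counitHom q) (σ.flip (X q)) := by
    intro σ h f hf a b
    have e1 : f a = σ a (g q) := LinearMap.congr_fun hf a
    have e2 : counitHom q b = σ b 1 := (h.pairing.one_right b).symm
    simp [h.pairing.mul_left, comul_X, e1, e2, add_comm]
  have inv : ∀ {σ : Ub q →ₗ[k] Ub q →ₗ[k] k}, IsBorelPairing q σ →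
      σ (X q) (gi q) = 0 ∧ (q : k) ^ 2 * σ (g q) (gi q) = 1 := by
    intro σ h
    have e1 := h.pairing.mul_right (g q) (g q) (gi q)
    have e2 := h.pairing.mul_right (X q) (g q) (gi q)
    rw [g_gi, h.pairing.one_right] at e1 e2
    simp [comul_g, comul_X, counit_g, counit_X, h.gg, h.Xg] at e1 e2
    exact ⟨e2, e1.symm⟩
  obtain ⟨f, hf⟩ := grp hσ _ (comul_g q) (counit_g q)
  obtain ⟨f', hf'⟩ := grp hτ _ (comul_g q) (counit_g q)
  obtain ⟨u, hu⟩ := grp hσ _ (comul_gi q) (counit_gi q)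
  obtain ⟨u', hu'⟩ := grp hτ _ (comul_gi q) (counit_gi q)
  have ap : ∀ {f : Ub q →ₐ[k] k} {a : Ub q} {σ : Ub q →ₗ[k] Ub q →ₗ[k] k},
      f.toLinearMap = σ.flip a → ∀ x, f x = σ x a := fun h x => LinearMap.congr_fun h x
  have hff : f = f' := hom_ext_of_g
    (by rw [ap hf, ap hf', hσ.Xg, hτ.Xg]) (by rw [ap hf, ap hf', hσ.gg, hτ.gg])
  have huu : u = u' := hom_ext_of_g
    (by rw [ap hu, ap hu', (inv hσ).1, (inv hτ).1])
    (by
      rw [ap hu, ap hu']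
      exact mul_left_cancel₀ (pow_ne_zero 2 q.ne_zero) ((inv hσ).2.trans (inv hτ).2.symm))
  have key : ∀ a, σ.flip a = τ.flip a := by
    intro a
    induction a using induction_gen with
    | hX =>
      exact (skew hσ f hf).ext (skew hτ f (hff ▸ hf')) (hσ.XX.trans hτ.XX.symm) (hσ.gX.trans hτ.gX.symm)
    | hg => rw [← hf, ← hf', hff]
    | hgi => rw [← hu, ← hu', huu]
    | hr r =>
      ext x
      simp [Algebra.algebraMap_eq_smul_one, hσ.pairing.one_right, hτ.pairing.one_right]
    | ha x y hx hy => rw [map_add, map_add, hx, hy]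
    | hm x y hx hy =>
      ext z
      rw [LinearMap.flip_apply, LinearMap.flip_apply, hσ.pairing.mul_right, hτ.pairing.mul_right,
        hx, hy]
  ext x a
  exact LinearMap.congr_fun (key a) x

end Ub
end BorelPairing

section BorelDouble

variable {k : Type*} [Field k] {q : kˣ}

namespace Ub

theorem intertwine {A : Type*} [Ring A] [Algebra k A] {f₁ f₂ : Ub q →ₐ[k] A} {d : A}
    (hX : f₁ (X q) * d = d * f₂ (X q)) (hg : f₁ (g q) * d = d * f₂ (g q)) (x : Ub q) :
    f₁ x * d = d * f₂ x := by
  induction x using induction_gen with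
  | hX => exact hX
  | hg => exact hg
  | hgi =>
    calc f₁ (gi q) * d = f₁ (gi q) * (d * f₂ (g q)) * f₂ (gi q) := by
          rw [mul_assoc, mul_assoc, ← map_mul, g_gi, map_one, mul_one]
      _ = d * f₂ (gi q) := by rw [← hg, ← mul_assoc, ← map_mul, gi_g, map_one, one_mul]
  | hr r => rw [AlgHom.commutes, AlgHom.commutes, Algebra.commutes]
  | ha x y hx hy => rw [map_add, map_add, add_mul, mul_add, hx, hy]
  | hm x y hx hy => rw [map_mul, map_mul, mul_assoc, hy, ← mul_assoc, hx, mul_assoc]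

/-- The inclusion of the factor `H`. -/
noncomputable def toDq (q : kˣ) : Ub q →ₐ[k] Dq q :=
  lift q (Dq.X q) (Dq.g q) (Dq.gi q) (Dq.g_gi q) (Dq.gi_g q) (Dq.gX q)

/-- The inclusion of the factor `Hᵒᵖ`. -/
noncomputable def toDqOp (q : kˣ) : Ub q →ₐ[k] (Dq q)ᵐᵒᵖ :=
  lift q (op (Dq.Y q)) (op (Dq.h q)) (op (Dq.hi q))
    (by rw [← op_mul, Dq.hi_h, op_one])
    (by rw [← op_mul, Dq.h_hi, op_one])
    (by
      rw [← op_mul, ← op_mul, ← op_smul, Dq.hY, smul_smul,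
        mul_inv_cancel₀ (Dq.q_ne q), one_smul])

/-- The inclusion of the factor `Hᵒᵖ` as a linear map. -/
noncomputable def toDq' (q : kˣ) : Ub q →ₗ[k] Dq q :=
  (opLinearEquiv k).symm.toLinearMap ∘ₗ (toDqOp q).toLinearMap

@[simp] theorem toDq_X : toDq q (X q) = Dq.X q := lift_X ..
@[simp] theorem toDq_g : toDq q (g q) = Dq.g q := lift_g ..
@[simp] theorem toDq_gi : toDq q (gi q) = Dq.gi q := lift_gi ..
@[simp] theorem toDqOp_X : toDqOp q (X q) = op (Dq.Y q) := lift_X ..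
@[simp] theorem toDqOp_g : toDqOp q (g q) = op (Dq.h q) := lift_g ..
@[simp] theorem toDq'_X : toDq' q (X q) = Dq.Y q := congrArg unop (lift_X ..)
@[simp] theorem toDq'_g : toDq' q (g q) = Dq.h q := congrArg unop (lift_g ..)
@[simp] theorem toDq'_gi : toDq' q (gi q) = Dq.hi q := congrArg unop (lift_gi ..)
@[simp] theorem toDq'_one : toDq' q 1 = 1 := congrArg unop (map_one (toDqOp q))
theorem toDq'_mul (a b : Ub q) : toDq' q (a * b) = toDq' q b * toDq' q a :=
  congrArg unop (map_mul (toDqOp q) a b)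
theorem op_toDq' (a : Ub q) : op (toDq' q a) = toDqOp q a := rfl

/-- `X ↦ q⁻² X`, `g ↦ g`. -/
noncomputable def dblG (q : kˣ) : Ub q →ₐ[k] Ub q :=
  lift q (((q : k) ^ 2)⁻¹ • X q) (g q) (gi q) (g_gi q) (gi_g q)
    (by simp [gX, smul_smul, -inv_pow])

/-- `X ↦ q⁻² X`, `g ↦ g`, inverse. -/
noncomputable def dblGi (q : kˣ) : Ub q →ₐ[k] Ub q :=
  lift q ((q : k) ^ 2 • X q) (g q) (gi q) (g_gi q) (gi_g q)
    (by simp [gX, smul_smul, -inv_pow])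

/-- `X ↦ q⁻² X`, `g ↦ q⁻² g`. -/
noncomputable def dblB (q : kˣ) : Ub q →ₐ[k] Ub q :=
  lift q (((q : k) ^ 2)⁻¹ • X q) (((q : k) ^ 2)⁻¹ • g q) ((q : k) ^ 2 • gi q)
    (by simp [g_gi, smul_smul, -inv_pow]) (by simp [gi_g, smul_smul, -inv_pow])
    (by simp [gX, smul_smul, -inv_pow])

@[simp] theorem dblG_X : dblG q (X q) = ((q : k) ^ 2)⁻¹ • X q := lift_X ..
@[simp] theorem dblG_g : dblG q (g q) = g q := lift_g ..
@[simp] theorem dblGi_X : dblGi q (X q) = (q : k) ^ 2 • X q := lift_X ..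
@[simp] theorem dblGi_g : dblGi q (g q) = g q := lift_g ..
@[simp] theorem dblB_X : dblB q (X q) = ((q : k) ^ 2)⁻¹ • X q := lift_X ..
@[simp] theorem dblB_g : dblB q (g q) = ((q : k) ^ 2)⁻¹ • g q := lift_g ..

theorem exists_dblD (q : kˣ) : ∃ D₁ D₂ : Ub q →ₗ[k] Ub q,
    (IsSkew (AlgHom.id k _) (dblB q) D₁ ∧ D₁ (X q) = (-((q : k) ^ 2 - 1)⁻¹) • 1 ∧ D₁ (g q) = 0) ∧
    (IsSkew (dblG q) (dblB q) D₂ ∧ D₂ (X q) = ((q : k) ^ 2 - 1)⁻¹ • g q ∧ D₂ (g q) = 0) := by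
  obtain ⟨D₁, h₁⟩ := exists_isSkew (q := q) (AlgHom.id k _) (dblB q) ((-((q : k) ^ 2 - 1)⁻¹) • 1)
    (by simp [smul_smul, -inv_pow])
  obtain ⟨D₂, h₂⟩ := exists_isSkew (q := q) (dblG q) (dblB q) (((q : k) ^ 2 - 1)⁻¹ • g q)
    (by simp [smul_smul, -inv_pow])
  exact ⟨D₁, D₂, h₁, h₂⟩

/-- The first skew derivation in the commutation relation of `X` with `Hᵒᵖ`. -/
noncomputable def dblD₁ (q : kˣ) : Ub q →ₗ[k] Ub q := (exists_dblD q).choose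
/-- The second skew derivation in the commutation relation of `X` with `Hᵒᵖ`. -/
noncomputable def dblD₂ (q : kˣ) : Ub q →ₗ[k] Ub q := (exists_dblD q).choose_spec.choose
theorem dblD₁_isSkew : IsSkew (AlgHom.id k _) (dblB q) (dblD₁ q) :=
  (exists_dblD q).choose_spec.choose_spec.1.1
@[simp] theorem dblD₁_X : dblD₁ q (X q) = (-((q : k) ^ 2 - 1)⁻¹) • 1 :=
  (exists_dblD q).choose_spec.choose_spec.1.2.1
@[simp] theorem dblD₁_g : dblD₁ q (g q) = 0 := (exists_dblD q).choose_spec.choose_spec.1.2.2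
theorem dblD₂_isSkew : IsSkew (dblG q) (dblB q) (dblD₂ q) :=
  (exists_dblD q).choose_spec.choose_spec.2.1
@[simp] theorem dblD₂_X : dblD₂ q (X q) = ((q : k) ^ 2 - 1)⁻¹ • g q :=
  (exists_dblD q).choose_spec.choose_spec.2.2.1
@[simp] theorem dblD₂_g : dblD₂ q (g q) = 0 := (exists_dblD q).choose_spec.choose_spec.2.2.2

theorem dblG_dblB (a : Ub q) : dblG q (dblB q a) = dblB q (dblG q a) := by
  have : (dblG q).comp (dblB q) = (dblB q).comp (dblG q) := by apply hom_ext_of_g <;> simp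
  exact DFunLike.congr_fun this a

theorem dblG_dblGi (a : Ub q) : dblG q (dblGi q a) = a := by
  have : (dblG q).comp (dblGi q) = AlgHom.id k _ := by
    apply hom_ext_of_g <;> simp [smul_smul, -inv_pow]
  exact DFunLike.congr_fun this a

theorem dblGi_dblG (a : Ub q) : dblGi q (dblG q a) = a := by
  have : (dblGi q).comp (dblG q) = AlgHom.id k _ := by
    apply hom_ext_of_g <;> simp [smul_smul, -inv_pow]
  exact DFunLike.congr_fun this a

theorem dblG_dblD₁ (a : Ub q) : dblG q (dblD₁ q a) = (q : k) ^ 2 • dblD₁ q (dblG q a) := by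
  have h : (dblG q).comp (dblB q) = (dblB q).comp (dblG q) := AlgHom.ext dblG_dblB
  refine LinearMap.congr_fun (IsSkew.ext (f₁ := dblG q) (dblD₁_isSkew.comp (dblG q))
    (h ▸ (dblD₁_isSkew.precomp (dblG q)).smul ((q : k) ^ 2)) ?_ ?_) a
  · simp [smul_smul, -inv_pow]
  · simp

theorem dblG_dblD₂ (a : Ub q) : dblG q (dblD₂ q a) = (q : k) ^ 2 • dblD₂ q (dblG q a) := by
  have h : (dblG q).comp (dblB q) = (dblB q).comp (dblG q) := AlgHom.ext dblG_dblB
  refine LinearMap.congr_fun (IsSkew.ext (dblD₂_isSkew.comp (dblG q))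
    (h ▸ (dblD₂_isSkew.precomp (dblG q)).smul ((q : k) ^ 2)) ?_ ?_) a
  · simp [smul_smul, -inv_pow]
  · simp

open LinearMap in
theorem dblRels (q : kˣ) : Dq.Rels (A := Module.End k (Ub q ⊗[k] Ub q)) q
    (TensorProduct.map (dblD₁ q) LinearMap.id +
      TensorProduct.map (dblB q).toLinearMap (mulLeft k (X q)) +
      TensorProduct.map (dblD₂ q) (mulLeft k (g q)))
    (TensorProduct.map (dblG q).toLinearMap (mulLeft k (g q)))
    (TensorProduct.map (dblGi q).toLinearMap (mulLeft k (gi q)))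
    (TensorProduct.map (mulRight k (X q)) LinearMap.id)
    (TensorProduct.map (mulRight k (g q)) LinearMap.id)
    (TensorProduct.map (mulRight k (gi q)) LinearMap.id) := by
  constructor <;> refine TensorProduct.ext' fun a x => ?_
  · simp [dblG_dblGi, ← mul_assoc, g_gi]
  · simp [dblGi_dblG, ← mul_assoc, gi_g]
  · simp [mul_assoc, gi_g]
  · simp [mul_assoc, g_gi]
  · simp
  · simp [dblG_dblD₁, dblG_dblB, dblG_dblD₂, ← mul_assoc, gX, TensorProduct.smul_tmul]
  · simp [dblD₁_isSkew a, dblD₂_isSkew a, ← TensorProduct.smul_tmul',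
      smul_smul, -inv_pow]
  · simp [TensorProduct.smul_tmul']
  · simp [TensorProduct.smul_tmul', mul_assoc, gX, smul_smul, -inv_pow]
  · simp [dblD₁_isSkew a, dblD₂_isSkew a, TensorProduct.add_tmul, TensorProduct.smul_tmul',
      -inv_pow, smul_sub, TensorProduct.neg_tmul]
    abel

end Ub
end BorelDouble

section BorelDouble

variable {k : Type*} [Field k] {q : kˣ}

namespace Ub

/-- The action of the quantum double on `A ⊗ H` by left multiplication. -/
noncomputable def dblAct (q : kˣ) : Dq q →ₐ[k] Module.End k (Ub q ⊗[k] Ub q) :=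
  Dq.lift q _ _ _ _ _ _ (dblRels q)

/-- The map `a ⊗ x ↦ a x` to the quantum double. -/
noncomputable def dblMap (q : kˣ) : Ub q ⊗[k] Ub q →ₗ[k] Dq q :=
  LinearMap.mul' k (Dq q) ∘ₗ TensorProduct.map (toDq' q) (toDq q).toLinearMap

theorem dblMap_tmul (a x : Ub q) : dblMap q (a ⊗ₜ x) = toDq' q a * toDq q x := rfl

theorem g_toDq' (a : Ub q) : Dq.g q * toDq' q a = toDq' q (dblG q a) * Dq.g q := by
  have := intertwine (f₁ := toDqOp q) (f₂ := (toDqOp q).comp (dblG q)) (d := op (Dq.g q))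
    (by simp [← op_mul, Dq.gY, -inv_pow]) (by simp [← op_mul, Dq.gh]) a
  exact congrArg unop this

theorem X_toDq' (a : Ub q) : Dq.X q * toDq' q a =
    toDq' q (dblD₁ q a) + toDq' q (dblB q a) * Dq.X q + toDq' q (dblD₂ q a) * Dq.g q := by
  have h1 : IsSkew (toDqOp q) ((toDqOp q).comp (dblB q))
      (LinearMap.mulRight k (op (Dq.X q)) ∘ₗ (toDqOp q).toLinearMap -
        LinearMap.mulLeft k (op (Dq.X q)) ∘ₗ ((toDqOp q).comp (dblB q)).toLinearMap) := by
    intro a b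
    simp [mul_sub, sub_mul, mul_assoc]
  have h2 : IsSkew (toDqOp q) ((toDqOp q).comp (dblB q))
      ((toDqOp q).toLinearMap ∘ₗ dblD₁ q + LinearMap.mulLeft k (op (Dq.g q)) ∘ₗ
        (toDqOp q).toLinearMap ∘ₗ dblD₂ q) := by
    intro a b
    have h := congrArg op (g_toDq' a)
    rw [op_mul, op_mul, op_toDq', op_toDq'] at h
    simp only [LinearMap.add_apply, LinearMap.comp_apply, AlgHom.toLinearMap_apply, dblD₁_isSkew a b,
      dblD₂_isSkew a b, map_add, map_mul, LinearMap.mulLeft_apply, AlgHom.coe_comp,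
      Function.comp_apply, AlgHom.coe_id, id, mul_add, add_mul, ← mul_assoc, h]
    abel
  have h := LinearMap.congr_fun (h1.ext h2
    (by
      have := Dq.XY q
      simp [← op_mul, -inv_pow, ← op_smul, ← op_sub,
        ← op_one, ← op_neg, ← op_add, this, smul_sub]
      abel)
    (by simp [← op_mul, -inv_pow, Dq.hX, ← op_smul, smul_smul])) a
  have h3 := congrArg unop h
  simp only [LinearMap.add_apply, LinearMap.comp_apply, AlgHom.toLinearMap_apply, LinearMap.sub_apply,
    LinearMap.mulLeft_apply, LinearMap.mulRight_apply, AlgHom.coe_comp, Function.comp_apply,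
    ← op_toDq', unop_sub, unop_add, unop_mul,
    unop_op] at h3
  rw [sub_eq_iff_eq_add] at h3
  rw [h3]
  abel

theorem gi_toDq' (a : Ub q) : Dq.gi q * toDq' q a = toDq' q (dblGi q a) * Dq.gi q := by
  have h := g_toDq' (dblGi q a)
  rw [dblG_dblGi] at h
  calc Dq.gi q * toDq' q a = Dq.gi q * (toDq' q a * Dq.g q) * Dq.gi q := by
        rw [mul_assoc, mul_assoc, Dq.g_gi, mul_one]
    _ = toDq' q (dblGi q a) * Dq.gi q := by rw [← h, ← mul_assoc, Dq.gi_g, one_mul]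

theorem dblMap_act (d : Dq q) (z : Ub q ⊗[k] Ub q) : dblMap q (dblAct q d z) = d * dblMap q z := by
  have hd : d ∈ Algebra.adjoin k (Set.range (Dq.gen q)) := Dq.adjoin_gen q ▸ Algebra.mem_top
  induction hd using Algebra.adjoin_induction generalizing z with
  | mem x hx =>
    obtain ⟨y, rfl⟩ := hx
    induction z with
    | zero => simp
    | add z₁ z₂ h₁ h₂ => simp only [map_add, h₁, h₂, mul_add]
    | tmul a x =>
      rw [dblMap_tmul, dblAct, Dq.lift_gen]
      cases y <;> simp [dblMap_tmul, toDq'_mul, mul_assoc]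
      · rw [← mul_assoc (Dq.X q), X_toDq']
        simp [add_mul, mul_assoc]
      · rw [← mul_assoc (Dq.g q), g_toDq', mul_assoc]
      · rw [← mul_assoc (Dq.gi q), gi_toDq', mul_assoc]
  | algebraMap r => rw [AlgHom.commutes, Module.algebraMap_end_apply, map_smul, Algebra.smul_def]
  | add x y _ _ hx hy => rw [map_add, LinearMap.add_apply, map_add, hx, hy, add_mul]
  | mul x y _ _ hx hy => rw [map_mul, Module.End.mul_apply, hx, hy, mul_assoc]

theorem dblAct_toDq (x y : Ub q) : dblAct q (toDq q x) (1 ⊗ₜ y) = 1 ⊗ₜ (x * y) := by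
  induction x using induction_gen generalizing y with
  | hX => simp [dblAct, Dq.lift_gen, dblD₁_isSkew.map_one, dblD₂_isSkew.map_one]
  | hg => simp [dblAct, Dq.lift_gen]
  | hgi => simp [dblAct, Dq.lift_gen]
  | hr r => simp [Algebra.algebraMap_eq_smul_one]
  | ha x y hx hy => simp [hx, hy, add_mul, TensorProduct.tmul_add]
  | hm x y hx hy => simp [hx, hy, mul_assoc]

theorem dblAct_toDq' (a b x : Ub q) : dblAct q (toDq' q a) (b ⊗ₜ x) = (b * a) ⊗ₜ x := by
  induction a using induction_gen generalizing b with
  | hX => simp [dblAct, Dq.lift_gen]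
  | hg => simp [dblAct, Dq.lift_gen]
  | hgi => simp [dblAct, Dq.lift_gen]
  | hr r =>
    simp [Algebra.algebraMap_eq_smul_one, TensorProduct.smul_tmul']
  | ha x y hx hy => simp [hx, hy, mul_add, TensorProduct.add_tmul]
  | hm x y hx hy => simp [toDq'_mul, hx, hy, mul_assoc]

/-- The underlying vector space of the quantum double is `A ⊗ H`. -/
noncomputable def dblEquiv (q : kˣ) : Ub q ⊗[k] Ub q ≃ₗ[k] Dq q :=
  LinearEquiv.ofLinearMap (dblMap q) ((dblAct q).toLinearMap.flip (1 ⊗ₜ 1))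
    (by ext d; simp [dblMap_act, dblMap_tmul])
    (by
      refine TensorProduct.ext' fun a x => ?_
      simp [dblMap_tmul, dblAct_toDq, dblAct_toDq'])

theorem dblEquiv_tmul (a x : Ub q) : dblEquiv q (a ⊗ₜ x) = toDq' q a * toDq q x := rfl

theorem comul_toDq (x : Ub q) : comul (R := k) (toDq q x) =
    TensorProduct.map (toDq q).toLinearMap (toDq q).toLinearMap (comul (R := k) x) := by
  have : (Bialgebra.comulAlgHom k (Dq q)).comp (toDq q) =
      (Algebra.TensorProduct.map (toDq q) (toDq q)).comp (Bialgebra.comulAlgHom k (Ub q)) := by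
    apply hom_ext_of_g <;> simp [comul_X, comul_g, Dq.comul_gen]
  exact DFunLike.congr_fun this x

theorem counit_toDq (x : Ub q) : counit (R := k) (toDq q x) = counit x := by
  have : (Bialgebra.counitAlgHom k (Dq q)).comp (toDq q) = Bialgebra.counitAlgHom k (Ub q) := by
    apply hom_ext_of_g <;> simp [counit_X, counit_g, Dq.counit_gen]
  exact DFunLike.congr_fun this x

theorem comul_toDq' (a : Ub q) : comul (R := k) (toDq' q a) =
    TensorProduct.map (toDq' q) (toDq' q) (comul (R := k) a) := by
  induction a using induction_gen with
  | hX => simp [comul_X, Dq.comul_gen]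
  | hg => simp [comul_g, Dq.comul_gen]
  | hgi => simp [comul_gi, Dq.comul_gen]
  | hr r => simp [Algebra.algebraMap_eq_smul_one, Algebra.TensorProduct.one_def]
  | ha x y hx hy => simp [hx, hy]
  | hm x y hx hy =>
    have key : ∀ z w : Ub q ⊗[k] Ub q, TensorProduct.map (toDq' q) (toDq' q) (z * w) =
        TensorProduct.map (toDq' q) (toDq' q) w * TensorProduct.map (toDq' q) (toDq' q) z := by
      intro z w
      induction z with
      | zero => simp
      | add z₁ z₂ h₁ h₂ => simp only [add_mul, mul_add, map_add, h₁, h₂]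
      | tmul a b =>
      induction w with
      | zero => simp
      | add z₁ z₂ h₁ h₂ => simp only [add_mul, mul_add, map_add, h₁, h₂]
      | tmul c d => simp [toDq'_mul]
    rw [toDq'_mul, Bialgebra.comul_mul, Bialgebra.comul_mul, key, hx, hy]

theorem counit_toDq' (a : Ub q) : counit (R := k) (toDq' q a) = counit a := by
  induction a using induction_gen with
  | hX => simp [counit_X, Dq.counit_gen]
  | hg => simp [counit_g, Dq.counit_gen]
  | hgi => simp [counit_gi, Dq.counit_gen]
  | hr r => simp [Algebra.algebraMap_eq_smul_one]
  | ha x y hx hy => simp [hx, hy]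
  | hm x y hx hy => simp [toDq'_mul, hx, hy, mul_comm]

theorem comul_dblEquiv (z : Ub q ⊗[k] Ub q) : comul (R := k) (dblEquiv q z) =
    TensorProduct.map (dblEquiv q).toLinearMap (dblEquiv q).toLinearMap
      (comul (R := k) z) := by
  induction z with
  | zero => simp
  | add z₁ z₂ h₁ h₂ => simp only [map_add, h₁, h₂]
  | tmul a x =>
    rw [dblEquiv_tmul, Bialgebra.comul_mul, comul_toDq, comul_toDq', TensorProduct.comul_tmul]
    generalize comul (R := k) a = z
    generalize comul (R := k) x = w
    induction z with
    | zero => simp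
    | add z₁ z₂ h₁ h₂ => simp only [add_mul, TensorProduct.add_tmul, map_add, h₁, h₂]
    | tmul a b =>
    induction w with
    | zero => simp
    | add z₁ z₂ h₁ h₂ => simp only [mul_add, TensorProduct.tmul_add, map_add, h₁, h₂]
    | tmul c d => simp [dblEquiv_tmul]

theorem counit_dblEquiv (z : Ub q ⊗[k] Ub q) : counit (R := k) (dblEquiv q z) =
    counit (R := k) z := by
  induction z with
  | zero => simp
  | add z₁ z₂ h₁ h₂ => simp only [map_add, h₁, h₂]
  | tmul a x => simp [dblEquiv_tmul, counit_toDq, counit_toDq', mul_comm]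

end Ub
end BorelDouble

section Convolution

open WithConv

variable {k C D : Type*} [Field k] [AddCommGroup C] [Module k C] [Coalgebra k C] [Ring D]
  [Algebra k D]

/-- The scalar functionals in the convolution algebra. -/
noncomputable def convScalar (k C D : Type*) [Field k] [AddCommGroup C] [Module k C]
    [Coalgebra k C] [Ring D] [Algebra k D] :
    WithConv (C →ₗ[k] k) →ₐ[k] WithConv (C →ₗ[k] D) :=
  AlgHom.ofLinearMap
    { toFun := fun f => toConv (Algebra.linearMap k D ∘ₗ f.ofConv)
      map_add' := fun f h => by ext; simp
      map_smul' := fun r f => by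
        ext x
        exact (Algebra.linearMap k D).map_smul r (f x) }
    (by ext; simp)
    (fun f h => by
      ext x
      simp only [LinearMap.coe_mk, AddHom.coe_mk, LinearMap.comp_apply, LinearMap.convMul_apply,
        Algebra.linearMap_apply]
      generalize comul (R := k) x = z
      induction z with
      | zero => simp
      | add z₁ z₂ h₁ h₂ => simp only [map_add, h₁, h₂]
      | tmul u v => simp)

theorem conv_smulRight_mul (d : D) (f : WithConv (C →ₗ[k] D)) (x : C) :
    (toConv ((counit (R := k) (A := C)).smulRight d) * f) x = d * f x := by
  have key : ∀ z : C ⊗[k] C, LinearMap.mul' k D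
      (TensorProduct.map ((counit (R := k) (A := C)).smulRight d) f.ofConv z) =
      d * f (TensorProduct.lid k C ((counit (R := k)).rTensor C z)) := by
    intro z
    induction z with
    | zero => simp
    | add z₁ z₂ h₁ h₂ => simp only [map_add, h₁, h₂, mul_add]
    | tmul u v => simp
  rw [LinearMap.convMul_apply, key, Coalgebra.rTensor_counit_comul, TensorProduct.lid_tmul, one_smul]

theorem conv_mul_smulRight (d : D) (f : WithConv (C →ₗ[k] D)) (x : C) :
    (f * toConv ((counit (R := k) (A := C)).smulRight d)) x = f x * d := by
  have key : ∀ z : C ⊗[k] C, LinearMap.mul' k D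
      (TensorProduct.map f.ofConv ((counit (R := k) (A := C)).smulRight d) z) =
      f (TensorProduct.rid k C ((counit (R := k)).lTensor C z)) * d := by
    intro z
    induction z with
    | zero => simp
    | add z₁ z₂ h₁ h₂ => simp only [map_add, h₁, h₂, add_mul]
    | tmul u v => simp
  rw [LinearMap.convMul_apply, key, Coalgebra.lTensor_counit_comul, TensorProduct.rid_tmul, one_smul]

/-- The constants in the convolution algebra. -/
noncomputable def convConst (k C : Type*) {D : Type*} [Field k] [AddCommGroup C] [Module k C]
    [Coalgebra k C] [Ring D] [Algebra k D] : D →ₐ[k] WithConv (C →ₗ[k] D) :=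
  AlgHom.ofLinearMap
    { toFun := fun d => toConv ((counit (R := k) (A := C)).smulRight d)
      map_add' := fun f h => by ext; simp
      map_smul' := fun r f => by
        ext x
        exact smul_comm _ _ _ }
    (by ext; simp [Algebra.algebraMap_eq_smul_one])
    (fun d e => by
      ext x
      refine Eq.trans ?_ (conv_smulRight_mul d _ x).symm
      simp)

theorem convConst_mul_apply (d : D) (f : WithConv (C →ₗ[k] D)) (x : C) :
    (convConst k C d * f) x = d * f x := conv_smulRight_mul d f x

theorem mul_convConst_apply (d : D) (f : WithConv (C →ₗ[k] D)) (x : C) :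
    (f * convConst k C d) x = f x * d := conv_mul_smulRight d f x

theorem convScalar_mul_convConst (f : WithConv (C →ₗ[k] k)) (d : D) :
    convScalar k C D f * convConst k C d = convConst k C d * convScalar k C D f := by
  ext x
  refine (mul_convConst_apply ..).trans (Eq.trans ?_ (convConst_mul_apply ..).symm)
  exact Algebra.commutes _ _

theorem convScalar_mul_apply (φ : WithConv (C →ₗ[k] k)) (f : WithConv (C →ₗ[k] D)) (x : C) :
    (convScalar k C D φ * f) x =
      f (TensorProduct.lid k C (φ.ofConv.rTensor C (comul (R := k) x))) := by
  rw [LinearMap.convMul_apply]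
  generalize comul (R := k) x = z
  induction z with
  | zero => simp
  | add z₁ z₂ h₁ h₂ => simp only [map_add, h₁, h₂]
  | tmul u v => simp [convScalar, Algebra.smul_def]

theorem mul_convScalar_apply (φ : WithConv (C →ₗ[k] k)) (f : WithConv (C →ₗ[k] D)) (x : C) :
    (f * convScalar k C D φ) x =
      f (TensorProduct.rid k C (φ.ofConv.lTensor C (comul (R := k) x))) := by
  rw [LinearMap.convMul_apply]
  generalize comul (R := k) x = z
  induction z with
  | zero => simp
  | add z₁ z₂ h₁ h₂ => simp only [map_add, h₁, h₂]
  | tmul u v => simp [convScalar, Algebra.smul_def, Algebra.commutes]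

theorem convMul_mul_apply_sum (f₁ f₂ f₃ : WithConv (C →ₗ[k] D)) {x : C} {m : ℕ}
    {x₁ x₂ x₃ : Fin m → C}
    (h : LinearMap.lTensor C (comul (R := k)) (comul (R := k) x)
      = ∑ i, x₁ i ⊗ₜ[k] (x₂ i ⊗ₜ[k] x₃ i)) :
    (f₁ * (f₂ * f₃)) x = ∑ i, f₁ (x₁ i) * (f₂ (x₂ i) * f₃ (x₃ i)) := by
  have e : (f₁ * (f₂ * f₃)) x = LinearMap.mul' k D (TensorProduct.map f₁.ofConv
      (LinearMap.mul' k D ∘ₗ TensorProduct.map f₂.ofConv f₃.ofConv)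
      (LinearMap.lTensor C (comul (R := k)) (comul (R := k) x))) := by
    rw [LinearMap.convMul_apply]
    generalize comul (R := k) x = z
    induction z with
    | zero => simp
    | add z₁ z₂ h₁ h₂ => simp only [map_add, h₁, h₂]
    | tmul u v => simp
  rw [e, h]
  simp

variable {H A : Type*} [Ring H] [HopfAlgebra k H] [Ring A] [HopfAlgebra k A]
  {σ : H →ₗ[k] A →ₗ[k] k}

/-- A Hopf pairing as a homomorphism to the convolution algebra of functionals. -/
noncomputable def IsHopfPairing.functional (hσ : IsHopfPairing σ) : A →ₐ[k] WithConv (H →ₗ[k] k) :=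
  AlgHom.ofLinearMap ((WithConv.linearEquiv k _).symm.toLinearMap ∘ₗ σ.flip)
    (by ext x; exact hσ.one_right x) (by intro a b; ext x; exact hσ.mul_right x a b)

/-- The map `u ⊗ v ↦ ⟨·, u⟩ i j(v)` to the convolution algebra. -/
noncomputable def IsHopfPairing.convL (hσ : IsHopfPairing σ) (i : H →ₐ[k] D) (j : A →ₗ[k] D) :
    A ⊗[k] A →ₗ[k] WithConv (H →ₗ[k] D) :=
  TensorProduct.lift (LinearMap.mk₂ k
    (fun u v => convScalar k H D (hσ.functional u) * (toConv i.toLinearMap * convConst k H (j v)))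
    (by simp [add_mul]) (by simp) (by simp [mul_add]) (by simp))

/-- The map `u ⊗ v ↦ j(u) i ⟨·, v⟩` to the convolution algebra. -/
noncomputable def IsHopfPairing.convR (hσ : IsHopfPairing σ) (i : H →ₐ[k] D) (j : A →ₗ[k] D) :
    A ⊗[k] A →ₗ[k] WithConv (H →ₗ[k] D) :=
  TensorProduct.lift (LinearMap.mk₂ k
    (fun u v => convConst k H (j u) * (toConv i.toLinearMap * convScalar k H D (hσ.functional v)))
    (by simp [add_mul]) (by simp) (by simp [mul_add]) (by simp))

/-- The exchange relation of the double for the element `b`. -/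
def IsHopfPairing.Exchange (hσ : IsHopfPairing σ) (i : H →ₐ[k] D) (j : A →ₗ[k] D) (b : A) : Prop :=
  hσ.convL i j (comul (R := k) b) = hσ.convR i j (comul (R := k) b)

variable (hσ : IsHopfPairing σ) {i : H →ₐ[k] D} {j : A →ₗ[k] D}

theorem IsHopfPairing.convL_tmul (u v : A) : hσ.convL i j (u ⊗ₜ v) =
    convScalar k H D (hσ.functional u) * (toConv i.toLinearMap * convConst k H (j v)) := rfl

theorem IsHopfPairing.convR_tmul (u v : A) : hσ.convR i j (u ⊗ₜ v) =
    convConst k H (j u) * (toConv i.toLinearMap * convScalar k H D (hσ.functional v)) := rfl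

theorem IsHopfPairing.Exchange.algebraMap (hj1 : j 1 = 1) (r : k) :
    hσ.Exchange i j (algebraMap k A r) := by
  rw [IsHopfPairing.Exchange, Bialgebra.comul_algebraMap, Algebra.TensorProduct.algebraMap_apply,
    Algebra.algebraMap_eq_smul_one, ← TensorProduct.smul_tmul', map_smul, map_smul,
    IsHopfPairing.convL_tmul, IsHopfPairing.convR_tmul]
  simp [hj1]

theorem IsHopfPairing.Exchange.add {b b' : A} (h : hσ.Exchange i j b) (h' : hσ.Exchange i j b') :
    hσ.Exchange i j (b + b') := by
  rw [IsHopfPairing.Exchange, map_add, map_add, map_add, h, h']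

theorem IsHopfPairing.Exchange.mul (hj : ∀ a b, j (a * b) = j b * j a) {b b' : A}
    (h : hσ.Exchange i j b) (h' : hσ.Exchange i j b') : hσ.Exchange i j (b * b') := by
  let P : A ⊗[k] A →ₗ[k] WithConv (H →ₗ[k] D) →ₗ[k] WithConv (H →ₗ[k] D) :=
    TensorProduct.lift (LinearMap.mk₂ k
      (fun u v => LinearMap.mulLeft k (convScalar k H D (hσ.functional u)) ∘ₗ
        LinearMap.mulRight k (convConst k H (j v)))
      (by intros; ext1; simp [add_mul]) (by intros; ext1; simp) (by intros; ext1; simp [mul_add])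
      (by intros; ext1; simp))
  let Q : A ⊗[k] A →ₗ[k] WithConv (H →ₗ[k] D) →ₗ[k] WithConv (H →ₗ[k] D) :=
    TensorProduct.lift (LinearMap.mk₂ k
      (fun u v => LinearMap.mulLeft k (convConst k H (j u)) ∘ₗ
        LinearMap.mulRight k (convScalar k H D (hσ.functional v)))
      (by intros; ext1; simp [add_mul]) (by intros; ext1; simp) (by intros; ext1; simp [mul_add])
      (by intros; ext1; simp))
  have hP : ∀ u v r, P (u ⊗ₜ v) r = convScalar k H D (hσ.functional u) * (r * convConst k H (j v)) :=
    fun _ _ _ => rfl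
  have hQ : ∀ u v r, Q (u ⊗ₜ v) r = convConst k H (j u) * (r * convScalar k H D (hσ.functional v)) :=
    fun _ _ _ => rfl
  have e1 : ∀ z w, hσ.convL i j (z * w) = P z (hσ.convL i j w) := by
    intro z w
    induction z with
    | zero => simp
    | add z₁ z₂ h₁ h₂ => simp only [add_mul, map_add, h₁, h₂, LinearMap.add_apply]
    | tmul u v =>
    induction w with
    | zero => simp
    | add z₁ z₂ h₁ h₂ => simp only [mul_add, map_add, h₁, h₂]
    | tmul u' v' =>
      simp only [Algebra.TensorProduct.tmul_mul_tmul, IsHopfPairing.convL_tmul, hP, map_mul, hj,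
        mul_assoc]
  have e2 : ∀ z w, hσ.convR i j (z * w) = Q w (hσ.convR i j z) := by
    intro z w
    induction w with
    | zero => simp
    | add z₁ z₂ h₁ h₂ => simp only [mul_add, map_add, h₁, h₂, LinearMap.add_apply]
    | tmul u v =>
    induction z with
    | zero => simp
    | add z₁ z₂ h₁ h₂ => simp only [add_mul, map_add, h₁, h₂]
    | tmul u' v' =>
      simp only [Algebra.TensorProduct.tmul_mul_tmul, IsHopfPairing.convR_tmul, hQ, map_mul, hj,
        mul_assoc]
  have e3 : ∀ z w, P z (hσ.convR i j w) = Q w (hσ.convL i j z) := by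
    intro z w
    induction w with
    | zero => simp
    | add z₁ z₂ h₁ h₂ => simp only [map_add, h₁, h₂, LinearMap.add_apply]
    | tmul u v =>
    induction z with
    | zero => simp
    | add z₁ z₂ h₁ h₂ => simp only [map_add, h₁, h₂, LinearMap.add_apply]
    | tmul u' v' =>
      simp only [IsHopfPairing.convR_tmul, IsHopfPairing.convL_tmul, hP, hQ]
      simp only [mul_assoc, ← convScalar_mul_convConst]
      simp only [← mul_assoc, ← convScalar_mul_convConst]
  rw [IsHopfPairing.Exchange, Bialgebra.comul_mul, e1, h', e3, h, e2]

theorem IsHopfPairing.exchange_of_comul (b : A)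
    (h : ∀ x, TensorProduct.lift (LinearMap.mk₂ k (fun u v =>
      i (TensorProduct.lid k H ((σ.flip u).rTensor H (comul (R := k) x))) * j v)
      (by simp [add_mul, LinearMap.rTensor_add]) (by simp [LinearMap.rTensor_smul])
      (by simp [mul_add]) (by simp)) (comul (R := k) b) =
      TensorProduct.lift (LinearMap.mk₂ k (fun u v =>
      j u * i (TensorProduct.rid k H ((σ.flip v).lTensor H (comul (R := k) x))))
      (by simp [add_mul]) (by simp)
      (by simp [mul_add, LinearMap.lTensor_add]) (by simp [LinearMap.lTensor_smul]))
        (comul (R := k) b)) : hσ.Exchange i j b := by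
  ext x
  refine Eq.trans ?_ ((h x).trans ?_)
  · generalize comul (R := k) b = z
    induction z with
    | zero => simp
    | add z₁ z₂ h₁ h₂ => simp only [map_add, WithConv.ofConv_add, LinearMap.add_apply, h₁, h₂]
    | tmul u v =>
      rw [IsHopfPairing.convL_tmul, ← mul_assoc]
      exact (mul_convConst_apply _ _ _).trans (congrArg (· * j v) (convScalar_mul_apply _ _ _))
  · generalize comul (R := k) b = z
    induction z with
    | zero => simp
    | add z₁ z₂ h₁ h₂ => simp only [map_add, WithConv.ofConv_add, LinearMap.add_apply, h₁, h₂]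
    | tmul u v =>
      refine (Eq.trans ?_ (congrArg (j u * ·) (mul_convScalar_apply (k := k) (C := H) (D := D)
        (hσ.functional v) (toConv i.toLinearMap) x))).symm
      exact convConst_mul_apply (k := k) (C := H) (D := D) _ _ _

theorem IsHopfPairing.conv_eq (h : ∀ b, hσ.Exchange i j b) (b : A) {n : ℕ} {b₁ b₂ b₃ : Fin n → A}
    (hb : LinearMap.lTensor A (comul (R := k)) (comul (R := k) b)
      = ∑ l, b₁ l ⊗ₜ[k] (b₂ l ⊗ₜ[k] b₃ l)) :
    toConv i.toLinearMap * convConst k H (j b) = ∑ l,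
      convScalar k H D (hσ.functional (HopfAlgebra.antipode k (b₁ l))) *
        (convConst k H (j (b₂ l)) * (toConv i.toLinearMap * convScalar k H D (hσ.functional (b₃ l)))) := by
  let S : A →ₗ[k] WithConv (H →ₗ[k] D) :=
    (convScalar k H D).toLinearMap ∘ₗ hσ.functional.toLinearMap ∘ₗ HopfAlgebra.antipode k
  let Λ : A ⊗[k] (A ⊗[k] A) →ₗ[k] WithConv (H →ₗ[k] D) :=
    LinearMap.mul' k _ ∘ₗ TensorProduct.map S (hσ.convR i j)
  let Λ' : A ⊗[k] (A ⊗[k] A) →ₗ[k] WithConv (H →ₗ[k] D) :=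
    LinearMap.mul' k _ ∘ₗ TensorProduct.map S (hσ.convL i j)
  have e1 : ∀ z : A ⊗[k] A, Λ (LinearMap.lTensor A (comul (R := k)) z) =
      Λ' (LinearMap.lTensor A (comul (R := k)) z) := by
    intro z
    induction z with
    | zero => simp
    | add z₁ z₂ h₁ h₂ => simp only [map_add, h₁, h₂]
    | tmul u v =>
      have := h v
      simp only [Λ, Λ', LinearMap.lTensor_tmul, LinearMap.comp_apply, TensorProduct.map_tmul, this.symm]
  have e2 : ∀ z : (A ⊗[k] A) ⊗[k] A, Λ' (TensorProduct.assoc k A A A z) =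
      LinearMap.mul' k _ (TensorProduct.map
        ((convScalar k H D).toLinearMap ∘ₗ hσ.functional.toLinearMap ∘ₗ LinearMap.mul' k A ∘ₗ
          (HopfAlgebra.antipode k).rTensor A)
        (LinearMap.mulLeft k (toConv i.toLinearMap) ∘ₗ (convConst k H).toLinearMap ∘ₗ j) z) := by
    intro z
    induction z with
    | zero => simp
    | add z₁ z₂ h₁ h₂ => simp only [map_add, h₁, h₂]
    | tmul u w =>
    induction u with
    | zero => simp
    | add z₁ z₂ h₁ h₂ => simp only [map_add, h₁, h₂, TensorProduct.add_tmul]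
    | tmul u v => simp [Λ', S, IsHopfPairing.convL_tmul, mul_assoc]
  have e3 : ∀ z : A ⊗[k] A, LinearMap.mul' k _ (TensorProduct.map
        ((convScalar k H D).toLinearMap ∘ₗ hσ.functional.toLinearMap ∘ₗ LinearMap.mul' k A ∘ₗ
          (HopfAlgebra.antipode k).rTensor A)
        (LinearMap.mulLeft k (toConv i.toLinearMap) ∘ₗ (convConst k H).toLinearMap ∘ₗ j)
          (LinearMap.rTensor A (comul (R := k)) z)) =
      toConv i.toLinearMap * convConst k H (j (TensorProduct.lid k A
        (LinearMap.rTensor A (counit (R := k)) z))) := by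
    intro z
    induction z with
    | zero => simp
    | add z₁ z₂ h₁ h₂ => simp only [map_add, h₁, h₂, mul_add]
    | tmul u v => simp [HopfAlgebra.mul_antipode_rTensor_comul_apply, ← Algebra.smul_def]
  have e4 : Λ (∑ l, b₁ l ⊗ₜ[k] (b₂ l ⊗ₜ[k] b₃ l)) =
      toConv i.toLinearMap * convConst k H (j b) := by
    rw [← hb, e1, ← Coalgebra.coassoc_apply, e2, e3, Coalgebra.rTensor_counit_comul]
    simp
  rw [← e4, map_sum]
  rfl

theorem IsHopfPairing.mul_eq (h : ∀ b, hσ.Exchange i j b) (b : A) (x : H) {m n : ℕ}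
    {x₁ x₂ x₃ : Fin m → H} {b₁ b₂ b₃ : Fin n → A}
    (hx : LinearMap.lTensor H (comul (R := k)) (comul (R := k) x)
      = ∑ l, x₁ l ⊗ₜ[k] (x₂ l ⊗ₜ[k] x₃ l))
    (hb : LinearMap.lTensor A (comul (R := k)) (comul (R := k) b)
      = ∑ l, b₁ l ⊗ₜ[k] (b₂ l ⊗ₜ[k] b₃ l)) :
    i x * j b = ∑ l, ∑ l', (σ (HopfAlgebra.antipode k (x₁ l)) (b₁ l') * σ (x₃ l) (b₃ l')) •
      (j (b₂ l') * i (x₂ l)) := by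
  have e := congrArg (fun f : WithConv (H →ₗ[k] D) => f x) (hσ.conv_eq h b hb)
  refine (mul_convConst_apply (j b) (toConv i.toLinearMap) x).symm.trans (e.trans ?_)
  rw [Finset.sum_comm]
  have hs : ∀ f : Fin n → WithConv (H →ₗ[k] D), (∑ l, f l) x = ∑ l, f l x := by
    intro f
    rw [WithConv.ofConv_sum, LinearMap.sum_apply]
  refine (hs _).trans (Finset.sum_congr rfl fun l' _ => ?_)
  rw [← mul_assoc (convConst k H (j (b₂ l')))]
  refine (convMul_mul_apply_sum _ _ _ hx).trans (Finset.sum_congr rfl fun l _ => ?_)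
  rw [show (convConst k H (j (b₂ l')) * toConv i.toLinearMap) (x₂ l) = j (b₂ l') * i (x₂ l) from
    convConst_mul_apply _ _ _, hσ.antipode]
  change Algebra.linearMap k D (σ (x₁ l) (HopfAlgebra.antipode k (b₁ l'))) *
    (_ * Algebra.linearMap k D (σ (x₃ l) (b₃ l'))) = _
  simp only [Algebra.linearMap_apply]
  rw [← Algebra.commutes (σ (x₃ l) (b₃ l')), ← mul_assoc, ← map_mul, Algebra.smul_def]

end Convolution

section BorelDouble

variable {k : Type*} [Field k] {q : kˣ}

namespace Ub

/-- `x ↦ ⟨x₁, g⟩ x₂` -/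
noncomputable def coactG (q : kˣ) : Ub q →ₐ[k] Ub q :=
  (Algebra.TensorProduct.lid k (Ub q)).toAlgHom.comp ((Algebra.TensorProduct.map
    ((counitHom q).comp (actG q)) (AlgHom.id k _)).comp (Bialgebra.comulAlgHom k (Ub q)))

/-- `x ↦ ⟨x₁, g⁻¹⟩ x₂` -/
noncomputable def coactGi (q : kˣ) : Ub q →ₐ[k] Ub q :=
  (Algebra.TensorProduct.lid k (Ub q)).toAlgHom.comp ((Algebra.TensorProduct.map
    ((counitHom q).comp (actGi q)) (AlgHom.id k _)).comp (Bialgebra.comulAlgHom k (Ub q)))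

/-- `x ↦ ⟨x₁, X⟩ x₂` -/
noncomputable def coactX (q : kˣ) : Ub q →ₗ[k] Ub q :=
  (TensorProduct.lid k (Ub q)).toLinearMap ∘ₗ ((pairing q).flip (X q)).rTensor (Ub q) ∘ₗ
    comul (R := k)

theorem coactG_X : coactG q (X q) = (q : k) ^ 2 • X q := by
  simp [coactG, comul_X, counitHom]
theorem coactG_g : coactG q (g q) = (q : k) ^ 2 • g q := by
  simp [coactG, comul_g, counitHom]
theorem coactGi_X : coactGi q (X q) = ((q : k) ^ 2)⁻¹ • X q := by
  simp [coactGi, comul_X, counitHom]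
theorem coactGi_g : coactGi q (g q) = ((q : k) ^ 2)⁻¹ • g q := by
  simp [coactGi, comul_g, counitHom]
theorem coactX_X : coactX q (X q) = sXX q • 1 := by
  simp [coactX, comul_X, pairing_X_X, pairing_g_X]
theorem coactX_g : coactX q (g q) = 0 := by
  simp [coactX, comul_g, pairing_g_X]

theorem coactX_isSkew : IsSkew (coactG q) (AlgHom.id k _) (coactX q) := by
  intro a b
  have e : ∀ x y, pairing q (x * y) (X q) = counitHom q (actG q x) * pairing q y (X q) +
      pairing q x (X q) * counitHom q y := by
    intro x y
    have e1 : counitHom q (actG q x) = pairing q x (g q) := by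
      rw [pairing_apply, act_g]
      rfl
    have e2 : counitHom q y = pairing q y 1 := (pairing_one_right y).symm
    rw [pairing_mul_left, comul_X, e1, e2]
    simp [add_comm]
  have key : ∀ z w : Ub q ⊗[k] Ub q,
      TensorProduct.lid k _ (((pairing q).flip (X q)).rTensor (Ub q) (z * w)) =
      Algebra.TensorProduct.lid k _ (Algebra.TensorProduct.map
        ((counitHom q).comp (actG q)) (AlgHom.id k _) z) *
        TensorProduct.lid k _ (((pairing q).flip (X q)).rTensor (Ub q) w) +
      TensorProduct.lid k _ (((pairing q).flip (X q)).rTensor (Ub q) z) *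
        TensorProduct.lid k _ ((counitHom q).toLinearMap.rTensor (Ub q) w) := by
    intro z w
    induction z with
    | zero => simp
    | add z₁ z₂ h₁ h₂ => simp only [add_mul, map_add, h₁, h₂]; abel
    | tmul a b =>
    induction w with
    | zero => simp
    | add z₁ z₂ h₁ h₂ => simp only [mul_add, map_add, h₁, h₂]; abel
    | tmul c d =>
      simp [e, add_smul, smul_smul, mul_comm]
  have h : TensorProduct.lid k _ ((counitHom q).toLinearMap.rTensor (Ub q)
      (comul (R := k) b)) = b :=
    (congrArg _ (Coalgebra.rTensor_counit_comul (R := k) b)).trans (by simp)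
  have := key (comul (R := k) a) (comul (R := k) b)
  rw [h, ← Bialgebra.comul_mul] at this
  exact this

theorem isHopfPairing (q : kˣ) : IsHopfPairing (pairing q) := (isBorelPairing q).pairing

theorem coactG_h (x : Ub q) : toDq q (coactG q x) * Dq.h q = Dq.h q * toDq q (actG q x) :=
  intertwine (f₁ := (toDq q).comp (coactG q)) (f₂ := (toDq q).comp (actG q))
    (by simp [coactG_X, Dq.hX]) (by simp [coactG_g, Dq.gh]) x

theorem coactGi_hi (x : Ub q) : toDq q (coactGi q x) * Dq.hi q = Dq.hi q * toDq q (actGi q x) :=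
  intertwine (f₁ := (toDq q).comp (coactGi q)) (f₂ := (toDq q).comp (actGi q))
    (by
      have := Dq.comm_inv (Dq.h_hi q) (Dq.hi_h q) (Dq.hX q)
      simp [coactGi_X, this, smul_smul, -inv_pow])
    (by
      have := Dq.comm_inv (r := 1) (Dq.h_hi q) (Dq.hi_h q) ((Dq.gh q).symm.trans (one_smul k _).symm)
      simp [coactGi_g, this]) x

theorem coactX_Y (hq : (q : k) ^ 2 ≠ 1) (x : Ub q) :
    toDq q (coactX q x) + toDq q (coactG q x) * Dq.Y q =
      Dq.Y q * toDq q x + Dq.h q * toDq q (actX q x) := by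
  have h1 : IsSkew ((toDq q).comp (coactG q)) (toDq q)
      ((toDq q).toLinearMap ∘ₗ coactX q +
        LinearMap.mulRight k (Dq.Y q) ∘ₗ ((toDq q).comp (coactG q)).toLinearMap -
        LinearMap.mulLeft k (Dq.Y q) ∘ₗ (toDq q).toLinearMap) := by
    intro a b
    simp [coactX_isSkew a b, mul_sub, sub_mul, mul_add, add_mul, mul_assoc]
    abel
  have h2 : IsSkew ((toDq q).comp (coactG q)) (toDq q)
      (LinearMap.mulLeft k (Dq.h q) ∘ₗ (toDq q).toLinearMap ∘ₗ actX q) := by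
    intro a b
    simp [actX_isSkew a b, mul_add, ← mul_assoc, coactG_h]
  have h := LinearMap.congr_fun (h1.ext h2
    (by
      have e := Dq.XY q
      have hs : sXX q * ((q : k) ^ 2 - 1) = (q : k) ^ 2 := by
        have h0 := Dq.q_ne q
        have h1 : (q : k) ^ 2 - 1 ≠ 0 := sub_ne_zero.2 hq
        have h2 : 1 - ((q : k) ^ 2)⁻¹ = ((q : k) ^ 2 - 1) / (q : k) ^ 2 := by field_simp
        rw [sXX, h2, inv_div, div_mul_cancel₀ _ h1]
      have h3 : sXX q = (q : k) ^ 2 * ((q : k) ^ 2 - 1)⁻¹ := by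
        exact (eq_mul_inv_iff_mul_eq₀ (sub_ne_zero.2 hq)).2 hs
      have e2 := congrArg ((q : k) ^ 2 • ·) e
      simp only [smul_sub, smul_smul, mul_inv_cancel₀ (Dq.q_ne q), one_smul, ← h3] at e2
      simp [coactX_X, coactG_X]
      rw [add_sub_assoc, e2]
      abel)
    (by simp [coactX_g, coactG_g, Dq.gY, smul_smul, -inv_pow])) x
  simp only [LinearMap.add_apply, LinearMap.comp_apply, AlgHom.toLinearMap_apply,
    LinearMap.sub_apply, LinearMap.mulLeft_apply, LinearMap.mulRight_apply, AlgHom.coe_comp,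
    Function.comp_apply] at h
  rw [sub_eq_iff_eq_add] at h
  rw [h, add_comm]

theorem exchange (hq : (q : k) ^ 2 ≠ 1) (b : Ub q) :
    (isHopfPairing q).Exchange (toDq q) (toDq' q) b := by
  have hl1 : ∀ x : Ub q, TensorProduct.lid k _ (((pairing q).flip (g q)).rTensor (Ub q)
      (comul (R := k) x)) = coactG q x := by
    intro x
    have : (pairing q).flip (g q) = ((counitHom q).comp (actG q)).toLinearMap := by
      ext y; rw [LinearMap.flip_apply, pairing_apply, act_g]; rfl
    rw [this]
    rfl
  have hl2 : ∀ x : Ub q, TensorProduct.lid k _ (((pairing q).flip (gi q)).rTensor (Ub q)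
      (comul (R := k) x)) = coactGi q x := by
    intro x
    have : (pairing q).flip (gi q) = ((counitHom q).comp (actGi q)).toLinearMap := by
      ext y; rw [LinearMap.flip_apply, pairing_apply, act_gi]; rfl
    rw [this]
    rfl
  have hl3 : ∀ x : Ub q, TensorProduct.lid k _ (((pairing q).flip (X q)).rTensor (Ub q)
      (comul (R := k) x)) = coactX q x := fun x => rfl
  have hr := fun x a : Ub q => (act_eq x a).symm
  induction b using induction_gen with
  | hX =>
    refine (isHopfPairing q).exchange_of_comul _ fun x => ?_
    have h1 : TensorProduct.rid k _ (((pairing q).flip 1).lTensor (Ub q)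
      (comul (R := k) x)) = x := by rw [hr, map_one]; rfl
    simp only [comul_X, map_add, TensorProduct.lift.tmul, LinearMap.mk₂_apply, hl1, hl3, hr,
      toDq'_one, toDq'_X, toDq'_g, mul_one, act_X, map_one]
    exact coactX_Y hq x
  | hg =>
    refine (isHopfPairing q).exchange_of_comul _ fun x => ?_
    simp only [comul_g, TensorProduct.lift.tmul, LinearMap.mk₂_apply, hl1, hr, toDq'_g, act_g]
    exact coactG_h x
  | hgi =>
    refine (isHopfPairing q).exchange_of_comul _ fun x => ?_
    simp only [comul_gi, TensorProduct.lift.tmul, LinearMap.mk₂_apply, hl2, hr, toDq'_gi, act_gi]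
    exact coactGi_hi x
  | hr r => exact IsHopfPairing.Exchange.algebraMap _ toDq'_one r
  | ha x y hx hy => exact IsHopfPairing.Exchange.add _ hx hy
  | hm x y hx hy => exact IsHopfPairing.Exchange.mul _ toDq'_mul hx hy

theorem isBorelDouble (hq : (q : k) ^ 2 ≠ 1) : IsBorelDouble q (pairing q) (dblEquiv q) where
  double :=
    { one := by simp [dblEquiv_tmul]
      counit := counit_dblEquiv
      comul := comul_dblEquiv
      mul := by
        intro a b x y m n x₁ x₂ x₃ b₁ b₂ b₃ hx hb
        have h := (isHopfPairing q).mul_eq (exchange hq) b x hx hb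
        have e : dblEquiv q (a ⊗ₜ x) * dblEquiv q (b ⊗ₜ y) =
            toDq' q a * (toDq q x * toDq' q b) * toDq q y := by
          simp only [dblEquiv_tmul, mul_assoc]
        rw [e, h]
        simp only [Finset.mul_sum, Finset.sum_mul, dblEquiv_tmul, toDq'_mul, map_mul,
          mul_smul_comm, smul_mul_assoc, mul_assoc] }
  X := by simp [dblEquiv_tmul]
  g := by simp [dblEquiv_tmul]
  Y := by simp [dblEquiv_tmul]
  h := by simp [dblEquiv_tmul]

end Ub
end BorelDouble

end QDbl

namespace QDbl

open PowerSeries renaming C → cst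
open _root_.QDbl.Comp (of)
open MulOpposite
open QDbl.QTData (inl inr)

section SkewR

variable {A : Type*} [Ring A] [Algebra Rt A] {c : ℂ}

theorem theta_of_sq_zero {z : Comp A} (hz : z * z = 0) :
    theta c z = 1 + (1 - qs c (-2)) • z := by
  have h : coefDiv c 1 = -qd c (-2) := by
    simpa [nq] using coefDiv_succ c 0
  refine (theta_isSum c z).unique Comp.sep fun n => ?_
  match n with
  | 0 => exact ⟨_, by rw [pow_zero, one_smul]⟩
  | 1 => exact ⟨(-qd c (-2)) • z, by simp [one_sub_qs, mul_smul]⟩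
  | n + 2 =>
    refine ⟨0, ?_⟩
    rw [Finset.sum_range_succ', Finset.sum_range_succ']
    have : ∀ k, z ^ (k + 1 + 1) = 0 := fun k => by rw [pow_succ, pow_succ, mul_assoc, hz, mul_zero]
    rw [Finset.sum_eq_zero fun k _ => by simp only [this, smul_zero]]
    simp [h, one_sub_qs, mul_smul, add_comm]

theorem log_unique [Module.IsTorsionFree Rt A] (hc : c ≠ 0) {a b : Comp A}
    (h : qpow c 1 a = qpow c 1 b) : a = b := by
  simpa using intertwine_of_qpow hc (a := a) (b := b) (x := 1) (by simpa using h)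

theorem half_mul_shift {l m : Comp A} (hlm : Commute l m) (w : ℂ) :
    qpow c (1 / 2) (l * (m + (cst w : Rt) • 1)) =
      qpow c (1 / 2) (l * m) * qpow c (w / 2) l := by
  rw [mul_add, mul_smul_comm, mul_one, qpow_add, qpow_eq (w / 2), qpow_eq _ (_ • l), smul_smul,
    ← map_mul]
  · congr 3
    ring_nf
  · exact ((Commute.refl l).mul_left hlm.symm).smul_right _

/-- The effect of a skew derivation in the second leg on the canonical element. -/
theorem skew_canonical [Module.IsTorsionFree Rt A] (hc : c ≠ 0) {l l₂ m x g gi X g₂ N : Comp A}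
    {s : Rt} (hs : (1 - qs c (-2)) * s = tt) (hl : qpow c 1 l = g) (hm : qpow c 1 m = g₂)
    (hg : g * gi = 1) (gx : g * x = qs c (-2) • (x * g)) (gX : g₂ * X = qs c 2 • (X * g₂))
    (hl₂ : qpow c 1 l₂ * N = qs c 2 • (N * g₂)) (lm : Commute l m) (xm : Commute x m)
    (xg : Commute x g₂)
    (giX : Commute gi X) (xX : Commute x X) (gig : Commute gi g₂) (lN : Commute l N)
    (xN : Commute x N) (giN : Commute gi N) (XN : Commute X N) (gN : Commute g₂ N) (hN : N * N = 0) :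
    qpow c (1 / 2) (l * l₂) * theta c (gi * x * (X + s • (g₂ * N))) =
      qpow c (1 / 2) (l * l₂) * theta c (gi * x * X) +
      tt • (x * (qpow c (1 / 2) (l * m) * theta c (gi * x * X)) * N) := by
  have h1 : l₂ * N = N * (m + (cst 2 : Rt) • 1) := by
    refine intertwine_of_qpow hc ?_
    rw [hl₂, qpow_add_scalar, hm, mul_smul_comm]
  have h2 : l * x = x * (l + (cst (-2) : Rt) • 1) := by
    refine intertwine_of_qpow hc ?_
    rw [qpow_add_scalar, hl, gx, mul_smul_comm]
  have uX : Commute (gi * x) X := giX.mul_left xX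
  have ug : Commute (gi * x) g₂ := gig.mul_left xg
  have uN : Commute (gi * x) N := giN.mul_left xN
  have hadd : theta c (gi * x * (X + s • (g₂ * N))) =
      theta c (s • (gi * x * (g₂ * N))) * theta c (gi * x * X) := by
    rw [mul_add, add_comm, mul_smul_comm]
    refine theta_add ?_
    have e1 : gi * x * X * (gi * x * (g₂ * N)) = gi * x * (gi * x) * (X * g₂ * N) := by
      rw [mul_assoc (gi * x) X, ← mul_assoc X, ← uX.eq]; simp only [mul_assoc]
    have e2 : gi * x * (g₂ * N) * (gi * x * X) = qs c 2 • (gi * x * (gi * x) * (X * g₂ * N)) := by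
      rw [mul_assoc (gi * x), mul_assoc g₂, ← mul_assoc N, ← uN.eq, mul_assoc (gi * x) N, ← XN.eq,
        ← mul_assoc g₂, ← ug.eq, mul_assoc (gi * x) g₂, ← mul_assoc g₂ X, gX, smul_mul_assoc,
        mul_smul_comm, mul_smul_comm]
      simp only [mul_assoc]
    rw [smul_mul_assoc, mul_smul_comm, e1, e2, smul_smul, smul_smul]
    congr 1
    rw [mul_right_comm, qs_neg_mul, one_mul]
  have hsq : s • (gi * x * (g₂ * N)) * s • (gi * x * (g₂ * N)) = 0 := by
    rw [smul_mul_assoc, mul_smul_comm, ← mul_assoc (gi * x), mul_assoc _ N,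
      ((uN.symm).mul_right gN.symm |>.mul_right (Commute.refl N)).eq]
    simp only [mul_assoc, hN, mul_zero, smul_zero]
  have hE : qpow c (1 / 2) (l * l₂) * (gi * x * (g₂ * N)) =
      x * qpow c (1 / 2) (l * m) * N := by
    have e1 : qpow c (1 / 2) (l * l₂) * N = N * (qpow c (1 / 2) (l * m) * g) := by
      rw [qpow_intertwine (b := l * (m + (cst 2 : Rt) • 1)), half_mul_shift lm]
      · norm_num [hl]
      · rw [mul_assoc, h1, ← mul_assoc, lN.eq, mul_assoc]
    have e2 : qpow c (1 / 2) (l * m) * x = x * (qpow c (1 / 2) (l * m) * qpow c 1 (-m)) := by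
      rw [qpow_intertwine (b := m * (l + (cst (-2) : Rt) • 1)), half_mul_shift lm.symm,
        lm.eq, qpow_eq (-2 / 2)]
      · norm_num
      · rw [lm.eq, mul_assoc, h2, ← mul_assoc, ← xm.eq, mul_assoc]
    calc qpow c (1 / 2) (l * l₂) * (gi * x * (g₂ * N)) =
          qpow c (1 / 2) (l * l₂) * N * (gi * x * g₂) := by
          rw [← mul_assoc (gi * x), ((uN.mul_left gN)).eq]; simp only [mul_assoc]
      _ = N * (qpow c (1 / 2) (l * m) * x * g₂) := by
          rw [e1]
          simp only [mul_assoc]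
          rw [← mul_assoc g gi, hg, one_mul]
      _ = N * (x * qpow c (1 / 2) (l * m)) := by
          rw [e2]
          simp only [mul_assoc]
          rw [← hm, qpow_neg_mul, mul_one]
      _ = _ := by
          have mN : Commute m N := by
            have := intertwine_of_qpow hc (a := m) (b := m) (x := N) (by rw [hm, gN.eq])
            exact this
          have : Commute N (x * qpow c (1 / 2) (l * m)) :=
            xN.symm.mul_right (Commute.qpow_right (lN.symm.mul_right mN.symm) _)
          exact this.eq
  have NT : Commute N (theta c (gi * x * X)) := (theta_intertwine c (uN.mul_left XN).eq).symm
  rw [hadd, theta_of_sq_zero hsq, smul_smul, hs, add_mul, one_mul, mul_add, smul_mul_assoc,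
    mul_smul_comm, ← mul_assoc (qpow c _ _), hE, mul_assoc _ N, NT.eq]
  simp only [mul_assoc]

end SkewR

instance {q : Ktˣ} : IsScalarTower Rt Kt (Ub q) :=
  IsScalarTower.of_algebraMap_smul fun r x => (Ub.base_smul q r x).symm

instance {q : Ktˣ} : IsScalarTower Rt Kt (Dq q) :=
  IsScalarTower.of_algebraMap_smul fun r x => (Dq.base_smul q r x).symm

namespace Ub

variable {k : Type*} [Field k] [Algebra Rt k] {q : kˣ}

theorem scale_sub_one {u : k} {a r : Rt} (hu : u ≠ 0)
    (h : algebraMap Rt k a = u * algebraMap Rt k r + 1) (x : Ub q) :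
    u⁻¹ • (algebraMap Rt k a • x - 1) = a • (u⁻¹ • (x - 1)) + r • (1 : Ub q) := by
  rw [Ub.base_smul q a, Ub.base_smul q r, h, smul_sub, smul_smul,
    show u⁻¹ * (u * algebraMap Rt k r + 1) = algebraMap Rt k r + u⁻¹ by field_simp, smul_smul,
    smul_sub,
    show (u * algebraMap Rt k r + 1) * u⁻¹ = algebraMap Rt k r + u⁻¹ by field_simp]
  module

variable (q) in
/-- `x ↦ t x₁ ⟨x₂, X⟩` -/
noncomputable def actXt : Ub q →ₗ[Rt] Ub q where
  toFun x := tt • actX q x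
  map_add' x y := by rw [map_add, smul_add]
  map_smul' r x := by
    rw [Ub.base_smul q r, map_smul, ← Ub.base_smul, RingHom.id_apply, smul_comm]

theorem actXt_apply (x : Ub q) : actXt q x = tt • actX q x := rfl

theorem actXt_X {s : Rt} (h : algebraMap Rt k tt * sXX q = algebraMap Rt k s) :
    actXt q (X q) = s • g q := by
  rw [actXt_apply, actX_X, Ub.base_smul q tt, smul_smul, h, ← Ub.base_smul]

@[simp] theorem actXt_g : actXt q (g q) = 0 := by rw [actXt_apply, actX_g, smul_zero]

@[simp] theorem actXt_one : actXt q 1 = 0 := by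
  rw [actXt_apply, actX_isSkew.map_one, smul_zero]

@[simp] theorem actXt_gi : actXt q (gi q) = 0 := by
  rw [actXt_apply, actX_isSkew.map_gi, actX_g, mul_zero, zero_mul, neg_zero, smul_zero]

theorem actXt_smul (r : k) (x : Ub q) : actXt q (r • x) = r • actXt q x := by
  rw [actXt_apply, actXt_apply, map_smul, Ub.base_smul q tt, Ub.base_smul q tt, smul_comm]

theorem actXt_mul (x y : Ub q) : actXt q (x * y) = actG q x * actXt q y + actXt q x * y := by
  rw [actXt_apply, actXt_apply, actXt_apply, actX_isSkew, smul_add, mul_smul_comm, smul_mul_assoc]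
  rfl

end Ub

namespace HR

variable {c : ℂ}

variable (c) in
/-- A generator of `HR`. -/
noncomputable def gen (z : BGen) : HR c := ⟨Ub.gen (qK c) z, Algebra.subset_adjoin (Or.inl ⟨z, rfl⟩)⟩

variable (c) in
/-- `(g - 1)/(q - 1)` -/
noncomputable def lg : HR c :=
  ⟨((qK c : Kt) - 1)⁻¹ • (Ub.g (qK c) - 1), Algebra.subset_adjoin (Or.inr rfl)⟩

theorem induction_gen {p : HR c → Prop} (hX : p (gen c BGen.X)) (hg : p (gen c BGen.g))
    (hgi : p (gen c BGen.gi)) (hl : p (lg c)) (hr : ∀ r, p (algebraMap Rt _ r))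
    (ha : ∀ x y, p x → p y → p (x + y)) (hm : ∀ x y, p x → p y → p (x * y)) (x : HR c) : p x := by
  obtain ⟨x, hx⟩ := x
  induction hx using Algebra.adjoin_induction with
  | mem x hx =>
    rcases hx with ⟨z, rfl⟩ | rfl
    · cases z <;> assumption
    · exact hl
  | algebraMap r => exact hr r
  | add x y _ _ hx hy => exact ha _ _ hx hy
  | mul x y _ _ hx hy => exact hm _ _ hx hy

theorem gi_g : gen c BGen.gi * gen c BGen.g = 1 := Subtype.ext (Ub.gi_g (qK c))
theorem gX : gen c BGen.g * gen c BGen.X = qs c 2 • (gen c BGen.X * gen c BGen.g) :=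
  Subtype.ext (Ub.base_gX (qK c) (qK_sq c))

theorem g_eq (hc : c ≠ 0) : gen c BGen.g = 1 + (qs c 1 - 1) • lg c := by
  apply Subtype.ext
  change Ub.g (qK c) = 1 + (qs c 1 - 1) • (((qK c : Kt) - 1)⁻¹ • (Ub.g (qK c) - 1))
  rw [Ub.base_smul_inv (qK_sub_one c) (qK_sub_one_ne hc), add_sub_cancel]

/-- A homomorphism from `U_q(b₋)` over `ℂ((t))` restricts to `HR`. -/
theorem map_mem {B : Type*} [Ring B] [Algebra Kt B] [Algebra Rt B] [IsScalarTower Rt Kt B]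
    (f : Ub (qK c) →ₐ[Kt] B) (S : Subalgebra Rt B) (hX : f (Ub.X _) ∈ S) (hg : f (Ub.g _) ∈ S)
    (hgi : f (Ub.gi _) ∈ S) (hl : ((qK c : Kt) - 1)⁻¹ • (f (Ub.g _) - 1) ∈ S) (x : HR c) :
    f x ∈ S := by
  induction x using induction_gen with
  | hX => exact hX
  | hg => exact hg
  | hgi => exact hgi
  | hl =>
    change f (((qK c : Kt) - 1)⁻¹ • (Ub.g (qK c) - 1)) ∈ S
    rwa [map_smul, map_sub, map_one]
  | hr r =>
    rw [show ((algebraMap Rt (HR c) r : HR c) : Ub (qK c)) = algebraMap Kt _ (algebraMap Rt Kt r) from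
      rfl, AlgHom.commutes, ← IsScalarTower.algebraMap_apply]
    exact S.algebraMap_mem r
  | ha x y hx hy => rw [Subalgebra.coe_add, map_add]; exact S.add_mem hx hy
  | hm x y hx hy => rw [Subalgebra.coe_mul, map_mul]; exact S.mul_mem hx hy

/-- The restriction of a homomorphism from `U_q(b₋)` over `ℂ((t))` to `HR`. -/
noncomputable def restrict {B : Type*} [Ring B] [Algebra Kt B] [Algebra Rt B] [IsScalarTower Rt Kt B]
    (f : Ub (qK c) →ₐ[Kt] B) (S : Subalgebra Rt B) (h : ∀ x : HR c, f x ∈ S) : HR c →ₐ[Rt] S :=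
  AlgHom.codRestrict ((f.restrictScalars Rt).comp (HR c).val) S h

theorem sub_one_dvd (hc : c ≠ 0) (w : ℂ) : qs c 1 - 1 ∣ qs c w - 1 := by
  rw [← tt_mul_qd, ← tt_mul_qd]
  refine mul_dvd_mul_left _ (IsUnit.dvd (isUnit_of_constCoeff ?_))
  rw [constCoeff_qd, one_mul]
  exact hc

/-- Rescaling of `g` preserves `HR`. -/
theorem scale_mem {w : ℂ} (f : Ub (qK c) →ₐ[Kt] Ub (qK c)) (hc : c ≠ 0) (hX : f (Ub.X _) = Ub.X _)
    (hg : f (Ub.g _) = algebraMap Rt Kt (qs c w) • Ub.g _)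
    (hgi : f (Ub.gi _) = algebraMap Rt Kt (qs c (-w)) • Ub.gi _) (x : HR c) : f x ∈ HR c := by
  refine map_mem f _ ?_ ?_ ?_ ?_ x
  · rw [hX]; exact (gen c BGen.X).2
  · rw [hg, ← Ub.base_smul]; exact (HR c).smul_mem (gen c BGen.g).2 _
  · rw [hgi, ← Ub.base_smul]; exact (HR c).smul_mem (gen c BGen.gi).2 _
  · obtain ⟨r, hr⟩ := sub_one_dvd hc w
    have hr' := congrArg (algebraMap Rt Kt) hr
    rw [map_mul, qK_sub_one, map_sub, map_one, sub_eq_iff_eq_add] at hr'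
    rw [hg, Ub.scale_sub_one (qK_sub_one_ne hc) hr']
    exact Subtype.prop (qs c w • lg c + r • 1)

theorem actG_mem (hc : c ≠ 0) (x : HR c) : Ub.actG (qK c) x ∈ HR c :=
  scale_mem (w := 2) _ hc (by simp) (by simp [qK_sq])
    (by rw [algebraMap_inv_sq (qK c) (qK_sq c) (qs_neg_mul c 2), Ub.actG_gi]) x

theorem actGi_mem (hc : c ≠ 0) (x : HR c) : Ub.actGi (qK c) x ∈ HR c :=
  scale_mem (w := -2) _ hc (by simp)
    (by rw [algebraMap_inv_sq (qK c) (qK_sq c) (qs_neg_mul c 2), Ub.actGi_g])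
    (by simp [qK_sq]) x

variable (hc : c ≠ 0)

/-- `x ↦ x₁ ⟨x₂, g⟩` on `HR`. -/
noncomputable def actG : HR c →ₐ[Rt] HR c := restrict (Ub.actG (qK c)) (HR c) (actG_mem hc)
/-- `x ↦ x₁ ⟨x₂, g⁻¹⟩` on `HR`. -/
noncomputable def actGi : HR c →ₐ[Rt] HR c := restrict (Ub.actGi (qK c)) (HR c) (actGi_mem hc)

theorem exists_sXX (hc : c ≠ 0) : ∃ s : Rt, (1 - qs c (-2)) * s = tt ∧
    algebraMap Rt Kt tt * Ub.sXX (qK c) = algebraMap Rt Kt s := by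
  have hu : IsUnit (-qd c (-2)) := by
    refine isUnit_of_constCoeff ?_
    rw [map_neg, constCoeff_qd]
    simpa using hc
  obtain ⟨u, hu⟩ := hu
  have h1 : (1 - qs c (-2)) * (u⁻¹ : Rtˣ) = tt := by
    rw [one_sub_qs, ← hu, mul_assoc, Units.mul_inv, mul_one]
  refine ⟨(u⁻¹ : Rtˣ), h1, ?_⟩
  have h2 := congrArg (algebraMap Rt Kt) h1
  rw [map_mul, map_sub, map_one, algebraMap_inv_sq (qK c) (qK_sq c) (qs_neg_mul c 2)] at h2
  rw [← h2, Ub.sXX, mul_right_comm, mul_inv_cancel₀, one_mul]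
  rw [sub_ne_zero]
  exact fun h => qK_sq_ne hc (inv_eq_one.1 h.symm)

theorem actXt_mem (hc : c ≠ 0) (x : HR c) : Ub.actXt (qK c) x ∈ HR c := by
  obtain ⟨s, -, hs⟩ := exists_sXX hc
  induction x using induction_gen with
  | hX =>
    change Ub.actXt (qK c) (Ub.X _) ∈ HR c
    rw [Ub.actXt_X hs]
    exact (HR c).smul_mem (gen c BGen.g).2 _
  | hg => rw [show ((gen c BGen.g : HR c) : Ub (qK c)) = Ub.g _ from rfl, Ub.actXt_g]; exact (HR c).zero_mem
  | hgi => rw [show ((gen c BGen.gi : HR c) : Ub (qK c)) = Ub.gi _ from rfl, Ub.actXt_gi]; exact (HR c).zero_mem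
  | hl =>
    change Ub.actXt (qK c) (((qK c : Kt) - 1)⁻¹ • (Ub.g (qK c) - 1)) ∈ HR c
    rw [Ub.actXt_smul, map_sub, Ub.actXt_g, Ub.actXt_one, sub_zero, smul_zero]
    exact (HR c).zero_mem
  | hr r =>
    rw [Algebra.algebraMap_eq_smul_one, Subalgebra.coe_smul, Subalgebra.coe_one, map_smul,
      Ub.actXt_one, smul_zero]
    exact (HR c).zero_mem
  | ha x y hx hy => rw [Subalgebra.coe_add, map_add]; exact (HR c).add_mem hx hy
  | hm x y hx hy =>
    rw [Subalgebra.coe_mul, Ub.actXt_mul]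
    exact (HR c).add_mem ((HR c).mul_mem (actG_mem hc x) hy) ((HR c).mul_mem hx y.2)

/-- `x ↦ t x₁ ⟨x₂, X⟩` on `HR`. -/
noncomputable def actX : HR c →ₗ[Rt] HR c :=
  LinearMap.codRestrict (Subalgebra.toSubmodule (HR c)) (Ub.actXt (qK c) ∘ₗ (HR c).val.toLinearMap)
    (actXt_mem hc)

/-- `x ↦ [[x₁ ⟨x₂, g⟩, t x₁ ⟨x₂, X⟩], [0, x]]` on `HR`. -/
noncomputable def skewMat : HR c →ₐ[Rt] Matrix (Fin 2) (Fin 2) (HR c) :=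
  AlgHom.ofLinearMap
    { toFun := fun x => !![actG hc x, actX hc x; 0, x]
      map_add' := fun x y => by simp
      map_smul' := fun r x => by simp }
    (by
      have : actX hc 1 = 0 := Subtype.ext Ub.actXt_one
      simp [this, Matrix.one_fin_two])
    (fun x y => by
      have : actX hc (x * y) = actG hc x * actX hc y + actX hc x * y :=
        Subtype.ext (Ub.actXt_mul (x : Ub (qK c)) y)
      simp [this])

/-- `x ↦ [[x₁ ⟨x₂, g⟩, 0], [0, x]]` on `HR`. -/
noncomputable def diagMat : HR c →ₐ[Rt] Matrix (Fin 2) (Fin 2) (HR c) :=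
  AlgHom.ofLinearMap
    { toFun := fun x => !![actG hc x, 0; 0, x]
      map_add' := fun x y => by simp
      map_smul' := fun r x => by simp }
    (by simp [Matrix.one_fin_two]) (fun x y => by simp)

/-- `x ↦ [[x, 0], [0, x]]` on `HR`. -/
noncomputable def scalarMat (c : ℂ) : HR c →ₐ[Rt] Matrix (Fin 2) (Fin 2) (HR c) :=
  AlgHom.ofLinearMap
    { toFun := fun x => !![x, 0; 0, x]
      map_add' := fun x y => by simp
      map_smul' := fun r x => by simp }
    (by simp [Matrix.one_fin_two]) (fun x y => by simp)

end HR

instance {m n A : Type*} [Ring A] [Algebra Rt A] [Module.IsTorsionFree Rt A] :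
    Module.IsTorsionFree Rt (Matrix m n A) :=
  inferInstanceAs (Module.IsTorsionFree Rt (m → n → A))

section SecondFactor

variable (A : Type*) {B B' B'' : Type*} [Ring A] [Algebra Rt A] [Ring B] [Algebra Rt B] [Ring B']
  [Algebra Rt B'] [Ring B''] [Algebra Rt B'']

/-- The action of a linear map on the second tensor factor. -/
noncomputable def sndMap (f : B →ₗ[Rt] B') : Comp (A ⊗[Rt] B) →ₗ[Rt] Comp (A ⊗[Rt] B') :=
  Comp.map (f.lTensor A)

/-- The action of a homomorphism on the second tensor factor. -/
noncomputable def sndHom (f : B →ₐ[Rt] B') : Comp (A ⊗[Rt] B) →ₐ[Rt] Comp (A ⊗[Rt] B') :=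
  Comp.mapHom (Algebra.TensorProduct.map (AlgHom.id Rt A) f)

variable {A}

theorem sndMap_of_tmul (f : B →ₗ[Rt] B') (a : A) (b : B) :
    sndMap A f (of (a ⊗ₜ b)) = of (a ⊗ₜ f b) := rfl

theorem sndHom_apply (f : B →ₐ[Rt] B') (z : Comp (A ⊗[Rt] B)) :
    sndHom A f z = sndMap A f.toLinearMap z := rfl

theorem sndHom_inl (f : B →ₐ[Rt] B') (a : A) : sndHom A f (inl A B a) = inl A B' a := by
  change of (a ⊗ₜ f 1) = of (a ⊗ₜ 1)
  rw [map_one]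

theorem sndHom_inr (f : B →ₐ[Rt] B') (b : B) : sndHom A f (inr A B b) = inr A B' (f b) := rfl

theorem sndMap_sndMap (f : B →ₗ[Rt] B') (g : B' →ₗ[Rt] B'') (z : Comp (A ⊗[Rt] B)) :
    sndMap A g (sndMap A f z) = sndMap A (g ∘ₗ f) z :=
  LinearMap.congr_fun (tensor_linear_ext Comp.sep (f := sndMap A g ∘ₗ sndMap A f)
    (g := sndMap A (g ∘ₗ f)) fun _ _ => rfl) z

theorem sndMap_zero (z : Comp (A ⊗[Rt] B)) : sndMap A (0 : B →ₗ[Rt] B') z = 0 :=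
  LinearMap.congr_fun (tensor_linear_ext Comp.sep (f := sndMap A (0 : B →ₗ[Rt] B'))
    (g := 0) fun a b => by rw [sndMap_of_tmul]; simp) z

theorem sndMap_id (z : Comp (A ⊗[Rt] B)) : sndMap A LinearMap.id z = z :=
  LinearMap.congr_fun (tensor_linear_ext Comp.sep (f := sndMap A (LinearMap.id : B →ₗ[Rt] B))
    (g := LinearMap.id) fun a b => by rw [sndMap_of_tmul]; rfl) z

theorem sndMap_add (f g : B →ₗ[Rt] B') (z : Comp (A ⊗[Rt] B)) :
    sndMap A (f + g) z = sndMap A f z + sndMap A g z :=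
  LinearMap.congr_fun (tensor_linear_ext Comp.sep (f := sndMap A (f + g))
    (g := sndMap A f + sndMap A g) fun a b => by
      rw [LinearMap.add_apply, sndMap_of_tmul, sndMap_of_tmul, sndMap_of_tmul, ← map_add,
        ← TensorProduct.tmul_add]; rfl) z

theorem sndMap_smul (r : Rt) (f : B →ₗ[Rt] B') (z : Comp (A ⊗[Rt] B)) :
    sndMap A (r • f) z = r • sndMap A f z :=
  LinearMap.congr_fun (tensor_linear_ext Comp.sep (f := sndMap A (r • f))
    (g := r • sndMap A f) fun a b => by
      rw [LinearMap.smul_apply, sndMap_of_tmul, sndMap_of_tmul, ← map_smul,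
        ← TensorProduct.tmul_smul]; rfl) z

theorem sndMap_inl_mul (f : B →ₗ[Rt] B') (a : A) (z : Comp (A ⊗[Rt] B)) :
    sndMap A f (inl A B a * z) = inl A B' a * sndMap A f z :=
  LinearMap.congr_fun (tensor_linear_ext Comp.sep
    (f := sndMap A f ∘ₗ LinearMap.mulLeft Rt (inl A B a))
    (g := LinearMap.mulLeft Rt (inl A B' a) ∘ₗ sndMap A f) fun a' b => by
      change sndMap A f (of (a ⊗ₜ 1) * of (a' ⊗ₜ b)) =
        of (a ⊗ₜ 1) * sndMap A f (of (a' ⊗ₜ b))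
      rw [← map_mul, Algebra.TensorProduct.tmul_mul_tmul, sndMap_of_tmul, sndMap_of_tmul, ← map_mul,
        Algebra.TensorProduct.tmul_mul_tmul, one_mul, one_mul]) z

theorem sndMap_mul_inr (f : B →ₗ[Rt] B') (b : B) (z : Comp (A ⊗[Rt] B)) :
    sndMap A f (z * inr A B b) = sndMap A (f ∘ₗ LinearMap.mulRight Rt b) z :=
  LinearMap.congr_fun (tensor_linear_ext Comp.sep
    (f := sndMap A f ∘ₗ LinearMap.mulRight Rt (inr A B b))
    (g := sndMap A (f ∘ₗ LinearMap.mulRight Rt b)) fun a' b' => by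
      change sndMap A f (of (a' ⊗ₜ b') * of (1 ⊗ₜ b)) = _
      rw [← map_mul, Algebra.TensorProduct.tmul_mul_tmul, mul_one]; rfl) z

end SecondFactor

namespace HR

variable {c : ℂ}

theorem exists_logL (hc : c ≠ 0) : ∃ L : Comp ((HR c)ᵐᵒᵖ ⊗[Rt] HR c),
    qpow c 1 L = inl _ _ (op (gen c BGen.g)) := by
  obtain ⟨L, hL⟩ := exists_log hc (inl (HR c)ᵐᵒᵖ (HR c) (op (qd c 1 • lg c)))
  refine ⟨L, ?_⟩
  rw [hL, g_eq hc, ← tt_mul_qd, op_add, op_one, map_add, map_one, mul_smul,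
    op_smul tt, map_smul _ tt]

theorem exists_logR (hc : c ≠ 0) : ∃ L : Comp ((HR c)ᵐᵒᵖ ⊗[Rt] HR c),
    qpow c 1 L = inr _ _ (gen c BGen.g) := by
  obtain ⟨L, hL⟩ := exists_log hc (inr (HR c)ᵐᵒᵖ (HR c) (qd c 1 • lg c))
  refine ⟨L, ?_⟩
  rw [hL, g_eq hc, ← tt_mul_qd, map_add, map_one, mul_smul, map_smul _ tt]

/-- The logarithm of `g` in the left factor. -/
noncomputable def logL (hc : c ≠ 0) : Comp ((HR c)ᵐᵒᵖ ⊗[Rt] HR c) := (exists_logL hc).choose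
/-- The logarithm of `g` in the right factor. -/
noncomputable def logR (hc : c ≠ 0) : Comp ((HR c)ᵐᵒᵖ ⊗[Rt] HR c) := (exists_logR hc).choose

theorem qpow_logL (hc : c ≠ 0) : qpow c 1 (logL hc) = inl _ _ (op (gen c BGen.g)) :=
  (exists_logL hc).choose_spec
theorem qpow_logR (hc : c ≠ 0) : qpow c 1 (logR hc) = inr _ _ (gen c BGen.g) :=
  (exists_logR hc).choose_spec

theorem commute_logs (hc : c ≠ 0) : Commute (logL hc) (logR hc) := by
  refine intertwine_of_qpow hc ?_
  rw [qpow_logL]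
  refine (intertwine_of_qpow hc ?_).symm
  rw [qpow_logR]
  exact (inl_inr_comm _ _).symm

/-- The canonical element of the pairing. -/
noncomputable def canon (hc : c ≠ 0) : Comp ((HR c)ᵐᵒᵖ ⊗[Rt] HR c) :=
  qpow c (1 / 2) (logL hc * logR hc) *
    theta c (inl _ _ (op (gen c BGen.gi)) * inl _ _ (op (gen c BGen.X)) *
      inr _ _ (gen c BGen.X))

theorem sndHom_logL (hc : c ≠ 0) {B : Type*} [Ring B] [Algebra Rt B] [Module.IsTorsionFree Rt B]
    (f f' : HR c →ₐ[Rt] B) : sndHom _ f (logL hc) = sndHom _ f' (logL hc) := by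
  refine log_unique hc ?_
  rw [← qpow_map, ← qpow_map, qpow_logL, sndHom_inl, sndHom_inl]

theorem sndHom_logR (hc : c ≠ 0) {B : Type*} [Ring B] [Algebra Rt B] [Module.IsTorsionFree Rt B]
    {f f' : HR c →ₐ[Rt] B} (h : f (gen c BGen.g) = f' (gen c BGen.g)) :
    sndHom (HR c)ᵐᵒᵖ f (logR hc) = sndHom _ f' (logR hc) := by
  refine log_unique hc ?_
  rw [← qpow_map, ← qpow_map, qpow_logR, sndHom_inr, sndHom_inr, h]

theorem sndHom_canon (hc : c ≠ 0) {B : Type*} [Ring B] [Algebra Rt B] (f : HR c →ₐ[Rt] B) :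
    sndHom (HR c)ᵐᵒᵖ f (canon hc) = qpow c (1 / 2) (sndHom _ f (logL hc) * sndHom _ f (logR hc)) *
    theta c (inl _ _ (op (gen c BGen.gi)) * inl _ _ (op (gen c BGen.X)) *
      inr _ _ (f (gen c BGen.X))) := by
  rw [canon, map_mul, qpow_map, theta_map, map_mul, map_mul, map_mul, sndHom_inl, sndHom_inl,
    sndHom_inr]

theorem sndHom_id {A B : Type*} [Ring A] [Algebra Rt A] [Ring B] [Algebra Rt B]
    (z : Comp (A ⊗[Rt] B)) : sndHom A (AlgHom.id Rt B) z = z := sndMap_id z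

/-- Rescaling of `g` in the second factor multiplies the canonical element by a power of `g`. -/
theorem scale_canon (hc : c ≠ 0) {f : HR c →ₐ[Rt] HR c} {w : ℂ}
    (hX : f (gen c BGen.X) = gen c BGen.X) (hg : f (gen c BGen.g) = qs c w • gen c BGen.g) :
    sndHom (HR c)ᵐᵒᵖ f (canon hc) = qpow c (w / 2) (logL hc) * canon hc := by
  have h1 : sndHom (HR c)ᵐᵒᵖ f (logL hc) = logL hc := by
    rw [sndHom_logL hc f (AlgHom.id Rt _), sndHom_id]
  have h2 : sndHom (HR c)ᵐᵒᵖ f (logR hc) = logR hc + (cst w : Rt) • 1 := by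
    refine log_unique hc ?_
    rw [← qpow_map, qpow_logR, sndHom_inr, qpow_add_scalar, qpow_logR, hg, map_smul]
  have h3 : Commute (logL hc) (logL hc * logR hc) := (Commute.refl _).mul_right (commute_logs hc)
  rw [sndHom_canon, h1, h2, hX, half_mul_shift (commute_logs hc), canon, ← mul_assoc,
    ((h3.qpow_left _).qpow_right _).eq]

theorem scalarMat_apply (x : HR c) : scalarMat c x = !![x, 0; 0, x] := rfl
theorem diagMat_apply (hc : c ≠ 0) (x : HR c) : diagMat hc x = !![actG hc x, 0; 0, x] := rfl
theorem skewMat_apply (hc : c ≠ 0) (x : HR c) :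
    skewMat hc x = !![actG hc x, actX hc x; 0, x] := rfl

theorem actG_g (hc : c ≠ 0) : actG hc (gen c BGen.g) = qs c 2 • gen c BGen.g :=
  Subtype.ext (by
    change Ub.actG (qK c) (Ub.g _) = qs c 2 • Ub.g (qK c)
    rw [Ub.actG_g, Ub.base_smul (qK c) (qs c 2), qK_sq])

theorem actG_X (hc : c ≠ 0) : actG hc (gen c BGen.X) = gen c BGen.X := Subtype.ext Ub.actG_X

theorem commute_scalarMat (x : HR c) : scalarMat c x * !![0, 1; 0, 0] = !![0, 1; 0, 0] * scalarMat c x := by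
  simp [scalarMat_apply]

theorem diagMat_mul (hc : c ≠ 0) : diagMat hc (gen c BGen.g) * !![0, 1; 0, 0] =
    qs c 2 • (!![0, 1; 0, 0] * scalarMat c (gen c BGen.g)) := by
  simp [scalarMat_apply, diagMat_apply, actG_g]

theorem skewMat_X (hc : c ≠ 0) {s : Rt}
    (hs : algebraMap Rt Kt tt * Ub.sXX (qK c) = algebraMap Rt Kt s) : skewMat hc (gen c BGen.X) =
      scalarMat c (gen c BGen.X) + s • (scalarMat c (gen c BGen.g) * !![0, 1; 0, 0]) := by
  have h1 : actX hc (gen c BGen.X) = s • gen c BGen.g := Subtype.ext (Ub.actXt_X hs)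
  simp [skewMat_apply, scalarMat_apply, h1, actG_X]

theorem diagMat_X (hc : c ≠ 0) : diagMat hc (gen c BGen.X) = scalarMat c (gen c BGen.X) := by
  simp [diagMat_apply, scalarMat_apply, actG_X]

theorem skewMat_g (hc : c ≠ 0) : skewMat hc (gen c BGen.g) = diagMat hc (gen c BGen.g) := by
  have h1 : actX hc (gen c BGen.g) = 0 := Subtype.ext Ub.actXt_g
  simp [skewMat_apply, diagMat_apply, h1]

theorem skew_canon (hc : c ≠ 0) {B : Type*} [Ring B] [Algebra Rt B] [Module.IsTorsionFree Rt B]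
    {f d σ : HR c →ₐ[Rt] B} {N : B} {s : Rt} (hs : (1 - qs c (-2)) * s = tt)
    (dX : d (gen c BGen.X) = σ (gen c BGen.X)) (fg : f (gen c BGen.g) = d (gen c BGen.g))
    (fX : f (gen c BGen.X) = σ (gen c BGen.X) + s • (σ (gen c BGen.g) * N))
    (dN : d (gen c BGen.g) * N = qs c 2 • (N * σ (gen c BGen.g)))
    (σN : ∀ x, σ x * N = N * σ x) (NN : N * N = 0) :
    sndHom (HR c)ᵐᵒᵖ f (canon hc) = sndHom _ d (canon hc) +
      tt • (inl _ _ (op (gen c BGen.X)) * sndHom _ σ (canon hc) * inr _ _ N) := by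
  have c1 : ∀ (a : (HR c)ᵐᵒᵖ) (b : B), Commute (inl _ _ a) (inr _ _ b) := inl_inr_comm
  have key := skew_canonical (A := (HR c)ᵐᵒᵖ ⊗[Rt] B) hc
    (l := sndHom _ σ (logL hc)) (l₂ := sndHom _ d (logR hc))
    (m := sndHom _ σ (logR hc)) (x := inl _ _ (op (gen c BGen.X)))
    (g := inl _ _ (op (gen c BGen.g))) (gi := inl _ _ (op (gen c BGen.gi)))
    (X := inr _ _ (σ (gen c BGen.X))) (g₂ := inr _ _ (σ (gen c BGen.g)))
    (N := inr _ _ N) hs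
    (by rw [← qpow_map, qpow_logL, sndHom_inl]) (by rw [← qpow_map, qpow_logR, sndHom_inr])
    (by rw [← map_mul, ← op_mul, gi_g, op_one, map_one])
    (by
      rw [← map_mul, ← map_mul, ← map_smul, ← op_mul, ← op_mul, gX,
        op_smul, smul_smul, qs_neg_mul, one_smul])
    (by rw [← map_mul, ← map_mul, ← map_mul, ← map_mul, ← map_smul, ← map_smul, gX])
    (by
      rw [← qpow_map, qpow_logR, sndHom_inr, ← map_mul, ← map_mul, ← map_smul, dN])
    (by rw [commute_iff_eq, ← map_mul, (commute_logs hc).eq, map_mul])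
    (intertwine_of_qpow hc
      (by rw [← qpow_map, qpow_logR, sndHom_inr]; exact (c1 _ _).symm)).symm
    (c1 _ _) (c1 _ _) (c1 _ _) (c1 _ _)
    (intertwine_of_qpow hc (by rw [← qpow_map, qpow_logL, sndHom_inl]; exact c1 _ _))
    (c1 _ _) (c1 _ _)
    (by rw [commute_iff_eq, ← map_mul, ← map_mul, σN])
    (by rw [commute_iff_eq, ← map_mul, ← map_mul, σN])
    (by rw [← map_mul, NN, map_zero])
  rw [← map_mul (inr _ _), ← map_smul (inr _ _), ← map_add (inr _ _), ← fX] at key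
  have h1 := sndHom_canon hc f
  rw [sndHom_logR hc fg, sndHom_logL hc f σ] at h1
  have h2 := sndHom_canon hc d
  rw [sndHom_logL hc d σ, dX] at h2
  rw [h1, h2, sndHom_canon hc σ]
  exact key

theorem skewMat_canon (hc : c ≠ 0) : sndHom (HR c)ᵐᵒᵖ (skewMat hc) (canon hc) =
    sndHom _ (diagMat hc) (canon hc) +
      tt • (inl _ _ (op (gen c BGen.X)) * sndHom _ (scalarMat c) (canon hc) *
        inr _ _ !![0, 1; 0, 0]) := by
  obtain ⟨s, hs, hs'⟩ := exists_sXX hc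
  exact skew_canon hc hs (diagMat_X hc) (skewMat_g hc) (skewMat_X hc hs') (diagMat_mul hc)
    commute_scalarMat (by ext i j; fin_cases i <;> fin_cases j <;> simp)

/-- The skew derivation `t x₁ ⟨x₂, X⟩` in the second factor of the canonical element. -/
theorem actX_canon (hc : c ≠ 0) : sndMap (HR c)ᵐᵒᵖ (actX hc) (canon hc) =
    inl _ _ (op (tt • gen c BGen.X)) * canon hc := by
  let e : Matrix (Fin 2) (Fin 2) (HR c) →ₗ[Rt] HR c := Matrix.entryLinearMap Rt (HR c) 0 1
  have key' := congrArg (sndMap (HR c)ᵐᵒᵖ e) (skewMat_canon hc)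
  rw [map_add, map_smul, mul_assoc, sndMap_inl_mul, sndMap_mul_inr, sndHom_apply, sndHom_apply,
    sndHom_apply, sndMap_sndMap, sndMap_sndMap, sndMap_sndMap,
    show e ∘ₗ (skewMat hc).toLinearMap = actX hc from rfl,
    show e ∘ₗ (diagMat hc).toLinearMap = 0 from rfl, sndMap_zero, zero_add,
    show (e ∘ₗ LinearMap.mulRight Rt !![0, 1; 0, 0]) ∘ₗ (scalarMat c).toLinearMap = LinearMap.id from
      LinearMap.ext fun x => by simp [e, scalarMat_apply], sndMap_id] at key'
  rw [key', op_smul, map_smul, smul_mul_assoc]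

end HR

namespace Ub

variable {k : Type*} [Field k] [Algebra Rt k] {q : kˣ}

theorem act_base_smul (r : Rt) (a x : Ub q) : act q (r • a) x = r • act q a x := by
  rw [Ub.base_smul q r, map_smul, LinearMap.smul_apply, ← Ub.base_smul]

theorem pairing_base_smul (r : Rt) (x a : Ub q) :
    pairing q x (r • a) = algebraMap Rt k r * pairing q x a := by
  rw [Ub.base_smul q r, map_smul, smul_eq_mul]

end Ub

namespace HR

variable {c : ℂ}

/-- Contracting the second factor of the canonical element with `b` gives `b`. -/
def Reproduces (hc : c ≠ 0) (b : HR c) : Prop :=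
  ∃ F : HR c →ₗ[Rt] HR c, (∀ x, (F x : Ub (qK c)) = Ub.act (qK c) b x) ∧
    sndMap (HR c)ᵐᵒᵖ F (canon hc) = inl _ _ (op b) * canon hc

variable {hc : c ≠ 0} {a b : HR c}

theorem Reproduces.one : Reproduces hc 1 :=
  ⟨LinearMap.id, fun x => by rw [Subalgebra.coe_one, map_one]; rfl, by
    rw [sndMap_id, op_one, map_one, one_mul]⟩

theorem Reproduces.add (ha : Reproduces hc a) (hb : Reproduces hc b) : Reproduces hc (a + b) := by
  obtain ⟨F, h1, h2⟩ := ha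
  obtain ⟨F', h3, h4⟩ := hb
  refine ⟨F + F', fun x => ?_, ?_⟩
  · rw [LinearMap.add_apply, Subalgebra.coe_add, Subalgebra.coe_add, h1, h3, map_add]; rfl
  · rw [sndMap_add, h2, h4, op_add, map_add, add_mul]

theorem Reproduces.smul (r : Rt) (ha : Reproduces hc a) : Reproduces hc (r • a) := by
  obtain ⟨F, h1, h2⟩ := ha
  refine ⟨r • F, fun x => ?_, ?_⟩
  · rw [LinearMap.smul_apply, Subalgebra.coe_smul, Subalgebra.coe_smul, h1, Ub.act_base_smul]
  · rw [sndMap_smul, h2, op_smul, map_smul, smul_mul_assoc]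

theorem Reproduces.mul (ha : Reproduces hc a) (hb : Reproduces hc b) : Reproduces hc (a * b) := by
  obtain ⟨F, h1, h2⟩ := ha
  obtain ⟨F', h3, h4⟩ := hb
  refine ⟨F ∘ₗ F', fun x => ?_, ?_⟩
  · rw [LinearMap.comp_apply, h1, h3, Subalgebra.coe_mul, map_mul]; rfl
  · rw [← sndMap_sndMap, h4, sndMap_inl_mul, h2, ← mul_assoc, ← map_mul, op_mul]

theorem reproduces_g : Reproduces hc (gen c BGen.g) := by
  refine ⟨(actG hc).toLinearMap, fun x => ?_, ?_⟩
  · exact (LinearMap.congr_fun Ub.act_g (x : Ub (qK c))).symm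
  · rw [← sndHom_apply, scale_canon hc (actG_X hc) (actG_g hc), div_self two_ne_zero, qpow_logL]

theorem reproduces_gi : Reproduces hc (gen c BGen.gi) := by
  refine ⟨(actGi hc).toLinearMap, fun x => ?_, ?_⟩
  · exact (LinearMap.congr_fun Ub.act_gi (x : Ub (qK c))).symm
  · have h : qpow c (-1) (logL hc) = inl _ _ (op (gen c BGen.gi)) := by
      rw [qpow_eq, map_neg, map_one, neg_one_smul]
      refine left_inv_eq_right_inv (qpow_neg_mul 1 (logL hc)) ?_
      rw [qpow_logL, ← map_mul, ← op_mul, gi_g, op_one, map_one]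
    rw [← sndHom_apply, scale_canon hc (w := -2) (Subtype.ext Ub.actGi_X) (Subtype.ext ?_),
      neg_div, div_self two_ne_zero, h]
    change Ub.actGi (qK c) (Ub.g _) = qs c (-2) • Ub.g (qK c)
    rw [Ub.actGi_g, Ub.base_smul (qK c) (qs c (-2)),
      algebraMap_inv_sq (qK c) (qK_sq c) (qs_neg_mul c 2)]

theorem reproduces_X : Reproduces hc (tt • gen c BGen.X) :=
  ⟨actX hc, fun x => by
    rw [Subalgebra.coe_smul, Ub.act_base_smul]
    exact congrArg (tt • ·) (LinearMap.congr_fun Ub.act_X (x : Ub (qK c))).symm, actX_canon hc⟩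

theorem reproduces_lg : Reproduces hc (tt • lg c) := by
  have hu : IsUnit (qd c 1) := by
    refine isUnit_of_constCoeff ?_
    rw [constCoeff_qd, one_mul]
    exact hc
  obtain ⟨u, hu⟩ := hu
  have : tt • lg c = ((u⁻¹ : Rtˣ) : Rt) • (gen c BGen.g + (-1 : Rt) • 1) := by
    rw [g_eq hc, neg_one_smul, add_neg_cancel_comm, smul_smul, ← tt_mul_qd, ← hu, mul_comm tt,
      ← mul_assoc, Units.inv_mul, one_mul]
  rw [this]
  exact (reproduces_g.add (Reproduces.one.smul _)).smul _

theorem exists_reproduces (hc : c ≠ 0) (b : HR c) : ∃ N : ℕ, Reproduces hc (tt ^ N • b) := by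
  induction b using induction_gen with
  | hX => exact ⟨1, by rw [pow_one]; exact reproduces_X⟩
  | hg => exact ⟨0, by rw [pow_zero, one_smul]; exact reproduces_g⟩
  | hgi => exact ⟨0, by rw [pow_zero, one_smul]; exact reproduces_gi⟩
  | hl => exact ⟨1, by rw [pow_one]; exact reproduces_lg⟩
  | hr r => exact ⟨0, by rw [Algebra.algebraMap_eq_smul_one]; exact (Reproduces.one.smul _).smul _⟩
  | ha x y hx hy =>
    obtain ⟨m, hx⟩ := hx
    obtain ⟨n, hy⟩ := hy
    refine ⟨m + n, ?_⟩
    rw [smul_add, pow_add, mul_smul (tt ^ m) _ y, mul_comm, mul_smul]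
    exact (hx.smul _).add (hy.smul _)
  | hm x y hx hy =>
    obtain ⟨m, hx⟩ := hx
    obtain ⟨n, hy⟩ := hy
    refine ⟨m + n, ?_⟩
    rw [pow_add, ← smul_mul_smul_comm]
    exact hx.mul hy

theorem counit_mem (x : HR c) : Ub.counitHom (qK c) x ∈ (⊥ : Subalgebra Rt Kt) := by
  refine map_mem _ _ ?_ ?_ ?_ ?_ x <;> simp [Ub.counitHom]

/-- The counit of `HR`. -/
noncomputable def counit (c : ℂ) : HR c →ₐ[Rt] Rt :=
  (Algebra.botEquivOfInjective algebraMap_Kt_injective).toAlgHom.comp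
    (restrict (Ub.counitHom (qK c)) ⊥ counit_mem)

theorem algebraMap_counit (x : HR c) :
    algebraMap Rt Kt (counit c x) = Coalgebra.counit (R := Kt) (x : Ub (qK c)) := by
  have := (Algebra.botEquivOfInjective (R := Rt) (A := Kt) algebraMap_Kt_injective).symm_apply_apply
    (restrict (Ub.counitHom (qK c)) ⊥ counit_mem x)
  exact congrArg Subtype.val this

/-- Contraction of the second factor with the counit. -/
noncomputable def evalSnd (A : Type*) [Ring A] [Algebra Rt A] (c : ℂ) :
    Comp (A ⊗[Rt] HR c) →ₐ[Rt] Comp A :=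
  Comp.mapHom ((Algebra.TensorProduct.rid Rt Rt A).toAlgHom.comp
    (Algebra.TensorProduct.map (AlgHom.id Rt A) (counit c)))

theorem evalSnd_inl {A : Type*} [Ring A] [Algebra Rt A] (a : A) :
    evalSnd A c (inl _ _ a) = of a := by
  change of (counit c 1 • a) = _
  rw [map_one, one_smul]

theorem evalSnd_inr {A : Type*} [Ring A] [Algebra Rt A] (x : HR c) :
    evalSnd A c (inr _ _ x) = counit c x • 1 := by
  change of (counit c x • (1 : A)) = _
  rw [map_smul, map_one]

theorem evalSnd_canon (hc : c ≠ 0) : evalSnd (HR c)ᵐᵒᵖ c (canon hc) = 1 := by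
  have hX : counit c (gen c BGen.X) = 0 := algebraMap_Kt_injective (by
    rw [algebraMap_counit, map_zero]; exact Ub.counit_X (qK c))
  have hg : counit c (gen c BGen.g) = 1 := algebraMap_Kt_injective (by
    rw [algebraMap_counit, map_one]; exact Ub.counit_g (qK c))
  have hR : evalSnd (HR c)ᵐᵒᵖ c (logR hc) = 0 := log_unique hc (by
    rw [← qpow_map, qpow_logR, evalSnd_inr, hg, one_smul, qpow_zero])
  rw [canon, map_mul, qpow_map, theta_map, map_mul, map_mul _ _ (inr _ _ _), evalSnd_inr, hR, hX,
    zero_smul, mul_zero, mul_zero, qpow_zero, theta_zero, one_mul]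

theorem iMem (x : HR c) : Ub.toDqOp (qK c) x ∈ (DR c).op := by
  refine map_mem _ _ ?_ ?_ ?_ ?_ x
  · rw [Ub.toDqOp_X]; exact (DR.gen c DGen.Y).2
  · rw [Ub.toDqOp_g]; exact (DR.gen c DGen.h).2
  · rw [show Ub.toDqOp (qK c) (Ub.gi _) = op (Dq.hi _) from Ub.lift_gi ..]
    exact (DR.gen c DGen.hi).2
  · rw [Ub.toDqOp_g]; exact (DR.lh c).2

theorem jMem (x : HR c) : Ub.toDq (qK c) x ∈ DR c := by
  refine map_mem _ _ ?_ ?_ ?_ ?_ x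
  · rw [Ub.toDq_X]; exact (DR.gen c DGen.X).2
  · rw [Ub.toDq_g]; exact (DR.gen c DGen.g).2
  · rw [Ub.toDq_gi]; exact (DR.gen c DGen.gi).2
  · rw [Ub.toDq_g]; exact (DR.lg c).2

/-- The inclusion of the second factor `U_q(b₋)` in the double. -/
noncomputable def toDR (c : ℂ) : HR c →ₐ[Rt] DR c := restrict (Ub.toDq (qK c)) (DR c) jMem

/-- The inclusion of the first factor `U_q(b₋)`, with the opposite product, in the double. -/
noncomputable def opToDR (c : ℂ) : (HR c)ᵐᵒᵖ →ₐ[Rt] DR c :=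
  AlgHom.ofLinearMap
    { toFun := fun x => ⟨Ub.toDq' (qK c) x.unop, iMem x.unop⟩
      map_add' := fun x y => Subtype.ext (map_add (Ub.toDq' (qK c)) (x.unop : Ub (qK c)) y.unop)
      map_smul' := fun r x => Subtype.ext (by
        change Ub.toDq' (qK c) (r • (x.unop : Ub (qK c))) = r • Ub.toDq' (qK c) x.unop
        rw [Ub.base_smul (qK c) r, map_smul, Dq.base_smul (qK c) r]) }
    (Subtype.ext Ub.toDq'_one) (fun x y => Subtype.ext (Ub.toDq'_mul (y.unop : Ub (qK c)) x.unop))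

/-- The map of completed tensor squares defining the canonical element of the double. -/
noncomputable def dblHom (c : ℂ) : Comp ((HR c)ᵐᵒᵖ ⊗[Rt] HR c) →ₐ[Rt] Comp (Dhat c ⊗[Rt] Dhat c) :=
  Comp.mapHom (Algebra.TensorProduct.map (of.comp (opToDR c)) (of.comp (toDR c)))

theorem dblHom_inl (x : (HR c)ᵐᵒᵖ) : dblHom c (inl _ _ x) = inl _ _ (of (opToDR c x)) := by
  change of (of (opToDR c x) ⊗ₜ of (toDR c 1)) = _
  rw [map_one, map_one]
  rfl

theorem dblHom_inr (x : HR c) : dblHom c (inr _ _ x) = inr _ _ (of (toDR c x)) := by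
  change of (of (opToDR c 1) ⊗ₜ of (toDR c x)) = _
  rw [map_one, map_one]
  rfl

theorem dblHom_canon (hc : c ≠ 0) : dblHom c (canon hc) = (Dhat.data hc).R := by
  have oX : opToDR c (op (gen c BGen.X)) = DR.gen c DGen.Y := Subtype.ext Ub.toDq'_X
  have og : opToDR c (op (gen c BGen.g)) = DR.gen c DGen.h := Subtype.ext Ub.toDq'_g
  have ogi : opToDR c (op (gen c BGen.gi)) = DR.gen c DGen.hi := Subtype.ext Ub.toDq'_gi
  have jX : toDR c (gen c BGen.X) = DR.gen c DGen.X := Subtype.ext Ub.toDq_X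
  have jg : toDR c (gen c BGen.g) = DR.gen c DGen.g := Subtype.ext Ub.toDq_g
  have hL : dblHom c (logL hc) = inl _ _ (Dhat.Gb hc) := log_unique hc (by
    rw [← qpow_map, ← qpow_map, qpow_logL, dblHom_inl, og, Dhat.qpow_Gb, Dhat.gen_eq])
  have hR : dblHom c (logR hc) = inr _ _ (Dhat.G hc) := log_unique hc (by
    rw [← qpow_map, ← qpow_map, qpow_logR, dblHom_inr, jg, Dhat.qpow_G, Dhat.gen_eq])
  have hq : qform (cst (1 / 2)) (1 : Rt) (inl _ _ (Dhat.H hc)) (inl _ _ (Dhat.C hc))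
      (inr _ _ (Dhat.H hc)) (inr _ _ (Dhat.C hc)) = (cst (1 / 2 : ℂ) : Rt) •
        (inl _ _ (Dhat.Gb hc) * inr _ _ (Dhat.G hc)) := by
    rw [qform, ← Dhat.neg_H_add_C hc, ← Dhat.neg_H_sub_C hc, one_smul, map_sub, map_neg, map_add,
      map_neg]
    congr 1
    noncomm_ring
  rw [(Dhat.isCartanForm hc).R, hq, ← qpow_eq, Dhat.gBi_eq, canon, map_mul, qpow_map, theta_map,
    map_mul, hL, hR, map_mul, map_mul, dblHom_inl, dblHom_inl, dblHom_inr, oX, ogi, jX, map_mul]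
  rfl

/-- The transport of the first factor from the opposite algebra. -/
noncomputable def unopFst (c : ℂ) : (HR c)ᵐᵒᵖ ⊗[Rt] HR c →ₗ[Rt] HR c ⊗[Rt] HR c :=
  (opLinearEquiv Rt).symm.toLinearMap.rTensor (HR c)

end HR

theorem Dhat.isCanonical {c : ℂ} (hc : c ≠ 0) :
    Dhat.IsCanonical c (Ub.pairing (qK c)) (Ub.dblEquiv (qK c)) (Dhat.data hc).R := by
  refine ⟨(HR.opToDR c).toLinearMap ∘ₗ (opLinearEquiv Rt).toLinearMap,
    (HR.toDR c).toLinearMap, fun x => ?_, fun x => ?_, Comp.map (HR.unopFst c) (HR.canon hc), ?_,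
    fun b => ?_⟩
  · rw [Ub.dblEquiv_tmul, map_one, mul_one]; rfl
  · rw [Ub.dblEquiv_tmul, Ub.toDq'_one, one_mul]; rfl
  · rw [← HR.dblHom_canon, Comp.map_map]
    refine LinearMap.congr_fun (f := (HR.dblHom c).toLinearMap) ?_ _
    exact tensor_linear_ext Comp.sep fun _ _ => rfl
  · obtain ⟨N, F, hF, h⟩ := HR.exists_reproduces hc b
    refine ⟨N, (HR.counit c).toLinearMap ∘ₗ F, fun x => ?_, ?_⟩
    · rw [← Ub.pairing_base_smul, Ub.pairing_apply]
      refine (HR.algebraMap_counit (F x)).trans ?_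
      rw [hF]
      rfl
    · have h1 := congrArg (HR.evalSnd (HR c)ᵐᵒᵖ c) h
      rw [map_mul, HR.evalSnd_canon, mul_one, HR.evalSnd_inl] at h1
      have h2 := congrArg (Comp.map (opLinearEquiv Rt).symm.toLinearMap) h1
      rw [Comp.map_of] at h2
      refine Eq.trans ?_ (h2.trans (map_smul of (tt ^ N) b))
      rw [Comp.map_map]
      exact LinearMap.congr_fun (tensor_linear_ext Comp.sep
        (f := Comp.map ((TensorProduct.rid Rt (HR c)).toLinearMap ∘ₗ
          ((HR.counit c).toLinearMap ∘ₗ F).lTensor (HR c) ∘ₗ HR.unopFst c))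
        (g := Comp.map (opLinearEquiv Rt).symm.toLinearMap ∘ₗ
          (HR.evalSnd (HR c)ᵐᵒᵖ c).toLinearMap ∘ₗ sndMap (HR c)ᵐᵒᵖ F) fun _ _ => rfl) _

theorem UL.commute_C {c : ℂ} (hc : c ≠ 0) (w : UL c) : UL.C c * w = w * UL.C c := by
  have hr := UL.cartanRels hc
  exact UL.dense.commute Comp.sep (AlgHom.id Rt _) (r := UL.C c)
    (by rintro _ (rfl | rfl | rfl | rfl); exacts [hr.CH, rfl, hr.CX, hr.CY]) w

theorem UL.chi_eq (c : ℂ) : UL.chi c = cartanTwist c (UL.H c) (UL.C c) := by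
  rw [UL.chi, of_tmul]; rfl

end QDbl

theorem mainTheorem4 :
    (∀ (k : Type*) [Field k] (q : kˣ), (q : k) ^ 2 ≠ 1 →
      ∃ σ : Ub q →ₗ[k] Ub q →ₗ[k] k,
        (IsBorelPairing q σ ∧ ∀ σ', IsBorelPairing q σ' → σ' = σ) ∧
        ∃ ψ : Ub q ⊗[k] Ub q ≃ₗ[k] Dq q, IsBorelDouble q σ ψ) ∧
    (∀ c : ℂ, c ≠ 0 →
      ∃ (σ : Ub (qK c) →ₗ[Kt] Ub (qK c) →ₗ[Kt] Kt)
        (ψ : Ub (qK c) ⊗[Kt] Ub (qK c) ≃ₗ[Kt] Dq (qK c)),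
      IsBorelPairing (qK c) σ ∧ IsBorelDouble (qK c) σ ψ ∧
      ∃ (dU : QTData (Usl c)) (dL : QTData Line) (dW dT : QTData (UL c)) (dD : QTData (Dhat c))
        (θ : UL c ≃ₐ[Rt] Dhat c),
        (dU.IsQTHopf ∧ Usl.IsStandard c dU) ∧
        (dL.IsQTHopf ∧ Line.IsStandard c dL) ∧
        (dW.IsQTHopf ∧ dU.IsTensor dL dW) ∧
        (dD.IsQTHopf ∧ Dhat.ExtendsDouble c dD ∧ Dhat.IsCanonical c σ ψ dD.R) ∧
        dW.IsCocycle (UL.chi c) ∧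
        (dT.IsQTHopf ∧ dW.IsTwist (UL.chi c) dT) ∧
        ((∀ w, UL.C c * w = w * UL.C c) ∧
          dT.comul (UL.C c) = Comp.of (UL.C c ⊗ₜ 1) + Comp.of (1 ⊗ₜ UL.C c) ∧
          dT.comul (UL.H c) = Comp.of (UL.H c ⊗ₜ 1) + Comp.of (1 ⊗ₜ UL.H c) ∧
          dT.comul (UL.E c) = Comp.of (UL.E c ⊗ₜ qpow c (1 / 2) (UL.H c)) +
            Comp.of ((qpow c (-1 / 2) (UL.H c) * qpow c (-1) (UL.C c)) ⊗ₜ UL.E c) ∧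
          dT.comul (UL.F c) = Comp.of (UL.F c ⊗ₜ qpow c (1 / 2) (UL.H c)) +
            Comp.of ((qpow c (-1 / 2) (UL.H c) * qpow c 1 (UL.C c)) ⊗ₜ UL.F c)) ∧
        dT.IsIso dD θ ∧
        (θ (qpow c (-1 / 2) (UL.H c) * UL.F c) = Dhat.gen c DGen.X ∧
          θ (qpow c (-1 / 2) (UL.H c) * UL.E c) = Dhat.gen c DGen.Y ∧
          θ (qpow c (-1) (UL.H c) * qpow c 1 (UL.C c)) = Dhat.gen c DGen.g ∧
          θ (qpow c (-1) (UL.H c) * qpow c (-1) (UL.C c)) = Dhat.gen c DGen.h)) := by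
  refine ⟨fun k _ q hq => ⟨Ub.pairing q,
    ⟨Ub.isBorelPairing q, fun _ h => h.ext (Ub.isBorelPairing q)⟩, Ub.dblEquiv q,
    Ub.isBorelDouble hq⟩, fun c hc => ⟨Ub.pairing (qK c), Ub.dblEquiv (qK c),
    Ub.isBorelPairing _, Ub.isBorelDouble (qK_sq_ne hc), Usl.data hc, Line.data hc, UL.data hc 0,
    UL.data hc 1, Dhat.data hc, thetaEquiv hc, ⟨Usl.isQTHopf hc, Usl.isStandard hc⟩,
    ⟨Line.isQTHopf hc, Line.isStandard hc⟩, ⟨UL.isQTHopf hc 0, Usl.isTensor hc⟩,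
    ⟨Dhat.isQTHopf hc, Dhat.extendsDouble hc, Dhat.isCanonical hc⟩, ?_,
    ⟨UL.isQTHopf hc 1, ?_⟩, ⟨UL.commute_C hc, ?_, ?_, ?_, ?_⟩, thetaEquiv_isIso hc,
    theta_formulas hc⟩⟩
  · rw [UL.chi_eq]
    exact (UL.cartanRels hc).cocycle (UL.isCartanForm hc 0)
  · rw [UL.chi_eq]
    exact (UL.cartanRels hc).isTwist (UL.commute_C hc) (UL.isCartanForm hc 0)
      (UL.isCartanForm hc 1) UL.dense
  · exact (UL.isCartanForm hc 1).comul_C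
  · exact (UL.isCartanForm hc 1).comul_H
  · rw [UL.comul_E hc 1, of_tmul, of_tmul, one_smul, qpow_eq (-1) (UL.C c), map_neg, map_one,
      neg_one_smul]
  · rw [UL.comul_F hc 1, of_tmul, of_tmul, one_smul]
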